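/- Let $d$ be a positive integer, let $\mathrm{Aff}(d,\mathbb Z)$ be the group of maps $x\mapsto Ax+b$ with $A\in GL(d,\mathbb Z)$, $b\in\mathbb Z^d$, and let it act on the set $X_d$ of finite subsets of $\mathbb Z^d$ by taking images. A \emph{canonical form} for a set $S$ with an action of a group $G$ is a function $f:S\to S$ with $f(x)\in\mathrm{Orb}(x)$ and $f(gx)=f(x)$ for all $x\in S$, $g\in G$. \textbf{Frames.} A \emph{frame} is an ordered set of affinely independent points of $\mathbb Q^d$; $\mathrm{Span}$ is the affine span over $\mathbb Q$. For $X\subseteq\mathbb Z^d$, an \emph{$X$-frame} is a frame contained in $X$. A frame $Q$ is \emph{$\Lambda$-covering} if $\Lambda\subseteq\mathrm{Span}(Q)$. The coordinates of a point $x$ with respect to $Q=(q_0,\dots,q_m)$ are the $c_1,\dots,c_m$ with $x=q_0+\sum_i c_i(q_i-q_0)$. Unions of frames are concatenations. Finite sets of points are compared lexicographically, as lexicographically sorted lists of points; frames as lists of points; pairs (set, frame) by the set first. \textbf{CanonicalFormWithFrame}$(\Lambda,Q)$, for $\Lambda\in X_d$ and a $\Lambda$-covering frame $Q$. Let $T:=Q\cap\Lambda$,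 ordered as in $Q$, and $k:=\dim\mathrm{Span}(\Lambda)$ ($k=-1$ if $\Lambda=\varnothing$). While $|T|<k+1$, append to $T$ the point of $\Lambda\setminus\mathrm{Span}(T)$ whose coordinates with respect to $Q$ are lexicographically minimal. Write $T=(p_0,\dots,p_k)$, let $M$ be the $d\times k$ matrix with columns $p_1-p_0,\dots,p_k-p_0$, take any $A\in GL(d,\mathbb Z)$ such that $AM$ is in Hermite normal form (upper triangular with positive diagonal, each entry above the diagonal reduced modulo the diagonal entry of its column), put $\psi(x)=A(x-p_0)$, and return $(\psi(\Lambda),\psi(T))$. (For $\Lambda=\varnothing$, return $(\varnothing,\varnothing)$.) \textbf{EquivariantFrames2}$(\Lambda,Q)$, for $\Lambda\in X_d$ and a frame $Q$. Replace $\Lambda$ by $\Lambda\setminus\mathrm{Span}(Q)$, and let $n:=|\Lambda|$. (i) If $n\le1$, return $\{\Lambda\}$. (ii) If all points of $\Lambda$ are congruent modulo $2$, take any $p\in\Lambda$, compute $S'=\mathrm{EquivariantFrames2}((\Lambda-p)/2,(Q-p)/2)$ and return $2S'+p$. (iii) Otherwise let $\Lambda_1,\dots,\Lambda_h$ be the congruence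 classes of $\Lambda$ modulo $2$. If $|\Lambda_i|\le n/2$ for all $i$, put $S_i=\mathrm{EquivariantFrames2}(\Lambda_i,Q)$ and let $\Lambda'$ be the set of all points of all frames in the $S_i$; return the set of those $\Lambda'$-frames $R$, with $Q\cap R=\varnothing$ and $Q\cup R$ a $\Lambda$-covering frame, for which $\mathrm{CanonicalFormWithFrame}(\Lambda,Q\cup R)$ is lexicographically minimal. (iv) Otherwise there is one class, say $\Lambda_h$, with $|\Lambda_h|>n/2$. Put $S_i=\mathrm{EquivariantFrames2}(\Lambda_i,Q)$ for $i<h$, let $\Lambda'$ be the set of all points of all frames in these $S_i$, let $E$ be the set of $\Lambda'$-frames $R$ with $Q\cap R=\varnothing$ and $Q\cup R$ a $(\Lambda\setminus\Lambda_h)$-covering frame, and put $S_R=\mathrm{EquivariantFrames2}(\Lambda_h,Q\cup R)$ for $R\in E$. Return the set of those $R\cup T$ ($R\in E$, $T\in S_R$) for which $\mathrm{CanonicalFormWithFrame}(\Lambda,Q\cup R\cup T)$ is lexicographically minimal. \textbf{CanonicalForm}$(\Lambda)$. Compute $S=\mathrm{EquivariantFrames2}(\Lambda,\varnothing)$, and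 $(\Omega_R,U_R)=\mathrm{CanonicalFormWithFrame}(\Lambda,R)$ for every $R\in S$; return the lexicographic minimum of the sets $\Omega_R$. \textbf{Theorem.} The algorithm CanonicalForm has an output on every $\Lambda\in X_d$, which does not depend on the choices made (those marked ``any''), and the function $X_d\to X_d$ it defines is a canonical form for $X_d$ with respect to the action of $\mathrm{Aff}(d,\mathbb Z)$. Moreover, for fixed $d$, its worst-case complexity is $O(n\log^2 n\; s\,\mu(s))$, where $n=|\Lambda|$, $s\ge 1$ is an upper bound for the size of the binary representation (including sign) of every coordinate of every point of $\Lambda$, and $\mu(s)$ is an upper bound for the cost of multiplying two $s$-bit integers. Precisely: consider the explicit implementation on lists of points that uses Gram determinants for linear algebra over $\mathbb Q$, Cramer's rule for coordinates, Euclidean row operations for the Hermite normal form, and merge sort. Count one unit for every element visited by a list operation, a linear number of units in the binary size for additions, comparisons and halvings of integers, the cost of schoolbook long division for divisions, and $\mu(t)$ for multiplying two integers of at most $t$ bits. On every repetition-free list enumerating $\Lambda$ this implementation returns, without repetitions, the points of the canonical form of $\Lambda$. For all $a,K\in\mathbb N$ there is a constant $C$ (depending only on $d,a,K$) such that for every nondecreasing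 $\mu:\mathbb N\to\mathbb N$ with $t\le a\,\mu(t)$ and $\mu(2t)\le K\mu(t)$ for all $t$, every such list and every such $s$, the number of operations is at most $$C\; n\,(\log_2 n)^2\; s\;\mu(s),$$ where $n$ is replaced by $2$ if $n\le 1$. -/

import Mathlib

namespace LatticeCanonicalForm

/-! ## Points, affinities, canonical forms -/

/-- Points of the integral lattice of dimension `d`. -/
abbrev Pt (d : ℕ) : Type := Fin d → ℤ

/-- Points of the rational affine space of dimension `d`. -/
abbrev RPt (d : ℕ) : Type := Fin d → ℚ

/-- The inclusion of the lattice into the rational space. -/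
def toRat {d : ℕ} (p : Pt d) : RPt d := fun i => (p i : ℚ)

/-- The group `Aff(d, ℤ)` of affinities `x ↦ A x + b` with `A ∈ GL(d, ℤ)` and `b ∈ ℤ^d`. -/
abbrev Aff (d : ℕ) : Type := Pt d ≃ᵃ[ℤ] Pt d

/-- `Aff(d, ℤ)` acts on the finite subsets of `ℤ^d` by taking images. -/
instance affAction (d : ℕ) : MulAction (Aff d) (Finset (Pt d)) where
  smul φ Λ := Λ.image φ
  one_smul Λ := (Finset.image_id' : Λ.image (fun x => x) = Λ)
  mul_smul φ χ Λ := (Finset.image_image : (Λ.image χ).image φ = Λ.image (φ ∘ χ)).symm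

/-- A canonical form for `S` with respect to the action of `G`. -/
def IsCanonicalForm (G : Type*) {S : Type*} [Group G] [MulAction G S] (f : S → S) : Prop :=
  (∀ x : S, f x ∈ MulAction.orbit G x) ∧ ∀ (g : G) (x : S), f (g • x) = f x

/-! ## Frames -/

/-- The affine subspace generated over `ℚ`. -/
def ratSpan {d : ℕ} (Q : List (RPt d)) : AffineSubspace ℚ (RPt d) :=
  affineSpan ℚ {x | x ∈ Q}

/-- A frame: an ordered set of affinely independent points of `ℚ^d`. -/
def IsFrame {d : ℕ} (Q : List (RPt d)) : Prop :=
  AffineIndependent ℚ (fun i : Fin Q.length => Q.get i)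

/-- `R` is a frame included in the set `X` of lattice points. -/
def IsFrameIn {d : ℕ} (X : Set (Pt d)) (R : List (Pt d)) : Prop :=
  (∀ p ∈ R, p ∈ X) ∧ IsFrame (R.map toRat)

/-- `Q` is a frame whose span contains `Λ`. -/
def IsCoveringFrame {d : ℕ} (Λ : Finset (Pt d)) (Q : List (RPt d)) : Prop :=
  IsFrame Q ∧ ∀ p ∈ Λ, toRat p ∈ ratSpan Q

/-- `k + 1`, where `k` is the dimension of the span of `Λ` (the empty set has dimension `-1`). -/
noncomputable def spanDimSucc {d : ℕ} (Λ : Finset (Pt d)) : ℕ :=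
  if Λ = ∅ then 0 else
    Module.finrank ℚ (vectorSpan ℚ (toRat '' (Λ : Set (Pt d)))) + 1

/-- `w` are the barycentric weights of `x` with respect to the frame `Q`. The coordinates of `x`
with respect to `Q = (q₀, …, q_m)` are the scalars `c₁, …, c_m` with `x = q₀ + ∑ cᵢ (qᵢ - q₀)`,
that is, `cᵢ = wᵢ` for `i ≥ 1`. -/
def IsWeights {d : ℕ} (Q : List (RPt d)) (x : RPt d) (w : Fin Q.length → ℚ) : Prop :=
  ∑ i, w i = 1 ∧ ∑ i, w i • Q.get i = x

/-- The coordinates of `x` with respect to `Q` are lexicographically smaller than those of `y`. -/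
def CoordLT {d : ℕ} (Q : List (RPt d)) (x y : RPt d) : Prop :=
  ∃ w v : Fin Q.length → ℚ, IsWeights Q x w ∧ IsWeights Q y v ∧
    ∃ j : Fin Q.length, 0 < (j : ℕ) ∧ w j < v j ∧
      ∀ i : Fin Q.length, 0 < (i : ℕ) → i < j → w i = v i

/-! ## Hermite normal form -/

/-- `H` is in (row style) Hermite normal form. The definition is for matrices of full column rank,
the only ones to which it is applied: the columns `p₁ - p₀, …, p_k - p₀` come from a frame.
For those, the normal form is upper triangular with positive diagonal entries, and each entry above
the diagonal is a reduced residue modulo the diagonal entry of its column. -/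
def IsHermite {d k : ℕ} (H : Matrix (Fin d) (Fin k) ℤ) : Prop :=
  (∀ (i : Fin d) (j : Fin k), (j : ℕ) < (i : ℕ) → H i j = 0) ∧
    ∀ j : Fin k, ∃ i : Fin d, (i : ℕ) = (j : ℕ) ∧ 0 < H i j ∧
      ∀ l : Fin d, l < i → 0 ≤ H l j ∧ H l j < H i j

/-- The matrix with columns `p₁ - p₀, …, p_k - p₀`, for `T = [p₀, …, p_k]`. -/
def frameMatrix {d : ℕ} (T : List (Pt d)) : Matrix (Fin d) (Fin (T.length - 1)) ℤ :=
  fun i j => T.getD ((j : ℕ) + 1) 0 i - T.headD 0 i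

/-! ## Lexicographic comparison -/

/-- A finite set of lattice points is encoded by the list of its points in lexicographic order;
such lists are compared lexicographically. -/
noncomputable def setKey {d : ℕ} (Ω : Finset (Pt d)) : List (Lex (Pt d)) :=
  (Ω.map (toLex : Pt d ≃ Lex (Pt d)).toEmbedding).sort

/-- Pairs consisting of a finite set and an ordered frame are compared lexicographically. -/
noncomputable def pairKey {d : ℕ} (X : Finset (Pt d) × List (Pt d)) :
    List (Lex (Pt d)) ×ₗ List (Lex (Pt d)) :=
  toLex (setKey X.1, X.2.map toLex)

/-! ## The algorithms, as nondeterministic procedures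

Each procedure is a relation between input and output. Wherever the pseudocode says "any", every
choice is allowed. -/

/-- One iteration of the loop of `CanonicalFormWithFrame`. -/
def FrameStep {d : ℕ} (Λ : Finset (Pt d)) (Q : List (RPt d)) (T T' : List (Pt d)) : Prop :=
  T.length < spanDimSucc Λ ∧
    ∃ p ∈ Λ, toRat p ∉ ratSpan (T.map toRat) ∧
      (∀ q ∈ Λ, toRat q ∉ ratSpan (T.map toRat) → q = p ∨ CoordLT Q (toRat p) (toRat q)) ∧
      T' = T ++ [p]

open Classical in
/-- `T` is the value of the frame after the loop of `CanonicalFormWithFrame` on input `(Λ, Q)`. It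
is initialized with `Q ∩ Λ`, ordered as in `Q`. -/
def FrameLoop {d : ℕ} (Λ : Finset (Pt d)) (Q : List (RPt d)) (T : List (Pt d)) : Prop :=
  ∃ T₀ : List (Pt d), T₀.map toRat = Q.filter (fun q => decide (∃ p ∈ Λ, toRat p = q)) ∧
    Relation.ReflTransGen (FrameStep Λ Q) T₀ T ∧ ¬ T.length < spanDimSucc Λ

/-- The affinity `x ↦ A (x - p₀)`, where `p₀` is the first point of `T`. -/
def frameMap {d : ℕ} (A : Matrix.GeneralLinearGroup (Fin d) ℤ) (T : List (Pt d)) (x : Pt d) :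
    Pt d :=
  (A : Matrix (Fin d) (Fin d) ℤ).mulVec (x - T.headD 0)

/-- `CanonicalFormWithFrame (Λ, Q)` may return `X = (Ω, U)`. For `Λ = ∅` (and then `T = []`) this
returns `(∅, [])`. -/
def CanonicalFormWithFrame {d : ℕ} (Λ : Finset (Pt d)) (Q : List (RPt d))
    (X : Finset (Pt d) × List (Pt d)) : Prop :=
  ∃ (T : List (Pt d)) (A : Matrix.GeneralLinearGroup (Fin d) ℤ), FrameLoop Λ Q T ∧
    IsHermite ((A : Matrix (Fin d) (Fin d) ℤ) * frameMatrix T) ∧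
    X = (Λ.image (frameMap A T), T.map (frameMap A T))

open Classical in
/-- `Λ \ Span(Q)`. -/
noncomputable def outside {d : ℕ} (Λ : Finset (Pt d)) (Q : List (RPt d)) : Finset (Pt d) :=
  Λ.filter (fun p => toRat p ∉ ratSpan Q)

/-- The residue of a lattice point modulo 2. -/
def residue {d : ℕ} (p : Pt d) : Fin d → ZMod 2 := fun i => (p i : ZMod 2)

/-- The congruence class modulo 2 of `Λ` with residue `c` (possibly empty). -/
def congClass {d : ℕ} (Λ : Finset (Pt d)) (c : Fin d → ZMod 2) : Finset (Pt d) :=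
  Λ.filter (fun p => residue p = c)

/-- All the points of `Λ` are congruent modulo 2. -/
def AllCongruent {d : ℕ} (Λ : Finset (Pt d)) : Prop :=
  ∀ p ∈ Λ, ∀ q ∈ Λ, residue p = residue q

/-- `F` is the set of those `R` in `cand` for which `val R` is minimal. -/
def IsMinimalSet {d : ℕ} (cand : Set (List (Pt d)))
    (val : List (Pt d) → Finset (Pt d) × List (Pt d)) (F : Finset (List (Pt d))) : Prop :=
  ∀ R, R ∈ F ↔ R ∈ cand ∧ ∀ R' ∈ cand, pairKey (val R) ≤ pairKey (val R')

/-- The frames `R` included in `X`, disjoint from `Q`, such that `Q ∪ R` is a `Λ`-covering frame. -/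
def completions {d : ℕ} (Λ : Finset (Pt d)) (Q : List (RPt d)) (X : Set (Pt d)) :
    Set (List (Pt d)) :=
  {R | IsFrameIn X R ∧ (∀ p ∈ R, toRat p ∉ Q) ∧ IsCoveringFrame Λ (Q ++ R.map toRat)}

/-- The points of the frames in `S c`, for all `c` in `I`. -/
def framePoints {d : ℕ} (I : Set (Fin d → ZMod 2))
    (S : (Fin d → ZMod 2) → Finset (List (Pt d))) : Set (Pt d) :=
  {x | ∃ c ∈ I, ∃ V ∈ S c, x ∈ V}

/-- `EquivariantFrames2 Λ Q S`: the procedure, called on `(Λ, Q)`, may return the set of frames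
`S`. The four rules are the branches of the procedure: at most one point outside `Span(Q)`; all
points congruent modulo 2; balanced partition; unbalanced partition (with `h` the residue of the
large class). -/
inductive EquivariantFrames2 {d : ℕ} :
    Finset (Pt d) → List (RPt d) → Finset (List (Pt d)) → Prop
  | small (Λ : Finset (Pt d)) (Q : List (RPt d)) (hcard : (outside Λ Q).card ≤ 1) :
      EquivariantFrames2 Λ Q {(outside Λ Q).toList}
  | congruent (Λ : Finset (Pt d)) (Q : List (RPt d)) (p : Pt d) (Λ' : Finset (Pt d))
      (S' : Finset (List (Pt d)))
      (hcard : 1 < (outside Λ Q).card) (hcong : AllCongruent (outside Λ Q))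
      (hp : p ∈ outside Λ Q)
      (hΛ' : outside Λ Q = Λ'.image (fun x => (2 : ℤ) • x + p))
      (hrec : EquivariantFrames2 Λ' (Q.map (fun q => (1 / 2 : ℚ) • (q - toRat p))) S') :
      EquivariantFrames2 Λ Q (S'.image (List.map (fun x => (2 : ℤ) • x + p)))
  | balanced (Λ : Finset (Pt d)) (Q : List (RPt d))
      (S : (Fin d → ZMod 2) → Finset (List (Pt d)))
      (val : List (Pt d) → Finset (Pt d) × List (Pt d)) (F : Finset (List (Pt d)))
      (hcard : 1 < (outside Λ Q).card) (hcong : ¬ AllCongruent (outside Λ Q))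
      (hbal : ∀ c, 2 * (congClass (outside Λ Q) c).card ≤ (outside Λ Q).card)
      (hrec : ∀ c, (congClass (outside Λ Q) c).Nonempty →
        EquivariantFrames2 (congClass (outside Λ Q) c) Q (S c))
      (hval : ∀ R ∈ completions (outside Λ Q) Q
          (framePoints {c | (congClass (outside Λ Q) c).Nonempty} S),
        CanonicalFormWithFrame (outside Λ Q) (Q ++ R.map toRat) (val R))
      (hF : IsMinimalSet (completions (outside Λ Q) Q
          (framePoints {c | (congClass (outside Λ Q) c).Nonempty} S)) val F) :
      EquivariantFrames2 Λ Q F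
  | unbalanced (Λ : Finset (Pt d)) (Q : List (RPt d)) (h : Fin d → ZMod 2)
      (S : (Fin d → ZMod 2) → Finset (List (Pt d))) (E : Set (List (Pt d)))
      (SR : List (Pt d) → Finset (List (Pt d)))
      (val : List (Pt d) → Finset (Pt d) × List (Pt d)) (F : Finset (List (Pt d)))
      (hcard : 1 < (outside Λ Q).card) (hcong : ¬ AllCongruent (outside Λ Q))
      (hunbal : (outside Λ Q).card < 2 * (congClass (outside Λ Q) h).card)
      (hrec : ∀ c, c ≠ h → (congClass (outside Λ Q) c).Nonempty →
        EquivariantFrames2 (congClass (outside Λ Q) c) Q (S c))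
      (hE : E = completions (outside Λ Q \ congClass (outside Λ Q) h) Q
        (framePoints {c | c ≠ h ∧ (congClass (outside Λ Q) c).Nonempty} S))
      (hrecE : ∀ R ∈ E,
        EquivariantFrames2 (congClass (outside Λ Q) h) (Q ++ R.map toRat) (SR R))
      (hval : ∀ R ∈ E, ∀ T ∈ SR R,
        CanonicalFormWithFrame (outside Λ Q) (Q ++ (R ++ T).map toRat) (val (R ++ T)))
      (hF : IsMinimalSet {V | ∃ R ∈ E, ∃ T ∈ SR R, V = R ++ T} val F) :
      EquivariantFrames2 Λ Q F

/-- The procedure `CanonicalForm`, called on `Λ`, may return `Ω`. -/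
def CanonicalForm {d : ℕ} (Λ Ω : Finset (Pt d)) : Prop :=
  ∃ (S : Finset (List (Pt d))) (val : List (Pt d) → Finset (Pt d) × List (Pt d)),
    EquivariantFrames2 Λ [] S ∧
    (∀ R ∈ S, CanonicalFormWithFrame Λ (R.map toRat) (val R)) ∧
    ∃ R ∈ S, Ω = (val R).1 ∧ ∀ R' ∈ S, setKey Ω ≤ setKey (val R').1

/-! ## Step-counted computations

The same algorithm, implemented on explicit data structures (lists of points, tuples of integers)
with its number of bit operations. Additions, comparisons and parity tests of integers are charged
linearly in their binary size, a division is charged as schoolbook long division, a multiplication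
of two numbers of at most `s` bits is charged `μ s`, and every call of a list-processing function
is charged one unit (per element it visits). -/

/-- The result of a computation together with the number of operations that it took. -/
structure Timed (α : Type) where
  val : α
  cost : ℕ

instance : Monad Timed where
  pure a := ⟨a, 0⟩
  bind x f :=
    let y := f x.val
    ⟨y.val, x.cost + y.cost⟩

/-- Charge `n` operations. -/
def tick (n : ℕ) : Timed Unit := ⟨(), n⟩

/-- The size of the binary representation of an integer (with a sign bit). -/
def bitSize (z : ℤ) : ℕ := Nat.size z.natAbs + 1

/-! ### Integers -/

def addT (a b : ℤ) : Timed ℤ := ⟨a + b, bitSize a + bitSize b⟩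

def subT (a b : ℤ) : Timed ℤ := ⟨a - b, bitSize a + bitSize b⟩

def negT (a : ℤ) : Timed ℤ := ⟨-a, bitSize a⟩

def mulT (μ : ℕ → ℕ) (a b : ℤ) : Timed ℤ := ⟨a * b, μ (max (bitSize a) (bitSize b))⟩

/-- Long division: each digit of the quotient costs one subtraction of the size of `b`. -/
def divT (a b : ℤ) : Timed ℤ := ⟨a / b, bitSize a + bitSize b * (bitSize (a / b) + 1)⟩

def halfT (a : ℤ) : Timed ℤ := ⟨a / 2, bitSize a⟩

def cmpT (a b : ℤ) : Timed Ordering := ⟨compare a b, bitSize a + bitSize b⟩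

def isZeroT (a : ℤ) : Timed Bool := ⟨a == 0, 1⟩

def sameParityT (a b : ℤ) : Timed Bool := ⟨a % 2 == b % 2, 2⟩

/-! ### Lists and tuples -/

section Lists

variable {α β : Type}

def mapT (f : α → Timed β) : List α → Timed (List β)
  | [] => do
    tick 1
    pure []
  | a :: as => do
    tick 1
    let b ← f a
    let bs ← mapT f as
    pure (b :: bs)

def filterT (f : α → Timed Bool) : List α → Timed (List α)
  | [] => do
    tick 1
    pure []
  | a :: as => do
    tick 1
    let b ← f a
    let bs ← filterT f as
    pure (if b then a :: bs else bs)

/-- The first element with the given property. -/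
def findT (f : α → Timed Bool) : List α → Timed (Option α)
  | [] => do
    tick 1
    pure none
  | a :: as => do
    tick 1
    let b ← f a
    if b then pure (some a) else findT f as

def allT (f : α → Timed Bool) : List α → Timed Bool
  | [] => do
    tick 1
    pure true
  | a :: as => do
    tick 1
    let b ← f a
    if b then allT f as else pure false

def lengthT : List α → Timed ℕ
  | [] => do
    tick 1
    pure 0
  | _ :: as => do
    tick 1
    let n ← lengthT as
    tick (Nat.size n + 1)
    pure (n + 1)

def appendT : List α → List α → Timed (List α)
  | [], bs => do
    tick 1
    pure bs
  | a :: as, bs => do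
    tick 1
    let cs ← appendT as bs
    pure (a :: cs)

def flattenT : List (List α) → Timed (List α)
  | [] => do
    tick 1
    pure []
  | l :: ls => do
    tick 1
    let r ← flattenT ls
    appendT l r

/-- Remove repetitions. -/
def dedupT (eqv : α → α → Timed Bool) : List α → Timed (List α)
  | [] => do
    tick 1
    pure []
  | a :: as => do
    tick 1
    let bs ← dedupT eqv as
    let o ← findT (eqv a) bs
    match o with
    | none => pure (a :: bs)
    | some _ => pure bs

/-- A minimum of `best` and the elements of a list. -/
def minT (cmp : α → α → Timed Ordering) : α → List α → Timed α
  | best, [] => do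
    tick 1
    pure best
  | best, a :: as => do
    tick 1
    let o ← cmp a best
    match o with
    | .lt => minT cmp a as
    | _ => minT cmp best as

/-- Lexicographic comparison of lists. -/
def cmpListT (cmp : α → α → Timed Ordering) : List α → List α → Timed Ordering
  | [], [] => do
    tick 1
    pure .eq
  | [], _ :: _ => do
    tick 1
    pure .lt
  | _ :: _, [] => do
    tick 1
    pure .gt
  | a :: as, b :: bs => do
    tick 1
    let o ← cmp a b
    match o with
    | .eq => cmpListT cmp as bs
    | .lt => pure .lt
    | .gt => pure .gt

/-- Distribute the elements of a list alternately into two lists. -/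
def splitT : List α → Timed (List α × List α)
  | [] => do
    tick 1
    pure ([], [])
  | a :: as => do
    tick 1
    let (l, r) ← splitT as
    pure (a :: r, l)

def mergeT (cmp : α → α → Timed Ordering) : List α → List α → Timed (List α)
  | [], bs => do
    tick 1
    pure bs
  | a :: as, [] => do
    tick 1
    pure (a :: as)
  | a :: as, b :: bs => do
    tick 1
    let o ← cmp a b
    match o with
    | .gt => do
      let r ← mergeT cmp (a :: as) bs
      pure (b :: r)
    | _ => do
      let r ← mergeT cmp as (b :: bs)
      pure (a :: r)
termination_by as bs => as.length + bs.length

/-- Merge sort. The first argument bounds the depth of the recursion; the length of the list is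
always enough. -/
def mergeSortT (cmp : α → α → Timed Ordering) : ℕ → List α → Timed (List α)
  | 0, as => do
    tick 1
    pure as
  | _ + 1, [] => do
    tick 1
    pure []
  | _ + 1, [a] => do
    tick 1
    pure [a]
  | r + 1, a :: b :: as => do
    tick 1
    let (l₁, l₂) ← splitT (a :: b :: as)
    let s₁ ← mergeSortT cmp r l₁
    let s₂ ← mergeSortT cmp r l₂
    mergeT cmp s₁ s₂

/-- Compute all the entries of a tuple. -/
def tupleT {m : ℕ} (f : Fin m → Timed α) : Timed (Fin m → α) :=
  ⟨fun i => (f i).val, ∑ i, ((f i).cost + 1)⟩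

/-- Compute all the terms of a sum, and add them. -/
def sumT : (m : ℕ) → (Fin m → Timed ℤ) → Timed ℤ
  | 0, _ => do
    tick 1
    pure 0
  | m + 1, f => do
    tick 1
    let a ← f 0
    let b ← sumT m (fun i => f i.succ)
    addT a b

end Lists

/-! ### Vectors, determinants, spans -/

def vecAddT {d : ℕ} (u v : Fin d → ℤ) : Timed (Fin d → ℤ) := tupleT (fun i => addT (u i) (v i))

def vecSubT {d : ℕ} (u v : Fin d → ℤ) : Timed (Fin d → ℤ) := tupleT (fun i => subT (u i) (v i))

def vecNegT {d : ℕ} (u : Fin d → ℤ) : Timed (Fin d → ℤ) := tupleT (fun i => negT (u i))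

def vecHalfT {d : ℕ} (u : Fin d → ℤ) : Timed (Fin d → ℤ) := tupleT (fun i => halfT (u i))

def vecScaleT (μ : ℕ → ℕ) {d : ℕ} (c : ℤ) (u : Fin d → ℤ) : Timed (Fin d → ℤ) :=
  tupleT (fun i => mulT μ c (u i))

def dotT (μ : ℕ → ℕ) {m : ℕ} (u v : Fin m → ℤ) : Timed ℤ := sumT m (fun i => mulT μ (u i) (v i))

/-- Lexicographic comparison of tuples. -/
def cmpVecT {d : ℕ} (u v : Fin d → ℤ) : Timed Ordering := do
  tick (2 * d)
  cmpListT cmpT (List.ofFn u) (List.ofFn v)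

def eqVecT {d : ℕ} (u v : Fin d → ℤ) : Timed Bool := do
  let o ← cmpVecT u v
  pure (o == .eq)

def sortT {d : ℕ} (l : List (Pt d)) : Timed (List (Pt d)) := do
  let n ← lengthT l
  mergeSortT cmpVecT n l

/-- Determinant, by expansion along the first row. -/
def detT (μ : ℕ → ℕ) : (m : ℕ) → (Fin m → Fin m → ℤ) → Timed ℤ
  | 0, _ => do
    tick 1
    pure 1
  | m + 1, A => sumT (m + 1) (fun j => do
      tick (m * m + 1)
      let δ ← detT μ m (fun r c => A r.succ (j.succAbove c))
      let t ← mulT μ (A 0 j) δ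
      if (j : ℕ) % 2 = 0 then pure t else negT t)

/-- The Gram matrix of a tuple of vectors. -/
def gramT (μ : ℕ → ℕ) {d m : ℕ} (w : Fin m → Pt d) : Timed (Fin m → Fin m → ℤ) :=
  tupleT (fun i => tupleT (fun j => dotT μ (w i) (w j)))

/-- The determinant of the Gram matrix of a list of vectors; it vanishes if and only if the vectors
are linearly dependent. -/
def gramDetT (μ : ℕ → ℕ) {d : ℕ} (vs : List (Pt d)) : Timed ℤ := do
  tick vs.length
  let G ← gramT μ vs.get
  detT μ vs.length G

def diffsT {d : ℕ} (q₀ : Pt d) (qs : List (Pt d)) : Timed (List (Pt d)) :=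
  mapT (fun q => vecSubT q q₀) qs

/-- Are the points affinely independent? -/
def indepT (μ : ℕ → ℕ) {d : ℕ} : List (Pt d) → Timed Bool
  | [] => do
    tick 1
    pure true
  | q₀ :: qs => do
    let vs ← diffsT q₀ qs
    let g ← gramDetT μ vs
    let z ← isZeroT g
    pure (!z)

/-- Does `x` belong to the span of the given affinely independent points? -/
def inSpanT (μ : ℕ → ℕ) {d : ℕ} (x : Pt d) : List (Pt d) → Timed Bool
  | [] => do
    tick 1
    pure false
  | q₀ :: qs => do
    let vs ← diffsT q₀ (x :: qs)
    let g ← gramDetT μ vs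
    isZeroT g

/-! ### Rational frames -/

/-- A frame of rational points, written with a common denominator: the points of the frame are
`p / den`, for `p` in `pts`. -/
structure RFrame (d : ℕ) where
  den : ℤ
  pts : List (Pt d)

/-- `Q ∪ R`, where `R` is a list of lattice points. -/
def RFrame.unionT (μ : ℕ → ℕ) {d : ℕ} (Q : RFrame d) (R : List (Pt d)) : Timed (RFrame d) := do
  let R' ← mapT (vecScaleT μ Q.den) R
  let pts ← appendT Q.pts R'
  pure ⟨Q.den, pts⟩

/-- `(Q - p) / 2`. -/
def RFrame.shrinkT (μ : ℕ → ℕ) {d : ℕ} (Q : RFrame d) (p : Pt d) : Timed (RFrame d) := do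
  let p' ← vecScaleT μ Q.den p
  let pts ← diffsT p' Q.pts
  let den ← addT Q.den Q.den
  pure ⟨den, pts⟩

/-- Does the lattice point `x` belong to the span of `Q`? -/
def RFrame.memSpanT (μ : ℕ → ℕ) {d : ℕ} (Q : RFrame d) (x : Pt d) : Timed Bool := do
  let y ← vecScaleT μ Q.den x
  inSpanT μ y Q.pts

/-- `Q ∩ Λ`, ordered as in `Q`. -/
def RFrame.interT (μ : ℕ → ℕ) {d : ℕ} (Q : RFrame d) (Λ : List (Pt d)) :
    Timed (List (Pt d)) := do
  let sc ← mapT (fun p => do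
    let y ← vecScaleT μ Q.den p
    pure (y, p)) Λ
  let os ← mapT (fun q => do
    let o ← findT (fun yp : Pt d × Pt d => eqVecT yp.1 q) sc
    match o with
    | none => pure []
    | some yp => pure [yp.2]) Q.pts
  flattenT os

/-- The list of the points of `Λ`, each with its coordinates with respect to `Q`, multiplied by a
common positive denominator. With `y = den • p - q₀` and `w` the vectors `qᵢ - q₀`, the coordinates
are computed by Cramer's rule from the normal equations with the Gram matrix of `w`. -/
def RFrame.coordsT (μ : ℕ → ℕ) {d : ℕ} (Q : RFrame d) (Λ : List (Pt d)) :
    Timed (List (List ℤ × Pt d)) :=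
  match Q.pts with
  | [] => mapT (fun p => pure ([], p)) Λ
  | q₀ :: qs => do
    let vs ← diffsT q₀ qs
    tick vs.length
    let m := vs.length
    let w : Fin m → Pt d := vs.get
    let G ← gramT μ w
    mapT (fun p => do
      let x ← vecScaleT μ Q.den p
      let y ← vecSubT x q₀
      let b ← tupleT (fun i => dotT μ (w i) y)
      let c ← tupleT (fun i : Fin m => do
        tick (m * m)
        detT μ m (fun r s => if s = i then b r else G r s))
      tick m
      pure (List.ofFn c, p)) Λ

/-! ### Hermite normal form -/

/-- A row of `(A M | A)`, where `A` is the current transformation matrix. -/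
abbrev Row (d k : ℕ) : Type := (Fin k → ℤ) × (Fin d → ℤ)

/-- `a - q • b`. -/
def rowSubT (μ : ℕ → ℕ) {d k : ℕ} (q : ℤ) (a b : Row d k) : Timed (Row d k) := do
  let b₁ ← vecScaleT μ q b.1
  let b₂ ← vecScaleT μ q b.2
  let c₁ ← vecSubT a.1 b₁
  let c₂ ← vecSubT a.2 b₂
  pure (c₁, c₂)

/-- The Euclidean algorithm on the `j`-th entries of two rows, performed on the whole rows. The
number bounds the length of the recursion; the absolute value of the `j`-th entry of `b` is always
enough. -/
def euclidT (μ : ℕ → ℕ) {d k : ℕ} (j : Fin k) : ℕ → Row d k → Row d k → Timed (Row d k × Row d k)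
  | 0, a, b => do
    tick 1
    pure (a, b)
  | r + 1, a, b => do
    tick 1
    let z ← isZeroT (b.1 j)
    if z then pure (a, b) else
      let q ← divT (a.1 j) (b.1 j)
      let c ← rowSubT μ q a b
      euclidT μ j r b c

/-- Clear the `j`-th entries of the rows of a list by means of a pivot row. -/
def clearColumnT (μ : ℕ → ℕ) {d k : ℕ} (j : Fin k) :
    Row d k → List (Row d k) → Timed (Row d k × List (Row d k))
  | a, [] => do
    tick 1
    pure (a, [])
  | a, b :: bs => do
    tick 1
    let (a', b') ← euclidT μ j (b.1 j).natAbs a b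
    let (a'', bs') ← clearColumnT μ j a' bs
    pure (a'', b' :: bs')

/-- Make the `j`-th entry of a row nonnegative by a change of sign. -/
def fixSignT {d k : ℕ} (j : Fin k) (a : Row d k) : Timed (Row d k) := do
  let o ← cmpT (a.1 j) 0
  match o with
  | .lt => do
    let a₁ ← vecNegT a.1
    let a₂ ← vecNegT a.2
    pure (a₁, a₂)
  | _ => pure a

/-- Treat the given columns one after the other: `rows` are the rows which do not have a pivot
yet, and the rows in `done` are reduced modulo each new pivot. -/
def hermiteT (μ : ℕ → ℕ) {d k : ℕ} :
    List (Fin k) → List (Row d k) → List (Row d k) → Timed (List (Row d k))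
  | [], done, rows => do
    tick 1
    appendT done rows
  | _ :: _, done, [] => do
    tick 1
    pure done
  | j :: js, done, a :: as => do
    tick 1
    let (a', as') ← clearColumnT μ j a as
    let p ← fixSignT j a'
    let done' ← mapT (fun r => do
      let q ← divT (r.1 j) (p.1 j)
      rowSubT μ q r p) done
    let done'' ← appendT done' [p]
    hermiteT μ js done'' as'

/-- A matrix `A ∈ GL(d, ℤ)` such that `A M` is in Hermite normal form, where `M` is the matrix with
the given columns. -/
def hermiteTransformT (μ : ℕ → ℕ) {d : ℕ} (cols : List (Pt d)) :
    Timed (Fin d → Fin d → ℤ) := do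
  tick (d * (cols.length + d) + cols.length)
  let rows : List (Row d cols.length) :=
    List.ofFn (fun i : Fin d => ((fun j => cols.get j i), (Pi.single i 1 : Fin d → ℤ)))
  let res ← hermiteT μ (List.finRange cols.length) [] rows
  tick d
  pure (fun i => (res.getD i (0, 0)).2)

/-! ### Canonical form, given a frame -/

/-- Extend `T` by points of `Λ`, given with their coordinates, until it spans `Λ`. The number bounds
the number of iterations. -/
def extendT (μ : ℕ → ℕ) {d : ℕ} (cs : List (List ℤ × Pt d)) :
    ℕ → List (Pt d) → Timed (List (Pt d))
  | 0, T => do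
    tick 1
    pure T
  | r + 1, T => do
    tick 1
    let out ← filterT (fun cp : List ℤ × Pt d => do
      let b ← inSpanT μ cp.2 T
      pure (!b)) cs
    match out with
    | [] => pure T
    | c :: out' => do
      let best ← minT (fun x y : List ℤ × Pt d => cmpListT cmpT x.1 y.1) c out'
      let T' ← appendT T [best.2]
      extendT μ cs r T'

/-- `CanonicalFormWithFrame`; the returned set is sorted lexicographically. -/
def canonicalFormWithFrameT (μ : ℕ → ℕ) {d : ℕ} (Λ : List (Pt d)) (Q : RFrame d) :
    Timed (List (Pt d) × List (Pt d)) := do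
  let T₀ ← Q.interT μ Λ
  let cs ← Q.coordsT μ Λ
  let T ← extendT μ cs (d + 1) T₀
  match T with
  | [] => pure ([], [])
  | p₀ :: ps => do
    let cols ← diffsT p₀ ps
    let A ← hermiteTransformT μ cols
    let ψ : Pt d → Timed (Pt d) := fun x => do
      let y ← vecSubT x p₀
      tupleT (fun i => dotT μ (A i) y)
    let Ω ← mapT ψ Λ
    let Ω' ← sortT Ω
    let U ← mapT ψ (p₀ :: ps)
    pure (Ω', U)

/-- Lexicographic comparison of pairs (sorted set, ordered frame). -/
def cmpPairT {d : ℕ} (x y : List (Pt d) × List (Pt d)) : Timed Ordering := do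
  let o ← cmpListT cmpVecT x.1 y.1
  match o with
  | .eq => cmpListT cmpVecT x.2 y.2
  | .lt => pure .lt
  | .gt => pure .gt

/-! ### Equivariant frames -/

/-- All the lists of length at most `m` with entries in `X`. -/
def listsT {α : Type} (X : List α) : ℕ → Timed (List (List α))
  | 0 => do
    tick 1
    pure [[]]
  | m + 1 => do
    tick 1
    let ls ← listsT X m
    let ls' ← mapT (fun x => mapT (fun l => pure (x :: l)) ls) X
    let r ← flattenT ls'
    pure ([] :: r)

/-- The lists `R` with entries in `X` such that `Q ∪ R` is a `Λ`-covering frame (and, in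
particular, `Q` and `R` are disjoint). -/
def completionsT (μ : ℕ → ℕ) {d : ℕ} (Λ : List (Pt d)) (Q : RFrame d) (X : List (Pt d)) :
    Timed (List (List (Pt d))) := do
  let ls ← listsT X (d + 1)
  filterT (fun R => do
    let Q' ← Q.unionT μ R
    let b ← indepT μ Q'.pts
    if b then allT (Q'.memSpanT μ) Λ else pure false) ls

/-- Those `R` in a list for which `CanonicalFormWithFrame (Λ, Q ∪ R)` is minimal. -/
def minimalT (μ : ℕ → ℕ) {d : ℕ} (Λ : List (Pt d)) (Q : RFrame d)
    (cand : List (List (Pt d))) : Timed (List (List (Pt d))) := do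
  let keyed ← mapT (fun R => do
    let Q' ← Q.unionT μ R
    let X ← canonicalFormWithFrameT μ Λ Q'
    pure (X, R)) cand
  match keyed with
  | [] => pure []
  | x :: xs => do
    let best ← minT (fun a b => cmpPairT a.1 b.1) x xs
    let sel ← filterT (fun a => do
      let o ← cmpPairT a.1 best.1
      pure (o == .eq)) keyed
    mapT (fun a => pure a.2) sel

def congruentT {d : ℕ} (p q : Pt d) : Timed Bool := do
  let b ← tupleT (fun i => sameParityT (p i) (q i))
  tick d
  pure (decide (∀ i, b i = true))

/-- Insert a point into a partial partition in congruence classes modulo 2. -/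
def insertClassT {d : ℕ} (p : Pt d) : List (List (Pt d)) → Timed (List (List (Pt d)))
  | [] => do
    tick 1
    pure [[p]]
  | [] :: cs => do
    tick 1
    let cs' ← insertClassT p cs
    pure ([] :: cs')
  | (q :: c) :: cs => do
    tick 1
    let b ← congruentT p q
    if b then pure ((p :: q :: c) :: cs) else
      let cs' ← insertClassT p cs
      pure ((q :: c) :: cs')

/-- The partition in congruence classes modulo 2. -/
def partitionT {d : ℕ} : List (Pt d) → Timed (List (List (Pt d)))
  | [] => do
    tick 1
    pure []
  | p :: ps => do
    tick 1
    let cs ← partitionT ps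
    insertClassT p cs

/-- Find a class with more than `n / 2` elements, and separate it from the other classes. -/
def largeClassT {α : Type} (n : ℕ) :
    List (List α) → Timed (Option (List α × List (List α)))
  | [] => do
    tick 1
    pure none
  | c :: cs => do
    tick 1
    let m ← lengthT c
    tick (Nat.size n + Nat.size (2 * m) + 1)
    if n < 2 * m then pure (some (c, cs)) else
      let o ← largeClassT n cs
      match o with
      | none => pure none
      | some (b, rest) => pure (some (b, c :: rest))

/-- `EquivariantFrames2`. The first argument bounds the depth of the recursion (it makes the
definition structurally recursive; see `recursionBound`). -/
def equivariantFrames2T (μ : ℕ → ℕ) {d : ℕ} :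
    ℕ → List (Pt d) → RFrame d → Timed (List (List (Pt d)))
  | 0, _, _ => pure []
  | r + 1, Λ₀, Q => do
    tick 1
    let Λ ← filterT (fun p => do
      let b ← Q.memSpanT μ p
      pure (!b)) Λ₀
    match Λ with
    | [] => pure [[]]
    | [p] => pure [[p]]
    | p :: _ :: _ => do
      let classes ← partitionT Λ
      match classes with
      | [_] => do
        let Λ' ← mapT (fun x => do
          let y ← vecSubT x p
          vecHalfT y) Λ
        let Q' ← Q.shrinkT μ p
        let S' ← equivariantFrames2T μ r Λ' Q'
        mapT (fun V => mapT (fun x => do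
          let y ← vecAddT x x
          vecAddT y p) V) S'
      | _ => do
        let n ← lengthT Λ
        let large ← largeClassT n classes
        match large with
        | none => do
          let S ← mapT (fun c => equivariantFrames2T μ r c Q) classes
          let S₁ ← flattenT S
          let S₂ ← flattenT S₁
          let X ← dedupT eqVecT S₂
          let cand ← completionsT μ Λ Q X
          minimalT μ Λ Q cand
        | some (big, rest) => do
          let S ← mapT (fun c => equivariantFrames2T μ r c Q) rest
          let S₁ ← flattenT S
          let S₂ ← flattenT S₁
          let X ← dedupT eqVecT S₂
          let small ← flattenT rest
          let E ← completionsT μ small Q X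
          let RT ← mapT (fun R => do
            let Q' ← Q.unionT μ R
            let SR ← equivariantFrames2T μ r big Q'
            mapT (appendT R) SR) E
          let cand ← flattenT RT
          minimalT μ Λ Q cand

/-- A bound on the depth of the recursion: on each level, either the number of points decreases or
the diameter of the set is halved. -/
def recursionBound {d : ℕ} (Λ : List (Pt d)) : ℕ :=
  Λ.length + (Λ.map (fun p => ∑ i, bitSize (p i))).sum + 1

/-- `CanonicalForm`, on a set of points given as a list; the output is sorted. -/
def canonicalFormT (μ : ℕ → ℕ) {d : ℕ} (Λ : List (Pt d)) : Timed (List (Pt d)) := do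
  tick 1
  let S ← equivariantFrames2T μ (recursionBound Λ) Λ ⟨1, []⟩
  let Ωs ← mapT (fun R => do
    let X ← canonicalFormWithFrameT μ Λ ⟨1, R⟩
    pure X.1) S
  match Ωs with
  | [] => pure []
  | Ω :: Ωs' => minT (cmpListT cmpVecT) Ω Ωs'

end LatticeCanonicalForm

/-! Correctness. The procedures are relations between input and output, so three facts are needed:
an output exists, it is unique, and it is compatible with affinities. An affinity `φ` of the lattice
extends to an injective affine map of `ℚ^d`. This map carries along spans, frames and coordinates
and, up to a permutation of the residues, the classes modulo 2. `CanonicalFormWithFrame` is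
deterministic because coordinates with respect to a frame separate points and because the Hermite
normal form is unique: the matrix `A` is not determined, but its action on the span of `T` is, and
`Λ` lies in that span. Replacing `A` by `A L⁻¹`, where `L` is the linear part of `φ`, shows that
`(Λ, Q)` and its image under `φ` have the same output (`CanonicalFormWithFrame.map`). By induction
`EquivariantFrames2` commutes with `φ` (`EquivariantFrames2.map`), and its determinism is a
consequence (`EquivariantFrames2.unique`): two choices of the point `p` lead to halved problems that
differ by a translation. Hence the final minimum is the same for all sets of an orbit. It belongs to
the orbit, being the image of `Λ` under an affinity `x ↦ A (x - p₀)`.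

Existence comes from the explicit implementation. Gram determinants decide spans, Cramer's rule
gives the coordinates up to a common positive factor, and row operations do not change the lattice
generated by the rows. The recursion stops because every call either has fewer points or halves the
diameter (`equivariantFrames2T_spec`).

Complexity. Three ideas keep the cost low.

Few frames: a call returns at most `3 ^ (d * d)` frames (`EquivariantFrames2.card_le`). In the
branches that minimize, two returned frames have the same value, so that `ψ'⁻¹ ψ` is an affinity
permuting the finite set `Λ`. If the two matrices agree modulo 3, its linear part is the identity
modulo 3, and Minkowski's argument shows that it fixes every point of `Λ`; the frames are then
equal. Consequently all pools of points and all lists of candidates have sizes bounded in terms of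
`d`.

Small numbers: each halving of `Λ` doubles the denominator of `Q`, but there are only as many
halvings as bits in the diameter, so all numbers keep `O(s)` bits (`NodeInv`). In the Hermite normal
form, a quantity that does not increase along the Euclidean algorithm bounds all the entries of the
rows, and the costs of the long divisions telescope (`euclidT_bound_of_lt`).

A potential: with `P = (log N + 1) s W`, `N` a bound for the size of the initial set, `W` the cost
of one operation and `δ` a bound for the bits of the diameter, a call costs at most `c κ ^ (d + 1 -
|Q|) |Λ| (W δ + P (1 + log |Λ|))` (`equivariantFrames2T_bound`). A halving lowers `δ`. A class with
at most half of the points lowers the logarithm, which pays for the local work. The large class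
keeps its logarithm and is treated once for each `R ∈ E`, but `R` is not empty, so the exponent of
`κ` drops and pays for the repetition. At the root `δ ≤ s`, and the bound becomes `n log² n · s
μ(s)`. -/

namespace LatticeCanonicalForm

/-! ## Values of timed computations -/

section TimedBasic

variable {α β γ : Type}

@[simp] theorem Timed.val_bind (x : Timed α) (f : α → Timed β) :
    (x >>= f).val = (f x.val).val := rfl

@[simp] theorem Timed.cost_bind (x : Timed α) (f : α → Timed β) :
    (x >>= f).cost = x.cost + (f x.val).cost := rfl

@[simp] theorem Timed.val_pure (a : α) : (pure a : Timed α).val = a := rfl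

@[simp] theorem Timed.cost_pure (a : α) : (pure a : Timed α).cost = 0 := rfl

@[simp] theorem tick_cost (n : ℕ) : (tick n).cost = n := rfl

@[simp] theorem tupleT_val {m : ℕ} (f : Fin m → Timed α) :
    (tupleT f).val = fun i => (f i).val := rfl

@[simp] theorem mapT_val (f : α → Timed β) (l : List α) :
    (mapT f l).val = l.map (fun a => (f a).val) := by
  induction l with
  | nil => simp [mapT]
  | cons a as ih => simp [mapT, ih]

@[simp] theorem filterT_val (f : α → Timed Bool) (l : List α) :
    (filterT f l).val = l.filter (fun a => (f a).val) := by
  induction l with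
  | nil => simp [filterT]
  | cons a as ih => simp [filterT, ih, List.filter_cons]

@[simp] theorem findT_val (f : α → Timed Bool) (l : List α) :
    (findT f l).val = l.find? (fun a => (f a).val) := by
  induction l with
  | nil => simp [findT]
  | cons a as ih =>
    by_cases h : (f a).val <;> simp [findT, ih, h]

@[simp] theorem allT_val (f : α → Timed Bool) (l : List α) :
    (allT f l).val = l.all (fun a => (f a).val) := by
  induction l with
  | nil => simp [allT]
  | cons a as ih =>
    by_cases h : (f a).val <;> simp [allT, ih, h]

@[simp] theorem lengthT_val (l : List α) : (lengthT l).val = l.length := by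
  induction l with
  | nil => simp [lengthT]
  | cons a as ih => simp [lengthT, ih]

@[simp] theorem appendT_val (l l' : List α) : (appendT l l').val = l ++ l' := by
  induction l with
  | nil => simp [appendT]
  | cons a as ih => simp [appendT, ih]

@[simp] theorem flattenT_val (l : List (List α)) : (flattenT l).val = l.flatten := by
  induction l with
  | nil => simp [flattenT]
  | cons a as ih => simp [flattenT, ih]

theorem dedupT_spec {eqv : α → α → Timed Bool} (heqv : ∀ a b, (eqv a b).val = true ↔ a = b)
    (l : List α) :
    (dedupT eqv l).val.Nodup ∧ (∀ a, a ∈ (dedupT eqv l).val ↔ a ∈ l) ∧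
      (dedupT eqv l).val.length ≤ l.length := by
  induction l with
  | nil => simp [dedupT]
  | cons a as ih =>
    obtain ⟨h1, h2, h3⟩ := ih
    simp only [dedupT, Timed.val_bind, findT_val]
    cases h : List.find? (fun b => (eqv a b).val) (dedupT eqv as).val with
    | none =>
      rw [List.find?_eq_none] at h
      have hn : a ∉ (dedupT eqv as).val := fun hm => h a hm ((heqv a a).2 rfl)
      refine ⟨by simpa using ⟨hn, h1⟩, fun b => by simp [h2], by simpa using h3⟩
    | some b =>
      have hb := List.find?_some h
      have hm := List.mem_of_find?_eq_some h
      simp only [heqv] at hb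
      subst hb
      refine ⟨h1, fun b => ?_, by simpa using h3.trans (Nat.le_succ _)⟩
      simp only [Timed.val_pure, List.mem_cons, h2]
      constructor
      · exact Or.inr
      · rintro (rfl | h)
        · exact (h2 _).1 hm
        · exact h

/-- The timed comparison `cmp` computes the comparison of keys in a linear order. -/
def Compares {κ : Type} [LinearOrder κ] (cmp : α → α → Timed Ordering) (key : α → κ) : Prop :=
  ∀ a b, (cmp a b).val = compare (key a) (key b)

section Compares

variable {κ : Type} [LinearOrder κ] {cmp : α → α → Timed Ordering} {key : α → κ}

theorem minT_spec (h : Compares cmp key) (best : α) (l : List α) :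
    (minT cmp best l).val ∈ best :: l ∧ ∀ a ∈ best :: l, key (minT cmp best l).val ≤ key a := by
  induction l generalizing best with
  | nil => simp [minT]
  | cons a as ih =>
    simp only [minT, Timed.val_bind, h a best]
    rcases lt_trichotomy (key a) (key best) with hlt | heq | hgt
    · rw [compare_lt_iff_lt.2 hlt]
      obtain ⟨h1, h2⟩ := ih a
      refine ⟨List.mem_cons_of_mem _ h1, fun b hb => ?_⟩
      rcases List.mem_cons.1 hb with rfl | hb
      · exact (h2 a List.mem_cons_self).trans hlt.le
      · exact h2 b hb
    all_goals
      obtain ⟨h1, h2⟩ := ih best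
      have hle : key best ≤ key a := by first | exact heq.ge | exact hgt.le
      have : (minT cmp best as).val ∈ best :: a :: as ∧
          ∀ b ∈ best :: a :: as, key (minT cmp best as).val ≤ key b := by
        refine ⟨?_, fun b hb => ?_⟩
        · rcases List.mem_cons.1 h1 with h1 | h1
          · rw [h1]; exact List.mem_cons_self
          · exact List.mem_cons_of_mem _ (List.mem_cons_of_mem _ h1)
        · rcases List.mem_cons.1 hb with rfl | hb
          · exact h2 b List.mem_cons_self
          · rcases List.mem_cons.1 hb with rfl | hb
            · exact (h2 best List.mem_cons_self).trans hle
            · exact h2 b (List.mem_cons_of_mem _ hb)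
    · rw [compare_eq_iff_eq.2 heq]; exact this
    · rw [compare_gt_iff_gt.2 hgt]; exact this

theorem compares_cmpListT (h : Compares cmp key) :
    Compares (cmpListT cmp) (fun l : List α => l.map key) := by
  intro as
  induction as with
  | nil =>
    intro bs
    cases bs with
    | nil => simp [cmpListT]
    | cons b bs =>
      simp only [cmpListT, Timed.val_bind, Timed.val_pure]
      exact (compare_lt_iff_lt.2 (by simp)).symm
  | cons a as ih =>
    intro bs
    cases bs with
    | nil =>
      simp only [cmpListT, Timed.val_bind, Timed.val_pure]
      exact (compare_gt_iff_gt.2 (by simp)).symm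
    | cons b bs =>
      simp only [cmpListT, Timed.val_bind, h a b, List.map_cons]
      rcases lt_trichotomy (key a) (key b) with hlt | heq | hgt
      · rw [compare_lt_iff_lt.2 hlt]
        exact (compare_lt_iff_lt.2 (List.cons_lt_cons_iff.2 (Or.inl hlt))).symm
      · rw [compare_eq_iff_eq.2 heq, heq]
        simp only [ih bs]
        rcases lt_trichotomy (as.map key) (bs.map key) with h1 | h1 | h1
        · rw [compare_lt_iff_lt.2 h1]
          exact (compare_lt_iff_lt.2 (List.cons_lt_cons_iff.2 (Or.inr ⟨rfl, h1⟩))).symm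
        · rw [compare_eq_iff_eq.2 h1, h1]
          exact (compare_eq_iff_eq.2 rfl).symm
        · rw [compare_gt_iff_gt.2 h1]
          exact (compare_gt_iff_gt.2 (List.cons_lt_cons_iff.2 (Or.inr ⟨rfl, h1⟩))).symm
      · rw [compare_gt_iff_gt.2 hgt]
        exact (compare_gt_iff_gt.2 (List.cons_lt_cons_iff.2 (Or.inl hgt))).symm

theorem splitT_spec (l : List α) :
    ((splitT l).val.1 ++ (splitT l).val.2).Perm l ∧
      (splitT l).val.1.length = (l.length + 1) / 2 ∧ (splitT l).val.2.length = l.length / 2 := by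
  induction l with
  | nil => simp [splitT]
  | cons a as ih =>
    obtain ⟨h1, h2, h3⟩ := ih
    simp only [splitT, Timed.val_bind, Timed.val_pure, List.length_cons]
    refine ⟨?_, by omega, by omega⟩
    -- The two halves exchange roles at every element, hence the commutation.
    simpa using List.perm_append_comm.trans h1

theorem mergeT_perm (cmp : α → α → Timed Ordering) (as bs : List α) :
    (mergeT cmp as bs).val.Perm (as ++ bs) := by
  induction as, bs using mergeT.induct with
  | case1 bs => simp [mergeT]
  | case2 a as => simp [mergeT]
  | case3 a as b bs ih1 ih2 =>
    rw [mergeT]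
    simp only [Timed.val_bind]
    cases (cmp a b).val
    all_goals simp only [Timed.val_bind, Timed.val_pure]
    · exact ih2.cons a
    · exact ih2.cons a
    · exact (ih1.cons b).trans List.perm_middle.symm

theorem mergeT_sorted (h : Compares cmp key) (as bs : List α)
    (ha : as.Pairwise (fun x y => key x ≤ key y)) (hb : bs.Pairwise (fun x y => key x ≤ key y)) :
    (mergeT cmp as bs).val.Pairwise (fun x y => key x ≤ key y) := by
  induction as, bs using mergeT.induct with
  | case1 bs => simpa [mergeT] using hb
  | case2 a as => simpa [mergeT] using ha
  | case3 a as b bs ih1 ih2 =>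
    rw [List.pairwise_cons] at ha hb
    have hle (hab : key a ≤ key b) : (a :: (mergeT cmp as (b :: bs)).val).Pairwise
        (fun x y => key x ≤ key y) := by
      rw [List.pairwise_cons]
      refine ⟨fun x hx => ?_, ih2 ha.2 (List.pairwise_cons.2 hb)⟩
      rw [(mergeT_perm cmp as (b :: bs)).mem_iff, List.mem_append, List.mem_cons] at hx
      rcases hx with hx | rfl | hx
      · exact ha.1 x hx
      · exact hab
      · exact hab.trans (hb.1 x hx)
    rw [mergeT]
    simp only [Timed.val_bind, h a b]
    rcases lt_trichotomy (key a) (key b) with hlt | heq | hgt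
    · rw [compare_lt_iff_lt.2 hlt]
      exact hle hlt.le
    · rw [compare_eq_iff_eq.2 heq]
      exact hle heq.le
    · rw [compare_gt_iff_gt.2 hgt]
      simp only [Timed.val_bind, Timed.val_pure]
      rw [List.pairwise_cons]
      refine ⟨fun x hx => ?_, ih1 (List.pairwise_cons.2 ha) hb.2⟩
      rw [(mergeT_perm cmp (a :: as) bs).mem_iff, List.mem_append, List.mem_cons] at hx
      rcases hx with (rfl | hx) | hx
      · exact hgt.le
      · exact hgt.le.trans (ha.1 x hx)
      · exact hb.1 x hx

theorem mergeSortT_perm (cmp : α → α → Timed Ordering) (n : ℕ) (l : List α) :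
    (mergeSortT cmp n l).val.Perm l := by
  induction n generalizing l with
  | zero => simp [mergeSortT]
  | succ n ih =>
    match l with
    | [] => simp [mergeSortT]
    | [a] => simp [mergeSortT]
    | a :: b :: l =>
      simp only [mergeSortT, Timed.val_bind]
      exact ((mergeT_perm cmp _ _).trans ((ih _).append (ih _))).trans (splitT_spec _).1

/-- The halves of a list of at least two elements are strictly shorter, so the length is enough as
depth of the recursion. -/
theorem mergeSortT_sorted (h : Compares cmp key) (n : ℕ) (l : List α) (hl : l.length ≤ n) :
    (mergeSortT cmp n l).val.Pairwise (fun x y => key x ≤ key y) := by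
  induction n generalizing l with
  | zero => simp [List.length_eq_zero_iff.1 (Nat.le_zero.1 hl), mergeSortT]
  | succ n ih =>
    match l with
    | [] => simp [mergeSortT]
    | [a] => simp [mergeSortT]
    | a :: b :: l =>
      simp only [mergeSortT, Timed.val_bind]
      obtain ⟨-, h1, h2⟩ := splitT_spec (a :: b :: l)
      simp only [List.length_cons] at h1 h2 hl
      exact mergeT_sorted h _ _ (ih _ (by omega)) (ih _ (by omega))

end Compares

theorem compares_cmpT : Compares cmpT (id : ℤ → ℤ) := fun _ _ => rfl

theorem ofFn_lt_ofFn {d : ℕ} {u v : Pt d} : List.ofFn u < List.ofFn v ↔ toLex u < toLex v := by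
  have key : ∀ {d : ℕ} (u v : Pt d), toLex u < toLex v → List.ofFn u < List.ofFn v := by
    rintro d u v ⟨i, h1, h2⟩
    simp only [Pi.toLex_apply] at h1 h2
    induction d with
    | zero => exact i.elim0
    | succ d ih =>
      rw [List.ofFn_succ, List.ofFn_succ, List.cons_lt_cons_iff]
      induction i using Fin.cases with
      | zero => exact Or.inl h2
      | succ i =>
        refine Or.inr ⟨h1 0 (Fin.succ_pos i), ih (fun i => u i.succ) (fun i => v i.succ) i
          (fun j hj => h1 j.succ (Fin.succ_lt_succ_iff.2 hj)) h2⟩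
  -- Both orders are linear, so one implication gives the other.
  refine ⟨fun h => ?_, key u v⟩
  rcases lt_trichotomy (toLex u) (toLex v) with h' | h' | h'
  · exact h'
  · rw [toLex.injective h'] at h
    exact absurd h (lt_irrefl _)
  · exact absurd h (key v u h').not_gt

theorem compares_cmpVecT {d : ℕ} : Compares (cmpVecT (d := d)) (toLex : Pt d → Lex (Pt d)) := by
  intro u v
  simp only [cmpVecT, Timed.val_bind, compares_cmpListT compares_cmpT _ _, List.map_id]
  rcases lt_trichotomy (toLex u) (toLex v) with h | h | h
  · rw [compare_lt_iff_lt.2 h, compare_lt_iff_lt.2 (by simpa using ofFn_lt_ofFn.2 h)]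
  · rw [compare_eq_iff_eq.2 h, toLex.injective h, compare_eq_iff_eq.2 rfl]
  · rw [compare_gt_iff_gt.2 h, compare_gt_iff_gt.2 (by simpa using ofFn_lt_ofFn.2 h)]

@[simp] theorem eqVecT_val {d : ℕ} (u v : Pt d) : (eqVecT u v).val = true ↔ u = v := by
  simp only [eqVecT, Timed.val_bind, Timed.val_pure, compares_cmpVecT u v, beq_iff_eq,
    compare_eq_iff_eq]
  exact toLex.injective.eq_iff

theorem compares_cmpPairT {d : ℕ} : Compares (cmpPairT (d := d))
    (fun X : List (Pt d) × List (Pt d) =>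
      (toLex (X.1.map toLex, X.2.map toLex) : List (Lex (Pt d)) ×ₗ List (Lex (Pt d)))) := by
  intro x y
  simp only [cmpPairT, Timed.val_bind, compares_cmpListT compares_cmpVecT _ _]
  rcases lt_trichotomy (x.1.map toLex) (y.1.map toLex) with h | h | h
  · rw [compare_lt_iff_lt.2 h]
    exact (compare_lt_iff_lt.2 (Prod.Lex.toLex_lt_toLex.2 (Or.inl h))).symm
  · rw [compare_eq_iff_eq.2 h, h]
    simp only [compares_cmpListT compares_cmpVecT _ _]
    rcases lt_trichotomy (x.2.map toLex) (y.2.map toLex) with h1 | h1 | h1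
    · rw [compare_lt_iff_lt.2 h1]
      exact (compare_lt_iff_lt.2 (Prod.Lex.toLex_lt_toLex.2 (Or.inr ⟨by simp only, h1⟩))).symm
    · rw [compare_eq_iff_eq.2 h1, h1]
      exact (compare_eq_iff_eq.2 rfl).symm
    · rw [compare_gt_iff_gt.2 h1]
      exact (compare_gt_iff_gt.2 (Prod.Lex.toLex_lt_toLex.2 (Or.inr ⟨by simp only, h1⟩))).symm
  · rw [compare_gt_iff_gt.2 h]
    exact (compare_gt_iff_gt.2 (Prod.Lex.toLex_lt_toLex.2 (Or.inl h))).symm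

/-- Two sorted lists without repetitions and with the same elements coincide. This identifies the
sorted list of the implementation with the key used to compare sets. -/
theorem sortT_spec {d : ℕ} (l : List (Pt d)) (hl : l.Nodup) :
    (sortT l).val.Perm l ∧ (sortT l).val.map toLex = setKey l.toFinset := by
  have hp : (sortT l).val.Perm l := by
    simpa [sortT] using mergeSortT_perm cmpVecT l.length l
  have hs : (sortT l).val.Pairwise (fun x y => toLex x ≤ toLex y) := by
    simpa [sortT] using mergeSortT_sorted compares_cmpVecT l.length l le_rfl
  refine ⟨hp, ?_⟩
  unfold setKey
  refine List.Perm.eq_of_pairwise (le := (· ≤ ·)) (fun a b _ _ h1 h2 => le_antisymm h1 h2)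
    (List.pairwise_map.2 hs) (Finset.pairwise_sort _ _) ?_
  refine (List.perm_ext_iff_of_nodup ((hp.nodup_iff.2 hl).map toLex.injective)
    (Finset.sort_nodup _ _)).2 fun a => ?_
  simp only [List.mem_map, hp.mem_iff, Finset.mem_sort, Finset.mem_map, List.mem_toFinset]
  rfl

theorem setKey_injective {d : ℕ} : Function.Injective (setKey (d := d)) := by
  intro Ω Ω' h
  have := congrArg List.toFinset h
  simp only [setKey, Finset.sort_toFinset] at this
  exact Finset.map_injective _ this

/-- A tie between minimal keys is therefore an equality of values. The bound on the number of frames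
starts from such equalities. -/
theorem pairKey_injective {d : ℕ} : Function.Injective (pairKey (d := d)) := by
  rintro ⟨Ω, U⟩ ⟨Ω', U'⟩ h
  have h' := toLex.injective h
  rw [Prod.mk.injEq] at h' ⊢
  exact ⟨setKey_injective h'.1, toLex.injective.list_map h'.2⟩

end TimedBasic

/-! ## Frames and their spans -/

section Frames

variable {d : ℕ}

theorem toRat_injective : Function.Injective (toRat (d := d)) := fun p q h => by
  ext i
  exact Int.cast_injective (congrFun h i)

@[simp] theorem toRat_inj {p q : Pt d} : toRat p = toRat q ↔ p = q := toRat_injective.eq_iff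

theorem mem_ratSpan {Q : List (RPt d)} {q : RPt d} (h : q ∈ Q) : q ∈ ratSpan Q :=
  subset_affineSpan ℚ _ h

theorem ratSpan_le {Q : List (RPt d)} {A : AffineSubspace ℚ (RPt d)} :
    ratSpan Q ≤ A ↔ ∀ q ∈ Q, q ∈ A :=
  affineSpan_le

theorem ratSpan_mono {Q Q' : List (RPt d)} (h : Q ⊆ Q') : ratSpan Q ≤ ratSpan Q' :=
  affineSpan_mono ℚ fun _ hx => h hx

theorem ratSpan_eq_range (Q : List (RPt d)) :
    ratSpan Q = affineSpan ℚ (Set.range fun i : Fin Q.length => Q.get i) := by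
  unfold ratSpan
  congr 1
  exact (Set.range_list_get Q).symm

@[simp] theorem notMem_ratSpan_nil {x : RPt d} : x ∉ ratSpan ([] : List (RPt d)) := by
  simp [ratSpan, AffineSubspace.notMem_bot]

theorem isFrame_nil : IsFrame ([] : List (RPt d)) := by
  have : IsEmpty (Fin ([] : List (RPt d)).length) := Fin.isEmpty'
  exact affineIndependent_of_subsingleton ℚ _

theorem IsFrame.sublist {Q Q' : List (RPt d)} (hQ : IsFrame Q) (h : Q'.Sublist Q) :
    IsFrame Q' := by
  obtain ⟨f, hf⟩ := List.sublist_iff_exists_fin_orderEmbedding_get_eq.1 h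
  have : (fun i : Fin Q'.length => Q'.get i) = (fun i : Fin Q.length => Q.get i) ∘ f.toEmbedding :=
    funext hf
  unfold IsFrame
  rw [this]
  exact AffineIndependent.comp_embedding _ hQ

theorem IsFrame.nodup {Q : List (RPt d)} (hQ : IsFrame Q) : Q.Nodup :=
  List.nodup_iff_injective_get.2 hQ.injective

/-- Frames are built and tested one point at a time; every such step goes through this equivalence.
-/
theorem isFrame_append_singleton {T : List (RPt d)} {p : RPt d} :
    IsFrame (T ++ [p]) ↔ IsFrame T ∧ p ∉ ratSpan T := by
  have hlen : (T ++ [p]).length = T.length + 1 := by simp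
  let e : Fin (T.length + 1) ≃ Fin (T ++ [p]).length := finCongr hlen.symm
  have key : IsFrame (T ++ [p]) ↔
      AffineIndependent ℚ (Fin.snoc (fun i : Fin T.length => T.get i) p : Fin (T.length + 1) → RPt d) := by
    unfold IsFrame
    rw [← affineIndependent_equiv e]
    have : ((fun i => (T ++ [p]).get i) ∘ e : Fin (T.length + 1) → RPt d) =
        (Fin.snoc (fun i : Fin T.length => T.get i) p : Fin (T.length + 1) → RPt d) := by
      funext i
      induction i using Fin.lastCases with
      | last => simp [e]
      | cast i => simp [e]
    rw [this]
  rw [key]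
  constructor
  · intro h
    constructor
    · have := h.comp_embedding (Fin.castSuccEmb (n := T.length))
      unfold IsFrame
      convert this using 1
      funext i
      simp
    · have := h.notMem_affineSpan_sdiff (Fin.last _) Set.univ
      rw [ratSpan_eq_range]
      intro hp
      apply this
      simp only [Fin.snoc_last]
      refine affineSpan_mono ℚ ?_ hp
      rintro _ ⟨i, rfl⟩
      exact ⟨i.castSucc, ⟨trivial, (Fin.castSucc_lt_last i).ne⟩, by simp⟩
  · rintro ⟨h, hp⟩
    apply AffineIndependent.affineIndependent_of_notMem_span (i := Fin.last T.length)
    · let f : {y : Fin (T.length + 1) // y ≠ Fin.last T.length} ↪ Fin T.length :=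
        ⟨fun y => y.1.castPred y.2, fun y z hyz => Subtype.ext (by
          have := congrArg Fin.castSucc hyz
          simpa using this)⟩
      have := h.comp_embedding f
      convert this using 1
      funext ⟨y, hy⟩
      induction y using Fin.lastCases with
      | last => exact absurd rfl hy
      | cast i =>
        simp only [Fin.snoc_castSucc, Function.comp_apply]
        rfl
    · simp only [Fin.snoc_last]
      intro hm
      apply hp
      rw [ratSpan_eq_range]
      refine affineSpan_mono ℚ ?_ hm
      rintro _ ⟨y, hy, rfl⟩
      induction y using Fin.lastCases with
      | last => exact absurd rfl hy
      | cast i => exact ⟨i, by simp⟩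

theorem IsFrame.append_right {Q R : List (RPt d)} (h : IsFrame (Q ++ R)) : IsFrame R :=
  h.sublist (List.sublist_append_right _ _)

/-- An affine map which restricts to the affinity `φ` on the lattice, and is injective. -/
structure Extends (g : RPt d →ᵃ[ℚ] RPt d) (φ : Aff d) : Prop where
  injective : Function.Injective g
  map_toRat : ∀ p, g (toRat p) = toRat (φ p)

section Map

variable {g : RPt d →ᵃ[ℚ] RPt d}

theorem isFrame_map (hg : Function.Injective g) {Q : List (RPt d)} :
    IsFrame (Q.map g) ↔ IsFrame Q := by
  have hlen : (Q.map g).length = Q.length := by simp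
  unfold IsFrame
  rw [← affineIndependent_equiv (finCongr hlen.symm), ← AffineMap.affineIndependent_iff (p := fun i : Fin Q.length => Q.get i) g hg]
  have : ((fun i => (Q.map g).get i) ∘ (finCongr hlen.symm) : Fin Q.length → RPt d) =
      g ∘ (fun i => Q.get i) := by
    funext i
    simp
  rw [this]

theorem mem_ratSpan_map (hg : Function.Injective g) {Q : List (RPt d)} {x : RPt d} :
    g x ∈ ratSpan (Q.map g) ↔ x ∈ ratSpan Q := by
  have : ratSpan (Q.map g) = (ratSpan Q).map g := by
    unfold ratSpan
    rw [AffineSubspace.map_span]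
    congr 1
    ext y
    simp
  rw [this, AffineSubspace.mem_map_iff_mem_of_injective hg]

end Map

/-! ### Dimensions -/

open Classical in
/-- One more than the dimension of an affine subspace (zero for the empty one). -/
noncomputable def affDim (A : AffineSubspace ℚ (RPt d)) : ℕ :=
  if A = ⊥ then 0 else Module.finrank ℚ A.direction + 1

theorem affDim_mono {A B : AffineSubspace ℚ (RPt d)} (h : A ≤ B) : affDim A ≤ affDim B := by
  unfold affDim
  split_ifs with h1 h2 h2
  · exact le_rfl
  · exact Nat.zero_le _
  · exact absurd (le_bot_iff.1 (h2 ▸ h)) h1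
  · exact Nat.succ_le_succ (Submodule.finrank_mono (AffineSubspace.direction_le h))

/-- The shift by one in `affDim` separates the empty subspace from a point. With the dimension of
the direction alone this would fail for `⊥` inside a point. -/
theorem eq_of_le_of_affDim_le {A B : AffineSubspace ℚ (RPt d)} (h : A ≤ B)
    (h' : affDim B ≤ affDim A) : A = B := by
  unfold affDim at h'
  split_ifs at h' with h1 h2 h2
  · rw [h1, h2]
  · rw [h1]; exact (le_bot_iff.1 (h1 ▸ h))
  · omega
  · exact AffineSubspace.eq_of_direction_eq_of_nonempty_of_le
      (Submodule.eq_of_le_of_finrank_le (AffineSubspace.direction_le h) (by omega))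
      ((AffineSubspace.nonempty_iff_ne_bot _).2 h2) h

theorem affDim_le (A : AffineSubspace ℚ (RPt d)) : affDim A ≤ d + 1 := by
  unfold affDim
  split_ifs
  · exact Nat.zero_le _
  · have := Submodule.finrank_le A.direction
    simp only [Module.finrank_fintype_fun_eq_card, Fintype.card_fin] at this
    omega

theorem affDim_ratSpan {T : List (RPt d)} (hT : IsFrame T) : affDim (ratSpan T) = T.length := by
  unfold affDim
  rcases T with _ | ⟨p, T⟩
  · simp [ratSpan]
  · have hp : p ∈ ratSpan (p :: T) := mem_ratSpan List.mem_cons_self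
    have hne : ratSpan (p :: T) ≠ ⊥ := by
      intro h
      rw [h] at hp
      exact AffineSubspace.notMem_bot ℚ _ p hp
    rw [if_neg hne, ratSpan_eq_range,
      direction_affineSpan, hT.finrank_vectorSpan (n := T.length) (by simp)]
    simp

theorem IsFrame.length_le {T : List (RPt d)} (hT : IsFrame T) : T.length ≤ d + 1 :=
  affDim_ratSpan hT ▸ affDim_le _

theorem spanDimSucc_eq (Λ : Finset (Pt d)) :
    spanDimSucc Λ = affDim (affineSpan ℚ (toRat '' (Λ : Set (Pt d)))) := by
  unfold spanDimSucc affDim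
  rw [direction_affineSpan]
  by_cases h : Λ = ∅
  · simp [h]
  · rw [if_neg h, if_neg]
    rw [affineSpan_eq_bot]
    simpa using h

/-- The guard of the loop counts dimensions. For a frame inside `Λ`, equal dimensions mean equal
spans, so the guard fails exactly when `T` spans `Λ`. -/
theorem length_lt_spanDimSucc_iff {Λ : Finset (Pt d)} {T : List (Pt d)} (hT : IsFrame (T.map toRat))
    (hTΛ : ∀ p ∈ T, p ∈ Λ) :
    T.length < spanDimSucc Λ ↔ ∃ p ∈ Λ, toRat p ∉ ratSpan (T.map toRat) := by
  have hle : ratSpan (T.map toRat) ≤ affineSpan ℚ (toRat '' (Λ : Set (Pt d))) := by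
    rw [ratSpan_le]
    intro q hq
    obtain ⟨p, hp, rfl⟩ := List.mem_map.1 hq
    exact subset_affineSpan ℚ _ ⟨p, hTΛ p hp, rfl⟩
  have hlen : T.length = affDim (ratSpan (T.map toRat)) := by rw [affDim_ratSpan hT]; simp
  rw [spanDimSucc_eq, hlen, ← not_iff_not]
  push Not
  constructor
  · intro h p hp
    rw [eq_of_le_of_affDim_le hle h]
    exact subset_affineSpan ℚ _ ⟨p, hp, rfl⟩
  · intro h
    apply affDim_mono
    rw [affineSpan_le]
    rintro _ ⟨p, hp, rfl⟩
    exact h p hp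

/-- Greedy choice: a point is appended exactly when it lies outside the current span. This is why
the algorithm always finds a candidate. -/
theorem exists_completion {Q : List (RPt d)} (hQ : IsFrame Q) (X : List (Pt d)) :
    ∃ R : List (Pt d), R ⊆ X ∧ IsFrame (Q ++ R.map toRat) ∧
      ∀ p ∈ X, toRat p ∈ ratSpan (Q ++ R.map toRat) := by
  induction X with
  | nil => exact ⟨[], by simp, by simpa using hQ, by simp⟩
  | cons x X ih =>
    obtain ⟨R, h1, h2, h3⟩ := ih
    by_cases hx : toRat x ∈ ratSpan (Q ++ R.map toRat)
    · exact ⟨R, fun p hp => List.mem_cons_of_mem _ (h1 hp), h2, by simpa using ⟨hx, h3⟩⟩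
    · refine ⟨R ++ [x], ?_, ?_, ?_⟩
      · intro p hp
        rcases List.mem_append.1 hp with hp | hp
        · exact List.mem_cons_of_mem _ (h1 hp)
        · rw [List.mem_singleton.1 hp]; exact List.mem_cons_self
      · rw [List.map_append, ← List.append_assoc]
        exact isFrame_append_singleton.2 ⟨h2, hx⟩
      · intro p hp
        rw [List.map_append, ← List.append_assoc]
        rcases List.mem_cons.1 hp with rfl | hp
        · exact mem_ratSpan (by simp)
        · exact ratSpan_mono (List.subset_append_left _ _) (h3 p hp)

/-! ### Weights -/

theorem isWeights_iff {Q : List (RPt d)} {x : RPt d} {w : Fin Q.length → ℚ} :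
    IsWeights Q x w ↔ ∑ i, w i = 1 ∧
      Finset.univ.affineCombination ℚ (fun i : Fin Q.length => Q.get i) w = x := by
  unfold IsWeights
  refine and_congr_right fun h => ?_
  rw [Finset.affineCombination_eq_linear_combination _ _ _ h]

theorem exists_isWeights {Q : List (RPt d)} {x : RPt d} (hx : x ∈ ratSpan Q) :
    ∃ w, IsWeights Q x w := by
  rw [ratSpan_eq_range] at hx
  obtain ⟨w, h1, h2⟩ := eq_affineCombination_of_mem_affineSpan_of_fintype hx
  exact ⟨w, isWeights_iff.2 ⟨h1, h2.symm⟩⟩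

theorem IsWeights.unique {Q : List (RPt d)} (hQ : IsFrame Q) {x : RPt d}
    {w v : Fin Q.length → ℚ} (hw : IsWeights Q x w) (hv : IsWeights Q x v) : w = v := by
  rw [isWeights_iff] at hw hv
  exact (affineIndependent_iff_eq_of_fintype_affineCombination_eq ℚ _).1 hQ w v hw.1 hv.1
    (hw.2.trans hv.2.symm)

/-- Weights with respect to a frame are unique, so two witnesses compare the same coordinates.
Asymmetry makes the point chosen in a loop step unique. -/
theorem CoordLT.asymm {Q : List (RPt d)} (hQ : IsFrame Q) {x y : RPt d} (h : CoordLT Q x y) :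
    ¬ CoordLT Q y x := by
  rintro ⟨v', w', hv', hw', j', hj', hlt', heq'⟩
  obtain ⟨w, v, hw, hv, j, hj, hlt, heq⟩ := h
  obtain rfl := hw.unique hQ hw'
  obtain rfl := hv.unique hQ hv'
  rcases lt_trichotomy j j' with h | rfl | h
  · exact absurd (heq' j hj h) hlt.ne'
  · exact absurd hlt hlt'.le.not_gt
  · exact absurd (heq j' hj' h) hlt'.ne'

/-- Affine maps preserve affine combinations. The casts only identify the index types of `Q` and
`Q.map g`. -/
theorem IsWeights.map {Q : List (RPt d)} {x : RPt d} {w : Fin Q.length → ℚ}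
    (h : IsWeights Q x w) (g : RPt d →ᵃ[ℚ] RPt d) :
    IsWeights (Q.map g) (g x) (fun i => w (i.cast (by simp))) := by
  rw [isWeights_iff] at h
  have hsum : ∀ {M : Type} [AddCommMonoid M] (F : Fin Q.length → M),
      ∑ i : Fin (Q.map g).length, F (i.cast (by simp)) = ∑ i, F i := fun F =>
    Fintype.sum_equiv (finCongr (by simp)) _ _ fun i => rfl
  refine ⟨(hsum w).trans h.1, ?_⟩
  rw [← h.2, Finset.map_affineCombination _ _ _ h.1,
    Finset.affineCombination_eq_linear_combination _ _ _ h.1]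
  refine Eq.trans ?_ (hsum fun i => w i • (g ∘ fun i => Q.get i) i)
  exact Finset.sum_congr rfl fun i _ => by simp

theorem CoordLT.map {Q : List (RPt d)} {x y : RPt d} (h : CoordLT Q x y)
    (g : RPt d →ᵃ[ℚ] RPt d) : CoordLT (Q.map g) (g x) (g y) := by
  obtain ⟨w, v, hw, hv, j, hj, hlt, heq⟩ := h
  exact ⟨_, _, hw.map g, hv.map g, j.cast (by simp), hj, hlt, fun i hi hij => heq _ hi hij⟩

end Frames

section CanonicalFormWithFrameTheory

variable {d : ℕ}

/-! ## Affinities over the rationals -/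

/-- The rational affine map `x ↦ A x + b`. -/
noncomputable def ratAff (A : Matrix (Fin d) (Fin d) ℤ) (b : RPt d) : RPt d →ᵃ[ℚ] RPt d :=
  (Matrix.toLin' (A.map (Int.cast : ℤ → ℚ))).toAffineMap + AffineMap.const ℚ _ b

theorem ratAff_apply (A : Matrix (Fin d) (Fin d) ℤ) (b x : RPt d) :
    ratAff A b x = (A.map (Int.cast : ℤ → ℚ)).mulVec x + b := by
  simp [ratAff]

theorem toRat_add (p q : Pt d) : toRat (p + q) = toRat p + toRat q := by
  ext i; simp [toRat]

theorem toRat_sub (p q : Pt d) : toRat (p - q) = toRat p - toRat q := by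
  ext i; simp [toRat]

theorem toRat_smul (c : ℤ) (p : Pt d) : toRat (c • p) = (c : ℚ) • toRat p := by
  ext i; simp [toRat]

theorem toRat_mulVec (A : Matrix (Fin d) (Fin d) ℤ) (p : Pt d) :
    toRat (A.mulVec p) = (A.map (Int.cast : ℤ → ℚ)).mulVec (toRat p) := by
  ext i; simp [toRat, Matrix.mulVec, dotProduct]

theorem ratAff_toRat (A : Matrix (Fin d) (Fin d) ℤ) (b p : Pt d) :
    ratAff A (toRat b) (toRat p) = toRat (A.mulVec p + b) := by
  rw [ratAff_apply, toRat_add, toRat_mulVec]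

theorem ratAff_injective {A B : Matrix (Fin d) (Fin d) ℤ} (h : B * A = 1) (b : RPt d) :
    Function.Injective (ratAff A b) := by
  have h' : B.map (Int.cast : ℤ → ℚ) * A.map (Int.cast : ℤ → ℚ) = 1 := by
    have := congrArg (fun M => M.map (Int.castRingHom ℚ)) h
    simp only [Matrix.map_mul] at this
    rw [Matrix.map_one _ (map_zero _) (map_one _)] at this
    exact this
  intro x y hxy
  rw [ratAff_apply, ratAff_apply, add_left_inj] at hxy
  have := congrArg (fun v => (B.map (Int.cast : ℤ → ℚ)).mulVec v) hxy
  simpa [Matrix.mulVec_mulVec, h'] using this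

/-- The matrix of an affinity of the lattice. -/
noncomputable def affMatrix (φ : Aff d) : Matrix (Fin d) (Fin d) ℤ :=
  LinearMap.toMatrix' (φ.linear : Pt d →ₗ[ℤ] Pt d)

theorem affMatrix_mulVec (φ : Aff d) (v : Pt d) : (affMatrix φ).mulVec v = φ.linear v := by
  simp [affMatrix, LinearMap.toMatrix'_mulVec]

theorem affMatrix_symm_mul (φ : Aff d) : affMatrix φ.symm * affMatrix φ = 1 := by
  apply Matrix.toLin'.injective
  ext1 i
  ext1
  simp only [LinearMap.comp_apply, Matrix.toLin'_apply, ← Matrix.mulVec_mulVec, affMatrix_mulVec,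
    Matrix.toLin'_one, LinearMap.id_apply]
  simp

theorem aff_apply (φ : Aff d) (p : Pt d) : φ p = (affMatrix φ).mulVec p + φ 0 := by
  rw [affMatrix_mulVec]
  have := φ.map_vadd 0 p
  simpa using this

theorem aff_sub (φ : Aff d) (p q : Pt d) : φ p - φ q = (affMatrix φ).mulVec (p - q) := by
  rw [aff_apply φ p, aff_apply φ q, Matrix.mulVec_sub]
  abel

/-- The same integral matrix and translation vector are read over `ℚ`. -/
theorem exists_extends (φ : Aff d) : ∃ g, Extends g φ :=
  ⟨ratAff (affMatrix φ) (toRat (φ 0)), ratAff_injective (affMatrix_symm_mul φ) _, fun p => by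
    rw [ratAff_toRat, ← aff_apply]⟩

/-- The matrix of an affinity of the lattice, as an element of `GL(d, ℤ)`. -/
noncomputable def affGL (φ : Aff d) : Matrix.GeneralLinearGroup (Fin d) ℤ where
  val := affMatrix φ
  inv := affMatrix φ.symm
  val_inv := affMatrix_symm_mul φ.symm
  inv_val := affMatrix_symm_mul φ

/-- The affinity `x ↦ A (x - p)`. -/
def glAff (A : Matrix.GeneralLinearGroup (Fin d) ℤ) (p : Pt d) : Aff d where
  toFun x := (A : Matrix (Fin d) (Fin d) ℤ).mulVec (x - p)
  invFun x := ((A⁻¹ : Matrix.GeneralLinearGroup (Fin d) ℤ) : Matrix (Fin d) (Fin d) ℤ).mulVec x + p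
  left_inv x := by
    simp only [Matrix.mulVec_mulVec, ← Units.val_mul]
    simp
  right_inv x := by
    simp only [add_sub_cancel_right, Matrix.mulVec_mulVec, ← Units.val_mul]
    simp
  linear := LinearEquiv.ofLinearMap (Matrix.toLin' (A : Matrix (Fin d) (Fin d) ℤ))
    (Matrix.toLin' ((A⁻¹ : Matrix.GeneralLinearGroup (Fin d) ℤ) : Matrix (Fin d) (Fin d) ℤ))
    (by rw [← Matrix.toLin'_mul, ← Units.val_mul]; simp)
    (by rw [← Matrix.toLin'_mul, ← Units.val_mul]; simp)
  map_vadd' x v := by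
    simp [Matrix.mulVec_add, add_sub_assoc]

theorem glAff_apply (A : Matrix.GeneralLinearGroup (Fin d) ℤ) (p x : Pt d) :
    glAff A p x = (A : Matrix (Fin d) (Fin d) ℤ).mulVec (x - p) := rfl

/-! ## Uniqueness of the Hermite normal form -/

/-- The Hermite normal form condition, for a sequence of columns. -/
def HermiteCols (k : ℕ) (h : ℕ → Fin d → ℤ) : Prop :=
  (∀ j < k, ∀ i : Fin d, j < i → h j i = 0) ∧
    ∀ j < k, ∃ i : Fin d, (i : ℕ) = j ∧ 0 < h j i ∧ ∀ l < i, 0 ≤ h j l ∧ h j l < h j i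

/-- The size of the matrix depends on the length of `T`. Columns indexed by natural numbers avoid
casts when `T` is replaced by its image under an affinity. -/
theorem isHermite_frameMatrix_iff {A : Matrix (Fin d) (Fin d) ℤ} {T : List (Pt d)} :
    IsHermite (A * frameMatrix T) ↔
      HermiteCols (T.length - 1) (fun j => A.mulVec (T.getD (j + 1) 0 - T.headD 0)) := by
  have key : ∀ (i : Fin d) (j : Fin (T.length - 1)), (A * frameMatrix T) i j =
      A.mulVec (T.getD (j + 1) 0 - T.headD 0) i := by
    intro i j
    simp [Matrix.mul_apply, Matrix.mulVec, dotProduct, frameMatrix]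
  unfold IsHermite HermiteCols
  simp only [key]
  exact ⟨fun h => ⟨fun j hj i hij => h.1 i ⟨j, hj⟩ hij, fun j hj => h.2 ⟨j, hj⟩⟩,
    fun h => ⟨fun i j hij => h.1 j j.2 i hij, fun j => h.2 j j.2⟩⟩

/-- In the uniqueness proof the columns of `B` before `j` are already known to be unit vectors. The
equation between two columns then involves only the unknown column `j`, one entry at a time. -/
theorem mulVec_of_unit_columns {B : Matrix (Fin d) (Fin d) ℤ} {v : Fin d → ℤ} {j : Fin d}
    (hv : ∀ i, j < i → v i = 0) (hB : ∀ l < j, ∀ i, B i l = if l = i then 1 else 0) (i : Fin d) :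
    B.mulVec v i = B i j * v j + if i < j then v i else 0 := by
  have : ∀ l, B i l * v l = (if l = j then B i j * v j else 0) +
      if l = i then (if i < j then v i else 0) else 0 := by
    intro l
    rcases lt_trichotomy l j with h | rfl | h
    · rw [hB l h i, if_neg h.ne, zero_add]
      by_cases hl : l = i
      · subst hl; simp [h]
      · simp [hl]
    · by_cases hl : l = i
      · subst hl; simp
      · simp [hl]
    · rw [hv l h, if_neg h.ne']
      by_cases hl : l = i
      · subst hl; simp [h.not_gt]
      · simp [hl]
  rw [Matrix.mulVec, dotProduct]
  refine (Finset.sum_congr rfl fun l _ => this l).trans ?_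
  rw [Finset.sum_add_distrib, Finset.sum_ite_eq', Finset.sum_ite_eq']
  simp

/-- Induction on the columns, with the stronger claim that the corresponding columns of `B` and `B'`
are unit vectors. On the diagonal the entries of `B` and `B'` have product 1, and positivity of the
pivots forces them to be 1. Below the diagonal the entries of `B` and `B'`, multiplied by a nonzero
pivot, give 0. Above it they are multiples of the pivot that compare two reduced residues. Neither
matrix is assumed invertible. -/
theorem HermiteCols.eq_of_mulVec {k : ℕ} {h h' : ℕ → Fin d → ℤ} (hh : HermiteCols k h)
    (hh' : HermiteCols k h') {B B' : Matrix (Fin d) (Fin d) ℤ} (hB : ∀ j < k, B.mulVec (h j) = h' j)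
    (hB' : ∀ j < k, B'.mulVec (h' j) = h j) : ∀ j < k, h j = h' j := by
  have key : ∀ j < k, ∀ l : Fin d, (l : ℕ) = j → ∀ i, (B i l = if l = i then 1 else 0) ∧
      (B' i l = if l = i then 1 else 0) ∧ h j i = h' j i := by
    intro j
    induction j using Nat.strong_induction_on with
    | _ j ih =>
      rintro hj l rfl
      have hz := hh.1 l hj
      have hz' := hh'.1 l hj
      obtain ⟨l1, hl1, hpos, hred⟩ := hh.2 l hj
      obtain ⟨l2, hl2, hpos', hred'⟩ := hh'.2 l hj
      obtain rfl : l1 = l := Fin.ext hl1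
      obtain rfl : l2 = l1 := Fin.ext hl2
      have e : ∀ i, B i l2 * h l2 l2 + (if i < l2 then h l2 i else 0) = h' l2 i := fun i => by
        rw [← hB l2 hj]
        exact (mulVec_of_unit_columns (fun i hi => hz i hi)
          (fun l hl i => (ih l hl (lt_trans hl hj) l rfl i).1) i).symm
      have e' : ∀ i, B' i l2 * h' l2 l2 + (if i < l2 then h' l2 i else 0) = h l2 i := fun i => by
        rw [← hB' l2 hj]
        exact (mulVec_of_unit_columns (fun i hi => hz' i hi)
          (fun l hl i => (ih l hl (lt_trans hl hj) l rfl i).2.1) i).symm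
      have d1 := e l2
      have d2 := e' l2
      simp only [lt_irrefl, if_false, add_zero] at d1 d2
      have hb : B' l2 l2 * B l2 l2 = 1 := by
        have : (B' l2 l2 * B l2 l2) * h l2 l2 = 1 * h l2 l2 := by rw [mul_assoc, d1, d2, one_mul]
        exact mul_right_cancel₀ hpos.ne' this
      have hb1 : 0 < B l2 l2 := by
        by_contra hcon
        have := mul_nonpos_of_nonpos_of_nonneg (not_lt.1 hcon) hpos.le
        omega
      have hb2 : B l2 l2 = 1 := by
        rcases Int.eq_one_or_neg_one_of_mul_eq_one' hb with h | h
        · exact h.2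
        · omega
      have hdiag : h l2 l2 = h' l2 l2 := by rw [← d1, hb2, one_mul]
      have off : ∀ i, i ≠ l2 → B i l2 = 0 ∧ B' i l2 = 0 ∧ h l2 i = h' l2 i := by
        intro i hi
        have ei := e i
        have ei' := e' i
        rcases lt_or_gt_of_ne hi with hlt | hgt
        -- Above the diagonal: two residues in `[0, h l2 l2)` whose difference is a multiple of the
        -- pivot are equal.
        · simp only [hlt, if_true, ← hdiag] at ei ei'
          have r := hred i hlt
          have r' := hred' i hlt
          rw [← hdiag] at r'
          have h0 : B i l2 = 0 := by
            by_contra hne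
            rcases lt_or_gt_of_ne hne with hn | hn
            · nlinarith
            · nlinarith
          have h0' : B' i l2 = 0 := by
            by_contra hne
            rcases lt_or_gt_of_ne hne with hn | hn
            · nlinarith
            · nlinarith
          rw [h0] at ei
          exact ⟨h0, h0', by linarith⟩
        · rw [hz i hgt, hz' i hgt] at *
          simp only [hgt.not_gt, if_false, add_zero, mul_eq_zero, hpos.ne', hpos'.ne', or_false]
            at ei ei'
          exact ⟨ei, ei', rfl⟩
      intro i
      by_cases hi : i = l2
      · subst hi
        have : B' i i = 1 := by rw [hb2, mul_one] at hb; exact hb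
        simp [hb2, hdiag, this]
      · have := off i hi
        rw [if_neg (Ne.symm hi)]
        exact this
  intro j hj
  obtain ⟨i, hi, -⟩ := hh.2 j hj
  funext l
  exact (key j hj i hi l).2.2

end CanonicalFormWithFrameTheory

section CanonicalFormWithFrameTheory

variable {d : ℕ}

/-! ## Determinism of `CanonicalFormWithFrame` -/

theorem frameStep_rightUnique {Λ : Finset (Pt d)} {Q : List (RPt d)} (hQ : IsFrame Q) :
    Relator.RightUnique (FrameStep Λ Q) := by
  rintro T T₁ T₂ ⟨-, p, hp, hpT, hmin, rfl⟩ ⟨-, p', hp', hpT', hmin', rfl⟩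
  rcases hmin p' hp' hpT' with rfl | h
  · rfl
  rcases hmin' p hp hpT with rfl | h'
  · rfl
  exact absurd h' (h.asymm hQ)

/-- Both runs start from the same list since `toRat` is injective. Of two runs of a deterministic
step one continues the other, and the stopping condition forbids any further step. -/
theorem frameLoop_unique {Λ : Finset (Pt d)} {Q : List (RPt d)} (hQ : IsFrame Q)
    {T T' : List (Pt d)} (h : FrameLoop Λ Q T) (h' : FrameLoop Λ Q T') : T = T' := by
  obtain ⟨T₀, h0, h1, h2⟩ := h
  obtain ⟨T₀', h0', h1', h2'⟩ := h'
  obtain rfl : T₀ = T₀' := toRat_injective.list_map (h0.trans h0'.symm)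
  rcases Relation.ReflTransGen.total_of_right_unique (frameStep_rightUnique hQ) h1 h1' with h | h
  · rcases Relation.ReflTransGen.cases_head h with h | ⟨_, h, -⟩
    · exact h
    · exact absurd h.1 h2
  · rcases Relation.ReflTransGen.cases_head h with h | ⟨_, h, -⟩
    · exact h.symm
    · exact absurd h.1 h2'

theorem frameSteps_spec {Λ : Finset (Pt d)} {Q : List (RPt d)} {T₀ T : List (Pt d)}
    (h : Relation.ReflTransGen (FrameStep Λ Q) T₀ T) (hT₀ : IsFrame (T₀.map toRat))
    (hT₀Λ : ∀ p ∈ T₀, p ∈ Λ) :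
    IsFrame (T.map toRat) ∧ (∀ p ∈ T, p ∈ Λ) ∧ T₀ <+: T := by
  induction h with
  | refl => exact ⟨hT₀, hT₀Λ, List.prefix_rfl⟩
  | tail _ hs ih =>
    obtain ⟨-, p, hp, hpT, -, rfl⟩ := hs
    refine ⟨?_, ?_, ih.2.2.trans (List.prefix_append _ _)⟩
    · rw [List.map_append]
      exact isFrame_append_singleton.2 ⟨ih.1, hpT⟩
    · intro q hq
      rcases List.mem_append.1 hq with hq | hq
      · exact ih.2.1 q hq
      · rw [List.mem_singleton.1 hq]; exact hp

theorem frameLoop_spec {Λ : Finset (Pt d)} {Q : List (RPt d)} (hQ : IsFrame Q)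
    {T : List (Pt d)} (h : FrameLoop Λ Q T) :
    IsFrame (T.map toRat) ∧ (∀ p ∈ T, p ∈ Λ) ∧ (∀ p ∈ Λ, toRat p ∈ ratSpan (T.map toRat)) := by
  obtain ⟨T₀, h0, h1, h2⟩ := h
  have hf : IsFrame (T₀.map toRat) := h0 ▸ hQ.sublist List.filter_sublist
  have hΛ : ∀ p ∈ T₀, p ∈ Λ := by
    intro p hp
    have : toRat p ∈ T₀.map toRat := List.mem_map_of_mem hp
    rw [h0, List.mem_filter] at this
    simpa using this.2
  obtain ⟨h3, h4, -⟩ := frameSteps_spec h1 hf hΛ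
  rw [length_lt_spanDimSucc_iff h3 h4] at h2
  push Not at h2
  exact ⟨h3, h4, h2⟩

theorem frameLoop_nil {Λ : Finset (Pt d)} {Q : List (RPt d)} (hQ : IsFrame Q)
    (h : FrameLoop Λ Q []) : Λ = ∅ := by
  obtain ⟨-, -, h⟩ := frameLoop_spec hQ h
  by_contra hne
  obtain ⟨p, hp⟩ := Finset.nonempty_iff_ne_empty.2 hne
  simpa using h p hp

/-- Both sides are restrictions of rational affine maps that agree on the points of `T`, hence on
the rational span. The conclusion returns to the lattice because `toRat` is injective. -/
theorem mulVec_sub_eq_of_span {A A' : Matrix (Fin d) (Fin d) ℤ} {T : List (Pt d)}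
    (h : ∀ j, j + 1 < T.length → A.mulVec (T.getD (j + 1) 0 - T.headD 0) =
      A'.mulVec (T.getD (j + 1) 0 - T.headD 0)) {p : Pt d}
    (hp : toRat p ∈ ratSpan (T.map toRat)) :
    A.mulVec (p - T.headD 0) = A'.mulVec (p - T.headD 0) := by
  rcases T with _ | ⟨p₀, T⟩
  · simp at hp
  simp only [List.headD_cons] at h ⊢
  have key : ∀ (A : Matrix (Fin d) (Fin d) ℤ) (q : Pt d),
      ratAff A (toRat (A.mulVec (-p₀))) (toRat q) = toRat (A.mulVec (q - p₀)) := by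
    intro A q
    rw [ratAff_toRat, ← Matrix.mulVec_add, sub_eq_add_neg]
  have : Set.EqOn (ratAff A (toRat (A.mulVec (-p₀)))) (ratAff A' (toRat (A'.mulVec (-p₀))))
      {x | x ∈ (p₀ :: T).map toRat} := by
    intro x hx
    obtain ⟨q, hq, rfl⟩ := List.mem_map.1 hx
    rw [key, key]
    congr 1
    rcases List.mem_cons.1 hq with rfl | hq
    · simp
    · obtain ⟨j, hj, rfl⟩ := List.getElem_of_mem hq
      have := h j (by simpa using hj)
      simpa [hj] using this
  have := AffineMap.eqOn_affineSpan this hp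
  rw [key, key] at this
  exact toRat_injective this

/-- The matrix `A` is in general not unique when `T` spans less than the whole space. Uniqueness of
the Hermite form fixes the images of the points of `T`, hence the map on the span of `T`, which
contains `Λ`. -/
theorem canonicalFormWithFrame_unique {Λ : Finset (Pt d)} {Q : List (RPt d)} (hQ : IsFrame Q)
    {X X' : Finset (Pt d) × List (Pt d)} (h : CanonicalFormWithFrame Λ Q X)
    (h' : CanonicalFormWithFrame Λ Q X') : X = X' := by
  obtain ⟨T, A, hT, hA, rfl⟩ := h
  obtain ⟨T', A', hT', hA', rfl⟩ := h'
  obtain rfl := frameLoop_unique hQ hT hT'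
  rw [isHermite_frameMatrix_iff] at hA hA'
  obtain ⟨hf, hTΛ, hcov⟩ := frameLoop_spec hQ hT
  have hcols := hA.eq_of_mulVec hA' (B := A' * A⁻¹) (B' := A * A'⁻¹)
    (fun j _ => by rw [Matrix.mulVec_mulVec, ← Units.val_mul, ← Units.val_mul]; simp)
    (fun j _ => by rw [Matrix.mulVec_mulVec, ← Units.val_mul, ← Units.val_mul]; simp)
  have key : ∀ p, toRat p ∈ ratSpan (T.map toRat) → frameMap A T p = frameMap A' T p :=
    fun p hp => mulVec_sub_eq_of_span (fun j hj => hcols j (by omega)) hp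
  refine Prod.ext ?_ ?_
  · exact Finset.image_congr fun p hp => key p (hcov p hp)
  · exact List.map_congr_left fun p hp => key p (mem_ratSpan (List.mem_map_of_mem hp))

/-! ## Equivariance of `CanonicalFormWithFrame` -/

section Equivariance

variable {g : RPt d →ᵃ[ℚ] RPt d} {φ : Aff d}

theorem Extends.map_map_toRat (hg : Extends g φ) (T : List (Pt d)) :
    (T.map φ).map toRat = (T.map toRat).map g := by
  simp [hg.map_toRat]

theorem mem_image_aff {Λ : Finset (Pt d)} {p : Pt d} : φ p ∈ Λ.image φ ↔ p ∈ Λ := by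
  rw [Finset.mem_image]
  exact ⟨fun ⟨q, hq, h⟩ => φ.injective h ▸ hq, fun h => ⟨p, h, rfl⟩⟩

theorem Extends.toRat_mem_ratSpan (hg : Extends g φ) {Q : List (RPt d)} {p : Pt d} :
    toRat (φ p) ∈ ratSpan (Q.map g) ↔ toRat p ∈ ratSpan Q := by
  rw [← hg.map_toRat, mem_ratSpan_map hg.injective]

theorem Extends.isCoveringFrame (hg : Extends g φ) {Λ : Finset (Pt d)} {Q : List (RPt d)} :
    IsCoveringFrame (Λ.image φ) (Q.map g) ↔ IsCoveringFrame Λ Q := by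
  unfold IsCoveringFrame
  simp [isFrame_map hg.injective, hg.toRat_mem_ratSpan]

theorem Extends.spanDimSucc_image (hg : Extends g φ) (Λ : Finset (Pt d)) :
    spanDimSucc (Λ.image φ) = spanDimSucc Λ := by
  unfold spanDimSucc
  have hi : toRat '' ((Λ.image φ : Finset (Pt d)) : Set (Pt d)) = g '' (toRat '' (Λ : Set (Pt d))) := by
    rw [Finset.coe_image, Set.image_image, Set.image_image]
    exact Set.image_congr fun p _ => (hg.map_toRat p).symm
  rw [hi, ← AffineMap.map_vectorSpan,
    ← (Submodule.equivMapOfInjective g.linear (g.linear_injective_iff.2 hg.injective) _).finrank_eq]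
  simp

theorem FrameStep.map (hg : Extends g φ) {Λ : Finset (Pt d)} {Q : List (RPt d)}
    {T T' : List (Pt d)} (h : FrameStep Λ Q T T') :
    FrameStep (Λ.image φ) (Q.map g) (T.map φ) (T'.map φ) := by
  obtain ⟨hlt, p, hp, hpT, hmin, rfl⟩ := h
  refine ⟨by simpa [hg.spanDimSucc_image] using hlt, φ p, mem_image_aff.2 hp, ?_, ?_, by simp⟩
  · rwa [hg.map_map_toRat, hg.toRat_mem_ratSpan]
  · intro q hq
    obtain ⟨r, hr, rfl⟩ := Finset.mem_image.1 hq
    rw [hg.map_map_toRat, hg.toRat_mem_ratSpan, φ.injective.eq_iff, ← hg.map_toRat,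
      ← hg.map_toRat]
    exact fun hqT => (hmin r hr hqT).imp id fun h => h.map g

theorem FrameLoop.map (hg : Extends g φ) {Λ : Finset (Pt d)} {Q : List (RPt d)}
    {T : List (Pt d)} (h : FrameLoop Λ Q T) : FrameLoop (Λ.image φ) (Q.map g) (T.map φ) := by
  obtain ⟨T₀, h0, h1, h2⟩ := h
  refine ⟨T₀.map φ, ?_, h1.lift _ fun _ _ hs => hs.map hg, by simpa [hg.spanDimSucc_image] using h2⟩
  rw [hg.map_map_toRat, h0, List.filter_map]
  congr 1
  refine List.filter_congr fun q _ => ?_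
  simp only [Function.comp_apply, Finset.exists_mem_image, ← hg.map_toRat,
    hg.injective.eq_iff]

/-- The matrix `A (affGL φ)⁻¹` takes the columns of `φ(T)` where `A` takes those of `T`. It is
therefore an admissible choice, and it produces literally the same pair. -/
theorem CanonicalFormWithFrame.map (hg : Extends g φ) {Λ : Finset (Pt d)} {Q : List (RPt d)}
    (hQ : IsFrame Q) {X : Finset (Pt d) × List (Pt d)} (h : CanonicalFormWithFrame Λ Q X) :
    CanonicalFormWithFrame (Λ.image φ) (Q.map g) X := by
  obtain ⟨T, A, hT, hA, rfl⟩ := h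
  have hinv : ∀ v, (A * (affGL φ)⁻¹ : Matrix.GeneralLinearGroup (Fin d) ℤ).1.mulVec
      ((affMatrix φ).mulVec v) = A.1.mulVec v := by
    intro v
    have : affMatrix φ = (affGL φ).1 := rfl
    rw [Matrix.mulVec_mulVec, this, ← Units.val_mul, inv_mul_cancel_right]
  refine ⟨T.map φ, A * (affGL φ)⁻¹, hT.map hg, ?_, ?_⟩
  · rw [isHermite_frameMatrix_iff] at hA ⊢
    have hcol : ∀ j < T.length - 1,
        (A * (affGL φ)⁻¹ : Matrix.GeneralLinearGroup (Fin d) ℤ).1.mulVec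
        ((T.map φ).getD (j + 1) 0 - (T.map φ).headD 0) =
        A.1.mulVec (T.getD (j + 1) 0 - T.headD 0) := by
      intro j hj
      rw [← hinv, ← aff_sub]
      rcases T with _ | ⟨p, T⟩
      · simp at hj
      · have : j < T.length := by simpa using hj
        simp [this]
    rw [List.length_map]
    constructor
    · intro j hj
      beta_reduce
      rw [hcol j hj]
      exact hA.1 j hj
    · intro j hj
      beta_reduce
      rw [hcol j hj]
      exact hA.2 j hj
  -- For an empty `T` the base point is the default `0`, which is not equivariant; but then `Λ` is
  -- empty too.
  · rcases T with _ | ⟨p, T⟩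
    · rw [frameLoop_nil hQ hT]
      simp
    · have : ∀ q, frameMap (A * (affGL φ)⁻¹) ((p :: T).map φ) (φ q) = frameMap A (p :: T) q := by
        intro q
        simp only [frameMap, List.map_cons, List.headD_cons]
        rw [aff_sub]
        exact hinv _
      refine Prod.ext ?_ ?_
      · simp only [Finset.image_image]
        exact (Finset.image_congr fun q _ => this q).symm
      · simp only [List.map_map]
        exact (List.map_congr_left fun q _ => this q).symm

end Equivariance

end CanonicalFormWithFrameTheory

section EquivariantFrames

variable {d : ℕ}

/-! ## The frames returned by `EquivariantFrames2` -/

theorem mem_outside {Λ : Finset (Pt d)} {Q : List (RPt d)} {p : Pt d} :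
    p ∈ outside Λ Q ↔ p ∈ Λ ∧ toRat p ∉ ratSpan Q := by
  simp [outside]

theorem mem_congClass {Λ : Finset (Pt d)} {c : Fin d → ZMod 2} {p : Pt d} :
    p ∈ congClass Λ c ↔ p ∈ Λ ∧ residue p = c := by
  simp [congClass]

theorem congClass_subset (Λ : Finset (Pt d)) (c : Fin d → ZMod 2) : congClass Λ c ⊆ Λ :=
  Finset.filter_subset _ _

theorem congClass_card_add_le (Λ : Finset (Pt d)) {c c' : Fin d → ZMod 2} (h : c ≠ c') :
    (congClass Λ c).card + (congClass Λ c').card ≤ Λ.card := by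
  have hd : Disjoint (congClass Λ c) (congClass Λ c') := by
    rw [Finset.disjoint_left]
    intro p hp hp'
    exact h ((mem_congClass.1 hp).2.symm.trans (mem_congClass.1 hp').2)
  rw [← Finset.card_union_of_disjoint hd]
  exact Finset.card_le_card (Finset.union_subset (congClass_subset Λ c) (congClass_subset Λ c'))

/-- The map `q ↦ (q - p) / 2`. -/
noncomputable def halveAt (p : RPt d) : RPt d →ᵃ[ℚ] RPt d :=
  (1 / 2 : ℚ) • (AffineMap.id ℚ (RPt d) - AffineMap.const ℚ _ p)

theorem halveAt_apply (p q : RPt d) : halveAt p q = (1 / 2 : ℚ) • (q - p) := rfl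

/-- The map `q ↦ 2 q + p`. -/
noncomputable def doubleAt (p : RPt d) : RPt d →ᵃ[ℚ] RPt d :=
  (2 : ℚ) • AffineMap.id ℚ (RPt d) + AffineMap.const ℚ _ p

theorem doubleAt_apply (p q : RPt d) : doubleAt p q = (2 : ℚ) • q + p := rfl

theorem doubleAt_halveAt (p q : RPt d) : doubleAt p (halveAt p q) = q := by
  rw [doubleAt_apply, halveAt_apply, smul_smul]
  norm_num

theorem halveAt_injective (p : RPt d) : Function.Injective (halveAt p) :=
  Function.LeftInverse.injective (doubleAt_halveAt p)

theorem doubleAt_injective (p : RPt d) : Function.Injective (doubleAt p) := by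
  intro x y h
  rw [doubleAt_apply, doubleAt_apply, add_left_inj] at h
  exact smul_right_injective _ (two_ne_zero) h

theorem doubleAt_toRat (p x : Pt d) : doubleAt (toRat p) (toRat x) = toRat ((2 : ℤ) • x + p) := by
  rw [doubleAt_apply, toRat_add, toRat_smul]
  norm_num

theorem two_smul_add_injective (p : Pt d) : Function.Injective (fun x : Pt d => (2 : ℤ) • x + p) := by
  intro x y h
  simp only [add_left_inj] at h
  exact smul_right_injective _ (two_ne_zero) h

theorem map_half_eq (Q : List (RPt d)) (p : RPt d) :
    Q.map (fun q => (1 / 2 : ℚ) • (q - p)) = Q.map (halveAt p) := rfl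

theorem ratSpan_append_left {Q R : List (RPt d)} : ratSpan Q ≤ ratSpan (Q ++ R) :=
  ratSpan_mono (List.subset_append_left _ _)

theorem isCoveringFrame_of_outside {Λ : Finset (Pt d)} {Q R : List (RPt d)}
    (h : IsCoveringFrame (outside Λ Q) (Q ++ R)) : IsCoveringFrame Λ (Q ++ R) := by
  refine ⟨h.1, fun p hp => ?_⟩
  by_cases hpQ : toRat p ∈ ratSpan Q
  · exact ratSpan_append_left hpQ
  · exact h.2 p (mem_outside.2 ⟨hp, hpQ⟩)

theorem isCoveringFrame_small {Λ : Finset (Pt d)} {Q : List (RPt d)} (hQ : IsFrame Q)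
    (hcard : (outside Λ Q).card ≤ 1) :
    IsCoveringFrame Λ (Q ++ ((outside Λ Q).toList).map toRat) := by
  apply isCoveringFrame_of_outside
  rcases Nat.le_one_iff_eq_zero_or_eq_one.1 hcard with h | h
  · rw [Finset.card_eq_zero] at h
    rw [h]
    exact ⟨by simpa using hQ, by simp⟩
  · obtain ⟨p, hp⟩ := Finset.card_eq_one.1 h
    have hm : p ∈ outside Λ Q := by simp [hp]
    rw [hp, Finset.toList_singleton]
    refine ⟨isFrame_append_singleton.2 ⟨hQ, (mem_outside.1 hm).2⟩, fun q hq => ?_⟩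
    rw [Finset.mem_singleton.1 hq]
    exact mem_ratSpan (by simp)

theorem map_doubleAt (p : Pt d) (Q : List (RPt d)) (V : List (Pt d)) :
    (Q.map (halveAt (toRat p)) ++ V.map toRat).map (doubleAt (toRat p)) =
      Q ++ (V.map (fun x => (2 : ℤ) • x + p)).map toRat := by
  simp only [List.map_append, List.map_map]
  congr 1
  · exact (List.map_congr_left fun q _ => doubleAt_halveAt _ q).trans (List.map_id _)
  · exact List.map_congr_left fun x _ => doubleAt_toRat p x

theorem isCoveringFrame_double {Λ' : Finset (Pt d)} {Q : List (RPt d)} {p : Pt d} {V : List (Pt d)}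
    (h : IsCoveringFrame Λ' (Q.map (halveAt (toRat p)) ++ V.map toRat)) :
    IsCoveringFrame (Λ'.image (fun x => (2 : ℤ) • x + p))
      (Q ++ (V.map (fun x => (2 : ℤ) • x + p)).map toRat) := by
  rw [← map_doubleAt]
  refine ⟨(isFrame_map (doubleAt_injective _)).2 h.1, fun q hq => ?_⟩
  obtain ⟨x, hx, rfl⟩ := Finset.mem_image.1 hq
  rw [← doubleAt_toRat, mem_ratSpan_map (doubleAt_injective _)]
  exact h.2 x hx

theorem isCoveringFrame_append {Λ : Finset (Pt d)} {Q : List (RPt d)} {h : Fin d → ZMod 2}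
    {R T : List (Pt d)} (h1 : IsCoveringFrame (Λ \ congClass Λ h) (Q ++ R.map toRat))
    (h2 : IsCoveringFrame (congClass Λ h) (Q ++ R.map toRat ++ T.map toRat)) :
    IsCoveringFrame Λ (Q ++ (R ++ T).map toRat) := by
  rw [List.map_append, ← List.append_assoc]
  refine ⟨h2.1, fun p hp => ?_⟩
  by_cases hph : p ∈ congClass Λ h
  · exact h2.2 p hph
  · exact ratSpan_append_left (h1.2 p (by simp [hp, hph]))

/-- Induction along the rules. Points inside the span of `Q` are covered from the start. In the
unbalanced branch `Q ∪ R` covers all but the large class, and the recursive call adds the points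
needed for that class. -/
theorem EquivariantFrames2.frames {Λ : Finset (Pt d)} {Q : List (RPt d)}
    {S : Finset (List (Pt d))} (h : EquivariantFrames2 Λ Q S) (hQ : IsFrame Q) :
    ∀ V ∈ S, (∀ p ∈ V, p ∈ outside Λ Q) ∧ IsCoveringFrame Λ (Q ++ V.map toRat) := by
  induction h with
  | small Λ Q hcard =>
    intro V hV
    obtain rfl := Finset.mem_singleton.1 hV
    exact ⟨fun p hp => by simpa using hp, isCoveringFrame_small hQ hcard⟩
  | congruent Λ Q p Λ' S' hcard hcong hp hΛ' hrec ih =>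
    intro V hV
    obtain ⟨V', hV', rfl⟩ := Finset.mem_image.1 hV
    rw [map_half_eq] at ih
    obtain ⟨h1, h2⟩ := ih ((isFrame_map (halveAt_injective _)).2 hQ) V' hV'
    refine ⟨fun q hq => ?_, isCoveringFrame_of_outside ?_⟩
    · obtain ⟨x, hx, rfl⟩ := List.mem_map.1 hq
      rw [hΛ']
      exact Finset.mem_image_of_mem _ (mem_outside.1 (h1 x hx)).1
    · rw [hΛ']
      exact isCoveringFrame_double h2
  | balanced Λ Q S val F hcard hcong hbal hrec hval hF ih =>
    intro V hV
    obtain ⟨⟨hX, -⟩, -, hcov⟩ := ((hF V).1 hV).1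
    refine ⟨fun p hp => ?_, isCoveringFrame_of_outside hcov⟩
    obtain ⟨c, hc, W, hW, hpW⟩ := hX p hp
    exact (mem_congClass.1 (mem_outside.1 ((ih c hc hQ W hW).1 p hpW)).1).1
  | unbalanced Λ Q h S E SR val F hcard hcong hunbal hrec hE hrecE hval hF ih ihE =>
    intro V hV
    obtain ⟨⟨R, hR, T, hT, rfl⟩, -⟩ := (hF V).1 hV
    have hR' := hR
    rw [hE] at hR'
    obtain ⟨⟨hX, -⟩, -, hcov⟩ := hR'
    obtain ⟨h1, h2⟩ := ihE R hR hcov.1 T hT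
    refine ⟨fun p hp => ?_, isCoveringFrame_of_outside (isCoveringFrame_append hcov h2)⟩
    rcases List.mem_append.1 hp with hp | hp
    · obtain ⟨c, hc, W, hW, hpW⟩ := hX p hp
      exact (mem_congClass.1 (mem_outside.1 ((ih c hc.1 hc.2 hQ W hW).1 p hpW)).1).1
    · exact (mem_congClass.1 (mem_outside.1 (h1 p hp)).1).1

/-! ## Equivariance of `EquivariantFrames2` -/

@[simp] theorem symm_comp_aff (φ : Aff d) : (⇑φ.symm ∘ ⇑φ) = id :=
  funext fun x => φ.symm_apply_apply x

@[simp] theorem comp_symm_aff (φ : Aff d) : (⇑φ ∘ ⇑φ.symm) = id :=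
  funext fun x => φ.apply_symm_apply x

theorem outside_image {g : RPt d →ᵃ[ℚ] RPt d} {φ : Aff d} (hg : Extends g φ) (Λ : Finset (Pt d))
    (Q : List (RPt d)) : outside (Λ.image φ) (Q.map g) = (outside Λ Q).image φ := by
  ext p
  simp only [mem_outside, Finset.mem_image]
  constructor
  · rintro ⟨⟨q, hq, rfl⟩, h⟩
    exact ⟨q, ⟨hq, by rwa [hg.toRat_mem_ratSpan] at h⟩, rfl⟩
  · rintro ⟨q, ⟨hq, h⟩, rfl⟩
    exact ⟨⟨q, hq, rfl⟩, by rwa [hg.toRat_mem_ratSpan]⟩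

theorem card_image_aff (φ : Aff d) (Λ : Finset (Pt d)) : (Λ.image φ).card = Λ.card :=
  Finset.card_image_of_injective _ φ.injective

theorem residue_surjective : Function.Surjective (residue (d := d)) := by
  intro c
  choose p hp using fun i => ZMod.intCast_surjective (c i)
  exact ⟨p, funext hp⟩

theorem residue_mulVec_add (A : Matrix (Fin d) (Fin d) ℤ) (p b : Pt d) :
    residue (A.mulVec p + b) = (A.map (Int.cast : ℤ → ZMod 2)).mulVec (residue p) + residue b := by
  ext i
  simp [residue, Matrix.mulVec, dotProduct]

/-- The action of an affinity on the residues modulo 2. -/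
noncomputable def residuePerm (φ : Aff d) : (Fin d → ZMod 2) ≃ (Fin d → ZMod 2) where
  toFun c := ((affMatrix φ).map (Int.cast : ℤ → ZMod 2)).mulVec c + residue (φ 0)
  invFun c := ((affMatrix φ.symm).map (Int.cast : ℤ → ZMod 2)).mulVec c + residue (φ.symm 0)
  left_inv c := by
    obtain ⟨p, rfl⟩ := residue_surjective c
    beta_reduce
    rw [← residue_mulVec_add, ← aff_apply, ← residue_mulVec_add, ← aff_apply]
    simp
  right_inv c := by
    obtain ⟨p, rfl⟩ := residue_surjective c
    beta_reduce
    rw [← residue_mulVec_add, ← aff_apply, ← residue_mulVec_add, ← aff_apply]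
    simp

theorem residue_aff (φ : Aff d) (p : Pt d) : residue (φ p) = residuePerm φ (residue p) := by
  rw [aff_apply φ p, residue_mulVec_add]
  rfl

theorem congClass_image (φ : Aff d) (Λ : Finset (Pt d)) (c : Fin d → ZMod 2) :
    congClass (Λ.image φ) c = (congClass Λ ((residuePerm φ).symm c)).image φ := by
  ext p
  simp only [mem_congClass, Finset.mem_image]
  constructor
  · rintro ⟨⟨q, hq, rfl⟩, rfl⟩
    exact ⟨q, ⟨hq, by rw [residue_aff, Equiv.symm_apply_apply]⟩, rfl⟩
  · rintro ⟨q, ⟨hq, h⟩, rfl⟩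
    exact ⟨⟨q, hq, rfl⟩, by rw [residue_aff, h, Equiv.apply_symm_apply]⟩

theorem allCongruent_image (φ : Aff d) (Λ : Finset (Pt d)) :
    AllCongruent (Λ.image φ) ↔ AllCongruent Λ := by
  unfold AllCongruent
  simp [residue_aff]

theorem completions_image {g : RPt d →ᵃ[ℚ] RPt d} {φ : Aff d} (hg : Extends g φ)
    (Λ : Finset (Pt d)) (Q : List (RPt d)) (X : Set (Pt d)) :
    completions (Λ.image φ) (Q.map g) (φ '' X) = List.map φ '' completions Λ Q X := by
  ext R'
  obtain ⟨R, rfl⟩ : ∃ R : List (Pt d), R.map φ = R' := ⟨R'.map φ.symm, by simp⟩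
  rw [φ.injective.list_map.mem_set_image]
  unfold completions IsFrameIn
  simp only [Set.mem_ofPred_eq, hg.map_map_toRat, ← List.map_append, hg.isCoveringFrame,
    isFrame_map hg.injective, List.forall_mem_map, φ.injective.mem_set_image, ← hg.map_toRat,
    List.mem_map_of_injective hg.injective]

/-- The class with residue `c` of the image is the image of the class with residue `(residuePerm
φ).symm c`, so families indexed by residues are transported by reindexing. -/
theorem framePoints_image (φ : Aff d) (I : Set (Fin d → ZMod 2))
    (S : (Fin d → ZMod 2) → Finset (List (Pt d))) :
    framePoints ((residuePerm φ).symm ⁻¹' I)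
      (fun c => (S ((residuePerm φ).symm c)).image (List.map φ)) = φ '' framePoints I S := by
  ext x
  simp only [framePoints, Set.mem_ofPred_eq, Set.mem_image]
  constructor
  · rintro ⟨c, hc, V, hV, hx⟩
    obtain ⟨W, hW, rfl⟩ := Finset.mem_image.1 hV
    obtain ⟨y, hy, rfl⟩ := List.mem_map.1 hx
    exact ⟨y, ⟨_, hc, W, hW, hy⟩, rfl⟩
  · rintro ⟨y, ⟨c, hc, W, hW, hy⟩, rfl⟩
    exact ⟨residuePerm φ c, by simpa using hc, W.map φ,
      Finset.mem_image_of_mem _ (by simpa using hW), List.mem_map_of_mem hy⟩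

/-- Transport does not change the values, only the candidates to which they are attached; minimality
is a statement about values. -/
theorem IsMinimalSet.image {cand : Set (List (Pt d))}
    {val : List (Pt d) → Finset (Pt d) × List (Pt d)} {F : Finset (List (Pt d))}
    (h : IsMinimalSet cand val F) (φ : Aff d) :
    IsMinimalSet (List.map φ '' cand) (fun R => val (R.map φ.symm)) (F.image (List.map φ)) := by
  intro R'
  obtain ⟨R, rfl⟩ : ∃ R : List (Pt d), R.map φ = R' := ⟨R'.map φ.symm, by simp⟩
  rw [φ.injective.list_map.mem_set_image, Finset.mem_image]
  have : (∃ a ∈ F, List.map φ a = List.map φ R) ↔ R ∈ F :=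
    ⟨fun ⟨a, ha, h⟩ => φ.injective.list_map h ▸ ha, fun h => ⟨R, h, rfl⟩⟩
  rw [this, h R]
  simp

theorem IsMinimalSet.unique {cand : Set (List (Pt d))}
    {val val' : List (Pt d) → Finset (Pt d) × List (Pt d)} {F F' : Finset (List (Pt d))}
    (h : IsMinimalSet cand val F) (h' : IsMinimalSet cand val' F')
    (hv : ∀ R ∈ cand, val R = val' R) : F = F' := by
  ext R
  rw [h R, h' R]
  refine and_congr_right fun hR => forall₂_congr fun R' hR' => ?_
  rw [hv R hR, hv R' hR']

/-- Since `φ (2 x + p) = 2 L x + φ p` with `L` the linear part of `φ`, the halved problem is moved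
by `L` and no longer by `φ`. -/
theorem Extends.linear {g : RPt d →ᵃ[ℚ] RPt d} {φ : Aff d} (hg : Extends g φ) :
    Extends g.linear.toAffineMap φ.linear.toAffineEquiv := by
  refine ⟨g.linear_injective_iff.2 hg.injective, fun p => ?_⟩
  have h1 := g.linearMap_vsub (toRat p) (toRat 0)
  have h2 : φ p - φ 0 = φ.linear p := by
    rw [aff_sub, affMatrix_mulVec, sub_zero]
  have h3 : toRat p -ᵥ toRat 0 = toRat p := by
    ext i
    simp [toRat]
  rw [h3] at h1
  simp only [LinearMap.coe_toAffineMap, LinearEquiv.coe_toAffineEquiv]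
  rw [h1, hg.map_toRat, hg.map_toRat, ← h2, toRat_sub]
  rfl

/-- The enumeration `Finset.toList` is an arbitrary choice and need not commute with `φ`; with at
most one point there is nothing to order. -/
theorem toList_image_of_card_le_one {s : Finset (Pt d)} (h : s.card ≤ 1) (φ : Aff d) :
    (s.image φ).toList = s.toList.map φ := by
  rcases Nat.le_one_iff_eq_zero_or_eq_one.1 h with h | h
  · rw [Finset.card_eq_zero.1 h]; simp
  · obtain ⟨p, rfl⟩ := Finset.card_eq_one.1 h
    simp

/-- The induction is over all affinities at once, because the congruent branch passes from `φ` to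
its linear part. In the other branches the classes are permuted by `residuePerm`, and the values to
be compared are the same before and after by `CanonicalFormWithFrame.map`. -/
theorem EquivariantFrames2.map {Λ : Finset (Pt d)} {Q : List (RPt d)}
    {S : Finset (List (Pt d))} (h : EquivariantFrames2 Λ Q S) (hQ : IsFrame Q)
    {g : RPt d →ᵃ[ℚ] RPt d} {φ : Aff d} (hg : Extends g φ) :
    EquivariantFrames2 (Λ.image φ) (Q.map g) (S.image (List.map φ)) := by
  induction h generalizing g φ with
  | small Λ Q hcard =>
    have := EquivariantFrames2.small (Λ.image φ) (Q.map g)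
      (by rwa [outside_image hg, card_image_aff])
    rwa [outside_image hg, toList_image_of_card_le_one hcard] at this
  | congruent Λ Q p Λ' S' hcard hcong hp hΛ' hrec ih =>
    have hlin : ∀ x : Pt d, φ ((2 : ℤ) • x + p) = (2 : ℤ) • φ.linear x + φ p := by
      intro x
      have := φ.map_vadd p ((2 : ℤ) • x)
      rw [map_smul] at this
      exact this
    have := EquivariantFrames2.congruent (Λ.image φ) (Q.map g) (φ p)
      (Λ'.image φ.linear.toAffineEquiv)
      (S'.image (List.map φ.linear.toAffineEquiv)) (by rwa [outside_image hg, card_image_aff])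
      (by rwa [outside_image hg, allCongruent_image])
      (by rw [outside_image hg]; exact Finset.mem_image_of_mem _ hp)
      (by
        rw [outside_image hg, hΛ', Finset.image_image, Finset.image_image]
        exact Finset.image_congr fun x _ => hlin x)
      (by
        have h1 := ih ((isFrame_map (halveAt_injective _)).2 hQ) hg.linear
        convert h1 using 1
        simp only [List.map_map]
        refine List.map_congr_left fun q _ => ?_
        -- The linear part of `g` carries the halved frame of `Q` at `p` to the halved frame of the
        -- image of `Q` at `φ p`.
        have h2 := g.linearMap_vsub q (toRat p)
        simp only [vsub_eq_sub] at h2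
        simp only [Function.comp_apply, ← hg.map_toRat, ← h2, LinearMap.coe_toAffineMap, map_smul])
    convert this using 1
    rw [Finset.image_image, Finset.image_image]
    refine Finset.image_congr fun V _ => ?_
    simp only [Function.comp_apply, List.map_map]
    exact List.map_congr_left fun x _ => hlin x
  | balanced Λ Q S val F hcard hcong hbal hrec hval hF ih =>
    have hI : {c | (congClass (outside (Λ.image φ) (Q.map g)) c).Nonempty} =
        (residuePerm φ).symm ⁻¹' {c | (congClass (outside Λ Q) c).Nonempty} := by
      ext c
      simp [outside_image hg, congClass_image]
    have hcomp : completions (outside (Λ.image φ) (Q.map g)) (Q.map g)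
        (framePoints {c | (congClass (outside (Λ.image φ) (Q.map g)) c).Nonempty}
          (fun c => (S ((residuePerm φ).symm c)).image (List.map φ))) =
        List.map φ '' completions (outside Λ Q) Q
          (framePoints {c | (congClass (outside Λ Q) c).Nonempty} S) := by
      rw [hI, framePoints_image, outside_image hg, completions_image hg]
    refine EquivariantFrames2.balanced _ _
      (fun c => (S ((residuePerm φ).symm c)).image (List.map φ)) (fun R => val (R.map φ.symm)) _
      ?_ ?_ ?_ ?_ ?_ ?_
    · rwa [outside_image hg, card_image_aff]
    · rwa [outside_image hg, allCongruent_image]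
    · intro c
      rw [outside_image hg, congClass_image, card_image_aff, card_image_aff]
      exact hbal _
    · intro c hc
      rw [outside_image hg, congClass_image] at hc ⊢
      exact ih _ (Finset.image_nonempty.1 hc) hQ hg
    · rw [hcomp]
      rintro _ ⟨R, hR, rfl⟩
      rw [outside_image hg, hg.map_map_toRat, ← List.map_append]
      simpa using (hval R hR).map hg hR.2.2.1
    · rw [hcomp]
      exact hF.image φ
  | unbalanced Λ Q h S E SR val F hcard hcong hunbal hrec hE hrecE hval hF ih ihE =>
    have hI : {c | c ≠ residuePerm φ h ∧ (congClass (outside (Λ.image φ) (Q.map g)) c).Nonempty} =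
        (residuePerm φ).symm ⁻¹' {c | c ≠ h ∧ (congClass (outside Λ Q) c).Nonempty} := by
      ext c
      simp [outside_image hg, congClass_image, Equiv.symm_apply_eq]
    have hh : congClass ((outside Λ Q).image φ) (residuePerm φ h) =
        (congClass (outside Λ Q) h).image φ := by
      rw [congClass_image, Equiv.symm_apply_apply]
    have hcomp : completions (outside (Λ.image φ) (Q.map g) \
          congClass (outside (Λ.image φ) (Q.map g)) (residuePerm φ h)) (Q.map g)
        (framePoints {c | c ≠ residuePerm φ h ∧
            (congClass (outside (Λ.image φ) (Q.map g)) c).Nonempty}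
          (fun c => (S ((residuePerm φ).symm c)).image (List.map φ))) =
        List.map φ '' E := by
      rw [hI, framePoints_image, outside_image hg, hh, ← Finset.image_sdiff _ _ φ.injective,
        completions_image hg, hE]
    have hEcov : ∀ R ∈ E, IsFrame (Q ++ R.map toRat) := fun R hR => by
      rw [hE] at hR
      exact hR.2.2.1
    refine EquivariantFrames2.unbalanced _ _ (residuePerm φ h)
      (fun c => (S ((residuePerm φ).symm c)).image (List.map φ)) (List.map φ '' E)
      (fun R => (SR (R.map φ.symm)).image (List.map φ)) (fun R => val (R.map φ.symm)) _
      ?_ ?_ ?_ ?_ ?_ ?_ ?_ ?_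
    · rwa [outside_image hg, card_image_aff]
    · rwa [outside_image hg, allCongruent_image]
    · rwa [outside_image hg, hh, card_image_aff, card_image_aff]
    · intro c hc1 hc
      rw [outside_image hg, congClass_image] at hc ⊢
      exact ih _ (fun h => hc1 ((Equiv.symm_apply_eq _).1 h)) (Finset.image_nonempty.1 hc) hQ hg
    · rw [hcomp]
    · rintro _ ⟨R, hR, rfl⟩
      rw [outside_image hg, hh, hg.map_map_toRat, ← List.map_append]
      simpa using ihE R hR (hEcov R hR) hg
    · rintro _ ⟨R, hR, rfl⟩ T' hT'
      obtain ⟨T, hT, rfl⟩ := Finset.mem_image.1 hT'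
      replace hT : T ∈ SR R := by simpa using hT
      rw [outside_image hg, ← List.map_append, hg.map_map_toRat, ← List.map_append]
      have hfr := ((hrecE R hR).frames (hEcov R hR) T hT).2.1
      rw [List.append_assoc, ← List.map_append] at hfr
      have := (hval R hR T hT).map hg hfr
      simpa only [List.map_map, List.map_id, symm_comp_aff] using this
    · convert hF.image φ using 1
      ext V
      constructor
      · rintro ⟨_, ⟨R, hR, rfl⟩, T', hT', rfl⟩
        obtain ⟨T, hT, rfl⟩ := Finset.mem_image.1 hT'
        exact ⟨R ++ T, ⟨R, hR, T, by simpa using hT, rfl⟩, by simp⟩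
      · rintro ⟨_, ⟨R, hR, T, hT, rfl⟩, rfl⟩
        exact ⟨_, ⟨R, hR, rfl⟩, T.map φ, Finset.mem_image_of_mem _ (by simpa using hT), by simp⟩

/-! ## Determinism of `EquivariantFrames2` -/

theorem extends_translation (t : Pt d) :
    Extends (AffineEquiv.constVAdd ℚ (RPt d) (toRat t)).toAffineMap
      (AffineEquiv.constVAdd ℤ (Pt d) t) :=
  ⟨(AffineEquiv.constVAdd ℚ (RPt d) (toRat t)).injective, fun p => (toRat_add t p).symm⟩

theorem framePoints_congr {I : Set (Fin d → ZMod 2)}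
    {S S' : (Fin d → ZMod 2) → Finset (List (Pt d))} (h : ∀ c ∈ I, S c = S' c) :
    framePoints I S = framePoints I S' := by
  ext x
  unfold framePoints
  refine exists_congr fun c => and_congr_right fun hc => ?_
  rw [h c hc]

/-- The only essential choice is the base point of the congruent branch. If `p₂ = 2 t + p`,
translation by `t` carries the problem halved at `p₂` to the one halved at `p`, and equivariance
under this translation identifies the two outputs. The large class is unique since two classes
cannot both have more than half of the points. -/
theorem EquivariantFrames2.unique {Λ : Finset (Pt d)} {Q : List (RPt d)}
    {S S' : Finset (List (Pt d))} (h : EquivariantFrames2 Λ Q S) (hQ : IsFrame Q)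
    (h' : EquivariantFrames2 Λ Q S') : S = S' := by
  induction h generalizing S' with
  | small Λ Q hcard =>
    cases h' with
    | small => rfl
    | congruent _ _ _ _ _ _ hcard' => omega
    | balanced _ _ _ _ _ hcard' => omega
    | unbalanced _ _ _ _ _ _ _ _ hcard' => omega
  | congruent Λ Q p Λ' S₁ hcard hcong hp hΛ' hrec ih =>
    cases h' with
    | small _ _ hcard' => omega
    | balanced _ _ _ _ _ hcard' hcong' => exact absurd hcong hcong'
    | unbalanced _ _ _ _ _ _ _ _ hcard' hcong' => exact absurd hcong hcong'
    | congruent _ _ p₂ Λ₂ S₂ hcard₂ hcong₂ hp₂ hΛ₂ hrec₂ =>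
      have hf := (isFrame_map (halveAt_injective (toRat p))).2 hQ
      have hf₂ := (isFrame_map (halveAt_injective (toRat p₂))).2 hQ
      obtain ⟨t, -, rfl⟩ : ∃ t ∈ Λ', (2 : ℤ) • t + p = p₂ := by
        rw [hΛ'] at hp₂
        exact Finset.mem_image.1 hp₂
      -- The second derivation is moved onto the input of the first one, to which the induction
      -- hypothesis applies.
      have key := hrec₂.map hf₂ (extends_translation t)
      have e1 : Λ₂.image (AffineEquiv.constVAdd ℤ (Pt d) t) = Λ' := by
        apply Finset.image_injective (two_smul_add_injective p)
        rw [← hΛ', hΛ₂, Finset.image_image]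
        refine Finset.image_congr fun x _ => ?_
        simp only [Function.comp_apply, AffineEquiv.constVAdd_apply, vadd_eq_add, smul_add]
        abel
      have e2 : (Q.map (fun q => (1 / 2 : ℚ) • (q - toRat ((2 : ℤ) • t + p)))).map
          (AffineEquiv.constVAdd ℚ (RPt d) (toRat t)).toAffineMap =
          Q.map (fun q => (1 / 2 : ℚ) • (q - toRat p)) := by
        rw [List.map_map]
        refine List.map_congr_left fun q _ => ?_
        simp only [Function.comp_apply, AffineEquiv.coe_toAffineMap, AffineEquiv.constVAdd_apply,
          vadd_eq_add, toRat_add, toRat_smul]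
        ext i
        simp
        ring
      rw [e1, e2] at key
      rw [ih hf key, Finset.image_image]
      refine Finset.image_congr fun V _ => ?_
      simp only [Function.comp_apply, List.map_map]
      refine List.map_congr_left fun x _ => ?_
      simp only [Function.comp_apply, AffineEquiv.constVAdd_apply, vadd_eq_add, smul_add]
      abel
  | balanced Λ Q S val F hcard hcong hbal hrec hval hF ih =>
    cases h' with
    | small _ _ hcard' => omega
    | congruent _ _ _ _ _ _ hcong' => exact absurd hcong' hcong
    | unbalanced _ _ h _ _ _ _ _ _ _ hunbal =>
      have := hbal h
      omega
    | balanced _ _ S₂ val₂ _ hcard₂ hcong₂ hbal₂ hrec₂ hval₂ hF₂ =>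
      have hfp : framePoints {c | (congClass (outside Λ Q) c).Nonempty} S₂ =
          framePoints {c | (congClass (outside Λ Q) c).Nonempty} S :=
        framePoints_congr fun c hc => (ih c hc hQ (hrec₂ c hc)).symm
      rw [hfp] at hF₂ hval₂
      exact hF.unique hF₂ fun R hR =>
        canonicalFormWithFrame_unique hR.2.2.1 (hval R hR) (hval₂ R hR)
  | unbalanced Λ Q h S E SR val F hcard hcong hunbal hrec hE hrecE hval hF ih ihE =>
    cases h' with
    | small _ _ hcard' => omega
    | congruent _ _ _ _ _ _ hcong' => exact absurd hcong' hcong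
    | balanced _ _ _ _ _ hcard' hcong' hbal =>
      have := hbal h
      omega
    | unbalanced _ _ h₂ S₂ E₂ SR₂ val₂ _ hcard₂ hcong₂ hunbal₂ hrec₂ hE₂ hrecE₂ hval₂ hF₂ =>
      -- Two different classes with more than half of the points each would not fit into the set.
      obtain rfl : h = h₂ := by
        by_contra hne
        have := congClass_card_add_le (outside Λ Q) hne
        omega
      have hfp : framePoints {c | c ≠ h ∧ (congClass (outside Λ Q) c).Nonempty} S₂ =
          framePoints {c | c ≠ h ∧ (congClass (outside Λ Q) c).Nonempty} S :=
        framePoints_congr fun c hc => (ih c hc.1 hc.2 hQ (hrec₂ c hc.1 hc.2)).symm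
      rw [hfp] at hE₂
      obtain rfl : E = E₂ := hE.trans hE₂.symm
      have hEcov : ∀ R ∈ E, IsFrame (Q ++ R.map toRat) := fun R hR => by
        rw [hE] at hR
        exact hR.2.2.1
      have hSR : ∀ R ∈ E, SR R = SR₂ R := fun R hR => ihE R hR (hEcov R hR) (hrecE₂ R hR)
      have hcand : {V | ∃ R ∈ E, ∃ T ∈ SR₂ R, V = R ++ T} = {V | ∃ R ∈ E, ∃ T ∈ SR R, V = R ++ T} := by
        ext V
        refine exists_congr fun R => and_congr_right fun hR => ?_
        rw [hSR R hR]
      rw [hcand] at hF₂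
      refine hF.unique hF₂ ?_
      rintro _ ⟨R, hR, T, hT, rfl⟩
      have hfr := ((hrecE R hR).frames (hEcov R hR) T hT).2.1
      rw [List.append_assoc, ← List.map_append] at hfr
      exact canonicalFormWithFrame_unique hfr (hval R hR T hT) (hval₂ R hR T (hSR R hR ▸ hT))

end EquivariantFrames

section CanonicalFormTheory

variable {d : ℕ}

/-! ## Determinism and equivariance of `CanonicalForm` -/

theorem EquivariantFrames2.isCoveringFrame_nil {Λ : Finset (Pt d)} {S : Finset (List (Pt d))}
    (h : EquivariantFrames2 Λ [] S) {R : List (Pt d)} (hR : R ∈ S) :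
    IsCoveringFrame Λ (R.map toRat) :=
  (h.frames isFrame_nil R hR).2

theorem canonicalForm_unique {Λ Ω Ω' : Finset (Pt d)} (h : CanonicalForm Λ Ω)
    (h' : CanonicalForm Λ Ω') : Ω = Ω' := by
  obtain ⟨S, val, hS, hval, R, hR, rfl, hmin⟩ := h
  obtain ⟨S', val', hS', hval', R', hR', rfl, hmin'⟩ := h'
  obtain rfl := hS.unique isFrame_nil hS'
  have hv : ∀ R ∈ S, val R = val' R := fun R hR =>
    canonicalFormWithFrame_unique (hS.isCoveringFrame_nil hR).1 (hval R hR) (hval' R hR)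
  apply setKey_injective
  refine le_antisymm ?_ ?_
  · rw [← hv R' hR']; exact hmin R' hR'
  · rw [hv R hR]; exact hmin' R hR

theorem CanonicalForm.map {Λ Ω : Finset (Pt d)} (h : CanonicalForm Λ Ω) (φ : Aff d) :
    CanonicalForm (Λ.image φ) Ω := by
  obtain ⟨S, val, hS, hval, R, hR, rfl, hmin⟩ := h
  obtain ⟨g, hg⟩ := exists_extends φ
  refine ⟨S.image (List.map φ), fun R => val (R.map φ.symm), by simpa using hS.map isFrame_nil hg,
    ?_, R.map φ, Finset.mem_image_of_mem _ hR, by simp, ?_⟩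
  · intro R' hR'
    obtain ⟨R, hR, rfl⟩ := Finset.mem_image.1 hR'
    rw [hg.map_map_toRat]
    simpa only [List.map_map, symm_comp_aff, List.map_id] using
      (hval R hR).map hg (hS.isCoveringFrame_nil hR).1
  · intro R' hR'
    obtain ⟨R₁, hR₁, rfl⟩ := Finset.mem_image.1 hR'
    simpa only [List.map_map, symm_comp_aff, List.map_id] using hmin R₁ hR₁

theorem CanonicalForm.mem_orbit {Λ Ω : Finset (Pt d)} (h : CanonicalForm Λ Ω) :
    Ω ∈ MulAction.orbit (Aff d) Λ := by
  obtain ⟨S, val, hS, hval, R, hR, rfl, -⟩ := h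
  obtain ⟨T, A, -, -, hX⟩ := hval R hR
  rw [hX]
  exact ⟨glAff A (T.headD 0), rfl⟩

/-- Once every input has some output, determinism turns the relation into a function. Its invariance
follows because the output at `Λ` is also an output at `φ • Λ`. -/
theorem isCanonicalForm_of_canonicalForm {f : Finset (Pt d) → Finset (Pt d)}
    (hf : ∀ Λ, CanonicalForm Λ (f Λ)) :
    (∀ Λ Ω, CanonicalForm Λ Ω ↔ Ω = f Λ) ∧ IsCanonicalForm (Aff d) f :=
  ⟨fun Λ _ => ⟨fun h => canonicalForm_unique h (hf Λ), fun h => h ▸ hf Λ⟩,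
    fun Λ => (hf Λ).mem_orbit,
    fun φ Λ => canonicalForm_unique (hf (φ • Λ)) ((hf Λ).map φ)⟩

end CanonicalFormTheory

section LinearAlgebra

variable {d : ℕ}

/-! ## Linear algebra on tuples of integers -/

@[simp] theorem sumT_val (m : ℕ) (f : Fin m → Timed ℤ) : (sumT m f).val = ∑ i, (f i).val := by
  induction m with
  | zero => simp [sumT]
  | succ m ih => simp [sumT, ih, addT, Fin.sum_univ_succ]

@[simp] theorem vecAddT_val (u v : Pt d) : (vecAddT u v).val = u + v := rfl

@[simp] theorem vecSubT_val (u v : Pt d) : (vecSubT u v).val = u - v := rfl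

@[simp] theorem vecNegT_val (u : Pt d) : (vecNegT u).val = -u := rfl

@[simp] theorem vecScaleT_val (μ : ℕ → ℕ) (c : ℤ) (u : Pt d) : (vecScaleT μ c u).val = c • u := rfl

@[simp] theorem dotT_val (μ : ℕ → ℕ) {m : ℕ} (u v : Fin m → ℤ) : (dotT μ u v).val = dotProduct u v := by
  simp [dotT, mulT, dotProduct]

theorem detT_val (μ : ℕ → ℕ) (m : ℕ) (A : Fin m → Fin m → ℤ) :
    (detT μ m A).val = (Matrix.of A).det := by
  induction m with
  | zero => simp [detT]
  | succ m ih =>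
    rw [detT, sumT_val, Matrix.det_succ_row_zero]
    refine Finset.sum_congr rfl fun j _ => ?_
    simp only [Timed.val_bind, ih]
    have : Matrix.of (fun r c => A r.succ (j.succAbove c)) =
        (Matrix.of A).submatrix Fin.succ j.succAbove := rfl
    rw [this]
    split_ifs with h
    · rw [Even.neg_one_pow (Nat.even_iff.2 h)]
      simp [mulT]
    · rw [Odd.neg_one_pow (Nat.odd_iff.2 (by omega))]
      simp [mulT, negT]

theorem gramT_val (μ : ℕ → ℕ) {m : ℕ} (w : Fin m → Pt d) :
    Matrix.of (gramT μ w).val = Matrix.of w * (Matrix.of w).transpose := by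
  ext i j
  simp [gramT, Matrix.mul_apply, dotProduct]

/-- If `M Mᵀ v = 0`, then `Mᵀ v` has scalar product zero with itself, hence vanishes over `ℚ`. So
the Gram matrix has the same kernel as the relations between the vectors. -/
theorem det_gram_eq_zero_iff {m : ℕ} (w : Fin m → Pt d) :
    (Matrix.of w * (Matrix.of w).transpose).det = 0 ↔
      ¬ LinearIndependent ℚ (fun i => toRat (w i)) := by
  set M : Matrix (Fin m) (Fin d) ℚ := Matrix.of (fun i => toRat (w i)) with hM
  have hcast : ((Matrix.of w * (Matrix.of w).transpose).det : ℚ) = (M * M.transpose).det := by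
    rw [Int.cast_det]
    congr 1
    ext i j
    simp [Matrix.mul_apply, hM, toRat]
  rw [← Int.cast_eq_zero (α := ℚ), hcast, ← Matrix.exists_mulVec_eq_zero_iff,
    Fintype.linearIndependent_iff]
  push Not
  refine exists_congr fun v => ?_
  have h1 : ∑ i, v i • toRat (w i) = Matrix.vecMul v M := by
    ext j
    simp [Matrix.vecMul, dotProduct, hM]
  rw [h1, ← Matrix.mulVec_mulVec, Matrix.mulVec_transpose, Function.ne_iff, and_comm]
  refine and_congr_left fun _ => ⟨fun h => ?_, fun h => by rw [h, Matrix.mulVec_zero]⟩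
  have h2 : dotProduct v (M.mulVec (Matrix.vecMul v M)) = 0 := by rw [h, dotProduct_zero]
  rw [Matrix.dotProduct_mulVec] at h2
  exact dotProduct_self_eq_zero.1 h2

/-- A Gram matrix is positive semidefinite over `ℝ`. The sign is needed so that the numerators of
Cramer's rule are ordered like the coordinates themselves. -/
theorem det_gram_nonneg {m : ℕ} (w : Fin m → Pt d) :
    0 ≤ (Matrix.of w * (Matrix.of w).transpose).det := by
  set M : Matrix (Fin m) (Fin d) ℝ := Matrix.of (fun i j => (w i j : ℝ)) with hM
  have hcast : ((Matrix.of w * (Matrix.of w).transpose).det : ℝ) = (M * M.conjTranspose).det := by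
    rw [Int.cast_det]
    congr 1
    ext i j
    simp [Matrix.mul_apply, hM]
  rw [← Int.cast_nonneg_iff (R := ℝ), hcast]
  exact (Matrix.posSemidef_self_mul_conjTranspose M).det_nonneg

theorem gramDetT_val (μ : ℕ → ℕ) (vs : List (Pt d)) :
    (gramDetT μ vs).val = 0 ↔ ¬ LinearIndependent ℚ (fun i : Fin vs.length => toRat (vs.get i)) := by
  simp only [gramDetT, Timed.val_bind, detT_val, gramT_val, det_gram_eq_zero_iff]

theorem diffsT_val (q : Pt d) (qs : List (Pt d)) : (diffsT q qs).val = qs.map (fun x => x - q) := by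
  simp [diffsT]

theorem isFrame_iff_nodup {Q : List (RPt d)} :
    IsFrame Q ↔ Q.Nodup ∧ AffineIndependent ℚ (Subtype.val : {x // x ∈ Q} → RPt d) := by
  classical
  have key : ∀ h : Q.Nodup, (IsFrame Q ↔
      AffineIndependent ℚ (Subtype.val : {x // x ∈ Q} → RPt d)) := fun h => by
    unfold IsFrame
    rw [← affineIndependent_equiv (List.Nodup.getEquiv Q h)]
    rfl
  exact ⟨fun h => ⟨h.nodup, (key h.nodup).1 h⟩, fun h => (key h.1).2 h.2⟩

/-- The tests insert a new point right after the base point, while frames grow at the end; this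
bridges the two orders. -/
theorem IsFrame.perm {Q Q' : List (RPt d)} (h : IsFrame Q) (hp : Q.Perm Q') : IsFrame Q' := by
  rw [isFrame_iff_nodup] at h ⊢
  refine ⟨hp.nodup_iff.1 h.1, ?_⟩
  rw [← affineIndependent_equiv (Equiv.subtypeEquivRight fun x => hp.mem_iff)]
  exact h.2

theorem isFrame_cons_iff {q : RPt d} {Q : List (RPt d)} :
    IsFrame (q :: Q) ↔ LinearIndependent ℚ (fun i : Fin Q.length => Q.get i - q) := by
  unfold IsFrame
  rw [affineIndependent_iff_linearIndependent_vsub ℚ _ (0 : Fin (Q.length + 1)),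
    ← linearIndependent_equiv (finSuccAboveEquiv (0 : Fin (Q.length + 1)))]
  rfl

theorem linearIndependent_diffs_iff (q : Pt d) (qs : List (Pt d)) :
    LinearIndependent ℚ (fun i : Fin (diffsT q qs).val.length => toRat ((diffsT q qs).val.get i)) ↔
      IsFrame ((q :: qs).map toRat) := by
  rw [List.map_cons, isFrame_cons_iff]
  have hlen : ((qs.map toRat).length) = (diffsT q qs).val.length := by simp [diffsT_val]
  rw [← linearIndependent_equiv (finCongr hlen)]
  have : ((fun i : Fin (diffsT q qs).val.length => toRat ((diffsT q qs).val.get i)) ∘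
      (finCongr hlen)) = fun i : Fin (qs.map toRat).length => (qs.map toRat).get i - toRat q := by
    funext i
    simp [diffsT_val, toRat_sub]
  rw [this]

theorem indepT_val (μ : ℕ → ℕ) (L : List (Pt d)) :
    (indepT μ L).val = true ↔ IsFrame (L.map toRat) := by
  rcases L with _ | ⟨q, qs⟩
  · simp [indepT, isFrame_nil]
  · rw [← linearIndependent_diffs_iff]
    simp only [indepT, Timed.val_bind, isZeroT, Timed.val_pure, Bool.not_eq_true', beq_eq_false_iff_ne,
      ne_eq, gramDetT_val, not_not]

theorem inSpanT_val (μ : ℕ → ℕ) {L : List (Pt d)} (hL : IsFrame (L.map toRat)) (x : Pt d) :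
    (inSpanT μ x L).val = true ↔ toRat x ∈ ratSpan (L.map toRat) := by
  rcases L with _ | ⟨q, qs⟩
  · simp [inSpanT]
  · simp only [inSpanT, Timed.val_bind, isZeroT, beq_iff_eq, gramDetT_val,
      linearIndependent_diffs_iff]
    rw [not_iff_comm]
    have : IsFrame ((q :: x :: qs).map toRat) ↔ IsFrame ((q :: qs).map toRat ++ [toRat x]) := by
      have hp : ((q :: x :: qs).map toRat).Perm ((q :: qs).map toRat ++ [toRat x]) := by
        simp only [List.map_cons, List.cons_append]
        exact (List.perm_append_singleton _ _).symm.cons _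
      exact ⟨fun h => h.perm hp, fun h => h.perm hp.symm⟩
    rw [this, isFrame_append_singleton]
    exact ⟨fun h => ⟨hL, h⟩, fun h => h.2⟩

/-! ## Rational frames with a common denominator -/

/-- The list of the points of a rational frame. -/
def RFrame.toList (Q : RFrame d) : List (RPt d) := Q.pts.map (fun p => (Q.den : ℚ)⁻¹ • toRat p)

theorem RFrame.toList_mk (den : ℤ) (pts : List (Pt d)) :
    (RFrame.mk den pts).toList = pts.map (fun p => (den : ℚ)⁻¹ • toRat p) := rfl

theorem RFrame.toList_one (R : List (Pt d)) : (RFrame.mk 1 R).toList = R.map toRat := by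
  simp [RFrame.toList_mk]

/-- The homothety with factor `c` at the origin. -/
noncomputable def scaleAt (c : ℚ) : RPt d →ᵃ[ℚ] RPt d := c • AffineMap.id ℚ (RPt d)

theorem scaleAt_apply (c : ℚ) (x : RPt d) : scaleAt c x = c • x := rfl

theorem scaleAt_injective {c : ℚ} (hc : c ≠ 0) : Function.Injective (scaleAt (d := d) c) :=
  smul_right_injective _ hc

theorem RFrame.toList_eq (Q : RFrame d) :
    Q.toList = (Q.pts.map toRat).map (scaleAt (Q.den : ℚ)⁻¹) := by
  rw [List.map_map]
  rfl

/-- Clearing the common denominator is a homothety, so independence and spans can be tested on the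
integral numerators. -/
theorem RFrame.isFrame_iff {Q : RFrame d} (hQ : 0 < Q.den) :
    IsFrame Q.toList ↔ IsFrame (Q.pts.map toRat) := by
  rw [Q.toList_eq, isFrame_map (scaleAt_injective (inv_ne_zero (by exact_mod_cast hQ.ne')))]

theorem RFrame.smul_toRat {Q : RFrame d} (hQ : 0 < Q.den) (p : Pt d) :
    (Q.den : ℚ)⁻¹ • toRat (Q.den • p) = toRat p := by
  rw [toRat_smul, smul_smul, inv_mul_cancel₀ (by exact_mod_cast hQ.ne'), one_smul]

theorem RFrame.memSpanT_val (μ : ℕ → ℕ) {Q : RFrame d} (hQ : 0 < Q.den) (hf : IsFrame Q.toList)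
    (x : Pt d) : (Q.memSpanT μ x).val = true ↔ toRat x ∈ ratSpan Q.toList := by
  simp only [RFrame.memSpanT, Timed.val_bind, vecScaleT_val]
  rw [inSpanT_val μ ((RFrame.isFrame_iff hQ).1 hf), Q.toList_eq, ← RFrame.smul_toRat hQ x,
    ← scaleAt_apply, mem_ratSpan_map (scaleAt_injective (inv_ne_zero (by exact_mod_cast hQ.ne')))]

theorem RFrame.unionT_toList (μ : ℕ → ℕ) {Q : RFrame d} (hQ : 0 < Q.den) (R : List (Pt d)) :
    (Q.unionT μ R).val.toList = Q.toList ++ R.map toRat := by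
  simp only [RFrame.unionT, Timed.val_bind, Timed.val_pure, appendT_val, mapT_val, vecScaleT_val,
    RFrame.toList, List.map_append, List.map_map]
  congr 1
  exact List.map_congr_left fun p _ => RFrame.smul_toRat hQ p

theorem RFrame.shrinkT_den (μ : ℕ → ℕ) (Q : RFrame d) (p : Pt d) :
    (Q.shrinkT μ p).val.den = Q.den + Q.den := rfl

theorem RFrame.shrinkT_toList (μ : ℕ → ℕ) {Q : RFrame d} (hQ : 0 < Q.den) (p : Pt d) :
    (Q.shrinkT μ p).val.toList = Q.toList.map (halveAt (toRat p)) := by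
  have hd : (Q.den : ℚ) ≠ 0 := by exact_mod_cast hQ.ne'
  simp only [RFrame.shrinkT, Timed.val_bind, Timed.val_pure, diffsT_val, vecScaleT_val, addT,
    RFrame.toList, List.map_map]
  refine List.map_congr_left fun q _ => ?_
  simp only [Function.comp_apply, halveAt_apply, toRat_sub, toRat_smul]
  ext i
  simp only [Pi.smul_apply, Pi.sub_apply, smul_eq_mul, Int.cast_add]
  field_simp
  ring

open Classical in
theorem RFrame.interT_val (μ : ℕ → ℕ) {Q : RFrame d} (hQ : 0 < Q.den) (Λ : List (Pt d)) :
    (Q.interT μ Λ).val.map toRat =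
      Q.toList.filter (fun q => decide (∃ p ∈ Λ.toFinset, toRat p = q)) := by
  have hd : (Q.den : ℚ) ≠ 0 := by exact_mod_cast hQ.ne'
  obtain ⟨den, pts⟩ := Q
  simp only at hQ hd
  simp only [RFrame.interT, Timed.val_bind, flattenT_val, mapT_val, findT_val, vecScaleT_val,
    Timed.val_pure, RFrame.toList]
  induction pts with
  | nil => simp
  | cons q qs ih =>
    rw [List.map_cons, List.flatten_cons, List.map_append, ih, List.map_cons, List.filter_cons]
    cases hfind : List.find? (fun yp : Pt d × Pt d => (eqVecT yp.1 q).val)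
        (Λ.map fun p => (den • p, p)) with
    | none =>
      rw [List.find?_eq_none] at hfind
      rw [if_neg]
      · simp
      · simp only [decide_eq_true_eq]
        rintro ⟨p, hp, h⟩
        refine hfind (den • p, p) (List.mem_map_of_mem (List.mem_toFinset.1 hp)) ?_
        rw [eqVecT_val, ← toRat_inj, toRat_smul, h, smul_smul, mul_inv_cancel₀ hd, one_smul]
    | some yp =>
      have h1 := List.find?_some hfind
      obtain ⟨p, hp, rfl⟩ := List.mem_map.1 (List.mem_of_find?_eq_some hfind)
      simp only [eqVecT_val] at h1
      have h2 : toRat p = (den : ℚ)⁻¹ • toRat q := by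
        rw [← h1, toRat_smul, smul_smul, inv_mul_cancel₀ hd, one_smul]
      rw [if_pos]
      · simp [h2]
      · simp only [decide_eq_true_eq]
        exact ⟨p, List.mem_toFinset.2 hp, h2⟩

end LinearAlgebra

section Coordinates

variable {d : ℕ}

/-! ## Coordinates and the loop of `CanonicalFormWithFrame` -/

/-- The scaled coordinates `coord` order the points of `Λ` as their coordinates do. -/
def ReflectsCoords (Λ : List (Pt d)) (Q : List (RPt d)) (coord : Pt d → List ℤ) : Prop :=
  ∀ p ∈ Λ, ∀ q ∈ Λ, (coord p < coord q → CoordLT Q (toRat p) (toRat q)) ∧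
    (coord p = coord q → p = q)

/-- Scalar products of the relation with each `w r` give the normal equations `G c = b`. Multiplying
by the adjugate of `G` isolates `det G * c i` without any division. -/
theorem cramer_gram {m : ℕ} (w : Fin m → Pt d) (y : Pt d) (c : Fin m → ℚ)
    (hy : ∑ i, c i • toRat (w i) = toRat y) (i : Fin m) :
    ((Matrix.of (fun r s => if s = i then dotProduct (w r) y else
      (Matrix.of w * (Matrix.of w).transpose) r s)).det : ℚ) =
      (Matrix.of w * (Matrix.of w).transpose).det * c i := by
  set G := Matrix.of w * (Matrix.of w).transpose with hG
  set b : Fin m → ℤ := fun r => dotProduct (w r) y with hb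
  have h1 : Matrix.of (fun r s => if s = i then b r else G r s) = G.updateCol i b := by
    ext r s
    rw [Matrix.updateCol_apply]
    rfl
  rw [h1, ← Matrix.cramer_apply, Matrix.cramer_eq_adjugate_mulVec]
  have h2 : (fun r => (b r : ℚ)) = (G.map (Int.cast : ℤ → ℚ)).mulVec c := by
    funext r
    have h3 : (b r : ℚ) = dotProduct (toRat (w r)) (toRat y) := by
      simp [hb, dotProduct, toRat]
    rw [h3, ← hy, dotProduct_sum]
    simp only [Matrix.mulVec, dotProduct_smul]
    rw [dotProduct]
    refine Finset.sum_congr rfl fun s _ => ?_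
    rw [smul_eq_mul, mul_comm]
    congr 1
    simp [hG, Matrix.mul_apply, dotProduct, toRat]
  have h4 : ((G.adjugate.mulVec b i : ℤ) : ℚ) =
      ((G.adjugate.map (Int.cast : ℤ → ℚ)).mulVec (fun r => (b r : ℚ))) i := by
    simp [Matrix.mulVec, dotProduct]
  have h5 : G.adjugate.map (Int.cast : ℤ → ℚ) * G.map (Int.cast : ℤ → ℚ) = (G.det : ℚ) • 1 := by
    have := congrArg (fun M => M.map (Int.castRingHom ℚ)) (Matrix.adjugate_mul G)
    simp only [Matrix.map_mul] at this
    rw [Matrix.map_smul' _ _ _ (fun a b => map_mul _ a b),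
      Matrix.map_one _ (map_zero _) (map_one _)] at this
    exact this
  rw [h4, h2, Matrix.mulVec_mulVec, h5, Matrix.smul_mulVec, Matrix.one_mulVec]
  rfl

/-- The computed numbers are the coordinates multiplied by `det G`, which is positive because `Q` is
a frame. The order is therefore preserved, and equal lists force equal points. -/
theorem RFrame.coordsT_spec (μ : ℕ → ℕ) {Q : RFrame d} (hQ : 0 < Q.den) {Λ : List (Pt d)}
    (hcov : IsCoveringFrame Λ.toFinset Q.toList) :
    ∃ coord : Pt d → List ℤ, (Q.coordsT μ Λ).val = Λ.map (fun p => (coord p, p)) ∧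
      ReflectsCoords Λ Q.toList coord := by
  obtain ⟨den, pts⟩ := Q
  simp only at hQ
  have hd : (den : ℚ) ≠ 0 := by exact_mod_cast hQ.ne'
  rcases pts with _ | ⟨q₀, qs⟩
  · refine ⟨fun _ => [], by simp [RFrame.coordsT], fun p hp => ?_⟩
    have := hcov.2 p (List.mem_toFinset.2 hp)
    simp [RFrame.toList] at this
  set vs := (diffsT q₀ qs).val with hvs
  have hlen : vs.length = qs.length := by simp [hvs, diffsT_val]
  set w : Fin vs.length → Pt d := vs.get with hw
  set G := Matrix.of w * (Matrix.of w).transpose with hG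
  set coord : Pt d → Fin vs.length → ℤ := fun p i =>
    (Matrix.of (fun r s => if s = i then dotProduct (w r) (den • p - q₀) else G r s)).det
    with hcoord
  have hf : IsFrame ((q₀ :: qs).map toRat) := (RFrame.isFrame_iff (Q := ⟨den, q₀ :: qs⟩) hQ).1 hcov.1
  have hdet : 0 < G.det := by
    refine lt_of_le_of_ne (det_gram_nonneg w) (Ne.symm ?_)
    rw [hG, Ne, det_gram_eq_zero_iff, not_not, hw, hvs, linearIndependent_diffs_iff]
    exact hf
  have hlenQ : (RFrame.mk den (q₀ :: qs)).toList.length = vs.length + 1 := by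
    simp [RFrame.toList, hlen]
  let e : Fin (vs.length + 1) ≃ Fin (RFrame.mk den (q₀ :: qs)).toList.length := finCongr hlenQ.symm
  have hweights : ∀ p u, IsWeights (RFrame.mk den (q₀ :: qs)).toList (toRat p) u →
      ∀ i : Fin vs.length, (coord p i : ℚ) = G.det * u (e i.succ) := by
    rintro p u ⟨hu1, hu2⟩
    refine cramer_gram w (den • p - q₀) (fun i => u (e i.succ)) ?_
    rw [← e.sum_comp, Fin.sum_univ_succ] at hu1 hu2
    have hget0 : (RFrame.mk den (q₀ :: qs)).toList.get (e 0) = (den : ℚ)⁻¹ • toRat q₀ := rfl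
    have hget : ∀ i : Fin vs.length, (RFrame.mk den (q₀ :: qs)).toList.get (e i.succ) =
        (den : ℚ)⁻¹ • (toRat (w i) + toRat q₀) := by
      intro i
      change (qs.map fun p => (den : ℚ)⁻¹ • toRat p)[(i : ℕ)]'(by simp [← hlen]) = _
      simp [hw, hvs, diffsT_val, ← toRat_add]
    rw [toRat_sub, toRat_smul, ← hu2, hget0]
    have hcancel : ∀ (c : ℚ) (x : RPt d), (den : ℚ) • c • (den : ℚ)⁻¹ • x = c • x := by
      intro c x
      rw [smul_comm c, smul_inv_smul₀ hd]
    simp only [hget, smul_add, Finset.sum_add_distrib, Finset.smul_sum, hcancel, ← Finset.sum_smul]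
    -- The weights add up to 1, so the weight of the base point can be eliminated and only the
    -- differences `w i` remain.
    have h0 : u (e 0) = 1 - ∑ i : Fin vs.length, u (e i.succ) := by linarith
    rw [h0, sub_smul, one_smul]
    abel
  refine ⟨fun p => List.ofFn (coord p), ?_, ?_⟩
  · simp only [RFrame.coordsT, Timed.val_bind, Timed.val_pure, mapT_val, vecScaleT_val,
      vecSubT_val, tupleT_val, dotT_val, detT_val]
    refine List.map_congr_left fun p _ => ?_
    simp only [Prod.mk.injEq, and_true]
    congr 1
    funext i
    simp only [hcoord, hG, ← gramT_val μ]
    rfl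
  · intro p hp q hq
    obtain ⟨u, hu⟩ := exists_isWeights (hcov.2 p (List.mem_toFinset.2 hp))
    obtain ⟨v, hv⟩ := exists_isWeights (hcov.2 q (List.mem_toFinset.2 hq))
    have hwu := hweights p u hu
    have hwv := hweights q v hv
    have hdq : (0 : ℚ) < G.det := by exact_mod_cast hdet
    constructor
    · intro hlt
      obtain ⟨i, h1, h2⟩ := ofFn_lt_ofFn.1 hlt
      simp only [Pi.toLex_apply] at h1 h2
      refine ⟨u, v, hu, hv, e i.succ, Nat.succ_pos _, ?_, ?_⟩
      · have h3 : (coord p i : ℚ) < coord q i := by exact_mod_cast h2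
        rw [hwu, hwv] at h3
        exact lt_of_mul_lt_mul_left h3 hdq.le
      · intro j hj hji
        obtain ⟨j, rfl⟩ := e.surjective j
        induction j using Fin.cases with
        | zero => exact absurd hj (lt_irrefl _)
        | succ j =>
          have h3 : (coord p j : ℚ) = coord q j := by
            exact_mod_cast h1 j (Fin.succ_lt_succ_iff.1 hji)
          rw [hwu, hwv] at h3
          exact mul_left_cancel₀ hdq.ne' h3
    · intro heq
      have heq' := List.ofFn_injective heq
      have h1 : ∀ i : Fin vs.length, u (e i.succ) = v (e i.succ) := by
        intro i
        have h3 : (coord p i : ℚ) = coord q i := by rw [heq']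
        rw [hwu, hwv] at h3
        exact mul_left_cancel₀ hdq.ne' h3
      have h0 : u (e 0) = v (e 0) := by
        have hs := hu.1.trans hv.1.symm
        rw [← e.sum_comp, Fin.sum_univ_succ, ← e.sum_comp v, Fin.sum_univ_succ] at hs
        simp only [h1] at hs
        exact add_right_cancel hs
      have : u = v := by
        funext j
        obtain ⟨j, rfl⟩ := e.surjective j
        induction j using Fin.cases with
        | zero => exact h0
        | succ j => exact h1 j
      rw [← toRat_inj, ← hu.2, ← hv.2, this]

/-- Every iteration lengthens a frame, and a frame has at most `d + 1` points; hence the fuel `r`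
suffices as soon as `d + 1 ≤ T.length + r`. -/
theorem extendT_spec (μ : ℕ → ℕ) {Λ : List (Pt d)} {Q : List (RPt d)} {coord : Pt d → List ℤ}
    (hc : ReflectsCoords Λ Q coord) (r : ℕ) (T : List (Pt d)) (hT : IsFrame (T.map toRat))
    (hTΛ : ∀ p ∈ T, p ∈ Λ) (hr : d + 1 ≤ T.length + r) :
    Relation.ReflTransGen (FrameStep Λ.toFinset Q) T
      (extendT μ (Λ.map fun p => (coord p, p)) r T).val ∧
    ¬ (extendT μ (Λ.map fun p => (coord p, p)) r T).val.length < spanDimSucc Λ.toFinset := by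
  induction r generalizing T with
  | zero =>
    refine ⟨Relation.ReflTransGen.refl, ?_⟩
    -- With no fuel left, `T` already has at least `d + 1` points, the largest possible value of
    -- `spanDimSucc`.
    have := affDim_le (affineSpan ℚ (toRat '' (Λ.toFinset : Set (Pt d))))
    rw [← spanDimSucc_eq] at this
    simp only [extendT, Timed.val_bind, Timed.val_pure]
    omega
  | succ r ih =>
    have hTΛ' : ∀ p ∈ T, p ∈ Λ.toFinset := fun p hp => List.mem_toFinset.2 (hTΛ p hp)
    have hmem : ∀ cp : List ℤ × Pt d, cp ∈ (Λ.map fun p => (coord p, p)).filter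
        (fun cp : List ℤ × Pt d => !(inSpanT μ cp.2 T).val) ↔
        cp.2 ∈ Λ ∧ toRat cp.2 ∉ ratSpan (T.map toRat) ∧ cp.1 = coord cp.2 := by
      rintro ⟨c, p⟩
      rw [List.mem_filter, List.mem_map, Bool.not_eq_true', ← Bool.not_eq_true,
        inSpanT_val μ hT]
      constructor
      · rintro ⟨⟨q, hq, h⟩, h'⟩
        obtain ⟨rfl, rfl⟩ := Prod.mk.inj h
        exact ⟨hq, h', rfl⟩
      · rintro ⟨h1, h2, h3⟩
        simp only at h1 h2 h3
        exact ⟨⟨p, h1, by rw [h3]⟩, h2⟩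
    simp only [extendT, Timed.val_bind, filterT_val, Timed.val_pure]
    generalize hout : (Λ.map fun p => (coord p, p)).filter
        (fun cp : List ℤ × Pt d => !(inSpanT μ cp.2 T).val) = out at hmem
    rcases out with _ | ⟨c, out⟩
    · refine ⟨Relation.ReflTransGen.refl, ?_⟩
      simp only [Timed.val_pure]
      rw [length_lt_spanDimSucc_iff hT hTΛ']
      rintro ⟨p, hp, hpT⟩
      have := (hmem (coord p, p)).2 ⟨List.mem_toFinset.1 hp, hpT, rfl⟩
      simp at this
    · simp only [Timed.val_bind, appendT_val]
      have hcmp : Compares (fun x y : List ℤ × Pt d => cmpListT cmpT x.1 y.1)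
          (fun x : List ℤ × Pt d => x.1) := by
        intro x y
        have := compares_cmpListT compares_cmpT x.1 y.1
        simpa using this
      obtain ⟨hb1, hb2⟩ := minT_spec hcmp c out
      generalize (minT (fun x y : List ℤ × Pt d => cmpListT cmpT x.1 y.1) c out).val = best at *
      obtain ⟨hbΛ, hbT, hbc⟩ := (hmem best).1 hb1
      have hstep : FrameStep Λ.toFinset Q T (T ++ [best.2]) := by
        refine ⟨(length_lt_spanDimSucc_iff hT hTΛ').2 ⟨_, List.mem_toFinset.2 hbΛ, hbT⟩, best.2,
          List.mem_toFinset.2 hbΛ, hbT, fun q hq hqT => ?_, rfl⟩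
        have hqΛ := List.mem_toFinset.1 hq
        have hle := hb2 _ ((hmem (coord q, q)).2 ⟨hqΛ, hqT, rfl⟩)
        rw [hbc] at hle
        rcases hle.lt_or_eq with hlt | heq
        · exact Or.inr ((hc _ hbΛ _ hqΛ).1 hlt)
        · exact Or.inl ((hc _ hbΛ _ hqΛ).2 heq).symm
      have hf : IsFrame ((T ++ [best.2]).map toRat) := by
        rw [List.map_append]
        exact isFrame_append_singleton.2 ⟨hT, hbT⟩
      obtain ⟨h1, h2⟩ := ih (T ++ [best.2]) hf (by
        intro p hp
        rcases List.mem_append.1 hp with hp | hp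
        · exact hTΛ p hp
        · rw [List.mem_singleton.1 hp]; exact hbΛ) (by simp; omega)
      exact ⟨Relation.ReflTransGen.head hstep h1, h2⟩

theorem frameLoop_extendT (μ : ℕ → ℕ) {Q : RFrame d} (hQ : 0 < Q.den) {Λ : List (Pt d)}
    (hcov : IsCoveringFrame Λ.toFinset Q.toList) :
    FrameLoop Λ.toFinset Q.toList
      (extendT μ (Q.coordsT μ Λ).val (d + 1) (Q.interT μ Λ).val).val := by
  obtain ⟨coord, h1, h2⟩ := Q.coordsT_spec μ hQ hcov
  rw [h1]
  have h3 := RFrame.interT_val μ hQ Λ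
  have h4 := extendT_spec μ h2 (d + 1) (Q.interT μ Λ).val
    (h3 ▸ hcov.1.sublist List.filter_sublist) (by
      intro p hp
      have : toRat p ∈ (Q.interT μ Λ).val.map toRat := List.mem_map_of_mem hp
      rw [h3, List.mem_filter] at this
      simpa using this.2) (by omega)
  exact ⟨_, h3, h4.1, h4.2⟩

end Coordinates

section HermiteAlgorithm

variable {d k : ℕ}

/-! ## The Hermite normal form algorithm -/

open Submodule

@[simp] theorem rowSubT_val (μ : ℕ → ℕ) (q : ℤ) (a b : Row d k) :
    (rowSubT μ q a b).val = a - q • b := rfl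

theorem span_pair_sub_smul {M : Type*} [AddCommGroup M] (a b : M) (q : ℤ) :
    span ℤ {b, a - q • b} = span ℤ {a, b} := by
  apply le_antisymm
  · rw [span_le]
    rintro x (rfl | rfl)
    · exact subset_span (by simp)
    · exact sub_mem (subset_span (by simp)) (smul_mem _ _ (subset_span (by simp)))
  · rw [span_le]
    rintro x (rfl | rfl)
    · have : x = (x - q • b) + q • b := by abel
      rw [this]
      refine add_mem (subset_span ?_) (smul_mem _ _ (subset_span (by simp)))
      simp
    · exact subset_span (by simp)

/-- A row operation does not change the lattice generated by the two rows. Remainders decrease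
strictly in absolute value, so the absolute value of the divisor is enough fuel. -/
theorem euclidT_spec (μ : ℕ → ℕ) (j : Fin k) (r : ℕ) (a b : Row d k) :
    span ℤ {(euclidT μ j r a b).val.1, (euclidT μ j r a b).val.2} = span ℤ {a, b} ∧
      ((b.1 j).natAbs ≤ r → (euclidT μ j r a b).val.2.1 j = 0) := by
  induction r generalizing a b with
  | zero => exact ⟨rfl, fun h => Int.natAbs_eq_zero.1 (Nat.le_zero.1 h)⟩
  | succ r ih =>
    simp only [euclidT, Timed.val_bind, isZeroT, beq_iff_eq]
    split_ifs with h
    · exact ⟨rfl, fun _ => h⟩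
    · simp only [Timed.val_bind, divT, rowSubT_val]
      obtain ⟨h1, h2⟩ := ih b (a - (a.1 j / b.1 j) • b)
      refine ⟨h1.trans (span_pair_sub_smul a b _), fun hr => h2 ?_⟩
      have h3 : (a - (a.1 j / b.1 j) • b).1 j = a.1 j % b.1 j := by
        have := Int.emod_add_mul_ediv (a.1 j) (b.1 j)
        simp only [Prod.fst_sub, Prod.smul_fst, Pi.sub_apply, Pi.smul_apply, smul_eq_mul]
        linarith
      rw [h3]
      have h4 := Int.emod_nonneg (a.1 j) h
      have h5 := Int.emod_lt_abs (a.1 j) h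
      rw [Int.abs_eq_natAbs] at h5
      omega

theorem clearColumnT_spec (μ : ℕ → ℕ) (j : Fin k) (a : Row d k) (bs : List (Row d k)) :
    span ℤ {x | x ∈ (clearColumnT μ j a bs).val.1 :: (clearColumnT μ j a bs).val.2} =
        span ℤ {x | x ∈ a :: bs} ∧
      (∀ b ∈ (clearColumnT μ j a bs).val.2, b.1 j = 0) ∧
      (clearColumnT μ j a bs).val.2.length = bs.length := by
  induction bs generalizing a with
  | nil => exact ⟨rfl, by simp [clearColumnT], rfl⟩
  | cons b bs ih =>
    simp only [clearColumnT, Timed.val_bind, Timed.val_pure]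
    obtain ⟨e1, e2⟩ := euclidT_spec μ j (b.1 j).natAbs a b
    generalize (euclidT μ j (b.1 j).natAbs a b).val = ab at *
    obtain ⟨h1, h2, h3⟩ := ih ab.1
    generalize (clearColumnT μ j ab.1 bs).val = c at *
    refine ⟨?_, ?_, by simpa using h3⟩
    · have hset : ∀ (x y : Row d k) (l : List (Row d k)),
          {z | z ∈ x :: y :: l} = {y} ∪ {z | z ∈ x :: l} := by
        intro x y l; ext z; simp; tauto
      have hset' : ∀ (x y : Row d k) (l : List (Row d k)),
          {z | z ∈ x :: y :: l} = {x, y} ∪ {z | z ∈ l} := by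
        intro x y l; ext z; simp; tauto
      have h4 : span ℤ {z | z ∈ c.1 :: ab.2 :: c.2} = span ℤ {z | z ∈ ab.1 :: ab.2 :: bs} := by
        rw [hset, span_union, h1, ← span_union, ← hset]
      rw [h4, hset', span_union, e1, ← span_union, ← hset']
    · intro x hx
      rcases List.mem_cons.1 hx with rfl | hx
      · exact e2 le_rfl
      · exact h2 x hx

theorem fixSignT_spec (j : Fin k) (a : Row d k) :
    ((fixSignT j a).val = a ∨ (fixSignT j a).val = -a) ∧ 0 ≤ (fixSignT j a).val.1 j := by
  simp only [fixSignT, Timed.val_bind, cmpT]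
  rcases lt_trichotomy (a.1 j) 0 with h | h | h
  · rw [compare_lt_iff_lt.2 h]
    exact ⟨Or.inr rfl, by simpa using h.le⟩
  · rw [compare_eq_iff_eq.2 h]
    exact ⟨Or.inl rfl, h.ge⟩
  · rw [compare_gt_iff_gt.2 h]
    exact ⟨Or.inl rfl, h.le⟩

/-- The rows with pivots found so far form a matrix in Hermite normal form. -/
def HermiteRows (rows : List (Row d k)) : Prop :=
  ∀ i r, rows[i]? = some r → ∀ j : Fin k, ((j : ℕ) < i → r.1 j = 0) ∧ ((j : ℕ) = i → 0 < r.1 j) ∧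
    ∀ s, i < j → rows[(j : ℕ)]? = some s → 0 ≤ r.1 j ∧ r.1 j < s.1 j

/-- Let `t` rows be finished. If all the other rows vanished in the columns `0, …, t`, these `t + 1`
columns would be seen by `t` rows only, and some nontrivial combination `v` of them would be
orthogonal to all the transformation parts. These span `ℤ^d`, so `v = 0`, against the independence
of the columns. -/
theorem exists_pivot {cols : List (Pt d)}
    (hcols : LinearIndependent ℚ (fun j : Fin cols.length => toRat (cols.get j)))
    {done rows : List (Row d cols.length)}
    (hspan : (span ℤ {x | x ∈ done ++ rows}).map (LinearMap.snd ℤ _ (Fin d → ℤ)) = ⊤)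
    (hrow : ∀ r ∈ done ++ rows, ∀ j, r.1 j = dotProduct r.2 (cols.get j))
    (ht : done.length < cols.length) :
    ∃ r ∈ rows, ∃ j : Fin cols.length, (j : ℕ) ≤ done.length ∧ r.1 j ≠ 0 := by
  by_contra hcon
  push Not at hcon
  set t := done.length
  let ι : Fin (t + 1) → Fin cols.length := fun l => ⟨l, by omega⟩
  have hι : Function.Injective ι := fun a b h => Fin.ext (by simpa [ι] using h)
  -- There are `t` linear conditions, one for each finished row, on `t + 1` coefficients.
  let f : (Fin (t + 1) → ℚ) →ₗ[ℚ] (Fin t → ℚ) :=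
    LinearMap.pi fun i => ∑ l, (((done.get i).1 (ι l) : ℤ) : ℚ) • LinearMap.proj l
  have hker : LinearMap.ker f ≠ ⊥ := LinearMap.ker_ne_bot_of_finrank_lt (by simp)
  obtain ⟨c, hc, hc0⟩ := (Submodule.ne_bot_iff _).1 hker
  have hfc : ∀ i : Fin t, ∑ l, c l * ((done.get i).1 (ι l) : ℤ) = 0 := by
    intro i
    have := congrFun (LinearMap.mem_ker.1 hc) i
    simp only [f, LinearMap.pi_apply, LinearMap.sum_apply, LinearMap.smul_apply,
      LinearMap.proj_apply, smul_eq_mul, Pi.zero_apply] at this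
    rw [← this]
    exact Finset.sum_congr rfl fun l _ => mul_comm _ _
  have hall : ∀ r ∈ done ++ rows, ∑ l, c l * ((r.1 (ι l) : ℤ) : ℚ) = 0 := by
    intro r hr
    rcases List.mem_append.1 hr with hr | hr
    · obtain ⟨i, hi, rfl⟩ := List.getElem_of_mem hr
      exact hfc ⟨i, hi⟩
    · refine Finset.sum_eq_zero fun l _ => ?_
      rw [hcon r hr (ι l) (by simp [ι]; omega)]
      simp
  set v : RPt d := ∑ l, c l • toRat (cols.get (ι l)) with hv
  have hdot : ∀ r ∈ done ++ rows, dotProduct (toRat r.2) v = 0 := by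
    intro r hr
    rw [← hall r hr, hv, dotProduct_sum]
    refine Finset.sum_congr rfl fun l _ => ?_
    rw [dotProduct_smul, smul_eq_mul, hrow r hr]
    simp [dotProduct, toRat]
  -- Orthogonality passes from the rows to the lattice spanned by their second parts, which is
  -- everything.
  have hdot' : ∀ u : Fin d → ℤ, dotProduct (toRat u) v = 0 := by
    intro u
    have hu : u ∈ (span ℤ {x | x ∈ done ++ rows}).map (LinearMap.snd ℤ _ (Fin d → ℤ)) := by
      rw [hspan]; trivial
    obtain ⟨x, hx, rfl⟩ := hu
    induction hx using Submodule.span_induction with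
    | mem x hx => exact hdot x hx
    | zero =>
      have : toRat ((LinearMap.snd ℤ (Fin cols.length → ℤ) (Fin d → ℤ)) 0) = 0 := by
        ext i; simp [toRat]
      rw [this, zero_dotProduct]
    | add x y _ _ h1 h2 => rw [map_add, toRat_add, add_dotProduct, h1, h2, add_zero]
    | smul q x _ h1 => rw [map_smul, toRat_smul, smul_dotProduct, h1, smul_zero]
  have hv0 : v = 0 := by
    ext i
    have := hdot' (Pi.single i 1)
    have h1 : toRat (Pi.single i 1 : Fin d → ℤ) = Pi.single i 1 := by
      ext l
      by_cases h : l = i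
      · subst h; simp [toRat]
      · simp [toRat, h]
    rw [h1, single_one_dotProduct] at this
    exact this
  have := Fintype.linearIndependent_iff.1 (hcols.comp ι hι) c hv0
  exact hc0 (funext this)

/-- Invariants: the second parts of the rows span `ℤ^d`, so that the final transformation is
invertible; each first part is the product of the second part with the columns; the finished rows
are in normal form; the other rows vanish in the columns already treated. The first two are
properties of the span of all rows and survive every row operation. -/
theorem hermiteT_spec (μ : ℕ → ℕ) {cols : List (Pt d)}
    (hcols : LinearIndependent ℚ (fun j : Fin cols.length => toRat (cols.get j)))
    (js : List (Fin cols.length)) (done rows : List (Row d cols.length))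
    (hjs : js = (List.finRange cols.length).drop done.length) (hdone : HermiteRows done)
    (hle : done.length ≤ cols.length)
    (hrows : ∀ r ∈ rows, ∀ j : Fin cols.length, (j : ℕ) < done.length → r.1 j = 0)
    (hspan : (span ℤ {x | x ∈ done ++ rows}).map (LinearMap.snd ℤ _ (Fin d → ℤ)) = ⊤)
    (hrow : ∀ r ∈ done ++ rows, ∀ j, r.1 j = dotProduct r.2 (cols.get j)) :
    ∃ done' rows', (hermiteT μ js done rows).val = done' ++ rows' ∧
      done'.length = cols.length ∧ HermiteRows done' ∧ (∀ r ∈ rows', r.1 = 0) ∧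
      done'.length + rows'.length = done.length + rows.length ∧
      (span ℤ {x | x ∈ done' ++ rows'}).map (LinearMap.snd ℤ _ (Fin d → ℤ)) = ⊤ ∧
      (∀ r ∈ done' ++ rows', ∀ j, r.1 j = dotProduct r.2 (cols.get j)) := by
  induction js generalizing done rows with
  | nil =>
    have hlen : done.length = cols.length := by
      have := congrArg List.length hjs
      simp at this
      omega
    refine ⟨done, rows, by simp [hermiteT], hlen, hdone, fun r hr => ?_, rfl, hspan, hrow⟩
    funext j
    exact hrows r hr j (by omega)
  | cons j js ih =>
    have hlt : done.length < cols.length := by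
      have := congrArg List.length hjs
      simp at this
      omega
    rw [List.drop_eq_getElem_cons (by simpa using hlt)] at hjs
    obtain ⟨hj, hjs⟩ := List.cons.inj hjs
    have hjv : (j : ℕ) = done.length := by rw [hj]; simp
    -- The rows cannot run out before the columns, because a pivot is still available among them.
    rcases rows with _ | ⟨a, as⟩
    · obtain ⟨r, hr, -⟩ := exists_pivot hcols hspan hrow hlt
      simp at hr
    simp only [hermiteT, Timed.val_bind, mapT_val, appendT_val, divT, rowSubT_val]
    obtain ⟨c1, c2, c3⟩ := clearColumnT_spec μ j a as
    generalize (clearColumnT μ j a as).val = ca at *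
    obtain ⟨f1, f2⟩ := fixSignT_spec j ca.1
    generalize (fixSignT j ca.1).val = p at *
    set done' := done.map (fun r => r - (r.1 j / p.1 j) • p) with hdone'
    have hspanp : span ℤ {x | x ∈ p :: ca.2} = span ℤ {x | x ∈ a :: as} := by
      rw [← c1]
      have hset : ∀ (x : Row d cols.length) (l : List (Row d cols.length)),
          {z | z ∈ x :: l} = {x} ∪ {z | z ∈ l} := by
        intro x l; ext z; simp
      rw [hset p, hset ca.1, span_union, span_union]
      congr 1
      rcases f1 with rfl | rfl
      · rfl
      · rw [← Set.neg_singleton, span_neg]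
    have hmem : ∀ x ∈ p :: ca.2, x ∈ span ℤ {x | x ∈ a :: as} := fun x hx =>
      hspanp ▸ subset_span hx
    have hzero : ∀ x ∈ p :: ca.2, ∀ l : Fin cols.length, (l : ℕ) < done.length → x.1 l = 0 := by
      intro x hx l hl
      have : span ℤ {x | x ∈ a :: as} ≤
          LinearMap.ker ((LinearMap.proj l).comp (LinearMap.fst ℤ (Fin cols.length → ℤ) (Fin d → ℤ))) := by
        rw [span_le]
        intro y hy
        exact hrows y hy l hl
      exact this (hmem x hx)
    have hspan2 : span ℤ {x | x ∈ (done' ++ [p]) ++ ca.2} = span ℤ {x | x ∈ done ++ a :: as} := by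
      have hset : ∀ (l l' : List (Row d cols.length)),
          {z | z ∈ l ++ l'} = {z | z ∈ l} ∪ {z | z ∈ l'} := by
        intro l l'; ext z; simp
      rw [List.append_assoc, List.singleton_append, hset, hset, span_union, span_union, ← hspanp]
      have hp : p ∈ span ℤ {x | x ∈ p :: ca.2} := subset_span List.mem_cons_self
      apply le_antisymm
      · refine sup_le (span_le.2 ?_) le_sup_right
        intro x hx
        obtain ⟨r, hr, rfl⟩ := List.mem_map.1 hx
        exact sub_mem (mem_sup_left (subset_span hr)) (smul_mem _ _ (mem_sup_right hp))
      · refine sup_le (span_le.2 ?_) le_sup_right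
        intro r hr
        have : r = (r - (r.1 j / p.1 j) • p) + (r.1 j / p.1 j) • p := by abel
        rw [this]
        exact add_mem (mem_sup_left (subset_span (List.mem_map.2 ⟨r, hr, rfl⟩)))
          (smul_mem _ _ (mem_sup_right hp))
    have hrow2 : ∀ r ∈ (done' ++ [p]) ++ ca.2, ∀ l, r.1 l = dotProduct r.2 (cols.get l) := by
      intro r hr l
      let F : Row d cols.length →ₗ[ℤ] ℤ :=
        ((LinearMap.proj l).comp (LinearMap.fst ℤ (Fin cols.length → ℤ) (Fin d → ℤ))) -
          (∑ i, (cols.get l i) • ((LinearMap.proj i).comp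
            (LinearMap.snd ℤ (Fin cols.length → ℤ) (Fin d → ℤ))))
      have hF : ∀ x : Row d cols.length, F x = x.1 l - dotProduct x.2 (cols.get l) := by
        intro x
        simp [F, dotProduct, mul_comm]
      have : span ℤ {x | x ∈ done ++ a :: as} ≤ LinearMap.ker F := by
        rw [span_le]
        intro y hy
        change F y = 0
        rw [hF, hrow y hy l, sub_self]
      have h0 : F r = 0 := this (hspan2 ▸ subset_span hr)
      rw [hF] at h0
      linarith
    have hlen' : done'.length = done.length := by simp [hdone']
    -- After the clearing, `p` is the only unfinished row that may be nonzero in column `j`, and all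
    -- of them vanish in earlier columns; `exists_pivot` leaves only the entry `p.1 j`.
    have hpiv : 0 < p.1 j := by
      refine lt_of_le_of_ne f2 (Ne.symm fun hp0 => ?_)
      have hset : {x | x ∈ done' ++ p :: ca.2} = {x | x ∈ (done' ++ [p]) ++ ca.2} := by
        ext; simp
      have hcov' : (span ℤ {x | x ∈ done' ++ p :: ca.2}).map (LinearMap.snd ℤ _ (Fin d → ℤ)) = ⊤ := by
        rw [hset, hspan2, hspan]
      obtain ⟨r, hr, l, hl, hne⟩ := exists_pivot hcols hcov'
        (fun r hr => hrow2 r (by simpa using hr)) (by omega)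
      apply hne
      rcases hl.lt_or_eq with hl | hl
      · exact hzero r hr l (by omega)
      · obtain rfl : l = j := Fin.ext (by omega)
        rcases List.mem_cons.1 hr with rfl | hr
        · exact hp0
        · exact c2 r hr
    -- Multiples of `p` do not affect the earlier columns, where `p` vanishes; in column `j` the
    -- entries of the finished rows become remainders modulo the new pivot.
    have hd2 : HermiteRows (done' ++ [p]) := by
      have hget : ∀ i r, (done' ++ [p])[i]? = some r →
          (i < done.length ∧ ∃ r₀, done[i]? = some r₀ ∧ r = r₀ - (r₀.1 j / p.1 j) • p) ∨
            (i = done.length ∧ r = p) := by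
        intro i r h
        by_cases hi : i < done.length
        · left
          rw [List.getElem?_append_left (by omega), hdone', List.getElem?_map,
            Option.map_eq_some_iff] at h
          obtain ⟨r₀, h1, h2⟩ := h
          exact ⟨hi, r₀, h1, h2.symm⟩
        · right
          rw [List.getElem?_append_right (by omega)] at h
          have h3 := (List.getElem?_eq_some_iff.1 h)
          obtain ⟨h4, h5⟩ := h3
          simp only [List.length_singleton] at h4
          refine ⟨by omega, ?_⟩
          rw [← h5]
          simp
      have hpz : ∀ l : Fin cols.length, (l : ℕ) < done.length → p.1 l = 0 := fun l hl =>
        hzero p List.mem_cons_self l hl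
      intro i r hi l
      rcases hget i r hi with ⟨hid, r₀, hr₀, rfl⟩ | ⟨rfl, rfl⟩
      · obtain ⟨g1, g2, g3⟩ := hdone i r₀ hr₀ l
        have hval : ∀ l : Fin cols.length, (l : ℕ) < done.length →
            (r₀ - (r₀.1 j / p.1 j) • p).1 l = r₀.1 l := by
          intro l hl
          simp [hpz l hl]
        refine ⟨fun h => ?_, fun h => ?_, fun s hil hs => ?_⟩
        · rw [hval l (by omega)]; exact g1 h
        · rw [hval l (by omega)]; exact g2 h
        · rcases hget l s hs with ⟨hld, s₀, hs₀, rfl⟩ | ⟨hld, rfl⟩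
          · have : (s₀ - (s₀.1 j / p.1 j) • p).1 l = s₀.1 l := by simp [hpz l hld]
            rw [hval l hld, this]
            exact g3 s₀ hil hs₀
          · obtain rfl : l = j := Fin.ext (by omega)
            have : (r₀ - (r₀.1 l / s.1 l) • s).1 l = r₀.1 l % s.1 l := by
              have := Int.emod_add_mul_ediv (r₀.1 l) (s.1 l)
              simp only [Prod.fst_sub, Prod.smul_fst, Pi.sub_apply, Pi.smul_apply, smul_eq_mul]
              linarith
            rw [this]
            exact ⟨Int.emod_nonneg _ hpiv.ne', Int.emod_lt_of_pos _ hpiv⟩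
      · refine ⟨fun h => hpz l h, fun h => ?_, fun s hil hs => ?_⟩
        · obtain rfl : l = j := Fin.ext (by omega)
          exact hpiv
        · have := hget l s hs
          omega
    obtain ⟨done₂, rows₂, r1, r2, r3, r4, r5, r6, r7⟩ := ih (done' ++ [p]) ca.2
      (by simpa [hlen'] using hjs) hd2 (by simp [hlen']; omega)
      (by
        intro r hr l hl
        simp only [List.length_append, List.length_singleton, hlen'] at hl
        rcases Nat.lt_succ_iff_lt_or_eq.1 hl with hl | hl
        · exact hzero r (List.mem_cons_of_mem _ hr) l hl
        · obtain rfl : l = j := Fin.ext (by omega)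
          exact c2 r hr)
      (by rw [hspan2, hspan]) hrow2
    refine ⟨done₂, rows₂, r1, r2, r3, r4, ?_, r6, r7⟩
    rw [r5]
    simp [hlen', c3]
    omega

/-- The second parts of the final rows generate `ℤ^d`. Writing the unit vectors in terms of them
gives a left inverse of `A`, which is an inverse since the matrices are square. -/
theorem hermiteTransformT_spec (μ : ℕ → ℕ) {cols : List (Pt d)}
    (hcols : LinearIndependent ℚ (fun j : Fin cols.length => toRat (cols.get j))) :
    ∃ A : Matrix.GeneralLinearGroup (Fin d) ℤ, A.1 = Matrix.of (hermiteTransformT μ cols).val ∧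
      HermiteCols cols.length (fun j => A.1.mulVec (cols.getD j 0)) := by
  set rows : List (Row d cols.length) :=
    List.ofFn (fun i : Fin d => ((fun j => cols.get j i), (Pi.single i 1 : Fin d → ℤ))) with hrows
  have hspan : (span ℤ {x | x ∈ rows}).map (LinearMap.snd ℤ _ (Fin d → ℤ)) = ⊤ := by
    rw [eq_top_iff, ← (Pi.basisFun ℤ (Fin d)).span_eq, span_le]
    rintro _ ⟨i, rfl⟩
    refine ⟨((fun j => cols.get j i), Pi.single i 1), subset_span ?_, by simp⟩
    exact List.mem_ofFn.2 ⟨i, rfl⟩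
  obtain ⟨done, rows', h1, h2, h3, h4, h5, h6, h7⟩ := hermiteT_spec μ hcols
    (List.finRange cols.length) [] rows rfl (by intro i r h; simp at h) (Nat.zero_le _)
    (by simp) hspan (by
      intro r hr j
      obtain ⟨i, rfl⟩ := List.mem_ofFn.1 hr
      simp)
  set A₀ : Fin d → Fin d → ℤ := (hermiteTransformT μ cols).val with hA₀
  -- The number of rows is preserved, so the default value of `getD` is never read.
  have hlen : (done ++ rows').length = d := by
    rw [List.length_append, h5]
    simp [hrows]
  have hA₀i : ∀ i : Fin d, A₀ i = ((done ++ rows')[(i : ℕ)]'(by omega)).2 := by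
    intro i
    simp only [hA₀, hermiteTransformT, Timed.val_bind, Timed.val_pure, ← hrows, h1]
    rw [List.getD_eq_getElem _ _ (by omega)]
  have hone : ∀ i : Fin d, ∃ c : Fin d → ℤ, ∑ l, c l • A₀ l = Pi.single i 1 := by
    intro i
    rw [← Submodule.mem_span_range_iff_exists_fun]
    have hi : (Pi.single i 1 : Fin d → ℤ) ∈
        (span ℤ {x | x ∈ done ++ rows'}).map (LinearMap.snd ℤ _ (Fin d → ℤ)) := by
      rw [h6]; trivial
    rw [map_span] at hi
    refine span_mono ?_ hi
    rintro _ ⟨x, hx, rfl⟩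
    obtain ⟨l, hl, rfl⟩ := List.getElem_of_mem hx
    exact ⟨⟨l, by omega⟩, hA₀i _⟩
  choose c hc using hone
  have hBA : Matrix.of c * Matrix.of A₀ = 1 := by
    ext i j
    have := congrFun (hc i) j
    simp only [Finset.sum_apply, Pi.smul_apply, smul_eq_mul] at this
    rw [Matrix.mul_apply, Matrix.one_apply]
    simp only [Matrix.of_apply]
    rw [this, Pi.single_apply]
    simp [eq_comm]
  refine ⟨⟨Matrix.of A₀, Matrix.of c, mul_eq_one_comm.1 hBA, hBA⟩, rfl, ?_⟩
  have hentry : ∀ (j : Fin cols.length) (i : Fin d), (Matrix.of A₀).mulVec (cols.getD j 0) i =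
      ((done ++ rows')[(i : ℕ)]'(by omega)).1 j := by
    intro j i
    rw [h7 _ (List.getElem_mem _), Matrix.mulVec]
    simp [hA₀i]
  have hlow : ∀ (i : ℕ) (hi : i < (done ++ rows').length), cols.length ≤ i →
      ((done ++ rows')[i]).1 = 0 := by
    intro i hi hle
    rw [List.getElem_append_right (by omega)]
    exact h4 _ (List.getElem_mem _)
  have hup : ∀ (i : ℕ) (hi : i < (done ++ rows').length), i < cols.length →
      done[i]? = some ((done ++ rows')[i]) := by
    intro i hi hle
    rw [List.getElem_append_left (by omega), List.getElem?_eq_getElem]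
  have hkd : cols.length ≤ d := by
    rw [List.length_append] at hlen
    omega
  constructor
  · intro j hj i hij
    refine (hentry ⟨j, hj⟩ i).trans ?_
    by_cases hi : (i : ℕ) < cols.length
    · exact (h3 i _ (hup i (by omega) hi) ⟨j, hj⟩).1 hij
    · rw [hlow i (by omega) (by omega)]
      rfl
  · intro j hj
    refine ⟨⟨j, by omega⟩, rfl, ?_, fun l hl => ?_⟩
    · exact lt_of_lt_of_eq ((h3 j _ (hup j (by omega) hj) ⟨j, hj⟩).2.1 rfl)
        (hentry ⟨j, hj⟩ ⟨j, by omega⟩).symm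
    · have hl' : (l : ℕ) < j := hl
      have e1 := hentry ⟨j, hj⟩ l
      have e2 := hentry ⟨j, hj⟩ ⟨j, by omega⟩
      simp only at e1 e2 ⊢
      rw [e1, e2]
      exact (h3 l _ (hup l (by omega) (by omega)) ⟨j, hj⟩).2.2 _ hl' (hup j (by omega) hj)

end HermiteAlgorithm

section FrameAlgorithm

variable {d : ℕ}

/-! ## Correctness of `canonicalFormWithFrameT` -/

theorem canonicalFormWithFrameT_spec (μ : ℕ → ℕ) {Q : RFrame d} (hQ : 0 < Q.den)
    {Λ : List (Pt d)} (hΛ : Λ.Nodup) (hcov : IsCoveringFrame Λ.toFinset Q.toList) :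
    (canonicalFormWithFrameT μ Λ Q).val.1.Nodup ∧
      (canonicalFormWithFrameT μ Λ Q).val.1.map toLex =
        setKey (canonicalFormWithFrameT μ Λ Q).val.1.toFinset ∧
      CanonicalFormWithFrame Λ.toFinset Q.toList
        ((canonicalFormWithFrameT μ Λ Q).val.1.toFinset, (canonicalFormWithFrameT μ Λ Q).val.2) := by
  have hT := frameLoop_extendT μ hQ hcov
  simp only [canonicalFormWithFrameT, Timed.val_bind]
  generalize (extendT μ (Q.coordsT μ Λ).val (d + 1) (Q.interT μ Λ).val).val = T at hT ⊢
  rcases T with _ | ⟨p₀, ps⟩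
  · have hempty := frameLoop_nil hcov.1 hT
    -- Without points there are no columns, and the identity matrix is a valid choice of `A`.
    refine ⟨List.nodup_nil, by simp [setKey], [], 1, hT, ?_, by simp [hempty]⟩
    rw [isHermite_frameMatrix_iff]
    exact ⟨fun j hj => absurd hj (Nat.not_lt_zero _), fun j hj => absurd hj (Nat.not_lt_zero _)⟩
  obtain ⟨hf, -, hspan⟩ := frameLoop_spec hcov.1 hT
  have hli : LinearIndependent ℚ
      (fun j : Fin (diffsT p₀ ps).val.length => toRat ((diffsT p₀ ps).val.get j)) :=
    (linearIndependent_diffs_iff p₀ ps).2 hf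
  obtain ⟨A, hA, hcols⟩ := hermiteTransformT_spec μ hli
  have hψ : ∀ x : Pt d, (fun i => dotProduct ((hermiteTransformT μ (diffsT p₀ ps).val).val i)
      (x - p₀)) = frameMap A (p₀ :: ps) x := by
    intro x
    rw [frameMap, hA]
    rfl
  simp only [Timed.val_bind, Timed.val_pure, mapT_val, vecSubT_val, tupleT_val, dotT_val, hψ]
  have hinj : Function.Injective (frameMap A (p₀ :: ps)) := (glAff A p₀).injective
  have hnd : (Λ.map (frameMap A (p₀ :: ps))).Nodup := hΛ.map hinj
  obtain ⟨h1, h2⟩ := sortT_spec _ hnd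
  have h3 := List.toFinset_eq_of_perm _ _ h1
  refine ⟨h1.nodup_iff.2 hnd, by rw [h2, h3], p₀ :: ps, A, hT, ?_, ?_⟩
  · rw [isHermite_frameMatrix_iff]
    have hlen : (diffsT p₀ ps).val.length = (p₀ :: ps).length - 1 := by simp [diffsT_val]
    rw [← hlen]
    have hcol : ∀ j < (diffsT p₀ ps).val.length, A.1.mulVec ((diffsT p₀ ps).val.getD j 0) =
        A.1.mulVec ((p₀ :: ps).getD (j + 1) 0 - (p₀ :: ps).headD 0) := by
      intro j hj
      have : j < ps.length := by simpa [diffsT_val] using hj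
      simp [diffsT_val, this]
    refine ⟨fun j hj => ?_, fun j hj => ?_⟩
    · have := hcols.1 j hj
      beta_reduce at this ⊢
      rwa [hcol j hj] at this
    · have := hcols.2 j hj
      beta_reduce at this ⊢
      rwa [hcol j hj] at this
  · rw [h3]
    ext1
    · ext x; simp
    · rfl

/-! ## Correctness of the list procedures -/

theorem congruentT_val (p q : Pt d) : (congruentT p q).val = true ↔ residue p = residue q := by
  simp only [congruentT, Timed.val_bind, Timed.val_pure, decide_eq_true_eq, tupleT_val, sameParityT,
    beq_iff_eq, residue, funext_iff]
  refine forall_congr' fun i => ?_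
  rw [ZMod.intCast_eq_intCast_iff']
  rfl

/-- The sublist of the points with residue `c`. -/
def classList (L : List (Pt d)) (c : Fin d → ZMod 2) : List (Pt d) :=
  L.filter (fun p => residue p = c)

theorem mem_classList {L : List (Pt d)} {c : Fin d → ZMod 2} {p : Pt d} :
    p ∈ classList L c ↔ p ∈ L ∧ residue p = c := by
  simp [classList]

theorem toFinset_classList (L : List (Pt d)) (c : Fin d → ZMod 2) :
    (classList L c).toFinset = congClass L.toFinset c := by
  ext p
  simp [mem_classList, mem_congClass]

theorem classList_cons (p : Pt d) (L : List (Pt d)) (c : Fin d → ZMod 2) :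
    classList (p :: L) c = if residue p = c then p :: classList L c else classList L c := by
  simp [classList, List.filter_cons]

/-- The state of the partition is described by the list of the residues met so far. No class is
empty, so comparison with its first element decides membership. -/
theorem insertClassT_val (p : Pt d) (L : List (Pt d)) (ρs : List (Fin d → ZMod 2))
    (hne : ∀ ρ ∈ ρs, ∃ q ∈ L, residue q = ρ) (hnd : ρs.Nodup) :
    (insertClassT p (ρs.map (classList L))).val =
      if residue p ∈ ρs then ρs.map (classList (p :: L)) else ρs.map (classList L) ++ [[p]] := by
  induction ρs with
  | nil => simp [insertClassT]
  | cons ρ ρs ih =>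
    rw [List.nodup_cons] at hnd
    have ih := ih (fun ρ' h => hne ρ' (List.mem_cons_of_mem _ h)) hnd.2
    obtain ⟨q₀, hq₀, hq₀ρ⟩ := hne ρ List.mem_cons_self
    rw [List.map_cons]
    cases hc : classList L ρ with
    | nil =>
      have := mem_classList.2 ⟨hq₀, hq₀ρ⟩
      simp [hc] at this
    | cons q c =>
      have hq : residue q = ρ := (mem_classList.1 (hc ▸ List.mem_cons_self : q ∈ classList L ρ)).2
      simp only [insertClassT, Timed.val_bind]
      by_cases hp : residue p = ρ
      · rw [if_pos ((congruentT_val p q).2 (hp.trans hq.symm)), if_pos (by simp [hp])]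
        rw [List.map_cons, classList_cons, if_pos hp, hc]
        simp only [Timed.val_pure, List.cons.injEq, true_and]
        refine List.map_congr_left fun ρ' hρ' => ?_
        rw [classList_cons, if_neg]
        rintro rfl
        exact hnd.1 (hp ▸ hρ')
      · rw [if_neg (fun h => hp (((congruentT_val p q).1 h).trans hq))]
        simp only [Timed.val_bind, Timed.val_pure, ih, List.mem_cons, hp, false_or]
        split_ifs with h
        · rw [List.map_cons, classList_cons, if_neg hp, hc]
        · rfl

theorem partitionT_spec (L : List (Pt d)) : ∃ ρs : List (Fin d → ZMod 2), ρs.Nodup ∧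
    (partitionT L).val = ρs.map (classList L) ∧ ∀ ρ, ρ ∈ ρs ↔ ∃ p ∈ L, residue p = ρ := by
  induction L with
  | nil => exact ⟨[], List.nodup_nil, rfl, by simp⟩
  | cons p L ih =>
    obtain ⟨ρs, h1, h2, h3⟩ := ih
    simp only [partitionT, Timed.val_bind, h2]
    rw [insertClassT_val p L ρs (fun ρ h => (h3 ρ).1 h) h1]
    by_cases hp : residue p ∈ ρs
    · refine ⟨ρs, h1, if_pos hp, fun ρ => ?_⟩
      rw [h3]
      constructor
      · rintro ⟨q, hq, rfl⟩; exact ⟨q, List.mem_cons_of_mem _ hq, rfl⟩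
      · rintro ⟨q, hq, rfl⟩
        rcases List.mem_cons.1 hq with rfl | hq
        · exact (h3 _).1 hp
        · exact ⟨q, hq, rfl⟩
    · refine ⟨ρs ++ [residue p], List.nodup_append.2 ⟨h1, by simp, ?_⟩, ?_, fun ρ => ?_⟩
      · rintro a ha b hb rfl
        rw [List.mem_singleton] at hb
        exact hp (hb ▸ ha)
      · rw [if_neg hp, List.map_append]
        congr 1
        · refine List.map_congr_left fun ρ hρ => ?_
          rw [classList_cons, if_neg]
          rintro rfl
          exact hp hρ
        · have : classList L (residue p) = [] := by
            refine List.eq_nil_iff_forall_not_mem.2 fun q hq => ?_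
            obtain ⟨h4, h5⟩ := mem_classList.1 hq
            exact hp ((h3 _).2 ⟨q, h4, h5⟩)
          simp [classList_cons, this]
      · rw [List.mem_append, h3, List.mem_singleton]
        simp [or_comm, eq_comm]

theorem largeClassT_none {α : Type} {n : ℕ} {cs : List (List α)}
    (h : (largeClassT n cs).val = none) : ∀ c ∈ cs, 2 * c.length ≤ n := by
  induction cs with
  | nil => simp
  | cons c cs ih =>
    simp only [largeClassT, Timed.val_bind, lengthT_val] at h
    split_ifs at h with h1
    simp only [Timed.val_bind] at h
    cases ho : (largeClassT n cs).val with
    | none =>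
      intro c' hc'
      rcases List.mem_cons.1 hc' with rfl | hc'
      · omega
      · exact ih ho c' hc'
    | some br => rw [ho] at h; simp at h

theorem largeClassT_some {α : Type} {n : ℕ} {cs : List (List α)} {b : List α}
    {rest : List (List α)} (h : (largeClassT n cs).val = some (b, rest)) :
    n < 2 * b.length ∧ ∃ l₁ l₂, cs = l₁ ++ b :: l₂ ∧ rest = l₁ ++ l₂ := by
  induction cs generalizing rest with
  | nil => simp [largeClassT] at h
  | cons c cs ih =>
    simp only [largeClassT, Timed.val_bind, lengthT_val] at h
    split_ifs at h with h1
    · simp only [Timed.val_pure, Option.some.injEq, Prod.mk.injEq] at h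
      obtain ⟨rfl, rfl⟩ := h
      exact ⟨h1, [], cs, rfl, rfl⟩
    · simp only [Timed.val_bind] at h
      cases ho : (largeClassT n cs).val with
      | none => rw [ho] at h; simp at h
      | some br =>
        rw [ho] at h
        simp only [Timed.val_pure, Option.some.injEq, Prod.mk.injEq] at h
        obtain ⟨rfl, rfl⟩ := h
        obtain ⟨h2, l₁, l₂, rfl, h3⟩ := ih ho
        exact ⟨h2, c :: l₁, l₂, rfl, by rw [h3]; rfl⟩

theorem mem_listsT {α : Type} (X : List α) (m : ℕ) (l : List α) :
    l ∈ (listsT X m).val ↔ l.length ≤ m ∧ ∀ x ∈ l, x ∈ X := by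
  induction m generalizing l with
  | zero =>
    simp only [listsT, Timed.val_bind, Timed.val_pure, List.mem_singleton, Nat.le_zero,
      List.length_eq_zero_iff]
    constructor
    · rintro rfl; simp
    · exact fun h => h.1
  | succ m ih =>
    simp only [listsT, Timed.val_bind, Timed.val_pure, flattenT_val, mapT_val, List.mem_cons,
      List.mem_flatten, List.mem_map]
    rcases l with _ | ⟨x, l⟩
    · simp
    · simp only [reduceCtorEq, false_or, List.length_cons, Nat.add_le_add_iff_right,
        List.forall_mem_cons]
      constructor
      · rintro ⟨_, ⟨y, hy, rfl⟩, h⟩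
        obtain ⟨l', hl', h⟩ := List.mem_map.1 h
        obtain ⟨rfl, rfl⟩ := List.cons.inj h
        obtain ⟨h1, h2⟩ := (ih l').1 hl'
        exact ⟨h1, hy, h2⟩
      · rintro ⟨h1, hx, h2⟩
        exact ⟨_, ⟨x, hx, rfl⟩, List.mem_map.2 ⟨l, (ih l).2 ⟨h1, h2⟩, rfl⟩⟩

theorem nodup_listsT {α : Type} {X : List α} (hX : X.Nodup) (m : ℕ) : (listsT X m).val.Nodup := by
  induction m with
  | zero => simp [listsT]
  | succ m ih =>
    simp only [listsT, Timed.val_bind, Timed.val_pure, flattenT_val, mapT_val]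
    rw [List.nodup_cons]
    refine ⟨by simp, ?_⟩
    rw [List.nodup_flatten]
    refine ⟨?_, ?_⟩
    · intro l hl
      obtain ⟨x, -, rfl⟩ := List.mem_map.1 hl
      exact ih.map (fun a b h => (List.cons.inj h).2)
    · rw [List.pairwise_map]
      refine hX.imp fun {x y} hxy => ?_
      rw [List.disjoint_left]
      intro l h1 h2
      obtain ⟨l₁, -, rfl⟩ := List.mem_map.1 h1
      obtain ⟨l₂, -, h⟩ := List.mem_map.1 h2
      exact hxy (List.cons.inj h).1.symm

theorem completionsT_spec (μ : ℕ → ℕ) {Q : RFrame d} (hQ : 0 < Q.den) (Λ X : List (Pt d)) :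
    (∀ R, R ∈ (completionsT μ Λ Q X).val ↔
      R ∈ completions Λ.toFinset Q.toList {x | x ∈ X}) ∧
    (X.Nodup → (completionsT μ Λ Q X).val.Nodup) := by
  constructor
  · intro R
    simp only [completionsT, Timed.val_bind, filterT_val, List.mem_filter, mem_listsT]
    have hden : 0 < (Q.unionT μ R).val.den := hQ
    have hind : (indepT μ (Q.unionT μ R).val.pts).val = true ↔
        IsFrame (Q.toList ++ R.map toRat) := by
      rw [indepT_val, ← RFrame.isFrame_iff hden, RFrame.unionT_toList μ hQ]
    unfold completions IsFrameIn IsCoveringFrame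
    constructor
    · rintro ⟨⟨-, hX⟩, h⟩
      split_ifs at h with hb
      · have hf := hind.1 hb
        rw [allT_val, List.all_eq_true] at h
        refine ⟨⟨hX, hf.append_right⟩, fun p hp hpQ => ?_, hf, fun p hp => ?_⟩
        -- Disjointness from `Q` is automatic: a frame has no repetitions.
        · have := List.nodup_append.1 hf.nodup
          exact this.2.2 _ hpQ _ (List.mem_map_of_mem hp) rfl
        · have h1 := h p (List.mem_toFinset.1 hp)
          rw [RFrame.memSpanT_val μ hden (by rwa [RFrame.unionT_toList μ hQ]),
            RFrame.unionT_toList μ hQ] at h1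
          exact h1
    · rintro ⟨⟨hX, hR⟩, -, hf, hcov⟩
      -- A frame has at most `d + 1` points, so enumerating lists up to that length misses nothing.
      refine ⟨⟨by simpa using hR.length_le, hX⟩, ?_⟩
      rw [if_pos (hind.2 hf), allT_val, List.all_eq_true]
      intro p hp
      rw [RFrame.memSpanT_val μ hden (by rwa [RFrame.unionT_toList μ hQ]),
        RFrame.unionT_toList μ hQ]
      exact hcov p (List.mem_toFinset.2 hp)
  · intro hX
    simp only [completionsT, Timed.val_bind, filterT_val]
    exact (nodup_listsT hX _).filter _

/-- The value compared by `minimalT`. -/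
def frameValue (μ : ℕ → ℕ) (Λ : List (Pt d)) (Q : RFrame d) (R : List (Pt d)) :
    Finset (Pt d) × List (Pt d) :=
  ((canonicalFormWithFrameT μ Λ (Q.unionT μ R).val).val.1.toFinset,
    (canonicalFormWithFrameT μ Λ (Q.unionT μ R).val).val.2)

theorem canonicalFormWithFrame_frameValue (μ : ℕ → ℕ) {Q : RFrame d} (hQ : 0 < Q.den)
    {Λ R : List (Pt d)} (hΛ : Λ.Nodup)
    (hcov : IsCoveringFrame Λ.toFinset (Q.toList ++ R.map toRat)) :
    CanonicalFormWithFrame Λ.toFinset (Q.toList ++ R.map toRat) (frameValue μ Λ Q R) := by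
  have hu := RFrame.unionT_toList μ hQ R
  have := (canonicalFormWithFrameT_spec μ (Q := (Q.unionT μ R).val) hQ hΛ (by rwa [hu])).2.2
  rwa [hu] at this

/-- The sublist statement transfers the absence of repetitions, and the nonemptiness is what lets
callers of the recursion find frames that cover each class. -/
theorem minimalT_spec (μ : ℕ → ℕ) {Q : RFrame d} (hQ : 0 < Q.den) {Λ : List (Pt d)}
    (hΛ : Λ.Nodup) {cand : List (List (Pt d))}
    (hcov : ∀ R ∈ cand, IsCoveringFrame Λ.toFinset (Q.toList ++ R.map toRat)) :
    (minimalT μ Λ Q cand).val.Sublist cand ∧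
      (cand ≠ [] → (minimalT μ Λ Q cand).val ≠ []) ∧
      IsMinimalSet {R | R ∈ cand} (frameValue μ Λ Q) (minimalT μ Λ Q cand).val.toFinset := by
  set X : List (Pt d) → List (Pt d) × List (Pt d) := fun R =>
    (canonicalFormWithFrameT μ Λ (Q.unionT μ R).val).val with hX
  set κ : List (Pt d) × List (Pt d) → List (Lex (Pt d)) ×ₗ List (Lex (Pt d)) :=
    fun X => toLex (X.1.map toLex, X.2.map toLex) with hκ
  have hkey : ∀ R ∈ cand, κ (X R) = pairKey (frameValue μ Λ Q R) := by
    intro R hR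
    have hu := RFrame.unionT_toList μ hQ R
    have := (canonicalFormWithFrameT_spec μ (Q := (Q.unionT μ R).val) hQ hΛ
      (by rw [hu]; exact hcov R hR)).2.1
    simp only [hκ, hX, pairKey, frameValue, this]
  have hcmp : Compares (fun a b : (List (Pt d) × List (Pt d)) × List (Pt d) => cmpPairT a.1 b.1)
      (fun a => κ a.1) := fun a b => compares_cmpPairT a.1 b.1
  rcases cand with _ | ⟨R₀, cand⟩
  · refine ⟨by simp [minimalT, mapT], by simp, ?_⟩
    intro R
    simp [minimalT, mapT]
  obtain ⟨hb1, hb2⟩ := minT_spec hcmp (X R₀, R₀) (cand.map fun R => (X R, R))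
  have hval : ∃ best ∈ (R₀ :: cand), (∀ R ∈ R₀ :: cand, κ (X best) ≤ κ (X R)) ∧
      (minimalT μ Λ Q (R₀ :: cand)).val =
        (R₀ :: cand).filter (fun R => decide (κ (X R) = κ (X best))) := by
    rw [← List.map_cons (f := fun R => (X R, R))] at hb1 hb2
    obtain ⟨best, hbest, hbe⟩ := List.mem_map.1 hb1
    refine ⟨best, hbest, fun R hR => ?_, ?_⟩
    · have := hb2 (X R, R) (List.mem_map.2 ⟨R, hR, rfl⟩)
      rw [← hbe] at this
      exact this
    · have hm : (mapT (fun R => do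
          let Q' ← Q.unionT μ R
          let X ← canonicalFormWithFrameT μ Λ Q'
          pure (X, R)) (R₀ :: cand)).val = (R₀ :: cand).map (fun R => (X R, R)) := by
        rw [mapT_val]
        rfl
      simp only [minimalT, Timed.val_bind, hm, List.map_cons, ← hbe, filterT_val, mapT_val,
        Timed.val_pure]
      rw [← List.map_cons (f := fun R => (X R, R)), List.filter_map, List.map_map]
      refine (List.map_id _).trans (List.filter_congr fun R _ => ?_)
      simp only [Function.comp_apply, compares_cmpPairT (X R) (X best)]
      rw [Bool.eq_iff_iff, beq_iff_eq, compare_eq_iff_eq, decide_eq_true_eq]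
  obtain ⟨best, hbest, hle, hval⟩ := hval
  refine ⟨hval ▸ List.filter_sublist, fun _ h => ?_, fun R => ?_⟩
  · have : best ∈ (minimalT μ Λ Q (R₀ :: cand)).val := by
      rw [hval, List.mem_filter]
      exact ⟨hbest, by simp⟩
    rw [h] at this
    simp at this
  · rw [hval, List.mem_toFinset, List.mem_filter, decide_eq_true_eq]
    refine and_congr_right fun hR => ?_
    rw [← hkey R hR]
    constructor
    · intro h R' hR'
      rw [← hkey R' hR', h]
      exact hle R' hR'
    · intro h
      refine le_antisymm ?_ (hle R hR)
      rw [hkey best hbest]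
      exact h best hbest

end FrameAlgorithm

section EquivariantFramesAlgorithm

variable {d : ℕ}

/-! ## Correctness of `equivariantFrames2T` -/

/-- All the differences of coordinates of points of `Λ` are less than `2 ^ δ`. -/
def DiamLT (Λ : List (Pt d)) (δ : ℕ) : Prop :=
  ∀ p ∈ Λ, ∀ q ∈ Λ, ∀ i, |p i - q i| < 2 ^ δ

theorem DiamLT.mono {Λ Λ' : List (Pt d)} {δ : ℕ} (h : DiamLT Λ δ) (hs : ∀ p ∈ Λ', p ∈ Λ) :
    DiamLT Λ' δ :=
  fun p hp q hq => h p (hs p hp) q (hs q hq)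

theorem DiamLT.pos {Λ : List (Pt d)} {δ : ℕ} (h : DiamLT Λ δ) {p q : Pt d} (hp : p ∈ Λ)
    (hq : q ∈ Λ) (hpq : p ≠ q) : 0 < δ := by
  rw [Nat.pos_iff_ne_zero]
  rintro rfl
  apply hpq
  ext i
  have := h p hp q hq i
  rw [pow_zero, Int.abs_lt_one_iff] at this
  linarith

/-- The image of a point under `x ↦ (x - p) / 2`, with rounding. -/
def halvePt (p x : Pt d) : Pt d := fun i => (x i - p i) / 2

theorem two_mul_halvePt {p x : Pt d} (h : residue x = residue p) :
    (2 : ℤ) • halvePt p x + p = x := by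
  ext i
  have hi := congrFun h i
  simp only [residue] at hi
  rw [ZMod.intCast_eq_intCast_iff'] at hi
  simp only [halvePt, Pi.add_apply, Pi.smul_apply, smul_eq_mul]
  push_cast at hi
  omega

theorem DiamLT.halve {Λ : List (Pt d)} {δ : ℕ} (h : DiamLT Λ (δ + 1)) {p : Pt d}
    (hres : ∀ x ∈ Λ, residue x = residue p) : DiamLT (Λ.map (halvePt p)) δ := by
  intro x' hx' y' hy' i
  obtain ⟨x, hx, rfl⟩ := List.mem_map.1 hx'
  obtain ⟨y, hy, rfl⟩ := List.mem_map.1 hy'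
  have hlt := h x hx y hy i
  have e1 := congrFun (two_mul_halvePt (hres x hx)) i
  have e2 := congrFun (two_mul_halvePt (hres y hy)) i
  simp only [Pi.add_apply, Pi.smul_apply, smul_eq_mul] at e1 e2
  rw [← e1, ← e2, pow_succ, abs_lt] at hlt
  rw [abs_lt]
  constructor <;> linarith [hlt.1, hlt.2]

theorem toFinset_filter_memSpanT (μ : ℕ → ℕ) {Q : RFrame d} (hQ : 0 < Q.den)
    (hf : IsFrame Q.toList) (Λ : List (Pt d)) :
    (Λ.filter (fun p => !(Q.memSpanT μ p).val)).toFinset = outside Λ.toFinset Q.toList := by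
  ext p
  rw [List.mem_toFinset, List.mem_filter, mem_outside, List.mem_toFinset, Bool.not_eq_true',
    ← Bool.not_eq_true, RFrame.memSpanT_val μ hQ hf]

theorem allCongruent_of_singleton {L : List (Pt d)} {ρ : Fin d → ZMod 2}
    (h : ∀ ρ', ρ' ∈ [ρ] ↔ ∃ p ∈ L, residue p = ρ') : ∀ p ∈ L, residue p = ρ := by
  intro p hp
  simpa using (h (residue p)).2 ⟨p, hp, rfl⟩

theorem not_allCongruent_of_two {L : List (Pt d)} {ρ ρ' : Fin d → ZMod 2}
    {ρs : List (Fin d → ZMod 2)} (hnd : (ρ :: ρ' :: ρs).Nodup)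
    (h : ∀ σ, σ ∈ ρ :: ρ' :: ρs ↔ ∃ p ∈ L, residue p = σ) : ¬ AllCongruent L.toFinset := by
  intro hc
  obtain ⟨p, hp, hpρ⟩ := (h ρ).1 (by simp)
  obtain ⟨q, hq, hqρ⟩ := (h ρ').1 (by simp)
  have := hc p (List.mem_toFinset.2 hp) q (List.mem_toFinset.2 hq)
  rw [hpρ, hqρ] at this
  simp [this] at hnd

theorem congClass_nonempty_iff {L : List (Pt d)} {c : Fin d → ZMod 2} :
    (congClass L.toFinset c).Nonempty ↔ ∃ p ∈ L, residue p = c := by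
  rw [← toFinset_classList]
  simp [Finset.Nonempty, mem_classList]

theorem classList_length_lt {L : List (Pt d)} {c c' : Fin d → ZMod 2} (h : c ≠ c')
    (h' : ∃ p ∈ L, residue p = c') : (classList L c).length < L.length := by
  obtain ⟨p, hp, hpc⟩ := h'
  refine List.length_filter_lt_length_iff_exists.2 ⟨p, hp, ?_⟩
  rw [hpc]
  simpa using h.symm

theorem card_congClass_toFinset {L : List (Pt d)} (hL : L.Nodup) (c : Fin d → ZMod 2) :
    (congClass L.toFinset c).card = (classList L c).length := by
  rw [← toFinset_classList]
  exact List.toFinset_card_of_nodup (hL.filter _)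

theorem mem_framePoints_flatten {I : List (Fin d → ZMod 2)}
    {S : (Fin d → ZMod 2) → List (List (Pt d))} {x : Pt d} :
    x ∈ ((I.map S).flatten).flatten ↔ x ∈ framePoints {c | c ∈ I} (fun c => (S c).toFinset) := by
  simp only [List.mem_flatten, List.mem_map, framePoints, List.mem_toFinset, Set.mem_ofPred_eq]
  constructor
  · rintro ⟨V, ⟨_, ⟨c, hc, rfl⟩, hV⟩, hx⟩
    exact ⟨c, hc, V, hV, hx⟩
  · rintro ⟨c, hc, V, hV, hx⟩
    exact ⟨V, ⟨_, ⟨c, hc, rfl⟩, hV⟩, hx⟩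

/-- The frames returned for a class cover that class, so a completion of `Q` by points of the pool
that spans the pool also spans all the classes involved. -/
theorem exists_mem_completionsT (μ : ℕ → ℕ) {Q : RFrame d} (hQ : 0 < Q.den)
    (hf : IsFrame Q.toList) {Λ X : List (Pt d)} {I : List (Fin d → ZMod 2)}
    {S : (Fin d → ZMod 2) → List (List (Pt d))} {L : List (Pt d)}
    (hΛ : ∀ p ∈ Λ, p ∈ L ∧ residue p ∈ I)
    (hX : ∀ x, x ∈ X ↔ x ∈ ((I.map S).flatten).flatten)
    (hS : ∀ c ∈ I, S c ≠ [] ∧ EquivariantFrames2 (classList L c).toFinset Q.toList (S c).toFinset) :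
    (completionsT μ Λ Q X).val ≠ [] := by
  obtain ⟨R, h1, h2, h3⟩ := exists_completion hf X
  refine List.ne_nil_of_mem (((completionsT_spec μ hQ Λ X).1 R).2 ⟨⟨h1, h2.append_right⟩, ?_, h2, ?_⟩)
  · intro p hp hpQ
    exact (List.nodup_append.1 h2.nodup).2.2 _ hpQ _ (List.mem_map_of_mem hp) rfl
  · intro p hp
    obtain ⟨hpL, hpI⟩ := hΛ p (List.mem_toFinset.1 hp)
    obtain ⟨hne, hE⟩ := hS _ hpI
    obtain ⟨V, hV⟩ := List.exists_mem_of_ne_nil _ hne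
    have hcov := (hE.frames hf V (List.mem_toFinset.2 hV)).2.2 p
      (List.mem_toFinset.2 (mem_classList.2 ⟨hpL, rfl⟩))
    refine (ratSpan_le.2 fun q hq => ?_ : ratSpan (Q.toList ++ V.map toRat) ≤ _) hcov
    rcases List.mem_append.1 hq with hq | hq
    · exact mem_ratSpan (List.mem_append_left _ hq)
    · obtain ⟨x, hx, rfl⟩ := List.mem_map.1 hq
      refine h3 x ((hX x).2 (mem_framePoints_flatten.2 ⟨_, hpI, V, ?_, hx⟩))
      simpa using hV

/-- All `R ∈ E` have the same length, since `Q ∪ R` and `Q ∪ R'` span each other. An equality `R ++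
T = R' ++ T'` can therefore be split. -/
theorem nodup_flatten_append {Q : List (RPt d)} {Λ : Finset (Pt d)} {E : List (List (Pt d))}
    {S : List (Pt d) → List (List (Pt d))} (hE : E.Nodup)
    (hcov : ∀ R ∈ E, (∀ p ∈ R, p ∈ Λ) ∧ IsCoveringFrame Λ (Q ++ R.map toRat))
    (hS : ∀ R ∈ E, (S R).Nodup ∧ ∀ T ∈ S R, IsFrame (Q ++ R.map toRat ++ T.map toRat)) :
    ((E.map fun R => (S R).map (R ++ ·)).flatten).Nodup := by
  have hlen : ∀ R ∈ E, ∀ R' ∈ E, R.length ≤ R'.length := by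
    intro R hR R' hR'
    have h1 := (hcov R hR).2
    have h2 := (hcov R' hR').2
    have hle : ratSpan (Q ++ R.map toRat) ≤ ratSpan (Q ++ R'.map toRat) := by
      refine ratSpan_le.2 fun q hq => ?_
      rcases List.mem_append.1 hq with hq | hq
      · exact mem_ratSpan (List.mem_append_left _ hq)
      · obtain ⟨x, hx, rfl⟩ := List.mem_map.1 hq
        exact h2.2 x ((hcov R hR).1 x hx)
    have := affDim_mono hle
    rw [affDim_ratSpan h1.1, affDim_ratSpan h2.1] at this
    simpa using this
  rw [List.nodup_flatten]
  constructor
  · intro l hl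
    obtain ⟨R, hR, rfl⟩ := List.mem_map.1 hl
    exact (hS R hR).1.map (List.append_right_injective R)
  · rw [List.pairwise_map]
    refine (List.pairwise_iff_forall_sublist.2 fun {R R'} hs => ?_)
    have hR : R ∈ E := hs.subset (by simp)
    have hR' : R' ∈ E := hs.subset (by simp)
    have hne : R ≠ R' := by
      have := hE.sublist hs
      simpa using this
    rw [List.disjoint_left]
    intro V h1 h2
    obtain ⟨T, -, rfl⟩ := List.mem_map.1 h1
    obtain ⟨T', -, h⟩ := List.mem_map.1 h2
    exact hne (List.append_inj_left h (le_antisymm (hlen _ hR' _ hR) (hlen _ hR _ hR'))).symm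

end EquivariantFramesAlgorithm

section EquivariantFramesAlgorithm

variable {d : ℕ}

theorem isMinimalSet_congr {cand cand' : Set (List (Pt d))}
    {val : List (Pt d) → Finset (Pt d) × List (Pt d)} {F : Finset (List (Pt d))}
    (h : IsMinimalSet cand val F) (hc : cand = cand') : IsMinimalSet cand' val F := hc ▸ h

/-- Fuel is measured by the number of points plus the bits of the diameter. The congruent branch
lowers `δ`; the other branches call the procedure on classes strictly smaller than the set.
Nonemptiness of the output belongs to the induction because the callers need frames for every class.
-/
theorem equivariantFrames2T_spec (μ : ℕ → ℕ) (r : ℕ) {Λ : List (Pt d)} {Q : RFrame d}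
    (hΛ : Λ.Nodup) (hQ : 0 < Q.den) (hf : IsFrame Q.toList) {δ : ℕ} (hδ : DiamLT Λ δ)
    (hr : Λ.length + δ + 1 ≤ r) :
    (equivariantFrames2T μ r Λ Q).val.Nodup ∧ (equivariantFrames2T μ r Λ Q).val ≠ [] ∧
      EquivariantFrames2 Λ.toFinset Q.toList (equivariantFrames2T μ r Λ Q).val.toFinset := by
  induction r generalizing Λ Q δ with
  | zero => omega
  | succ r ih =>
    simp only [equivariantFrames2T, Timed.val_bind, filterT_val, Timed.val_pure]
    have hout := toFinset_filter_memSpanT μ hQ hf Λ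
    have hLnd : (Λ.filter (fun p => !(Q.memSpanT μ p).val)).Nodup := hΛ.filter _
    have hLlen : (Λ.filter (fun p => !(Q.memSpanT μ p).val)).length ≤ Λ.length :=
      List.length_filter_le _ _
    have hLsub : ∀ p ∈ Λ.filter (fun p => !(Q.memSpanT μ p).val), p ∈ Λ :=
      fun p hp => List.mem_of_mem_filter hp
    generalize Λ.filter (fun p => !(Q.memSpanT μ p).val) = L at hout hLnd hLlen hLsub ⊢
    have hδL := hδ.mono hLsub
    have hcardL : (outside Λ.toFinset Q.toList).card = L.length := by
      rw [← hout, List.toFinset_card_of_nodup hLnd]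
    match L with
    | [] =>
      have := EquivariantFrames2.small Λ.toFinset Q.toList (by rw [hcardL]; simp)
      rw [← hout] at this
      exact ⟨by simp, by simp, by simpa using this⟩
    | [p] =>
      have := EquivariantFrames2.small Λ.toFinset Q.toList (by rw [hcardL]; simp)
      rw [← hout] at this
      exact ⟨by simp, by simp, by simpa using this⟩
    | p :: p' :: L' =>
      simp only
      set L := p :: p' :: L' with hL
      have hcard : 1 < (outside Λ.toFinset Q.toList).card := by rw [hcardL, hL]; simp
      have hLpos : 2 ≤ L.length := by rw [hL]; simp
      obtain ⟨ρs, hρnd, hρval, hρmem⟩ := partitionT_spec L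
      simp only [Timed.val_bind, hρval]
      match ρs with
      | [] =>
        have := (hρmem (residue p)).2 ⟨p, by simp [hL], rfl⟩
        simp at this
      | [ρ] =>
        have hres := allCongruent_of_singleton hρmem
        have hpL : p ∈ L := by simp [hL]
        have hresp : ∀ x ∈ L, residue x = residue p := fun x hx => (hres x hx).trans (hres p hpL).symm
        have hne : p ≠ p' := by
          intro h
          rw [hL, h] at hLnd
          simp at hLnd
        -- Two distinct points differ in some coordinate by at least 1, so the diameter bound is not
        -- `2 ^ 0`.
        obtain ⟨δ, rfl⟩ : ∃ δ', δ = δ' + 1 :=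
          Nat.exists_eq_succ_of_ne_zero (hδL.pos hpL (by simp [hL]) hne).ne'
        simp only [List.map_cons, List.map_nil, Timed.val_bind, mapT_val]
        have hmap : L.map (fun a => (vecHalfT (vecSubT a p).val).val) = L.map (halvePt p) := rfl
        rw [hmap]
        have hhalf : ∀ x ∈ L, (2 : ℤ) • halvePt p x + p = x := fun x hx =>
          two_mul_halvePt (hresp x hx)
        have hnd' : (L.map (halvePt p)).Nodup := by
          refine hLnd.map_on fun x hx y hy h => ?_
          rw [← hhalf x hx, ← hhalf y hy, h]
        obtain ⟨h1, h2, h3⟩ := ih (Λ := L.map (halvePt p)) (Q := (Q.shrinkT μ p).val) hnd'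
          (by rw [RFrame.shrinkT_den]; omega)
          (by rw [RFrame.shrinkT_toList μ hQ]; exact (isFrame_map (halveAt_injective _)).2 hf)
          (hδL.halve hresp) (by rw [List.length_map]; omega)
        have hdbl : (fun V : List (Pt d) => V.map (fun a => (vecAddT (vecAddT a a).val p).val)) =
            List.map (fun x : Pt d => (2 : ℤ) • x + p) := by
          funext V
          refine List.map_congr_left fun x _ => ?_
          simp [two_smul]
        simp only [hdbl]
        refine ⟨h1.map (two_smul_add_injective p).list_map, by simpa using h2, ?_⟩
        have := EquivariantFrames2.congruent Λ.toFinset Q.toList p (L.map (halvePt p)).toFinset _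
          hcard (by
            rw [← hout]
            intro x hx y hy
            rw [hres x (List.mem_toFinset.1 hx), hres y (List.mem_toFinset.1 hy)])
          (by rw [← hout]; simp [hL])
          (by
            rw [← hout]
            ext x
            simp only [List.mem_toFinset, Finset.mem_image, List.mem_map]
            constructor
            · exact fun hx => ⟨halvePt p x, ⟨x, hx, rfl⟩, hhalf x hx⟩
            · rintro ⟨_, ⟨y, hy, rfl⟩, rfl⟩
              rwa [hhalf y hy])
          (by
            rw [RFrame.shrinkT_toList μ hQ] at h3
            exact h3)
        convert this using 1
        ext V
        simp
      | ρ :: ρ' :: ρs =>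
        have hcong : ¬ AllCongruent (outside Λ.toFinset Q.toList) := by
          rw [← hout]
          exact not_allCongruent_of_two hρnd hρmem
        have hclass_lt : ∀ c, c ∈ ρ :: ρ' :: ρs → (classList L c).length < L.length := by
          intro c hc
          by_cases h : c = ρ
          · exact classList_length_lt (c' := ρ') (by
              rintro rfl
              simp [← h] at hρnd) ((hρmem ρ').1 (by simp))
          · exact classList_length_lt h ((hρmem ρ).1 (by simp))
        generalize hσ : ρ :: ρ' :: ρs = σs at hρnd hρmem hclass_lt
        -- This excludes the singleton branch of the `match` on the classes.
        have hσ2 : ∀ x, σs.map (classList L) = [x] → False := by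
          intro x h
          rw [← hσ] at h
          simp at h
        simp only
        clear hσ2
        simp only [Timed.val_bind, lengthT_val]
        set S : (Fin d → ZMod 2) → List (List (Pt d)) := fun c =>
          (equivariantFrames2T μ r (classList L c) Q).val with hS
        have hSspec : ∀ c ∈ σs, (S c).Nodup ∧ S c ≠ [] ∧
            EquivariantFrames2 (classList L c).toFinset Q.toList (S c).toFinset := by
          intro c hc
          have hlt := hclass_lt c hc
          exact ih (hLnd.filter _) hQ hf (hδL.mono fun x hx => List.mem_of_mem_filter hx) (by omega)
        have hI : ∀ c, c ∈ σs ↔ (congClass L.toFinset c).Nonempty := by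
          intro c
          rw [hρmem, congClass_nonempty_iff]
        cases hlarge : (largeClassT L.length (σs.map (classList L))).val with
        | none =>
          simp only [Timed.val_bind, mapT_val, flattenT_val, List.map_map]
          have hcomp : (fun c => (equivariantFrames2T μ r c Q).val) ∘ classList L = S := rfl
          rw [hcomp]
          obtain ⟨hXnd, hXmem, -⟩ := dedupT_spec (eqv := eqVecT) eqVecT_val
            (((σs.map S).flatten).flatten)
          generalize (dedupT eqVecT (((σs.map S).flatten).flatten)).val = X at hXnd hXmem ⊢
          have hXset : {x | x ∈ X} =
              framePoints {c | (congClass L.toFinset c).Nonempty} (fun c => (S c).toFinset) := by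
            ext x
            rw [Set.mem_ofPred_eq, hXmem, mem_framePoints_flatten]
            simp only [hI]
          obtain ⟨hCmem, hCnd⟩ := completionsT_spec μ hQ L X
          have hcov : ∀ R ∈ (completionsT μ L Q X).val,
              IsCoveringFrame L.toFinset (Q.toList ++ R.map toRat) := fun R hR =>
            ((hCmem R).1 hR).2.2
          have hne : (completionsT μ L Q X).val ≠ [] :=
            exists_mem_completionsT μ hQ hf (I := σs) (S := S) (L := L)
              (fun p hp => ⟨hp, (hρmem _).2 ⟨p, hp, rfl⟩⟩) hXmem
              (fun c hc => ⟨(hSspec c hc).2.1, (hSspec c hc).2.2⟩)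
          obtain ⟨hm1, hm2, hm3⟩ := minimalT_spec μ hQ hLnd hcov
          refine ⟨(hCnd hXnd).sublist hm1, hm2 hne, ?_⟩
          have hcandset : {R | R ∈ (completionsT μ L Q X).val} =
              completions L.toFinset Q.toList
                (framePoints {c | (congClass L.toFinset c).Nonempty} (fun c => (S c).toFinset)) := by
            ext R
            rw [Set.mem_ofPred_eq, hCmem, hXset]
          refine EquivariantFrames2.balanced _ _ (fun c => (S c).toFinset) (frameValue μ L Q) _
            hcard hcong ?_ ?_ ?_ ?_
          · intro c
            rw [← hout, List.toFinset_card_of_nodup hLnd, card_congClass_toFinset hLnd]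
            by_cases hc : c ∈ σs
            · exact largeClassT_none hlarge _ (List.mem_map_of_mem hc)
            · have : classList L c = [] := by
                refine List.eq_nil_iff_forall_not_mem.2 fun x hx => hc ?_
                obtain ⟨h1, h2⟩ := mem_classList.1 hx
                exact (hρmem c).2 ⟨x, h1, h2⟩
              simp [this]
          · intro c hc
            rw [← hout] at hc ⊢
            rw [← toFinset_classList]
            exact (hSspec c ((hI c).2 hc)).2.2
          · rw [← hout, ← hcandset]
            intro R hR
            exact canonicalFormWithFrame_frameValue μ hQ hLnd (hcov R hR)
          · rw [← hout, ← hcandset]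
            exact hm3
        | some br =>
          obtain ⟨big, rest⟩ := br
          obtain ⟨hbig, l₁, l₂, hcl, hrest⟩ := largeClassT_some hlarge
          obtain ⟨σ₁, σ₂', hσ', rfl, h2⟩ := List.map_eq_append_iff.1 hcl
          obtain ⟨h, σ₂, rfl, rfl, rfl⟩ := List.map_eq_cons_iff.1 h2
          subst hσ'
          have hhσ : h ∈ σ₁ ++ h :: σ₂ := by simp
          have hrestI : ∀ c, c ∈ σ₁ ++ σ₂ ↔ c ≠ h ∧ (congClass L.toFinset c).Nonempty := by
            intro c
            rw [← hI c]
            have hp : (σ₁ ++ h :: σ₂).Perm (h :: (σ₁ ++ σ₂)) := List.perm_middle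
            rw [hp.mem_iff, List.mem_cons]
            have := hp.nodup_iff.1 hρnd
            rw [List.nodup_cons] at this
            constructor
            · exact fun hc => ⟨fun e => this.1 (e ▸ hc), Or.inr hc⟩
            · rintro ⟨h1, h2 | h2⟩
              · exact absurd h2 h1
              · exact h2
          have hrest' : rest = (σ₁ ++ σ₂).map (classList L) := by rw [hrest, List.map_append]
          subst hrest'
          clear hrest h2
          have hσsub : ∀ c ∈ σ₁ ++ σ₂, c ∈ σ₁ ++ h :: σ₂ := by
            intro c hc
            rcases List.mem_append.1 hc with hc | hc <;> simp [hc]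
          simp only [Timed.val_bind, mapT_val, flattenT_val, List.map_map]
          have hcomp : (fun c => (equivariantFrames2T μ r c Q).val) ∘ classList L = S := rfl
          rw [hcomp]
          obtain ⟨hXnd, hXmem, -⟩ := dedupT_spec (eqv := eqVecT) eqVecT_val
            ((((σ₁ ++ σ₂).map S).flatten).flatten)
          generalize (dedupT eqVecT ((((σ₁ ++ σ₂).map S).flatten).flatten)).val = X at hXnd hXmem ⊢
          have hXset : {x | x ∈ X} = framePoints {c | c ≠ h ∧ (congClass L.toFinset c).Nonempty}
              (fun c => (S c).toFinset) := by
            ext x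
            rw [Set.mem_ofPred_eq, hXmem, mem_framePoints_flatten]
            simp only [hrestI]
          have hsmallmem : ∀ x, x ∈ ((σ₁ ++ σ₂).map (classList L)).flatten ↔
              x ∈ L ∧ residue x ∈ σ₁ ++ σ₂ := by
            intro x
            simp only [List.mem_flatten, List.mem_map]
            constructor
            · rintro ⟨_, ⟨c, hc, rfl⟩, hx⟩
              obtain ⟨h1, rfl⟩ := mem_classList.1 hx
              exact ⟨h1, hc⟩
            · rintro ⟨h1, h2⟩
              exact ⟨_, ⟨_, h2, rfl⟩, mem_classList.2 ⟨h1, rfl⟩⟩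
          have hsmall : (((σ₁ ++ σ₂).map (classList L)).flatten).toFinset =
              L.toFinset \ congClass L.toFinset h := by
            ext x
            rw [List.mem_toFinset, hsmallmem, hrestI, Finset.mem_sdiff, mem_congClass,
              List.mem_toFinset, congClass_nonempty_iff]
            constructor
            · rintro ⟨h1, h2, -⟩
              exact ⟨h1, fun h3 => h2 h3.2⟩
            · rintro ⟨h1, h2⟩
              exact ⟨h1, fun h3 => h2 ⟨h1, h3⟩, x, h1, rfl⟩
          generalize ((σ₁ ++ σ₂).map (classList L)).flatten = sm at hsmallmem hsmall ⊢
          obtain ⟨hCmem, hCnd⟩ := completionsT_spec μ hQ sm X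
          have hEne : (completionsT μ sm Q X).val ≠ [] :=
            exists_mem_completionsT μ hQ hf (I := σ₁ ++ σ₂) (S := S) (L := L)
              (fun p hp => (hsmallmem p).1 hp) hXmem
              (fun c hc => ⟨(hSspec c (hσsub c hc)).2.1, (hSspec c (hσsub c hc)).2.2⟩)
          have hCnd := hCnd hXnd
          generalize (completionsT μ sm Q X).val = E at hCmem hEne hCnd ⊢
          have hXsm : ∀ x ∈ X, x ∈ sm := by
            intro x hx
            rw [hXmem, mem_framePoints_flatten] at hx
            obtain ⟨c, hc, V, hV, hxV⟩ := hx
            have := ((hSspec c (hσsub c hc)).2.2.frames hf V hV).1 x hxV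
            have := mem_classList.1 (List.mem_toFinset.1 (mem_outside.1 this).1)
            exact (hsmallmem x).2 ⟨this.1, this.2 ▸ hc⟩
          set SR : List (Pt d) → List (List (Pt d)) := fun R =>
            (equivariantFrames2T μ r (classList L h) (Q.unionT μ R).val).val with hSR
          have hSRspec : ∀ R ∈ E, (SR R).Nodup ∧ SR R ≠ [] ∧
              EquivariantFrames2 (classList L h).toFinset (Q.toList ++ R.map toRat)
                (SR R).toFinset := by
            intro R hR
            have hlt := hclass_lt h hhσ
            have hfR := ((hCmem R).1 hR).2.2.1
            rw [← RFrame.unionT_toList μ hQ R] at hfR ⊢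
            exact ih (Q := (Q.unionT μ R).val) (hLnd.filter _) hQ hfR
              (hδL.mono fun x hx => List.mem_of_mem_filter hx) (by omega)
          have hRT : (fun R => List.map (fun T => R ++ T) (equivariantFrames2T μ r (classList L h)
              (Q.unionT μ R).val).val) = fun R => (SR R).map (R ++ ·) := rfl
          simp only [appendT_val]
          rw [hRT]
          set cand := (E.map fun R => (SR R).map (R ++ ·)).flatten with hcand
          have hcandmem : ∀ V, V ∈ cand ↔ ∃ R ∈ E, ∃ T ∈ SR R, V = R ++ T := by
            intro V
            simp only [hcand, List.mem_flatten, List.mem_map]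
            constructor
            · rintro ⟨_, ⟨R, hR, rfl⟩, hV⟩
              obtain ⟨T, hT, rfl⟩ := List.mem_map.1 hV
              exact ⟨R, hR, T, hT, rfl⟩
            · rintro ⟨R, hR, T, hT, rfl⟩
              exact ⟨_, ⟨R, hR, rfl⟩, List.mem_map.2 ⟨T, hT, rfl⟩⟩
          have hSRframes : ∀ R ∈ E, ∀ T ∈ SR R, IsCoveringFrame (congClass L.toFinset h)
              (Q.toList ++ R.map toRat ++ T.map toRat) := by
            intro R hR T hT
            have := ((hSRspec R hR).2.2.frames ((hCmem R).1 hR).2.2.1 T (List.mem_toFinset.2 hT)).2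
            rwa [toFinset_classList] at this
          have hcov : ∀ V ∈ cand, IsCoveringFrame L.toFinset (Q.toList ++ V.map toRat) := by
            intro V hV
            obtain ⟨R, hR, T, hT, rfl⟩ := (hcandmem V).1 hV
            have := ((hCmem R).1 hR).2.2
            rw [hsmall] at this
            exact isCoveringFrame_append this (hSRframes R hR T hT)
          -- The frames in `E` consist of points outside the large class and cover all such points,
          -- as required for cutting a concatenation in a unique way.
          have hcandnd : cand.Nodup := nodup_flatten_append (Q := Q.toList) (Λ := sm.toFinset) hCnd
            (fun R hR => ⟨fun x hx => List.mem_toFinset.2 (hXsm x (((hCmem R).1 hR).1.1 x hx)),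
              ((hCmem R).1 hR).2.2⟩)
            (fun R hR => ⟨(hSRspec R hR).1, fun T hT => (hSRframes R hR T hT).1⟩)
          have hcandne : cand ≠ [] := by
            obtain ⟨R, hR⟩ := List.exists_mem_of_ne_nil _ hEne
            obtain ⟨T, hT⟩ := List.exists_mem_of_ne_nil _ (hSRspec R hR).2.1
            exact List.ne_nil_of_mem ((hcandmem _).2 ⟨R, hR, T, hT, rfl⟩)
          obtain ⟨hm1, hm2, hm3⟩ := minimalT_spec μ hQ hLnd hcov
          refine ⟨hcandnd.sublist hm1, hm2 hcandne, ?_⟩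
          refine EquivariantFrames2.unbalanced _ _ h (fun c => (S c).toFinset) {R | R ∈ E}
            (fun R => (SR R).toFinset) (frameValue μ L Q) _ hcard hcong ?_ ?_ ?_ ?_ ?_ ?_
          · rw [← hout, List.toFinset_card_of_nodup hLnd, card_congClass_toFinset hLnd]
            exact hbig
          · intro c hch hc
            rw [← hout] at hc ⊢
            rw [← toFinset_classList]
            exact (hSspec c (hσsub c ((hrestI c).2 ⟨hch, hc⟩))).2.2
          · rw [← hout, ← hsmall, ← hXset]
            ext R
            exact hCmem R
          · intro R hR
            rw [← hout, ← toFinset_classList]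
            exact (hSRspec R hR).2.2
          · intro R hR T hT
            rw [← hout]
            exact canonicalFormWithFrame_frameValue μ hQ hLnd
              (hcov _ ((hcandmem _).2 ⟨R, hR, T, by simpa using hT, rfl⟩))
          · refine isMinimalSet_congr hm3 ?_
            ext V
            rw [Set.mem_ofPred_eq, hcandmem]
            simp

end EquivariantFramesAlgorithm

section CanonicalFormAlgorithm

variable {d : ℕ}

theorem abs_lt_two_pow_of_bitSize_le {z : ℤ} {b : ℕ} (h : bitSize z ≤ b + 1) : |z| < 2 ^ b := by
  have h1 : z.natAbs < 2 ^ b := Nat.size_le.1 (by unfold bitSize at h; omega)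
  rw [Int.abs_eq_natAbs]
  exact_mod_cast h1

theorem bitSize_le_of_abs_lt {z : ℤ} {b : ℕ} (h : |z| < 2 ^ b) : bitSize z ≤ b + 1 := by
  rw [Int.abs_eq_natAbs] at h
  have : z.natAbs < 2 ^ b := by exact_mod_cast h
  unfold bitSize
  exact Nat.succ_le_succ (Nat.size_le.2 this)

theorem diamLT_of_bitSize_le {l : List (Pt d)} {b : ℕ}
    (h : ∀ p ∈ l, ∀ i, bitSize (p i) ≤ b) : DiamLT l b := by
  intro p hp q hq i
  have hpi := h p hp i
  have hqi := h q hq i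
  have hb : 1 ≤ b := le_trans (by unfold bitSize; omega) hpi
  obtain ⟨b, rfl⟩ := Nat.exists_eq_add_of_le' hb
  have h1 := abs_lt.1 (abs_lt_two_pow_of_bitSize_le hpi)
  have h2 := abs_lt.1 (abs_lt_two_pow_of_bitSize_le hqi)
  rw [abs_lt, pow_succ]
  constructor <;> linarith

theorem diamLT_recursionBound (l : List (Pt d)) :
    DiamLT l (l.map (fun p => ∑ i, bitSize (p i))).sum := by
  refine diamLT_of_bitSize_le fun p hp i => ?_
  calc bitSize (p i) ≤ ∑ i, bitSize (p i) :=
        Finset.single_le_sum (f := fun i => bitSize (p i)) (fun _ _ => Nat.zero_le _)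
          (Finset.mem_univ i)
    _ ≤ _ := List.single_le_sum (by simp) _ (List.mem_map.2 ⟨p, hp, rfl⟩)

theorem canonicalFormT_spec (μ : ℕ → ℕ) {l : List (Pt d)} (hl : l.Nodup) :
    (canonicalFormT μ l).val.Nodup ∧
      CanonicalForm l.toFinset (canonicalFormT μ l).val.toFinset := by
  obtain ⟨-, hne, hS⟩ := equivariantFrames2T_spec μ (recursionBound l) hl
    (Q := ⟨1, []⟩) one_pos isFrame_nil (diamLT_recursionBound l) le_rfl
  change EquivariantFrames2 l.toFinset [] _ at hS
  set S := (equivariantFrames2T μ (recursionBound l) l ⟨1, []⟩).val with hSdef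
  set X : List (Pt d) → List (Pt d) × List (Pt d) := fun R =>
    (canonicalFormWithFrameT μ l ⟨1, R⟩).val with hX
  have hspec : ∀ R ∈ S, (X R).1.Nodup ∧ (X R).1.map toLex = setKey (X R).1.toFinset ∧
      CanonicalFormWithFrame l.toFinset (R.map toRat) ((X R).1.toFinset, (X R).2) := by
    intro R hR
    have := canonicalFormWithFrameT_spec μ (Q := ⟨1, R⟩) one_pos hl (by
      rw [RFrame.toList_one]
      exact hS.isCoveringFrame_nil (List.mem_toFinset.2 hR))
    rwa [RFrame.toList_one] at this
  have hval : ∃ R ∈ S, (canonicalFormT μ l).val = (X R).1 ∧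
      ∀ R' ∈ S, (X R).1.map toLex ≤ (X R').1.map toLex := by
    have hm : (mapT (fun R => do
        let X ← canonicalFormWithFrameT μ l ⟨1, R⟩
        pure X.1) S).val = S.map (fun R => (X R).1) := by
      rw [mapT_val]
      rfl
    simp only [canonicalFormT, Timed.val_bind]
    rw [← hSdef, hm]
    match S, hne with
    | R :: Rs, _ =>
      obtain ⟨h1, h2⟩ := minT_spec (compares_cmpListT compares_cmpVecT) (X R).1
        (Rs.map fun R => (X R).1)
      rw [← List.map_cons (f := fun R => (X R).1)] at h1 h2
      obtain ⟨R₀, hR₀, he⟩ := List.mem_map.1 h1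
      refine ⟨R₀, hR₀, he.symm, fun R' hR' => ?_⟩
      have := h2 _ (List.mem_map.2 ⟨R', hR', rfl⟩)
      rwa [← he] at this
  obtain ⟨R, hR, hv, hmin⟩ := hval
  rw [hv]
  refine ⟨(hspec R hR).1, S.toFinset, fun R => ((X R).1.toFinset, (X R).2), hS,
    fun R hR => (hspec R (List.mem_toFinset.1 hR)).2.2, R, List.mem_toFinset.2 hR, rfl,
    fun R' hR' => ?_⟩
  have hR' := List.mem_toFinset.1 hR'
  rw [← (hspec R hR).2.1, ← (hspec R' hR').2.1]
  exact hmin R' hR'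

/-- The cost function does not influence values, so any `μ` can be used for existence. -/
theorem exists_canonicalForm (Λ : Finset (Pt d)) : CanonicalForm Λ
    (canonicalFormT (fun _ => 0) Λ.toList).val.toFinset := by
  simpa using (canonicalFormT_spec (fun _ => 0) Λ.nodup_toList).2

end CanonicalFormAlgorithm

/-! ## The number of frames in the output of `EquivariantFrames2` -/

section FrameCount

variable {d : ℕ}

/-- A matrix that is a nonzero scalar modulo 3 has determinant nonzero modulo 3, hence nonzero. -/
theorem eq_zero_of_mulVec_of_map {M : Matrix (Fin d) (Fin d) ℤ} {k : ZMod 3} (hk : k ≠ 0)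
    (hM : M.map (Int.castRingHom (ZMod 3)) = k • (1 : Matrix (Fin d) (Fin d) (ZMod 3)))
    {u : Pt d} (hu : M.mulVec u = 0) : u = 0 := by
  have : Fact (Nat.Prime 3) := ⟨by norm_num⟩
  have hdet : M.det ≠ 0 := by
    intro h
    have h1 := RingHom.map_det (Int.castRingHom (ZMod 3)) M
    rw [h, map_zero, RingHom.mapMatrix_apply, hM, Matrix.det_smul, Matrix.det_one, mul_one] at h1
    exact pow_ne_zero _ hk h1.symm
  exact Matrix.eq_zero_of_mulVec_eq_zero hdet hu

theorem map_pow_eq_one {B : Matrix (Fin d) (Fin d) ℤ}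
    (hB : B.map (Int.castRingHom (ZMod 3)) = 1) (k : ℕ) :
    (B ^ k).map (Int.castRingHom (ZMod 3)) = 1 := by
  have : (Int.castRingHom (ZMod 3)).mapMatrix (B ^ k) = 1 := by
    rw [map_pow, RingHom.mapMatrix_apply, hB, one_pow]
  exact this

/-- With `u = B v - v`, the sum `1 + B + ⋯ + B ^ (p - 1)` maps `u` to `B ^ p v - v = 0`. For `p ≠ 3`
this sum is `p` modulo 3, a nonzero scalar. For `p = 3`, writing `B = 1 + 3 C` makes it `3 (1 + 3 (C
+ C²))`, whose second factor is the identity modulo 3. In both cases `u = 0`. -/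
theorem mulVec_eq_self_of_pow_prime {B : Matrix (Fin d) (Fin d) ℤ}
    (hB : B.map (Int.castRingHom (ZMod 3)) = 1) {p : ℕ} (hp : p.Prime) {v : Pt d}
    (h : (B ^ p).mulVec v = v) : B.mulVec v = v := by
  have : Fact (Nat.Prime 3) := ⟨by norm_num⟩
  rw [← sub_eq_zero]
  set u := B.mulVec v - v with hu
  have hsum : (∑ i ∈ Finset.range p, B ^ i).mulVec u = 0 := by
    have h1 : (∑ i ∈ Finset.range p, B ^ i) * (B - 1) = B ^ p - 1 := geom_sum_mul B p
    have h2 : u = (B - 1).mulVec v := by rw [Matrix.sub_mulVec, Matrix.one_mulVec]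
    rw [h2, Matrix.mulVec_mulVec, h1, Matrix.sub_mulVec, Matrix.one_mulVec, h, sub_self]
  by_cases hp3 : p = 3
  · subst hp3
    have hC : ∃ C : Matrix (Fin d) (Fin d) ℤ, B = 1 + (3 : ℤ) • C := by
      have : ∀ i j, ∃ c : ℤ, B i j = (1 : Matrix (Fin d) (Fin d) ℤ) i j + 3 * c := by
        intro i j
        have hij := congrFun (congrFun hB i) j
        have : ((B i j - (1 : Matrix (Fin d) (Fin d) ℤ) i j : ℤ) : ZMod 3) = 0 := by
          rw [Int.cast_sub, sub_eq_zero]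
          rw [Matrix.map_apply, eq_intCast] at hij
          rw [hij]
          by_cases e : i = j <;> simp [Matrix.one_apply, e]
        obtain ⟨c, hc⟩ := (ZMod.intCast_zmod_eq_zero_iff_dvd _ 3).1 this
        exact ⟨c, by push_cast at hc; linarith⟩
      choose C hC using this
      exact ⟨Matrix.of C, by ext i j; simpa using hC i j⟩
    obtain ⟨C, hC⟩ := hC
    have he : (∑ i ∈ Finset.range 3, B ^ i) =
        (3 : ℤ) • ((1 : Matrix (Fin d) (Fin d) ℤ) + (3 : ℤ) • (C + C ^ 2)) := by
      simp only [Finset.sum_range_succ, Finset.sum_range_zero, hC]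
      simp only [pow_two, pow_zero, pow_one, smul_add, add_mul, mul_add, one_mul, mul_one,
        smul_mul_assoc, mul_smul_comm, smul_smul]
      module
    rw [he, Matrix.smul_mulVec] at hsum
    refine eq_zero_of_mulVec_of_map (k := 1) one_ne_zero ?_ ((smul_eq_zero_iff_right (by norm_num)).1 hsum)
    have h3 : (Int.castRingHom (ZMod 3)).mapMatrix
        ((1 : Matrix (Fin d) (Fin d) ℤ) + (3 : ℤ) • (C + C ^ 2)) = 1 := by
      rw [map_add, map_one, map_zsmul, ← Int.cast_smul_eq_zsmul (ZMod 3)]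
      have : ((3 : ℤ) : ZMod 3) = 0 := rfl
      rw [this, zero_smul, add_zero]
    rw [one_smul]
    exact h3
  · refine eq_zero_of_mulVec_of_map (k := (p : ZMod 3)) ?_ ?_ hsum
    · intro h0
      rw [ZMod.natCast_eq_zero_iff] at h0
      exact hp3 ((Nat.prime_dvd_prime_iff_eq (by norm_num) hp).1 h0).symm
    · have : (Int.castRingHom (ZMod 3)).mapMatrix (∑ i ∈ Finset.range p, B ^ i) =
          (p : ZMod 3) • (1 : Matrix (Fin d) (Fin d) (ZMod 3)) := by
        rw [map_sum, Finset.sum_congr rfl fun i _ => show (Int.castRingHom (ZMod 3)).mapMatrix (B ^ i) = 1 from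
          map_pow_eq_one hB i]
        simp [Nat.cast_smul_eq_nsmul]
      exact this

/-- A matrix congruent to the identity modulo 3 fixes all the points which are periodic for it
(Minkowski). -/
theorem mulVec_eq_self_of_pow {B : Matrix (Fin d) (Fin d) ℤ}
    (hB : B.map (Int.castRingHom (ZMod 3)) = 1) {N : ℕ} (hN : 0 < N) {v : Pt d}
    (h : (B ^ N).mulVec v = v) : B.mulVec v = v := by
  induction N using Nat.strong_induction_on with
  | _ N ih =>
    by_cases h1 : N = 1
    · simpa [h1] using h
    obtain ⟨p, hp, M, rfl⟩ := Nat.exists_prime_and_dvd h1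
    have hM : 0 < M := Nat.pos_of_mul_pos_left hN
    refine ih M (by nlinarith [hp.two_le]) hM ?_
    -- The exponent is stripped of one prime at a time: `B ^ M` is again the identity modulo 3, and
    -- `(B ^ M) ^ p` fixes `v`.
    rw [mul_comm, pow_mul] at h
    exact mulVec_eq_self_of_pow_prime (map_pow_eq_one hB M) hp h

/-- A map `x ↦ B x + t` which permutes a finite set, with `B` congruent to the identity modulo 3,
fixes all the points of this set. -/
theorem eq_self_of_permutes {B : Matrix (Fin d) (Fin d) ℤ}
    (hB : B.map (Int.castRingHom (ZMod 3)) = 1) {L : Finset (Pt d)} {φ : Pt d → Pt d}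
    (hφ : ∀ x y, φ x - φ y = B.mulVec (x - y)) (hinj : Function.Injective φ)
    (hL : L.image φ = L) : ∀ x ∈ L, φ x = x := by
  have hmaps : ∀ x ∈ L, φ x ∈ L := fun x hx => by
    rw [← hL]; exact Finset.mem_image_of_mem _ hx
  let σ : Equiv.Perm L := Equiv.ofBijective (fun x : L => (⟨φ x, hmaps x x.2⟩ : L))
    (Finite.injective_iff_bijective.1 fun x y h => Subtype.ext (hinj (congrArg Subtype.val h)))
  have hσ : ∀ x : L, ((σ x : L) : Pt d) = φ x := fun _ => rfl
  have hpow : ∀ k : ℕ, ∀ x y : L,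
      (((σ ^ k) x : L) : Pt d) - ((σ ^ k) y : L) = (B ^ k).mulVec ((x : Pt d) - y) := by
    intro k x y
    induction k with
    | zero => simp
    | succ k ih =>
      rw [pow_succ' σ, Equiv.Perm.mul_apply, Equiv.Perm.mul_apply, hσ, hσ, hφ, ih,
        Matrix.mulVec_mulVec, ← pow_succ']
  -- A permutation of a finite set has finite order, so the differences of points of `L` are
  -- periodic for `B`, hence fixed by it.
  have hfix : ∀ x ∈ L, ∀ y ∈ L, φ x - φ y = x - y := by
    intro x hx y hy
    rw [hφ]
    refine mulVec_eq_self_of_pow hB (orderOf_pos σ) ?_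
    have := hpow (orderOf σ) ⟨x, hx⟩ ⟨y, hy⟩
    rw [pow_orderOf_eq_one] at this
    exact this.symm
  intro x hx
  -- By now `φ` is a translation on `L`. It preserves the sum of the points, so the translation
  -- vector multiplied by the number of points is zero.
  have hsum : ∑ y ∈ L, φ y = ∑ y ∈ L, y := by
    conv_rhs => rw [← hL, Finset.sum_image fun _ _ _ _ h => hinj h]
  have h1 : ∑ y ∈ L, (φ x - x) = 0 := by
    rw [← sub_eq_zero.2 hsum, ← Finset.sum_sub_distrib]
    refine Finset.sum_congr rfl fun y hy => ?_
    have := hfix x hx y hy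
    rw [sub_eq_sub_iff_add_eq_add] at this ⊢
    rw [this, add_comm]
  rw [Finset.sum_const, smul_eq_zero_iff_right (Finset.card_ne_zero_of_mem hx)] at h1
  exact sub_eq_zero.1 h1

theorem card_matrix_zmod_three : Fintype.card (Matrix (Fin d) (Fin d) (ZMod 3)) = 3 ^ (d * d) := by
  have : Fintype.card (Matrix (Fin d) (Fin d) (ZMod 3)) =
    Fintype.card (Fin d → Fin d → ZMod 3) := rfl
  rw [this]
  simp [ZMod.card, ← pow_mul]

/-- No point of `L` lies in the span of `Q`, so `(Q ∪ R) ∩ L` is `R` and the loop starts with `R`.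
-/
theorem isPrefix_of_frameLoop {L : Finset (Pt d)} {Q : List (RPt d)} {R T : List (Pt d)}
    (hQ : ∀ p ∈ L, toRat p ∉ ratSpan Q) (hR : ∀ p ∈ R, p ∈ L)
    (hf : IsFrame (Q ++ R.map toRat)) (h : FrameLoop L (Q ++ R.map toRat) T) : R <+: T := by
  obtain ⟨T₀, h0, h1, -⟩ := h
  rw [List.filter_append, List.filter_eq_nil_iff.2, List.filter_eq_self.2, List.nil_append] at h0
  · obtain rfl := toRat_injective.list_map h0
    exact (frameSteps_spec h1 hf.append_right hR).2.2
  · intro q hq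
    obtain ⟨p, hp, rfl⟩ := List.mem_map.1 hq
    exact decide_eq_true ⟨p, hR p hp, rfl⟩
  · intro q hq hq'
    obtain ⟨p, hp, rfl⟩ := of_decide_eq_true hq'
    exact hQ p hp (mem_ratSpan hq)

/-- A further point of `R'` would lie in `L`, hence in the span of `Q ∪ R`, against independence. -/
theorem eq_of_isPrefix_of_coveringFrame {L : Finset (Pt d)} {Q : List (RPt d)} {R R' : List (Pt d)}
    (h : R <+: R') (hR' : ∀ p ∈ R', p ∈ L) (hc : IsCoveringFrame L (Q ++ R.map toRat))
    (hf : IsFrame (Q ++ R'.map toRat)) : R = R' := by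
  obtain ⟨t, rfl⟩ := h
  match t with
  | [] => simp
  | x :: t =>
    exfalso
    have : IsFrame ((Q ++ R.map toRat) ++ [toRat x]) := by
      refine hf.sublist ?_
      rw [List.map_append, ← List.append_assoc]
      exact (List.Sublist.refl _).append (by simp)
    exact (isFrame_append_singleton.1 this).2 (hc.2 x (hR' x (by simp)))

/-- The matrices modulo 3 separate the frames. If those of `R` and `R'` agree, the affinity `ψ'⁻¹ ψ`
is the identity modulo 3, and it permutes `L` because the images `ψ(L)` and `ψ'(L)` are the same
set. It fixes `L` pointwise, so `T R = T R'`, and both `R` and `R'` are prefixes of this list. -/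
theorem card_le_of_value_eq {L : Finset (Pt d)} {Q : List (RPt d)}
    {val : List (Pt d) → Finset (Pt d) × List (Pt d)} {F : Finset (List (Pt d))}
    (hQ : ∀ p ∈ L, toRat p ∉ ratSpan Q)
    (hR : ∀ R ∈ F, (∀ p ∈ R, p ∈ L) ∧ IsCoveringFrame L (Q ++ R.map toRat))
    (hval : ∀ R ∈ F, CanonicalFormWithFrame L (Q ++ R.map toRat) (val R))
    (heq : ∀ R ∈ F, ∀ R' ∈ F, val R = val R') : F.card ≤ 3 ^ (d * d) := by
  classical
  choose! T A hT _ hX using hval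
  rw [← card_matrix_zmod_three]
  refine Finset.card_le_card_of_injOn
    (fun R => (A R : Matrix (Fin d) (Fin d) ℤ).map (Int.castRingHom (ZMod 3)))
    (fun _ _ => Finset.mem_univ _) fun R hRF R' hRF' hA => ?_
  have hRF : R ∈ F := hRF
  have hRF' : R' ∈ F := hRF'
  have hv := heq R hRF R' hRF'
  rw [hX R hRF, hX R' hRF', Prod.mk.injEq] at hv
  obtain ⟨hv1, hv2⟩ := hv
  set ψ : Aff d := glAff (A R) ((T R).headD 0) with hψ
  set ψ' : Aff d := glAff (A R') ((T R').headD 0) with hψ'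
  have hψe : frameMap (A R) (T R) = ψ := rfl
  have hψe' : frameMap (A R') (T R') = ψ' := rfl
  rw [hψe, hψe'] at hv1 hv2
  set B : Matrix (Fin d) (Fin d) ℤ :=
    ((A R')⁻¹ : Matrix.GeneralLinearGroup (Fin d) ℤ) * (A R : Matrix (Fin d) (Fin d) ℤ) with hBdef
  have hB : B.map (Int.castRingHom (ZMod 3)) = 1 := by
    have h1 : (Int.castRingHom (ZMod 3)).mapMatrix B = 1 := by
      rw [hBdef, map_mul]
      have : (Int.castRingHom (ZMod 3)).mapMatrix (A R : Matrix (Fin d) (Fin d) ℤ) =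
          (Int.castRingHom (ZMod 3)).mapMatrix (A R' : Matrix (Fin d) (Fin d) ℤ) := hA
      rw [this, ← map_mul, ← Units.val_mul, inv_mul_cancel, Units.val_one, map_one]
    exact h1
  have hid := eq_self_of_permutes hB (L := L) (φ := fun x => ψ'.symm (ψ x)) (by
      intro x y
      apply (Matrix.mulVec_injective_of_isUnit (A R').isUnit)
      have hs : ∀ x y, ψ' x - ψ' y = (A R' : Matrix (Fin d) (Fin d) ℤ).mulVec (x - y) := by
        intro x y
        rw [hψ', glAff_apply, glAff_apply, ← Matrix.mulVec_sub, sub_sub_sub_cancel_right]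
      rw [← hs, AffineEquiv.apply_symm_apply, AffineEquiv.apply_symm_apply, Matrix.mulVec_mulVec,
        hBdef, ← mul_assoc, ← Units.val_mul, mul_inv_cancel, Units.val_one, one_mul, hψ,
        glAff_apply, glAff_apply, ← Matrix.mulVec_sub, sub_sub_sub_cancel_right])
    (ψ'.symm.injective.comp ψ.injective) (by
      have : (fun x => ψ'.symm (ψ x)) = ψ'.symm ∘ ψ := rfl
      rw [this, ← Finset.image_image, hv1, Finset.image_image]
      simp)
  have hRT := isPrefix_of_frameLoop hQ (hR R hRF).1 (hR R hRF).2.1 (hT R hRF)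
  have hRT' := isPrefix_of_frameLoop hQ (hR R' hRF').1 (hR R' hRF').2.1 (hT R' hRF')
  have hTT : T R = T R' := by
    have h1 : (T R).map (fun x => ψ'.symm (ψ x)) = T R' := by
      have := congrArg (List.map ψ'.symm) hv2
      simpa [List.map_map, Function.comp_def] using this
    rw [← h1]
    refine (List.map_id _).symm.trans (List.map_congr_left fun x hx => (hid x ?_).symm)
    exact (frameLoop_spec (hR R hRF).2.1 (hT R hRF)).2.1 x hx
  rw [← hTT] at hRT'
  -- One frame is a prefix of the other, and the shorter one together with `Q` already covers `L`.
  rcases List.prefix_or_prefix_of_prefix hRT hRT' with h | h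
  · exact eq_of_isPrefix_of_coveringFrame h (hR R' hRF').1 (hR R hRF).2 (hR R' hRF').2.1
  · exact (eq_of_isPrefix_of_coveringFrame h (hR R hRF).1 (hR R' hRF').2 (hR R hRF).2.1).symm

theorem IsMinimalSet.value_eq {cand : Set (List (Pt d))}
    {val : List (Pt d) → Finset (Pt d) × List (Pt d)} {F : Finset (List (Pt d))}
    (h : IsMinimalSet cand val F) : ∀ R ∈ F, ∀ R' ∈ F, val R = val R' := fun R hR R' hR' =>
  pairKey_injective (le_antisymm (((h R).1 hR).2 R' ((h R').1 hR').1)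
    (((h R').1 hR').2 R ((h R).1 hR).1))

/-- No growth accumulates along the recursion: the congruent branch only transports frames, and the
branches with a minimum start afresh from the equality of the minimal values, whatever the size of
the pool. -/
theorem EquivariantFrames2.card_le {Λ : Finset (Pt d)} {Q : List (RPt d)}
    {S : Finset (List (Pt d))} (h : EquivariantFrames2 Λ Q S) (hQ : IsFrame Q) :
    S.card ≤ 3 ^ (d * d) := by
  have hframes := h.frames hQ
  have hout : ∀ p ∈ outside Λ Q, toRat p ∉ ratSpan Q := fun p hp => (mem_outside.1 hp).2
  have hcov : ∀ R ∈ S, (∀ p ∈ R, p ∈ outside Λ Q) ∧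
      IsCoveringFrame (outside Λ Q) (Q ++ R.map toRat) := fun R hR =>
    ⟨(hframes R hR).1, (hframes R hR).2.1, fun p hp =>
      (hframes R hR).2.2 p (mem_outside.1 hp).1⟩
  induction h with
  | small Λ Q hcard =>
    rw [Finset.card_singleton]
    exact Nat.one_le_pow _ _ (by norm_num)
  | congruent Λ Q p Λ' S' hcard hcong hp hΛ' hrec ih =>
    rw [map_half_eq] at hrec ih
    have hQ' := (isFrame_map (halveAt_injective (toRat p))).2 hQ
    have hframes' := hrec.frames hQ'
    exact Finset.card_image_le.trans (ih hQ' hframes' (fun p hp => (mem_outside.1 hp).2)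
      fun R hR => ⟨(hframes' R hR).1, (hframes' R hR).2.1, fun p hp =>
      (hframes' R hR).2.2 p (mem_outside.1 hp).1⟩)
  | balanced Λ Q S val F hcard hcong hbal hrec hval hF ih =>
    exact card_le_of_value_eq hout hcov (fun R hR => hval R ((hF R).1 hR).1) hF.value_eq
  | unbalanced Λ Q h S E SR val F hcard hcong hunbal hrec hE hrecE hval hF ih ihE =>
    refine card_le_of_value_eq hout hcov (fun V hV => ?_) hF.value_eq
    obtain ⟨R, hR, T, hT, rfl⟩ := ((hF V).1 hV).1
    exact hval R hR T hT

end FrameCount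

/-! ## Cost of the list operations -/

section ListCost

variable {α β : Type}

theorem mapT_cost_le {f : α → Timed β} {l : List α} {c : ℕ} (h : ∀ a ∈ l, (f a).cost ≤ c) :
    (mapT f l).cost ≤ l.length * (c + 1) + 1 := by
  induction l with
  | nil => simp [mapT]
  | cons a l ih =>
    have h1 := h a (by simp)
    have h2 := ih fun x hx => h x (by simp [hx])
    simp only [mapT, Timed.cost_bind, tick_cost, Timed.cost_pure, List.length_cons, add_mul]
    omega

theorem mapT_cost_le_sum {f : α → Timed β} {l : List α} {c : α → ℕ}
    (h : ∀ a ∈ l, (f a).cost ≤ c a) : (mapT f l).cost ≤ (l.map c).sum + l.length + 1 := by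
  induction l with
  | nil => simp [mapT]
  | cons a l ih =>
    have h1 := h a (by simp)
    have h2 := ih fun x hx => h x (by simp [hx])
    simp only [mapT, Timed.cost_bind, tick_cost, Timed.cost_pure, List.length_cons, List.map_cons,
      List.sum_cons]
    omega

theorem filterT_cost_le {f : α → Timed Bool} {l : List α} {c : ℕ} (h : ∀ a ∈ l, (f a).cost ≤ c) :
    (filterT f l).cost ≤ l.length * (c + 1) + 1 := by
  induction l with
  | nil => simp [filterT]
  | cons a l ih =>
    have h1 := h a (by simp)
    have h2 := ih fun x hx => h x (by simp [hx])
    simp only [filterT, Timed.cost_bind, tick_cost, Timed.cost_pure, List.length_cons, add_mul]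
    omega

theorem findT_cost_le {f : α → Timed Bool} {l : List α} {c : ℕ} (h : ∀ a ∈ l, (f a).cost ≤ c) :
    (findT f l).cost ≤ l.length * (c + 1) + 1 := by
  induction l with
  | nil => simp [findT]
  | cons a l ih =>
    have h1 := h a (by simp)
    have h2 := ih fun x hx => h x (by simp [hx])
    simp only [findT, Timed.cost_bind, tick_cost, List.length_cons, add_mul]
    split
    · simp only [Timed.cost_pure]; omega
    · omega

theorem allT_cost_le {f : α → Timed Bool} {l : List α} {c : ℕ} (h : ∀ a ∈ l, (f a).cost ≤ c) :
    (allT f l).cost ≤ l.length * (c + 1) + 1 := by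
  induction l with
  | nil => simp [allT]
  | cons a l ih =>
    have h1 := h a (by simp)
    have h2 := ih fun x hx => h x (by simp [hx])
    simp only [allT, Timed.cost_bind, tick_cost, List.length_cons, add_mul]
    split
    · omega
    · simp only [Timed.cost_pure]; omega

theorem lengthT_cost_le (l : List α) :
    (lengthT l).cost ≤ l.length * (Nat.size l.length + 2) + 1 := by
  induction l with
  | nil => simp [lengthT]
  | cons a l ih =>
    simp only [lengthT, Timed.cost_bind, tick_cost, Timed.cost_pure, List.length_cons, lengthT_val]
    have h1 : Nat.size l.length ≤ Nat.size (l.length + 1) := Nat.size_le_size (Nat.le_succ _)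
    have h2 := Nat.mul_le_mul_left l.length (Nat.add_le_add_right h1 2)
    rw [add_mul, one_mul]
    omega

theorem appendT_cost (l m : List α) : (appendT l m).cost = l.length + 1 := by
  induction l with
  | nil => simp [appendT]
  | cons a l ih =>
    simp only [appendT, Timed.cost_bind, tick_cost, Timed.cost_pure, ih, List.length_cons]
    omega

theorem flattenT_cost (ls : List (List α)) :
    (flattenT ls).cost = ls.flatten.length + 2 * ls.length + 1 := by
  induction ls with
  | nil => simp [flattenT]
  | cons l ls ih =>
    simp only [flattenT, Timed.cost_bind, tick_cost, ih, appendT_cost, List.length_cons,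
      List.flatten_cons, List.length_append]
    omega

theorem length_flatten_le {ls : List (List α)} {c : ℕ} (h : ∀ l ∈ ls, l.length ≤ c) :
    ls.flatten.length ≤ ls.length * c := by
  rw [List.length_flatten]
  simpa using List.sum_le_card_nsmul (ls.map List.length) c (by simpa using h)

theorem length_dedupT_le (eqv : α → α → Timed Bool) (l : List α) :
    (dedupT eqv l).val.length ≤ l.length := by
  induction l with
  | nil => simp [dedupT]
  | cons a l ih =>
    simp only [dedupT, Timed.val_bind, List.length_cons]
    split <;> simp only [Timed.val_pure, List.length_cons] <;> omega

theorem dedupT_val_subset (eqv : α → α → Timed Bool) (l : List α) :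
    ∀ a ∈ (dedupT eqv l).val, a ∈ l := by
  induction l with
  | nil => simp [dedupT]
  | cons a l ih =>
    simp only [dedupT, Timed.val_bind]
    split
    · intro x hx
      rcases List.mem_cons.1 hx with rfl | hx
      · simp
      · exact List.mem_cons_of_mem _ (ih x hx)
    · intro x hx
      exact List.mem_cons_of_mem _ (ih x hx)

/-- The quadratic cost is harmless: the lists of frame points to which this is applied have lengths
bounded in terms of `d`. -/
theorem dedupT_cost_le {eqv : α → α → Timed Bool} {l : List α} {c : ℕ}
    (h : ∀ a ∈ l, ∀ b ∈ l, (eqv a b).cost ≤ c) :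
    (dedupT eqv l).cost ≤ l.length * (l.length * (c + 1) + 2) + 1 := by
  induction l with
  | nil => simp [dedupT]
  | cons a l ih =>
    have h1 := ih fun x hx y hy => h x (by simp [hx]) y (by simp [hy])
    have h2 : (findT (eqv a) (dedupT eqv l).val).cost ≤ l.length * (c + 1) + 1 :=
      (findT_cost_le fun x hx => h a (by simp) x
        (List.mem_cons_of_mem _ (dedupT_val_subset eqv l x hx))).trans
        (by gcongr; exact length_dedupT_le eqv l)
    have h3 : (dedupT eqv (a :: l)).cost =
        1 + ((dedupT eqv l).cost + (findT (eqv a) (dedupT eqv l).val).cost) := by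
      simp only [dedupT, Timed.cost_bind, tick_cost]
      split <;> simp
    rw [h3, List.length_cons]
    nlinarith [Nat.zero_le (l.length * (c + 1)), Nat.zero_le c]

theorem minT_cost_le {cmp : α → α → Timed Ordering} {l : List α} {x : α} {c : ℕ}
    (h : ∀ a ∈ x :: l, ∀ b ∈ x :: l, (cmp a b).cost ≤ c) :
    (minT cmp x l).cost ≤ l.length * (c + 1) + 1 := by
  induction l generalizing x with
  | nil => simp [minT]
  | cons a l ih =>
    have h1 := h a (by simp) x (by simp)
    simp only [minT, Timed.cost_bind, tick_cost, List.length_cons, add_mul]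
    split
    · have := ih (x := a) fun y hy z hz => h y (by simp at hy ⊢; tauto) z (by simp at hz ⊢; tauto)
      omega
    · have := ih (x := x) fun y hy z hz => h y (by simp at hy ⊢; tauto) z (by simp at hz ⊢; tauto)
      omega

theorem minT_mem (cmp : α → α → Timed Ordering) (x : α) (l : List α) :
    (minT cmp x l).val ∈ x :: l := by
  induction l generalizing x with
  | nil => simp [minT]
  | cons a l ih =>
    simp only [minT, Timed.val_bind]
    split
    · have := ih a
      simp at this ⊢
      tauto
    · have := ih x
      simp at this ⊢
      tauto

theorem cmpListT_cost_le {cmp : α → α → Timed Ordering} {l m : List α} {c : ℕ}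
    (h : ∀ a ∈ l, ∀ b ∈ m, (cmp a b).cost ≤ c) :
    (cmpListT cmp l m).cost ≤ l.length * (c + 1) + 1 := by
  induction l generalizing m with
  | nil => cases m <;> simp [cmpListT]
  | cons a l ih =>
    cases m with
    | nil => simp [cmpListT]
    | cons b m =>
      have h1 := h a (by simp) b (by simp)
      have h2 := ih (m := m) fun x hx y hy => h x (by simp [hx]) y (by simp [hy])
      simp only [cmpListT, Timed.cost_bind, tick_cost, List.length_cons, add_mul]
      split
      · omega
      · simp only [Timed.cost_pure]; omega
      · simp only [Timed.cost_pure]; omega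

theorem splitT_cost (l : List α) : (splitT l).cost = l.length + 1 := by
  induction l with
  | nil => simp [splitT]
  | cons a l ih =>
    simp only [splitT, Timed.cost_bind, tick_cost, ih, List.length_cons, Timed.cost_pure]
    omega

theorem mergeT_cost_le {cmp : α → α → Timed Ordering} {l m : List α} {c : ℕ}
    (h : ∀ a ∈ l, ∀ b ∈ m, (cmp a b).cost ≤ c) :
    (mergeT cmp l m).cost ≤ (l.length + m.length) * (c + 1) + 1 := by
  induction l, m using mergeT.induct with
  | case1 m => simp [mergeT]
  | case2 a l => simp [mergeT]
  | case3 a l b m ih1 ih2 =>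
    have h0 := h a (by simp) b (by simp)
    have h1 := ih1 fun x hx y hy => h x hx y (by simp [hy])
    have h2 := ih2 fun x hx y hy => h x (by simp [hx]) y hy
    rw [mergeT]
    simp only [Timed.cost_bind, tick_cost, List.length_cons, add_mul] at h1 h2 ⊢
    split <;> simp only [Timed.cost_bind, Timed.cost_pure] <;> omega

/-- For `n ≥ 2` the recursion `clog n = clog ⌈n / 2⌉ + 1` is exact and matches the larger half. The
constant `c + 4` absorbs the splitting, the merging and the unit charges, since `n ≥ 2`. -/
theorem mergeSortT_cost_le {cmp : α → α → Timed Ordering} {r : ℕ} {l : List α} {c : ℕ}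
    (h : ∀ a ∈ l, ∀ b ∈ l, (cmp a b).cost ≤ c) :
    (mergeSortT cmp r l).cost ≤ (c + 4) * l.length * Nat.clog 2 l.length + 1 := by
  induction r generalizing l with
  | zero => simp [mergeSortT]
  | succ r ih =>
    match l with
    | [] => simp [mergeSortT]
    | [a] => simp [mergeSortT]
    | a :: b :: t =>
      rw [mergeSortT]
      generalize hL : a :: b :: t = L at h ⊢
      have hL2 : 2 ≤ L.length := by rw [← hL]; simp
      simp only [Timed.cost_bind, tick_cost, splitT_cost]
      obtain ⟨hp, hl1, hl2⟩ := splitT_spec L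
      have hm1 : ∀ x ∈ (splitT L).val.1, x ∈ L := fun x hx =>
        hp.subset (List.mem_append_left _ hx)
      have hm2 : ∀ x ∈ (splitT L).val.2, x ∈ L := fun x hx =>
        hp.subset (List.mem_append_right _ hx)
      have h1 := ih (l := (splitT L).val.1) fun x hx y hy => h x (hm1 x hx) y (hm1 y hy)
      have h2 := ih (l := (splitT L).val.2) fun x hx y hy => h x (hm2 x hx) y (hm2 y hy)
      have p1 := mergeSortT_perm cmp r (splitT L).val.1
      have p2 := mergeSortT_perm cmp r (splitT L).val.2
      have h3 := mergeT_cost_le (cmp := cmp) (l := (mergeSortT cmp r (splitT L).val.1).val)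
        (m := (mergeSortT cmp r (splitT L).val.2).val) (c := c) fun x hx y hy =>
        h x (hm1 x (p1.subset hx)) y (hm2 y (p2.subset hy))
      rw [p1.length_eq, p2.length_eq] at h3
      have hclog : Nat.clog 2 L.length = Nat.clog 2 ((L.length + 1) / 2) + 1 := by
        rw [Nat.clog_of_two_le one_lt_two hL2]
        rfl
      have hle : Nat.clog 2 (splitT L).val.2.length ≤ Nat.clog 2 ((L.length + 1) / 2) :=
        Nat.clog_mono_right 2 (by omega)
      have hlen : (splitT L).val.1.length + (splitT L).val.2.length = L.length := by omega
      rw [hl1] at h1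
      have h2' := h2.trans (Nat.add_le_add_right
        (Nat.mul_le_mul_left ((c + 4) * (splitT L).val.2.length) hle) 1)
      rw [hclog]
      generalize Nat.clog 2 ((L.length + 1) / 2) = e at *
      rw [← hl1] at h1
      generalize (splitT L).val.1.length = n1 at *
      generalize (splitT L).val.2.length = n2 at *
      generalize L.length = n at *
      subst hlen
      nlinarith

end ListCost

/-! ## Bit sizes, and cost of the operations on vectors -/

section VectorCost

variable {d : ℕ}

theorem one_le_bitSize (z : ℤ) : 1 ≤ bitSize z := by unfold bitSize; omega

theorem bitSize_le_iff {z : ℤ} {b : ℕ} : bitSize z ≤ b + 1 ↔ |z| < 2 ^ b :=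
  ⟨abs_lt_two_pow_of_bitSize_le, bitSize_le_of_abs_lt⟩

theorem bitSize_neg (x : ℤ) : bitSize (-x) = bitSize x := by
  unfold bitSize; rw [Int.natAbs_neg]

theorem bitSize_zero : bitSize 0 = 1 := by simp [bitSize]

theorem bitSize_one : bitSize 1 = 2 := by simp [bitSize]

theorem bitSize_add_le {x y : ℤ} {b : ℕ} (hx : bitSize x ≤ b) (hy : bitSize y ≤ b) :
    bitSize (x + y) ≤ b + 1 := by
  obtain ⟨b, rfl⟩ := Nat.exists_eq_add_of_le' ((one_le_bitSize x).trans hx)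
  rw [bitSize_le_iff] at *
  have := abs_add_le x y
  rw [pow_succ]
  linarith

theorem bitSize_sub_le {x y : ℤ} {b : ℕ} (hx : bitSize x ≤ b) (hy : bitSize y ≤ b) :
    bitSize (x - y) ≤ b + 1 := by
  rw [sub_eq_add_neg]
  exact bitSize_add_le hx (by rwa [bitSize_neg])

theorem bitSize_mul_le {x y : ℤ} {b c : ℕ} (hx : bitSize x ≤ b) (hy : bitSize y ≤ c) :
    bitSize (x * y) ≤ b + c := by
  obtain ⟨b, rfl⟩ := Nat.exists_eq_add_of_le' ((one_le_bitSize x).trans hx)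
  obtain ⟨c, rfl⟩ := Nat.exists_eq_add_of_le' ((one_le_bitSize y).trans hy)
  rw [bitSize_le_iff] at hx hy
  have : bitSize (x * y) ≤ (b + c) + 1 := by
    rw [bitSize_le_iff, abs_mul, pow_add]
    exact mul_lt_mul'' hx hy (abs_nonneg _) (abs_nonneg _)
  omega

/-- All numbers of at most `B` bits are multiplied, and added, at cost at most `W`. -/
structure Cap (μ : ℕ → ℕ) (B W : ℕ) : Prop where
  mono : Monotone μ
  le : B ≤ W
  mul_le : μ B ≤ W

variable {μ : ℕ → ℕ} {B W : ℕ}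

theorem Cap.of_le (h : Cap μ B W) {B' : ℕ} (hB : B' ≤ B) : Cap μ B' W :=
  ⟨h.mono, hB.trans h.le, (h.mono hB).trans h.mul_le⟩

theorem Cap.mulT_cost_le (h : Cap μ B W) {x y : ℤ} (hx : bitSize x ≤ B) (hy : bitSize y ≤ B) :
    (mulT μ x y).cost ≤ W :=
  (h.mono (max_le hx hy)).trans h.mul_le

theorem Cap.addT_cost_le (h : Cap μ B W) {x y : ℤ} (hx : bitSize x ≤ B) (hy : bitSize y ≤ B) :
    (addT x y).cost ≤ 2 * W := by
  have := h.le
  show bitSize x + bitSize y ≤ 2 * W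
  omega

theorem Cap.subT_cost_le (h : Cap μ B W) {x y : ℤ} (hx : bitSize x ≤ B) (hy : bitSize y ≤ B) :
    (subT x y).cost ≤ 2 * W :=
  h.addT_cost_le hx hy

theorem tupleT_cost_le {α : Type} {m : ℕ} {f : Fin m → Timed α} {c : ℕ}
    (h : ∀ i, (f i).cost ≤ c) : (tupleT f).cost ≤ m * (c + 1) := by
  show ∑ i, ((f i).cost + 1) ≤ _
  calc ∑ i, ((f i).cost + 1) ≤ ∑ _i : Fin m, (c + 1) :=
        Finset.sum_le_sum fun i _ => Nat.add_le_add_right (h i) 1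
    _ = m * (c + 1) := by simp

theorem bitSize_sumT_le {m : ℕ} {f : Fin m → Timed ℤ} {b : ℕ} (hb : 1 ≤ b)
    (h : ∀ i, bitSize (f i).val ≤ b) : bitSize (sumT m f).val ≤ b + m := by
  induction m with
  | zero =>
    show bitSize 0 ≤ _
    rw [bitSize_zero]
    omega
  | succ m ih =>
    have h1 := ih (f := fun i => f i.succ) fun i => h i.succ
    show bitSize ((f 0).val + (sumT m (fun i => f i.succ)).val) ≤ _
    exact bitSize_add_le ((h 0).trans (Nat.le_add_right _ _)) h1

theorem sumT_cost_le {m : ℕ} {f : Fin m → Timed ℤ} {b c : ℕ} (hb : 1 ≤ b)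
    (h : ∀ i, bitSize (f i).val ≤ b) (hc : ∀ i, (f i).cost ≤ c) :
    (sumT m f).cost ≤ m * (c + 1 + 2 * (b + m)) + 1 := by
  induction m with
  | zero => simp [sumT]
  | succ m ih =>
    have h1 := ih (f := fun i => f i.succ) (fun i => h i.succ) fun i => hc i.succ
    have h2 := bitSize_sumT_le (f := fun i => f i.succ) hb fun i => h i.succ
    have h3 := h 0
    have h4 := hc 0
    have h5 : (sumT (m + 1) f).cost = 1 + ((f 0).cost + ((sumT m (fun i => f i.succ)).cost +
      (bitSize (f 0).val + bitSize (sumT m (fun i => f i.succ)).val))) := rfl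
    rw [h5]
    have h6 : m * (c + 1 + 2 * (b + m)) ≤ m * (c + 1 + 2 * (b + (m + 1))) := by
      gcongr; omega
    rw [add_mul]
    omega

section Vectors

variable {m : ℕ} {u v : Fin m → ℤ}

theorem Cap.vecAddT_cost_le (h : Cap μ B W) (hu : ∀ i, bitSize (u i) ≤ B)
    (hv : ∀ i, bitSize (v i) ≤ B) : (vecAddT u v).cost ≤ m * (2 * W + 1) :=
  tupleT_cost_le fun i => h.addT_cost_le (hu i) (hv i)

theorem Cap.vecSubT_cost_le (h : Cap μ B W) (hu : ∀ i, bitSize (u i) ≤ B)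
    (hv : ∀ i, bitSize (v i) ≤ B) : (vecSubT u v).cost ≤ m * (2 * W + 1) :=
  tupleT_cost_le fun i => h.subT_cost_le (hu i) (hv i)

theorem Cap.vecScaleT_cost_le (h : Cap μ B W) {c : ℤ} (hc : bitSize c ≤ B)
    (hu : ∀ i, bitSize (u i) ≤ B) : (vecScaleT μ c u).cost ≤ m * (W + 1) :=
  tupleT_cost_le fun i => h.mulT_cost_le hc (hu i)

theorem Cap.vecNegT_cost_le (h : Cap μ B W) (hu : ∀ i, bitSize (u i) ≤ B) :
    (vecNegT u).cost ≤ m * (W + 1) :=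
  tupleT_cost_le fun i => (hu i).trans h.le

theorem Cap.vecHalfT_cost_le (h : Cap μ B W) (hu : ∀ i, bitSize (u i) ≤ B) :
    (vecHalfT u).cost ≤ m * (W + 1) :=
  tupleT_cost_le fun i => (hu i).trans h.le

theorem bitSize_dotT_le {b c : ℕ} (hb : 1 ≤ b) (hu : ∀ i, bitSize (u i) ≤ b)
    (hv : ∀ i, bitSize (v i) ≤ c) : bitSize (dotT μ u v).val ≤ b + c + m :=
  bitSize_sumT_le (by omega) fun i => bitSize_mul_le (hu i) (hv i)

theorem Cap.dotT_cost_le {b c : ℕ} (h : Cap μ (b + c + m) W) (hb : 1 ≤ b)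
    (hu : ∀ i, bitSize (u i) ≤ b) (hv : ∀ i, bitSize (v i) ≤ c) :
    (dotT μ u v).cost ≤ m * (3 * W + 1) + 1 := by
  have h1 := sumT_cost_le (f := fun i => mulT μ (u i) (v i)) (b := b + c) (c := W) (by omega)
    (fun i => bitSize_mul_le (hu i) (hv i))
    fun i => h.mulT_cost_le ((hu i).trans (by omega)) ((hv i).trans (by omega))
  have h2 : m * (W + 1 + 2 * (b + c + m)) ≤ m * (3 * W + 1) :=
    Nat.mul_le_mul_left _ (by have := h.le; omega)
  show (sumT m _).cost ≤ _
  omega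

theorem cmpVecT_cost_le {b : ℕ} (hu : ∀ i, bitSize (u i) ≤ b) (hv : ∀ i, bitSize (v i) ≤ b) :
    (cmpVecT u v).cost ≤ m * (2 * b + 3) + 1 := by
  have : (cmpListT cmpT (List.ofFn u) (List.ofFn v)).cost ≤ (List.ofFn u).length * (2 * b + 1) + 1 :=
    cmpListT_cost_le fun x hx y hy => by
      obtain ⟨i, rfl⟩ := List.mem_ofFn.1 hx
      obtain ⟨j, rfl⟩ := List.mem_ofFn.1 hy
      have h1 := hu i
      have h2 := hv j
      show bitSize (u i) + bitSize (v j) ≤ 2 * b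
      omega
  simp only [cmpVecT, Timed.cost_bind, tick_cost]
  rw [List.length_ofFn] at this
  linarith

theorem eqVecT_cost_le {b : ℕ} (hu : ∀ i, bitSize (u i) ≤ b) (hv : ∀ i, bitSize (v i) ≤ b) :
    (eqVecT u v).cost ≤ m * (2 * b + 3) + 1 := by
  simpa [eqVecT] using cmpVecT_cost_le hu hv

end Vectors

end VectorCost

/-! ## Cost of determinants and of span tests -/

section SpanCost

variable {d : ℕ}

theorem Cap.one_le {μ : ℕ → ℕ} {B W : ℕ} (h : Cap μ B W) (hB : 1 ≤ B) : 1 ≤ W := hB.trans h.le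

/-- For a fixed size the expansion has a fixed number of terms. All later bounds have the same
shape: the constant `C` depends only on dimensions and numbers of points, `b` bounds the sizes of
the input, and `W` bounds the cost of an operation on numbers of `C * b` bits. In this form bounds
can be composed by multiplying constants. -/
theorem detT_bound (m : ℕ) : ∃ C, 1 ≤ C ∧ ∀ μ b W, 1 ≤ b → Cap μ (C * b) W →
    ∀ A : Fin m → Fin m → ℤ, (∀ i j, bitSize (A i j) ≤ b) →
      bitSize (detT μ m A).val ≤ C * b ∧ (detT μ m A).cost ≤ C * W := by
  induction m with
  | zero =>
    refine ⟨2, by norm_num, fun μ b W hb h A _ => ⟨?_, ?_⟩⟩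
    · show bitSize 1 ≤ _
      rw [bitSize_one]; omega
    · have := h.one_le (by omega)
      simp only [detT, Timed.cost_bind, tick_cost, Timed.cost_pure]; omega
  | succ m ih =>
    obtain ⟨C, hC1, hC⟩ := ih
    refine ⟨(m + 1) * (m * m + C + 6) + 1 + (C + m + 2), by omega, fun μ b W hb h A hA => ?_⟩
    have hW := h.one_le (Nat.mul_pos (by positivity) hb)
    have hcap : Cap μ ((C + m + 2) * b) W := h.of_le (Nat.mul_le_mul_right _ (by omega))
    set t : Fin (m + 1) → Timed ℤ := fun j => do
      tick (m * m + 1)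
      let δ ← detT μ m (fun r c => A r.succ (j.succAbove c))
      let t ← mulT μ (A 0 j) δ
      if (j : ℕ) % 2 = 0 then pure t else negT t with ht
    have hdet : detT μ (m + 1) A = sumT (m + 1) t := rfl
    have hsub : ∀ j : Fin (m + 1), _ := fun j =>
      hC μ b W hb (h.of_le (Nat.mul_le_mul_right _ (by omega)))
        (fun r c => A r.succ (j.succAbove c)) fun r c => hA _ _
    have hle1 : C * b ≤ (C + m + 2) * b := Nat.mul_le_mul_right _ (by omega)
    have hle2 : b ≤ (C + m + 2) * b := Nat.le_mul_of_pos_left _ (by omega)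
    have hmul : ∀ j : Fin (m + 1),
        bitSize (A 0 j * (detT μ m (fun r c => A r.succ (j.succAbove c))).val) ≤ (C + 1) * b :=
      fun j => by
        have := bitSize_mul_le (hA 0 j) (hsub j).1
        rw [add_mul]; omega
    have hbits : ∀ j, bitSize (t j).val ≤ (C + 1) * b := by
      intro j
      have := hmul j
      simp only [ht, Timed.val_bind]
      split
      · exact this
      · show bitSize (-_) ≤ _
        rw [bitSize_neg]; exact this
    have hcost : ∀ j, (t j).cost ≤ (m * m + C + 3) * W := by
      intro j
      have h1 := (hsub j).2
      have h2 := hcap.mulT_cost_le ((hA 0 j).trans hle2) ((hsub j).1.trans hle1)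
      have h3 : (C + 1) * b ≤ W :=
        (Nat.mul_le_mul_right _ (by omega : C + 1 ≤ C + m + 2)).trans hcap.le
      have h4 := (hmul j).trans h3
      have h5 : m * m + 1 ≤ (m * m + 1) * W := Nat.le_mul_of_pos_right _ hW
      have h6 : (t j).cost ≤ (m * m + 1) + (C * W + (W + W)) := by
        simp only [ht, Timed.cost_bind, tick_cost]
        refine Nat.add_le_add_left (Nat.add_le_add h1 (Nat.add_le_add h2 ?_)) _
        split
        · exact Nat.zero_le _
        · exact h4
      calc (t j).cost ≤ (m * m + 1) * W + (C * W + (W + W)) := h6.trans (by omega)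
        _ = (m * m + C + 3) * W := by ring
    have hb1 : 1 ≤ (C + 1) * b := by nlinarith
    have hb2 : (C + 1) * b + (m + 1) ≤ (C + m + 2) * b := by nlinarith
    rw [hdet]
    constructor
    · exact (bitSize_sumT_le hb1 hbits).trans (hb2.trans (Nat.mul_le_mul_right _ (by omega)))
    · have h1 := sumT_cost_le hb1 hbits hcost
      have h2 : (m + 1) * ((m * m + C + 3) * W + 1 + 2 * ((C + 1) * b + (m + 1))) ≤
          (m + 1) * ((m * m + C + 6) * W) := by
        refine Nat.mul_le_mul_left _ ?_
        have := hb2.trans hcap.le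
        nlinarith
      nlinarith

/-- The number of vectors varies with the frame, so one constant has to serve for all sizes up to
`N`; the sum of the single constants does. -/
theorem detT_bound_le (N : ℕ) : ∃ C, 1 ≤ C ∧ ∀ m ≤ N, ∀ μ b W, 1 ≤ b → Cap μ (C * b) W →
    ∀ A : Fin m → Fin m → ℤ, (∀ i j, bitSize (A i j) ≤ b) →
      bitSize (detT μ m A).val ≤ C * b ∧ (detT μ m A).cost ≤ C * W := by
  choose C hC1 hC using detT_bound
  refine ⟨∑ m ∈ Finset.range (N + 1), C m, ?_, fun m hm μ b W hb h A hA => ?_⟩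
  · exact (hC1 0).trans (Finset.single_le_sum (f := C) (fun _ _ => Nat.zero_le _) (by simp))
  · have hle : C m ≤ ∑ m ∈ Finset.range (N + 1), C m :=
      Finset.single_le_sum (f := C) (fun _ _ => Nat.zero_le _) (Finset.mem_range.2 (by omega))
    obtain ⟨h1, h2⟩ := hC m μ b W hb (h.of_le (Nat.mul_le_mul_right _ hle)) A hA
    exact ⟨h1.trans (Nat.mul_le_mul_right _ hle), h2.trans (Nat.mul_le_mul_right _ hle)⟩

theorem bitSize_gramT_le {μ : ℕ → ℕ} {b m : ℕ} (hb : 1 ≤ b) {w : Fin m → Pt d}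
    (hw : ∀ i j, bitSize (w i j) ≤ b) (i j : Fin m) :
    bitSize ((gramT μ w).val i j) ≤ (d + 2) * b := by
  have := bitSize_dotT_le (μ := μ) hb (hw i) (hw j)
  have h2 : b + b + d ≤ (d + 2) * b := by nlinarith
  exact this.trans h2

theorem Cap.dotT_cost_le' {μ : ℕ → ℕ} {b W m : ℕ} {u v : Fin m → ℤ}
    (h : Cap μ ((m + 2) * b) W) (hb : 1 ≤ b)
    (hu : ∀ i, bitSize (u i) ≤ b) (hv : ∀ i, bitSize (v i) ≤ b) :
    (dotT μ u v).cost ≤ (4 * m + 1) * W := by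
  have h2 : b + b + m ≤ (m + 2) * b := by nlinarith
  have h1 := (h.of_le h2).dotT_cost_le hb hu hv
  have hW := h.one_le (by nlinarith)
  nlinarith

theorem gramT_cost_le {μ : ℕ → ℕ} {b W m : ℕ} (hb : 1 ≤ b) (h : Cap μ ((d + 2) * b) W)
    {w : Fin m → Pt d} (hw : ∀ i j, bitSize (w i j) ≤ b) :
    (gramT μ w).cost ≤ m * (m * (4 * d + 2) + 1) * W := by
  have hW := h.one_le (by nlinarith)
  have h1 : (gramT μ w).cost ≤ m * (m * ((4 * d + 1) * W + 1) + 1) :=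
    tupleT_cost_le fun i => tupleT_cost_le fun j => h.dotT_cost_le' hb (hw i) (hw j)
  refine h1.trans ?_
  calc m * (m * ((4 * d + 1) * W + 1) + 1) ≤ m * (m * ((4 * d + 1) * W + W) + W) := by gcongr
    _ = _ := by ring

theorem gramDetT_bound (d N : ℕ) : ∃ C, 1 ≤ C ∧ ∀ μ b W, 1 ≤ b → Cap μ (C * b) W →
    ∀ vs : List (Pt d), vs.length ≤ N → (∀ v ∈ vs, ∀ i, bitSize (v i) ≤ b) →
      (gramDetT μ vs).cost ≤ C * W := by
  obtain ⟨C, hC1, hC⟩ := detT_bound_le N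
  refine ⟨C * (d + 2) + N + N * (N * (4 * d + 2) + 1),
    by have : 0 < C := hC1
       exact Nat.succ_le_of_lt (by positivity), fun μ b W hb h vs hN hvs => ?_⟩
  have hget : ∀ i j, bitSize (vs.get i j) ≤ b := fun i j => hvs _ (List.get_mem vs i) j
  have hC0 : 0 < C := hC1
  have hW := h.one_le (Nat.mul_pos (by positivity) hb)
  have hcap : Cap μ (C * ((d + 2) * b)) W :=
    h.of_le (by rw [← mul_assoc]; exact Nat.mul_le_mul_right _ (by omega))
  have h1 := gramT_cost_le (μ := μ) hb (hcap.of_le (Nat.le_mul_of_pos_left _ hC1)) hget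
  have h2 := (hC vs.length hN μ ((d + 2) * b) W (by nlinarith) hcap (gramT μ vs.get).val
    (bitSize_gramT_le hb hget)).2
  have h3 : vs.length * (vs.length * (4 * d + 2) + 1) * W ≤ N * (N * (4 * d + 2) + 1) * W := by
    gcongr
  have h4 : C * W ≤ C * (d + 2) * W := by
    rw [mul_assoc]; exact Nat.mul_le_mul_left _ (Nat.le_mul_of_pos_left _ (by omega))
  have h5 : vs.length ≤ N * W := hN.trans (Nat.le_mul_of_pos_right _ hW)
  have h6 : (gramDetT μ vs).cost = vs.length + ((gramT μ vs.get).cost +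
    (detT μ vs.length (gramT μ vs.get).val).cost) := rfl
  rw [h6, add_mul, add_mul]
  omega

theorem diffsT_cost_le {μ : ℕ → ℕ} {B W : ℕ} (h : Cap μ B W) (hW : 1 ≤ W) {q : Pt d}
    {qs : List (Pt d)} (hq : ∀ i, bitSize (q i) ≤ B) (hqs : ∀ v ∈ qs, ∀ i, bitSize (v i) ≤ B) :
    (diffsT q qs).cost ≤ (qs.length * (3 * d + 1) + 1) * W := by
  have h1 : (diffsT q qs).cost ≤ qs.length * (d * (2 * W + 1) + 1) + 1 :=
    mapT_cost_le fun v hv => h.vecSubT_cost_le (hqs v hv) hq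
  refine h1.trans ?_
  calc qs.length * (d * (2 * W + 1) + 1) + 1 ≤ qs.length * (d * (2 * W + W) + W) + W := by gcongr
    _ = _ := by ring

theorem bitSize_diffsT_le {b : ℕ} {q : Pt d} {qs : List (Pt d)} (hq : ∀ i, bitSize (q i) ≤ b)
    (hqs : ∀ v ∈ qs, ∀ i, bitSize (v i) ≤ b) :
    ∀ v ∈ (diffsT q qs).val, ∀ i, bitSize (v i) ≤ b + 1 := by
  intro v hv i
  rw [diffsT, mapT_val] at hv
  obtain ⟨w, hw, rfl⟩ := List.mem_map.1 hv
  exact bitSize_sub_le (hqs w hw i) (hq i)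

theorem length_diffsT (q : Pt d) (qs : List (Pt d)) : (diffsT q qs).val.length = qs.length := by
  rw [diffsT, mapT_val, List.length_map]

theorem gramDet_diffsT_bound (d N : ℕ) : ∃ C, 1 ≤ C ∧ ∀ μ b W, 1 ≤ b → Cap μ (C * b) W →
    ∀ (q : Pt d) (qs : List (Pt d)), qs.length ≤ N → (∀ i, bitSize (q i) ≤ b) →
      (∀ v ∈ qs, ∀ i, bitSize (v i) ≤ b) →
      (diffsT q qs).cost + (gramDetT μ (diffsT q qs).val).cost ≤ C * W := by
  obtain ⟨C, hC1, hC⟩ := gramDetT_bound d N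
  refine ⟨2 * C + (N * (3 * d + 1) + 1), by omega, fun μ b W hb h q qs hN hq hqs => ?_⟩
  have hcap : Cap μ (C * (b + 1)) W := h.of_le <|
    calc C * (b + 1) ≤ C * (b + b) := by gcongr
      _ = 2 * C * b := by ring
      _ ≤ _ := Nat.mul_le_mul_right _ (Nat.le_add_right _ _)
  have hW := hcap.one_le (by nlinarith)
  have hB : b ≤ C * (b + 1) := by nlinarith
  have h1 := diffsT_cost_le hcap hW (fun i => (hq i).trans hB) fun v hv i => (hqs v hv i).trans hB
  have h2 := hC μ (b + 1) W (by omega) hcap (diffsT q qs).val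
    (by rw [length_diffsT]; exact hN) (bitSize_diffsT_le hq hqs)
  have h3 : (qs.length * (3 * d + 1) + 1) * W ≤ (N * (3 * d + 1) + 1) * W := by gcongr
  rw [add_mul, mul_assoc 2]
  omega

theorem indepT_bound (d N : ℕ) : ∃ C, 1 ≤ C ∧ ∀ μ b W, 1 ≤ b → Cap μ (C * b) W →
    ∀ qs : List (Pt d), qs.length ≤ N → (∀ v ∈ qs, ∀ i, bitSize (v i) ≤ b) →
      (indepT μ qs).cost ≤ C * W := by
  obtain ⟨C, hC1, hC⟩ := gramDet_diffsT_bound d N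
  refine ⟨C + 1, by omega, fun μ b W hb h qs hN hqs => ?_⟩
  have hW := h.one_le (by nlinarith)
  match qs with
  | [] =>
    simp only [indepT, Timed.cost_bind, tick_cost, Timed.cost_pure]
    nlinarith
  | q :: qs =>
    have h1 := hC μ b W hb (h.of_le (by nlinarith)) q qs (by simp at hN; omega) (hqs q (by simp))
      fun v hv => hqs v (by simp [hv])
    have h2 : (indepT μ (q :: qs)).cost = (diffsT q qs).cost +
      ((gramDetT μ (diffsT q qs).val).cost + (1 + 0)) := rfl
    rw [h2, add_mul]
    omega

theorem inSpanT_bound (d N : ℕ) : ∃ C, 1 ≤ C ∧ ∀ μ b W, 1 ≤ b → Cap μ (C * b) W →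
    ∀ (x : Pt d) (qs : List (Pt d)), qs.length ≤ N → (∀ i, bitSize (x i) ≤ b) →
      (∀ v ∈ qs, ∀ i, bitSize (v i) ≤ b) → (inSpanT μ x qs).cost ≤ C * W := by
  obtain ⟨C, hC1, hC⟩ := gramDet_diffsT_bound d N
  refine ⟨C + 1, by omega, fun μ b W hb h x qs hN hx hqs => ?_⟩
  have hW := h.one_le (by nlinarith)
  match qs with
  | [] =>
    simp only [inSpanT, Timed.cost_bind, tick_cost, Timed.cost_pure]
    nlinarith
  | q :: qs =>
    have h1 := hC μ b W hb (h.of_le (by nlinarith)) q (x :: qs) (by simp at hN ⊢; omega)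
      (hqs q (by simp)) fun v hv => by
        rcases List.mem_cons.1 hv with rfl | hv
        · exact hx
        · exact hqs v (by simp [hv])
    have h2 : (inSpanT μ x (q :: qs)).cost = (diffsT q (x :: qs)).cost +
      ((gramDetT μ (diffsT q (x :: qs)).val).cost + 1) := rfl
    rw [h2, add_mul]
    omega

end SpanCost

/-! ## Cost of the operations on rational frames -/

section RationalFrameCost

variable {d : ℕ}

/-- The common denominator and the points of `Q` have at most `b` bits. -/
structure RFrame.BitsLE (Q : RFrame d) (b : ℕ) : Prop where
  den : bitSize Q.den ≤ b
  pts : ∀ q ∈ Q.pts, ∀ i, bitSize (q i) ≤ b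

theorem bitSize_vecScaleT_le {μ : ℕ → ℕ} {b : ℕ} {c : ℤ} {x : Pt d} (hc : bitSize c ≤ b)
    (hx : ∀ i, bitSize (x i) ≤ b) (i : Fin d) : bitSize ((vecScaleT μ c x).val i) ≤ 2 * b := by
  have := bitSize_mul_le hc (hx i)
  show bitSize (c * x i) ≤ _
  omega

theorem RFrame.memSpanT_bound (d N : ℕ) : ∃ C, 1 ≤ C ∧ ∀ μ b W, 1 ≤ b → Cap μ (C * b) W →
    ∀ (Q : RFrame d) (x : Pt d), Q.pts.length ≤ N → Q.BitsLE b → (∀ i, bitSize (x i) ≤ b) →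
      (Q.memSpanT μ x).cost ≤ C * W := by
  obtain ⟨C, hC1, hC⟩ := inSpanT_bound d N
  refine ⟨2 * C + 2 * d, by omega, fun μ b W hb h Q x hN hQ hx => ?_⟩
  have hcap : Cap μ (C * (2 * b)) W := h.of_le <| by
    calc C * (2 * b) = 2 * C * b := by ring
      _ ≤ _ := Nat.mul_le_mul_right _ (Nat.le_add_right _ _)
  have hW := hcap.one_le (Nat.mul_pos hC1 (by omega))
  have hB : b ≤ C * (2 * b) := by nlinarith
  have h1 := hC μ (2 * b) W (by omega) hcap (vecScaleT μ Q.den x).val Q.pts hN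
    (bitSize_vecScaleT_le hQ.den hx) fun v hv i => (hQ.pts v hv i).trans (by omega)
  have h2 := hcap.vecScaleT_cost_le (hQ.den.trans hB) fun i => (hx i).trans hB
  have h3 : (Q.memSpanT μ x).cost = (vecScaleT μ Q.den x).cost +
    (inSpanT μ (vecScaleT μ Q.den x).val Q.pts).cost := rfl
  have h4 : d * (W + 1) ≤ d * (W + W) := by gcongr
  rw [h3]
  nlinarith

theorem RFrame.unionT_pts (μ : ℕ → ℕ) (Q : RFrame d) (R : List (Pt d)) :
    (Q.unionT μ R).val.pts = Q.pts ++ R.map (fun x => (vecScaleT μ Q.den x).val) := by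
  simp only [RFrame.unionT, Timed.val_bind, appendT_val, mapT_val, Timed.val_pure]

theorem RFrame.length_unionT (μ : ℕ → ℕ) (Q : RFrame d) (R : List (Pt d)) :
    (Q.unionT μ R).val.pts.length = Q.pts.length + R.length := by
  rw [RFrame.unionT_pts, List.length_append, List.length_map]

theorem RFrame.BitsLE.unionT {μ : ℕ → ℕ} {Q : RFrame d} {R : List (Pt d)} {b : ℕ}
    (hQ : Q.BitsLE b) (hR : ∀ x ∈ R, ∀ i, bitSize (x i) ≤ b) :
    (Q.unionT μ R).val.BitsLE (2 * b) := by
  refine ⟨hQ.den.trans (by omega), fun q hq i => ?_⟩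
  rw [RFrame.unionT_pts, List.mem_append] at hq
  rcases hq with hq | hq
  · exact (hQ.pts q hq i).trans (by omega)
  · obtain ⟨x, hx, rfl⟩ := List.mem_map.1 hq
    exact bitSize_vecScaleT_le hQ.den (hR x hx) i

theorem RFrame.unionT_cost_le {μ : ℕ → ℕ} {B W N : ℕ} (h : Cap μ B W) (hW : 1 ≤ W)
    {Q : RFrame d} {R : List (Pt d)} (hQN : Q.pts.length ≤ N) (hRN : R.length ≤ N)
    (hQ : bitSize Q.den ≤ B) (hR : ∀ x ∈ R, ∀ i, bitSize (x i) ≤ B) :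
    (Q.unionT μ R).cost ≤ (N * (2 * d + 2) + 2) * W := by
  have h1 : (mapT (vecScaleT μ Q.den) R).cost ≤ R.length * (d * (W + 1) + 1) + 1 :=
    mapT_cost_le fun x hx => h.vecScaleT_cost_le hQ (hR x hx)
  have h2 : R.length * (d * (W + 1) + 1) + 1 ≤ N * (d * (W + W) + W) + W := by gcongr
  have h3 : (Q.unionT μ R).cost = (mapT (vecScaleT μ Q.den) R).cost + (Q.pts.length + 1 + 0) := by
    rw [← appendT_cost Q.pts (mapT (vecScaleT μ Q.den) R).val]
    rfl
  nlinarith [Nat.mul_le_mul_left N hW]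

theorem RFrame.shrinkT_cost_le {μ : ℕ → ℕ} {b W N : ℕ} (h : Cap μ (2 * b) W) (hb : 1 ≤ b)
    {Q : RFrame d} {p : Pt d} (hQN : Q.pts.length ≤ N) (hQ : Q.BitsLE b)
    (hp : ∀ i, bitSize (p i) ≤ b) : (Q.shrinkT μ p).cost ≤ (N * (3 * d + 1) + 2 * d + 3) * W := by
  have hW := h.one_le (by omega)
  have h1 := h.vecScaleT_cost_le (u := p) (hQ.den.trans (by omega))
    fun i => (hp i).trans (by omega)
  have h2 := diffsT_cost_le h hW (bitSize_vecScaleT_le (μ := μ) hQ.den hp)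
    fun v hv i => (hQ.pts v hv i).trans (by omega)
  have h3 := h.addT_cost_le (x := Q.den) (y := Q.den) (hQ.den.trans (by omega))
    (hQ.den.trans (by omega))
  have h4 : (Q.shrinkT μ p).cost = (vecScaleT μ Q.den p).cost +
    ((diffsT (vecScaleT μ Q.den p).val Q.pts).cost + ((addT Q.den Q.den).cost + 0)) := rfl
  have h5 : (Q.pts.length * (3 * d + 1) + 1) * W ≤ (N * (3 * d + 1) + 1) * W := by gcongr
  have h6 : d * (W + 1) ≤ d * (W + W) := by gcongr
  nlinarith

theorem RFrame.interT_bound (d N : ℕ) : ∃ C, 1 ≤ C ∧ ∀ μ b W, 1 ≤ b → Cap μ (C * b) W →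
    ∀ (Q : RFrame d) (Λ : List (Pt d)), Q.pts.length ≤ N → Q.BitsLE b →
      (∀ p ∈ Λ, ∀ i, bitSize (p i) ≤ b) →
      (Q.interT μ Λ).cost ≤ C * ((Λ.length + 1) * W) ∧ (Q.interT μ Λ).val.length ≤ N := by
  refine ⟨(2 * d + 1) + N * (d * 5 + 4) + 3 * N + 3, by omega,
    fun μ b W hb h Q Λ hN hQ hΛ => ?_⟩
  have hcap : Cap μ (2 * b) W := h.of_le (Nat.mul_le_mul_right _ (by omega))
  have hW := hcap.one_le (by omega)
  set n := Λ.length with hn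
  set sc := mapT (fun p => do
    let y ← vecScaleT μ Q.den p
    pure (y, p)) Λ with hsc
  set f : Pt d → Timed (List (Pt d)) := fun q => do
    let o ← findT (fun yp : Pt d × Pt d => eqVecT yp.1 q) sc.val
    match o with
    | none => pure []
    | some yp => pure [yp.2] with hf
  have h1 : sc.cost ≤ n * (d * (W + 1) + 1) + 1 := mapT_cost_le fun p hp => by
    simpa using hcap.vecScaleT_cost_le (hQ.den.trans (by omega))
      fun i => (hΛ p hp i).trans (by omega)
  have hscval : sc.val = Λ.map (fun p => ((vecScaleT μ Q.den p).val, p)) := by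
    rw [hsc, mapT_val]
    rfl
  have h2 : ∀ q ∈ Q.pts, (f q).cost ≤ n * (d * (4 * b + 3) + 2) + 1 := by
    intro q hq
    have h3 : (findT (fun yp : Pt d × Pt d => eqVecT yp.1 q) sc.val).cost ≤
        sc.val.length * ((d * (2 * (2 * b) + 3) + 1) + 1) + 1 := by
      refine findT_cost_le fun yp hyp => ?_
      rw [hscval] at hyp
      obtain ⟨p, hp, rfl⟩ := List.mem_map.1 hyp
      exact eqVecT_cost_le (bitSize_vecScaleT_le (μ := μ) hQ.den (hΛ p hp))
        fun i => (hQ.pts q hq i).trans (by omega)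
    have h4 : (f q).cost = (findT (fun yp : Pt d × Pt d => eqVecT yp.1 q) sc.val).cost := by
      simp only [hf, Timed.cost_bind]
      split <;> simp
    rw [h4]
    refine h3.trans (le_of_eq ?_)
    rw [hscval, List.length_map]
    ring
  have hflen : ∀ q, (f q).val.length ≤ 1 := by
    intro q
    simp only [hf, Timed.val_bind]
    split <;> simp
  have h3 : (mapT f Q.pts).cost ≤ N * (n * (d * (4 * b + 3) + 2) + 1 + 1) + 1 :=
    (mapT_cost_le h2).trans (by gcongr)
  have hmlen : (mapT f Q.pts).val.length ≤ N := by rw [mapT_val, List.length_map]; exact hN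
  have hflat : ((mapT f Q.pts).val).flatten.length ≤ N := by
    refine (length_flatten_le (c := 1) fun l hl => ?_).trans (by omega)
    rw [mapT_val] at hl
    obtain ⟨q, -, rfl⟩ := List.mem_map.1 hl
    exact hflen q
  have hval : (Q.interT μ Λ).val = ((mapT f Q.pts).val).flatten := by
    rw [← flattenT_val]
    rfl
  have hcost : (Q.interT μ Λ).cost = sc.cost + ((mapT f Q.pts).cost +
    (flattenT (mapT f Q.pts).val).cost) := rfl
  refine ⟨?_, hval ▸ hflat⟩
  rw [hcost, flattenT_cost]
  have hbW : b ≤ W := le_trans (by omega) hcap.le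
  have h2bW : 4 * b ≤ 2 * W := by have := hcap.le; omega
  calc _ ≤ (n * (d * (W + 1) + 1) + 1) + ((N * (n * (d * (4 * b + 3) + 2) + 1 + 1) + 1) +
        (N + 2 * N + 1)) := by gcongr
    _ ≤ ((n + 1) * (d * (W + W) + W) + (n + 1) * W) +
        ((N * ((n + 1) * (d * (2 * W + 3 * W) + 2 * W) + (n + 1) * W + (n + 1) * W) + (n + 1) * W)
          + (n + 1) * W + 3 * N * ((n + 1) * W)) := by
        have e1 : n ≤ n + 1 := by omega
        have e2 : 1 ≤ (n + 1) * W := Nat.mul_pos (by omega) hW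
        have e3 : (3 : ℕ) ≤ 3 * W := by omega
        have e4 : (2 : ℕ) ≤ 2 * W := by omega
        have e5 : n * (d * (4 * b + 3) + 2) ≤ (n + 1) * (d * (2 * W + 3 * W) + 2 * W) := by gcongr
        have e6 : n * (d * (W + 1) + 1) ≤ (n + 1) * (d * (W + W) + W) := by gcongr
        have e7 : N * (n * (d * (4 * b + 3) + 2) + 1 + 1) ≤
          N * ((n + 1) * (d * (2 * W + 3 * W) + 2 * W) + (n + 1) * W + (n + 1) * W) := by gcongr
        have e8 : 3 * N * 1 ≤ 3 * N * ((n + 1) * W) := by gcongr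
        linarith
    _ = _ := by ring

end RationalFrameCost

/-! ## Cost of the completion of a frame -/

section ExtensionCost

variable {d : ℕ}

/-- The coordinates of the point `p`, multiplied by a common denominator. -/
def pointCoordsT (μ : ℕ → ℕ) (den : ℤ) (q₀ : Pt d) {m : ℕ} (w : Fin m → Pt d)
    (G : Fin m → Fin m → ℤ) (p : Pt d) : Timed (List ℤ × Pt d) := do
  let x ← vecScaleT μ den p
  let y ← vecSubT x q₀
  let b ← tupleT (fun i => dotT μ (w i) y)
  let c ← tupleT (fun i : Fin m => do
    tick (m * m)
    detT μ m (fun r s => if s = i then b r else G r s))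
  tick m
  pure (List.ofFn c, p)

theorem pointCoordsT_bound (d N : ℕ) : ∃ C, 1 ≤ C ∧ ∀ μ b W, 1 ≤ b → Cap μ (C * b) W →
    ∀ (den : ℤ) (q₀ : Pt d) (m : ℕ) (w : Fin m → Pt d) (G : Fin m → Fin m → ℤ) (p : Pt d),
      m ≤ N → bitSize den ≤ b → (∀ i, bitSize (q₀ i) ≤ b) → (∀ i j, bitSize (w i j) ≤ b) →
      (∀ i j, bitSize (G i j) ≤ b) → (∀ i, bitSize (p i) ≤ b) →
      (pointCoordsT μ den q₀ w G p).cost ≤ C * W ∧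
      ∀ c ∈ (pointCoordsT μ den q₀ w G p).val.1, bitSize c ≤ C * b := by
  obtain ⟨C, hC1, hC⟩ := detT_bound_le N
  refine ⟨C * ((d + 2) * 3) + (5 * d + N * (4 * d + 2) + N * (N * N + C + 1) + N),
    by have : 0 < C := hC1
       exact Nat.succ_le_of_lt (by positivity),
    fun μ b W hb h den q₀ m w G p hm hden hq hw hG hp => ?_⟩
  have hcap : Cap μ (C * ((d + 2) * (3 * b))) W := h.of_le <| by
    calc C * ((d + 2) * (3 * b)) = C * ((d + 2) * 3) * b := by ring
      _ ≤ _ := Nat.mul_le_mul_right _ (Nat.le_add_right _ _)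
  have hcap' : Cap μ ((d + 2) * (3 * b)) W := hcap.of_le (Nat.le_mul_of_pos_left _ hC1)
  have hcap'' : Cap μ (3 * b) W := hcap'.of_le (Nat.le_mul_of_pos_left _ (by omega))
  have hW := hcap''.one_le (by omega)
  set x := vecScaleT μ den p with hx
  have hxb : ∀ i, bitSize (x.val i) ≤ 2 * b := bitSize_vecScaleT_le hden hp
  set y := vecSubT x.val q₀ with hy
  have hyb : ∀ i, bitSize (y.val i) ≤ 3 * b := fun i =>
    (bitSize_sub_le (hxb i) ((hq i).trans (by omega))).trans (by omega)
  set v := tupleT (fun i => dotT μ (w i) y.val) with hv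
  have hvb : ∀ i, bitSize (v.val i) ≤ (d + 2) * (3 * b) := fun i => by
    have := bitSize_dotT_le (μ := μ) (b := b) hb (hw i) hyb
    have h2 : b + 3 * b + d ≤ (d + 2) * (3 * b) := by nlinarith
    exact this.trans h2
  have hGb : ∀ i j, bitSize (G i j) ≤ (d + 2) * (3 * b) := fun i j =>
    (hG i j).trans (by nlinarith)
  have hdet : ∀ i : Fin m, _ := fun i =>
    hC m hm μ ((d + 2) * (3 * b)) W (by nlinarith) hcap
      (fun r s => if s = i then v.val r else G r s) fun r s => by
        split
        · exact hvb r
        · exact hGb r s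
  set c := tupleT (fun i : Fin m => do
    tick (m * m)
    detT μ m (fun r s => if s = i then v.val r else G r s)) with hc
  have hval : (pointCoordsT μ den q₀ w G p).val.1 = List.ofFn c.val := rfl
  have hcost : (pointCoordsT μ den q₀ w G p).cost =
    x.cost + (y.cost + (v.cost + (c.cost + (m + 0)))) := rfl
  constructor
  · have h1 : x.cost ≤ d * (W + 1) := hcap''.vecScaleT_cost_le (hden.trans (by omega))
      fun i => (hp i).trans (by omega)
    have h2 : y.cost ≤ d * (2 * W + 1) := hcap''.vecSubT_cost_le (fun i => (hxb i).trans (by omega))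
      fun i => (hq i).trans (by omega)
    have h3 : v.cost ≤ m * ((4 * d + 1) * W + 1) := tupleT_cost_le fun i =>
      hcap'.dotT_cost_le' (by omega) (fun j => (hw i j).trans (by omega)) hyb
    have h4 : c.cost ≤ m * (m * m + C * W + 1) := tupleT_cost_le fun i =>
      Nat.add_le_add_left (hdet i).2 _
    rw [hcost]
    calc _ ≤ d * (W + 1) + (d * (2 * W + 1) + (m * ((4 * d + 1) * W + 1) +
          (m * (m * m + C * W + 1) + (m + 0)))) := by gcongr
      _ ≤ d * (W + W) + (d * (2 * W + W) + (N * ((4 * d + 1) * W + W) +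
          (N * (N * N * W + C * W + W) + (N * W + 0)))) := by
        have e1 : m ≤ N * W := hm.trans (Nat.le_mul_of_pos_right _ hW)
        have e2 : m * m ≤ N * N * W :=
          (Nat.mul_le_mul hm hm).trans (Nat.le_mul_of_pos_right _ hW)
        gcongr
      _ = (5 * d + N * (4 * d + 2) + N * (N * N + C + 1) + N) * W := by ring
      _ ≤ _ := Nat.mul_le_mul_right _ (Nat.le_add_left _ _)
  · intro z hz
    rw [hval] at hz
    obtain ⟨i, rfl⟩ := List.mem_ofFn.1 hz
    refine (hdet i).1.trans ?_
    calc C * ((d + 2) * (3 * b)) = C * ((d + 2) * 3) * b := by ring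
      _ ≤ _ := Nat.mul_le_mul_right _ (Nat.le_add_right _ _)

theorem RFrame.coordsT_bound (d N : ℕ) : ∃ C, 1 ≤ C ∧ ∀ μ b W, 1 ≤ b → Cap μ (C * b) W →
    ∀ (Q : RFrame d) (Λ : List (Pt d)), Q.pts.length ≤ N → Q.BitsLE b →
      (∀ p ∈ Λ, ∀ i, bitSize (p i) ≤ b) →
      (Q.coordsT μ Λ).cost ≤ C * ((Λ.length + 1) * W) ∧
      (Q.coordsT μ Λ).val.length = Λ.length ∧
      ∀ cp ∈ (Q.coordsT μ Λ).val, cp.2 ∈ Λ ∧ cp.1.length ≤ N ∧ ∀ c ∈ cp.1, bitSize c ≤ C * b := by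
  obtain ⟨C, hC1, hC⟩ := pointCoordsT_bound d N
  refine ⟨C * ((d + 2) * 2) + ((N * (3 * d + 1) + 1) + N + N * (N * (4 * d + 2) + 1) + 2),
    by have : 0 < C := hC1
       exact Nat.succ_le_of_lt (by positivity),
    fun μ b W hb h Q Λ hN hQ hΛ => ?_⟩
  have hCle : C * ((d + 2) * (2 * b)) ≤ (C * ((d + 2) * 2) +
      ((N * (3 * d + 1) + 1) + N + N * (N * (4 * d + 2) + 1) + 2)) * b := by
    calc C * ((d + 2) * (2 * b)) = C * ((d + 2) * 2) * b := by ring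
      _ ≤ _ := Nat.mul_le_mul_right _ (Nat.le_add_right _ _)
  have hcap : Cap μ (C * ((d + 2) * (2 * b))) W := h.of_le hCle
  have hcap' : Cap μ ((d + 2) * (2 * b)) W := hcap.of_le (Nat.le_mul_of_pos_left _ hC1)
  have hcap'' : Cap μ (2 * b) W := hcap'.of_le (Nat.le_mul_of_pos_left _ (by omega))
  have hW := hcap''.one_le (by omega)
  obtain ⟨den, pts⟩ := Q
  match pts with
  | [] =>
    have hcost : (RFrame.coordsT μ ⟨den, []⟩ Λ).cost =
      (mapT (fun p => pure (([] : List ℤ), p)) Λ).cost := rfl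
    have hval : (RFrame.coordsT μ ⟨den, []⟩ Λ).val = Λ.map (fun p => ([], p)) := by
      show (mapT (fun p => pure (([] : List ℤ), p)) Λ).val = _
      rw [mapT_val]
      rfl
    rw [hcost, hval]
    refine ⟨?_, by simp, ?_⟩
    · have h1 : (mapT (fun p => pure (([] : List ℤ), p)) Λ).cost ≤ Λ.length * (0 + 1) + 1 :=
        mapT_cost_le fun _ _ => le_rfl
      calc _ ≤ Λ.length * (0 + 1) + 1 := h1
        _ = 1 * ((Λ.length + 1) * 1) := by ring
        _ ≤ _ := Nat.mul_le_mul (by omega) (Nat.mul_le_mul_left _ hW)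
    · intro cp hcp
      obtain ⟨p, hp, rfl⟩ := List.mem_map.1 hcp
      exact ⟨hp, by simp, by simp⟩
  | q₀ :: qs =>
    have hqs : qs.length ≤ N := by simp at hN; omega
    set vs := (diffsT q₀ qs).val with hvs
    have hq₀ : ∀ i, bitSize (q₀ i) ≤ b := hQ.pts q₀ (by simp)
    have hqsb : ∀ v ∈ qs, ∀ i, bitSize (v i) ≤ b := fun v hv => hQ.pts v (by simp [hv])
    have hvsb : ∀ i j, bitSize (vs.get i j) ≤ 2 * b := fun i j =>
      (bitSize_diffsT_le hq₀ hqsb _ (List.get_mem vs i) j).trans (by omega)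
    have hm : vs.length ≤ N := by rw [hvs, length_diffsT]; exact hqs
    have hle : 2 * b ≤ (d + 2) * (2 * b) := Nat.le_mul_of_pos_left _ (by omega)
    have hpc : ∀ p ∈ Λ, _ := fun p hp =>
      hC μ ((d + 2) * (2 * b)) W (by omega) hcap den q₀ vs.length vs.get (gramT μ vs.get).val p hm
        (hQ.den.trans (by omega)) (fun i => (hq₀ i).trans (by omega))
        (fun i j => (hvsb i j).trans hle) (bitSize_gramT_le (by omega) hvsb)
        (fun i => (hΛ p hp i).trans (by omega))
    have hcost : (RFrame.coordsT μ ⟨den, q₀ :: qs⟩ Λ).cost = (diffsT q₀ qs).cost +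
      (vs.length + ((gramT μ vs.get).cost +
        (mapT (pointCoordsT μ den q₀ vs.get (gramT μ vs.get).val) Λ).cost)) := rfl
    have hval : (RFrame.coordsT μ ⟨den, q₀ :: qs⟩ Λ).val =
        Λ.map (fun p => (pointCoordsT μ den q₀ vs.get (gramT μ vs.get).val p).val) := by
      rw [← mapT_val]
      rfl
    rw [hcost, hval]
    refine ⟨?_, by simp, ?_⟩
    · have h1 := diffsT_cost_le hcap'' hW (fun i => (hq₀ i).trans (by omega))
        fun v hv i => (hqsb v hv i).trans (by omega : b ≤ 2 * b)
      have h2 := gramT_cost_le (by omega) hcap' hvsb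
      have h3 : (mapT (pointCoordsT μ den q₀ vs.get (gramT μ vs.get).val) Λ).cost ≤
        Λ.length * (C * W + 1) + 1 := mapT_cost_le fun p hp => (hpc p hp).1
      set n := Λ.length
      calc _ ≤ (qs.length * (3 * d + 1) + 1) * W + (vs.length +
            (vs.length * (vs.length * (4 * d + 2) + 1) * W + (n * (C * W + 1) + 1))) := by gcongr
        _ ≤ (N * (3 * d + 1) + 1) * ((n + 1) * W) + (N * ((n + 1) * W) +
            (N * (N * (4 * d + 2) + 1) * ((n + 1) * W) +
              ((n + 1) * (C * W + W) + (n + 1) * W))) := by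
          have e1 : W ≤ (n + 1) * W := Nat.le_mul_of_pos_left _ (by omega)
          have e2 : 1 ≤ (n + 1) * W := hW.trans e1
          have e3 : vs.length ≤ N * ((n + 1) * W) := hm.trans (Nat.le_mul_of_pos_right _ e2)
          have e4 : n ≤ n + 1 := by omega
          gcongr
        _ = (C + ((N * (3 * d + 1) + 1) + N + N * (N * (4 * d + 2) + 1) + 2)) *
            ((n + 1) * W) := by ring
        _ ≤ _ := by
          gcongr
          exact Nat.le_mul_of_pos_right _ (by omega)
    · intro cp hcp
      obtain ⟨p, hp, rfl⟩ := List.mem_map.1 hcp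
      refine ⟨hp, ?_, fun c hc => ((hpc p hp).2 c hc).trans hCle⟩
      have : (pointCoordsT μ den q₀ vs.get (gramT μ vs.get).val p).val.1.length = vs.length :=
        List.length_ofFn
      omega

/-- The factor `r + 1` counts the iterations. The number of points is bounded together with the
cost, because the span tests are charged according to the length of `T`. -/
theorem extendT_bound (d N : ℕ) : ∃ C, 1 ≤ C ∧ ∀ μ b W, 1 ≤ b → Cap μ (C * b) W →
    ∀ (cs : List (List ℤ × Pt d)),
      (∀ cp ∈ cs, (∀ i, bitSize (cp.2 i) ≤ b) ∧ cp.1.length ≤ N ∧ ∀ c ∈ cp.1, bitSize c ≤ b) →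
    ∀ (r : ℕ) (T : List (Pt d)), T.length + r ≤ N → (∀ p ∈ T, ∀ i, bitSize (p i) ≤ b) →
      (extendT μ cs r T).cost ≤ (r + 1) * (C * ((cs.length + 1) * W)) ∧
      (extendT μ cs r T).val.length ≤ N ∧
      ∀ p ∈ (extendT μ cs r T).val, ∀ i, bitSize (p i) ≤ b := by
  obtain ⟨C, hC1, hC⟩ := inSpanT_bound d N
  refine ⟨C + 3 * N + N + 6, by omega, fun μ b W hb h cs hcs r => ?_⟩
  have hcap : Cap μ (C * b) W := h.of_le (by gcongr; omega)
  have hbW : b ≤ W := (Nat.le_mul_of_pos_left _ hC1).trans hcap.le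
  have hW : 1 ≤ W := hb.trans hbW
  set n := cs.length with hn
  have hU : 1 ≤ (n + 1) * W := Nat.mul_pos (by omega) hW
  induction r with
  | zero =>
    intro T hT hTb
    refine ⟨?_, by simpa [extendT] using hT, by simpa [extendT] using hTb⟩
    simp only [extendT, Timed.cost_bind, tick_cost, Timed.cost_pure]
    nlinarith
  | succ r ih =>
    intro T hT hTb
    set out := filterT (fun cp : List ℤ × Pt d => do
      let b ← inSpanT μ cp.2 T
      pure (!b)) cs with hout
    have hsub : ∀ cp ∈ out.val, cp ∈ cs := by
      intro cp hcp
      rw [hout, filterT_val] at hcp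
      exact List.mem_of_mem_filter hcp
    have hlen : out.val.length ≤ n := by
      rw [hout, filterT_val]
      exact List.length_filter_le _ _
    have h1 : out.cost ≤ n * (C * W + 1) + 1 := filterT_cost_le fun cp hcp => by
      simpa using hC μ b W hb hcap cp.2 T (by omega) (hcs cp hcp).1 hTb
    have h1' : out.cost ≤ (n + 1) * (C * W + W) + (n + 1) * W := h1.trans (by gcongr; omega)
    have hext : extendT μ cs (r + 1) T = (do
        tick 1
        let out ← out
        match out with
        | [] => pure T
        | c :: out' => do
          let best ← minT (fun x y : List ℤ × Pt d => cmpListT cmpT x.1 y.1) c out'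
          let T' ← appendT T [best.2]
          extendT μ cs r T') := rfl
    rw [hext]
    simp only [Timed.cost_bind, Timed.val_bind, tick_cost]
    cases ho : out.val with
    | nil =>
      simp only [Timed.cost_pure, Timed.val_pure]
      refine ⟨?_, by omega, hTb⟩
      have : (n + 1) * (C * W + W) + (n + 1) * W + 1 ≤ (C + 3 * N + N + 6) * ((n + 1) * W) := by
        nlinarith
      nlinarith [Nat.zero_le (r * ((C + 3 * N + N + 6) * ((n + 1) * W)))]
    | cons c out' =>
      rw [ho] at hsub hlen
      simp only [Timed.cost_bind, Timed.val_bind, appendT_val, appendT_cost]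
      have hmem := minT_mem (fun x y : List ℤ × Pt d => cmpListT cmpT x.1 y.1) c out'
      have h2 : (minT (fun x y : List ℤ × Pt d => cmpListT cmpT x.1 y.1) c out').cost ≤
          out'.length * ((N * (2 * b + 1) + 1) + 1) + 1 := by
        refine minT_cost_le fun x hx y hy => ?_
        refine (cmpListT_cost_le (c := 2 * b) fun z hz w hw => ?_).trans ?_
        · have e1 := (hcs x (hsub x hx)).2.2 z hz
          have e2 := (hcs y (hsub y hy)).2.2 w hw
          show bitSize z + bitSize w ≤ _
          omega
        · have := (hcs x (hsub x hx)).2.1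
          gcongr
      generalize (minT (fun x y : List ℤ × Pt d => cmpListT cmpT x.1 y.1) c out') = best at *
      obtain ⟨i1, i2, i3⟩ := ih (T ++ [best.val.2]) (by simp; omega) (by
        intro p hp
        rcases List.mem_append.1 hp with hp | hp
        · exact hTb p hp
        · rw [List.mem_singleton.1 hp]
          exact (hcs _ (hsub _ hmem)).1)
      refine ⟨?_, i2, i3⟩
      have h3 : out'.length * ((N * (2 * b + 1) + 1) + 1) + 1 ≤
          (n + 1) * (N * (2 * W + W) + W + W) + (n + 1) * W := by
        have : out'.length ≤ n + 1 := by simp at hlen; omega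
        gcongr
      have h4 : T.length + 1 ≤ N * ((n + 1) * W) := by
        calc T.length + 1 ≤ N * 1 := by omega
          _ ≤ _ := Nat.mul_le_mul_left _ hU
      have h5 : (r + 1 + 1) * ((C + 3 * N + N + 6) * ((n + 1) * W)) =
        (r + 1) * ((C + 3 * N + N + 6) * ((n + 1) * W)) + ((n + 1) * (C * W + W) + (n + 1) * W +
        ((n + 1) * (N * (2 * W + W) + W + W) + (n + 1) * W) + N * ((n + 1) * W) + (n + 1) * W) := by
        ring
      rw [h5]
      omega

end ExtensionCost

/-! ## Cost of the Hermite normal form -/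

section HermiteCost

variable {d k : ℕ}

/-- The entries of a row. -/
def rowEntry (a : Row d k) : Fin k ⊕ Fin d → ℤ := Sum.elim a.1 a.2

theorem rowEntry_rowSubT (μ : ℕ → ℕ) (q : ℤ) (a b : Row d k) (x : Fin k ⊕ Fin d) :
    rowEntry (rowSubT μ q a b).val x = rowEntry a x - q * rowEntry b x := by
  cases x <;> rfl

theorem Cap.rowSubT_cost_le {μ : ℕ → ℕ} {B W : ℕ} (h : Cap μ B W) (hW : 1 ≤ W) {q : ℤ}
    {a b : Row d k} (hq : bitSize q ≤ B) (ha : ∀ x, bitSize (rowEntry a x) ≤ B)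
    (hb : ∀ x, bitSize (rowEntry b x) ≤ B) (hqb : ∀ x, bitSize (q * rowEntry b x) ≤ B) :
    (rowSubT μ q a b).cost ≤ 5 * (k + d) * W := by
  have h1 := h.vecScaleT_cost_le (u := b.1) hq fun i => hb (.inl i)
  have h2 := h.vecScaleT_cost_le (u := b.2) hq fun i => hb (.inr i)
  have h3 := h.vecSubT_cost_le (u := a.1) (v := (vecScaleT μ q b.1).val) (fun i => ha (.inl i))
    fun i => hqb (.inl i)
  have h4 := h.vecSubT_cost_le (u := a.2) (v := (vecScaleT μ q b.2).val) (fun i => ha (.inr i))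
    fun i => hqb (.inr i)
  have h5 : (rowSubT μ q a b).cost = (vecScaleT μ q b.1).cost + ((vecScaleT μ q b.2).cost +
    ((vecSubT a.1 (vecScaleT μ q b.1).val).cost +
      ((vecSubT a.2 (vecScaleT μ q b.2).val).cost + 0))) := rfl
  rw [h5]
  calc _ ≤ k * (W + 1) + (d * (W + 1) + (k * (2 * W + 1) + (d * (2 * W + 1) + 0))) := by gcongr
    _ ≤ k * (W + W) + (d * (W + W) + (k * (2 * W + W) + (d * (2 * W + W) + 0))) := by gcongr
    _ = _ := by ring

theorem bitSize_ediv_le (x y : ℤ) : bitSize (x / y) ≤ bitSize x := by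
  unfold bitSize
  exact Nat.succ_le_succ (Nat.size_le_size (Int.natAbs_ediv_le_natAbs x y))

/-- This crude quadratic bound is used for the initial steps of the Euclidean algorithm and for the
reductions above a pivot, of which there is a bounded number; the remaining divisions need a finer
estimate. -/
theorem divT_cost_le {x y : ℤ} {b : ℕ} (hx : bitSize x ≤ b) (hy : bitSize y ≤ b) :
    (divT x y).cost ≤ 3 * (b * b) := by
  have hb := (one_le_bitSize x).trans hx
  have h1 := (bitSize_ediv_le x y).trans hx
  have h2 : (divT x y).cost = bitSize x + bitSize y * (bitSize (x / y) + 1) := rfl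
  rw [h2]
  calc _ ≤ b + b * (b + 1) := by gcongr
    _ ≤ b * b + b * (b + b) := by gcongr; exact Nat.le_mul_of_pos_left _ hb
    _ = _ := by ring

theorem euclidT_zero (μ : ℕ → ℕ) (j : Fin k) (a b : Row d k) :
    (euclidT μ j 0 a b).val = (a, b) ∧ (euclidT μ j 0 a b).cost = 1 := ⟨rfl, rfl⟩

theorem euclidT_succ_of_eq_zero (μ : ℕ → ℕ) (j : Fin k) (r : ℕ) {a b : Row d k}
    (hb : b.1 j = 0) :
    (euclidT μ j (r + 1) a b).val = (a, b) ∧ (euclidT μ j (r + 1) a b).cost = 2 := by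
  have : (b.1 j == 0) = true := by simp [hb]
  simp only [euclidT, Timed.val_bind, Timed.cost_bind, isZeroT, this, tick_cost]
  exact ⟨rfl, rfl⟩

theorem euclidT_succ_of_ne_zero (μ : ℕ → ℕ) (j : Fin k) (r : ℕ) {a b : Row d k}
    (hb : b.1 j ≠ 0) :
    (euclidT μ j (r + 1) a b).val =
        (euclidT μ j r b (rowSubT μ (a.1 j / b.1 j) a b).val).val ∧
      (euclidT μ j (r + 1) a b).cost = 2 + (divT (a.1 j) (b.1 j)).cost +
        (rowSubT μ (a.1 j / b.1 j) a b).cost +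
        (euclidT μ j r b (rowSubT μ (a.1 j / b.1 j) a b).val).cost := by
  have : (b.1 j == 0) = false := by simp [hb]
  simp only [euclidT, Timed.val_bind, Timed.cost_bind, isZeroT, this, tick_cost]
  refine ⟨rfl, ?_⟩
  show 1 + (1 + ((divT (a.1 j) (b.1 j)).cost + ((rowSubT μ (a.1 j / b.1 j) a b).cost +
    (euclidT μ j r b (rowSubT μ (a.1 j / b.1 j) a b).val).cost))) = _
  omega

/-- The quantity `|u| β + |v| α` does not increase in a step of the Euclidean algorithm. -/
theorem euclid_step_entry {α β u v M : ℤ} (hα : 0 ≤ α) (hβ : 0 < β)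
    (h : |u| * β + |v| * α < M) :
    |α / β * v| < M ∧ |u - α / β * v| < M ∧ |v| * (α - α / β * β) + |u - α / β * v| * β < M := by
  have hq : 0 ≤ α / β := Int.ediv_nonneg hα hβ.le
  have hqβ : α / β * β ≤ α := Int.ediv_mul_le _ hβ.ne'
  have habs : |α / β * v| = α / β * |v| := by rw [abs_mul, abs_of_nonneg hq]
  have hsub : |u - α / β * v| ≤ |u| + α / β * |v| := habs ▸ abs_sub u (α / β * v)
  have hu := abs_nonneg u
  have hv := abs_nonneg v
  have h1 : α / β * |v| * β ≤ |v| * α := by nlinarith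
  have h0 : 0 ≤ α / β * |v| := by positivity
  have h2 : |v| * (α - α / β * β) + |u - α / β * v| * β < M := by nlinarith
  refine ⟨?_, ?_, h2⟩
  · rw [habs]; nlinarith
  · have h3 : 0 ≤ |v| * (α - α / β * β) := mul_nonneg hv (by linarith)
    have h4 := abs_nonneg (u - α / β * v)
    nlinarith

/-- The size of a quotient is paid for by the difference of the sizes of dividend and divisor. Along
the Euclidean algorithm these differences telescope. -/
theorem size_ediv_add_le {α β : ℕ} (hβ : 0 < β) (h : β ≤ α) :
    Nat.size (α / β) + Nat.size β ≤ Nat.size α + 1 := by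
  have h1 : 0 < Nat.size β := Nat.size_pos.2 hβ
  have h2 : Nat.size β ≤ Nat.size α := Nat.size_le_size h
  have h3 : 2 ^ (Nat.size β - 1) ≤ β := Nat.lt_size.1 (by omega)
  have h4 : Nat.size (α / β) ≤ Nat.size α + 1 - Nat.size β := by
    rw [Nat.size_le, Nat.div_lt_iff_lt_mul hβ]
    calc α < 2 ^ Nat.size α := Nat.lt_size_self α
      _ = 2 ^ (Nat.size α + 1 - Nat.size β) * 2 ^ (Nat.size β - 1) := by
        rw [← pow_add]; congr 1; omega
      _ ≤ _ := Nat.mul_le_mul_left _ h3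
  omega

theorem size_lt_size_of_two_mul_le {x y : ℕ} (hy : 0 < y) (h : 2 * x ≤ y) :
    Nat.size x < Nat.size y := by
  rw [Nat.lt_size]
  cases hs : Nat.size x with
  | zero => simpa using Nat.succ_le_of_lt hy
  | succ t =>
    have : 2 ^ t ≤ x := Nat.lt_size.1 (by omega)
    rw [pow_succ]
    omega

/-- The hypothesis on `|a| b_j + |b| a_j` is preserved by each step and keeps every entry below `2 ^
B`, so no growth accumulates. The potential is the sum of the sizes of `a_j` and `b_j`. It decreases
at each step, and by an amount that also controls the size of the quotient, so that all the long
divisions together cost a constant times `W` times the initial potential. -/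
theorem euclidT_bound_of_lt {μ : ℕ → ℕ} {B W : ℕ} (h : Cap μ (B + 1) W) (j : Fin k) (r : ℕ)
    {a b : Row d k} (hb : 0 ≤ b.1 j) (hba : b.1 j < a.1 j)
    (ha2 : ∀ x, |rowEntry a x| < 2 ^ B) (hb2 : ∀ x, |rowEntry b x| < 2 ^ B)
    (hab : ∀ x, |rowEntry a x| * b.1 j + |rowEntry b x| * a.1 j < 2 ^ B) :
    (euclidT μ j r a b).cost ≤ (5 * (k + d) + 7) * W *
        (Nat.size (a.1 j).natAbs + Nat.size (b.1 j).natAbs + 1) ∧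
      (∀ x, |rowEntry (euclidT μ j r a b).val.1 x| < 2 ^ B) ∧
      ∀ x, |rowEntry (euclidT μ j r a b).val.2 x| < 2 ^ B := by
  have hW := h.one_le (by omega)
  induction r generalizing a b with
  | zero =>
    obtain ⟨h1, h2⟩ := euclidT_zero μ j a b
    rw [h1, h2]
    refine ⟨?_, ha2, hb2⟩
    exact Nat.mul_pos (Nat.mul_pos (by omega) hW) (by omega)
  | succ r ih =>
    by_cases hb0 : b.1 j = 0
    · obtain ⟨h1, h2⟩ := euclidT_succ_of_eq_zero μ j r (a := a) hb0
      rw [h1, h2]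
      refine ⟨?_, ha2, hb2⟩
      calc 2 ≤ (5 * (k + d) + 7) * 1 * 1 := by omega
        _ ≤ _ := by gcongr; omega
    obtain ⟨h1, h2⟩ := euclidT_succ_of_ne_zero μ j r (a := a) hb0
    have hbpos : 0 < b.1 j := lt_of_le_of_ne hb (Ne.symm hb0)
    have hapos : 0 < a.1 j := hbpos.trans hba
    rw [h1, h2]
    set q := a.1 j / b.1 j with hq
    set c := (rowSubT μ q a b).val with hc
    have hcx : ∀ x, rowEntry c x = rowEntry a x - q * rowEntry b x := rowEntry_rowSubT μ q a b
    have hcj : c.1 j = a.1 j - q * b.1 j := hcx (.inl j)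
    have hstep : ∀ x, _ := fun x => euclid_step_entry hapos.le hbpos (hab x)
    have hmod : a.1 j - q * b.1 j = a.1 j % b.1 j := by
      rw [Int.emod_def, mul_comm]
    have hc0 : 0 ≤ c.1 j := by rw [hcj, hmod]; exact Int.emod_nonneg _ hb0
    have hcb : c.1 j < b.1 j := by rw [hcj, hmod]; exact Int.emod_lt_of_pos _ hbpos
    have hc2 : ∀ x, |rowEntry c x| < 2 ^ B := fun x => by rw [hcx]; exact (hstep x).2.1
    obtain ⟨i1, i2, i3⟩ := ih hc0 hcb hb2 hc2 fun x => by
      rw [hcx, hcj]; exact (hstep x).2.2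
    refine ⟨?_, i2, i3⟩
    have hqa : bitSize q ≤ B + 1 := (bitSize_ediv_le _ _).trans (bitSize_le_iff.2 (ha2 (.inl j)))
    have hrs := h.rowSubT_cost_le hW hqa (fun x => bitSize_le_iff.2 (ha2 x))
      (fun x => bitSize_le_iff.2 (hb2 x)) fun x => bitSize_le_iff.2 (hstep x).1
    have hqnat : q.natAbs = (a.1 j).natAbs / (b.1 j).natAbs := by
      rw [hq, Int.natAbs_ediv_of_nonneg hapos.le]
    have hdiv : (divT (a.1 j) (b.1 j)).cost = bitSize (a.1 j) + bitSize (b.1 j) * (bitSize q + 1) :=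
      rfl
    have hab' : (b.1 j).natAbs ≤ (a.1 j).natAbs := by omega
    have hsz := size_ediv_add_le (α := (a.1 j).natAbs) (β := (b.1 j).natAbs) (by omega) hab'
    rw [← hqnat] at hsz
    have hq1 : 1 ≤ q := by
      rw [hq, Int.le_ediv_iff_mul_le hbpos]; linarith
    have h2c : 2 * (c.1 j).natAbs ≤ (a.1 j).natAbs := by
      have : b.1 j + c.1 j ≤ a.1 j := by nlinarith
      omega
    have hsc := size_lt_size_of_two_mul_le (x := (c.1 j).natAbs) (y := (a.1 j).natAbs)
      (by omega) h2c
    have hcb' : Nat.size (c.1 j).natAbs ≤ Nat.size (b.1 j).natAbs := Nat.size_le_size (by omega)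
    have hba' : Nat.size (b.1 j).natAbs ≤ Nat.size (a.1 j).natAbs := Nat.size_le_size hab'
    have hbW : bitSize (b.1 j) ≤ W := (bitSize_le_iff.2 (hb2 (.inl j))).trans h.le
    have haW : bitSize (a.1 j) ≤ W := (bitSize_le_iff.2 (ha2 (.inl j))).trans h.le
    have hqs : bitSize q = Nat.size q.natAbs + 1 := rfl
    rw [hdiv, hqs]
    generalize Nat.size (a.1 j).natAbs = sa at *
    generalize Nat.size (b.1 j).natAbs = sb at *
    generalize Nat.size (c.1 j).natAbs = sc at *
    generalize Nat.size q.natAbs = sq at *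
    -- The potential drops by `e + 1` in this step, and the quotient has size at most `e + 2`.
    obtain ⟨e, rfl⟩ := Nat.exists_eq_add_of_lt hsc
    have hsq : sq + 1 + 1 ≤ e + 4 := by omega
    calc _ ≤ 2 * W + (W + W * (e + 4)) + 5 * (k + d) * W +
          (5 * (k + d) + 7) * W * (sb + sc + 1) := by
          have : 2 ≤ 2 * W := by omega
          gcongr
      _ ≤ 2 * W + (W + W * (e + 4)) + 5 * (k + d) * W + (5 * (k + d) + 6) * W * e +
          (5 * (k + d) + 7) * W * (sb + sc + 1) := by
          have := Nat.zero_le ((5 * (k + d) + 6) * W * e)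
          omega
      _ = (5 * (k + d) + 7) * W * (sc + e + 1 + sb + 1) := by ring

/-- One step of the Euclidean algorithm, on arbitrary rows. -/
theorem euclidT_bound_of_step {μ : ℕ → ℕ} {t X Y W : ℕ} (h : Cap μ (3 * t) W) (ht : 1 ≤ t)
    (hX : 3 * t ≤ X) (j : Fin k) {a b : Row d k} (ha : ∀ x, bitSize (rowEntry a x) ≤ t)
    (hb : ∀ x, bitSize (rowEntry b x) ≤ t)
    (hrec : ∀ (r : ℕ) (c : Row d k), (∀ x, bitSize (rowEntry c x) ≤ 3 * t) → 0 ≤ c.1 j →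
      c.1 j < |b.1 j| → (euclidT μ j r b c).cost ≤ Y ∧
        (∀ x, bitSize (rowEntry (euclidT μ j r b c).val.1 x) ≤ X) ∧
        ∀ x, bitSize (rowEntry (euclidT μ j r b c).val.2 x) ≤ X) (r : ℕ) :
    (euclidT μ j r a b).cost ≤ Y + 5 * (k + d + 1) * (t * W) ∧
      (∀ x, bitSize (rowEntry (euclidT μ j r a b).val.1 x) ≤ X) ∧
      ∀ x, bitSize (rowEntry (euclidT μ j r a b).val.2 x) ≤ X := by
  have hW := h.one_le (by omega)
  have htW : 1 ≤ t * W := Nat.mul_pos ht hW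
  have hconst : 2 ≤ Y + 5 * (k + d + 1) * (t * W) := by nlinarith
  have haX : ∀ x, bitSize (rowEntry a x) ≤ X := fun x => (ha x).trans (by omega)
  have hbX : ∀ x, bitSize (rowEntry b x) ≤ X := fun x => (hb x).trans (by omega)
  cases r with
  | zero =>
    obtain ⟨h1, h2⟩ := euclidT_zero μ j a b
    rw [h1, h2]
    exact ⟨by omega, haX, hbX⟩
  | succ r =>
    by_cases hb0 : b.1 j = 0
    · obtain ⟨h1, h2⟩ := euclidT_succ_of_eq_zero μ j r (a := a) hb0
      rw [h1, h2]
      exact ⟨hconst, haX, hbX⟩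
    obtain ⟨h1, h2⟩ := euclidT_succ_of_ne_zero μ j r (a := a) hb0
    rw [h1, h2]
    set q := a.1 j / b.1 j with hq
    set c := (rowSubT μ q a b).val with hc
    have hcx : ∀ x, rowEntry c x = rowEntry a x - q * rowEntry b x := rowEntry_rowSubT μ q a b
    have hcj : c.1 j = a.1 j % b.1 j := by
      have : c.1 j = a.1 j - q * b.1 j := hcx (.inl j)
      rw [this, Int.emod_def, mul_comm]
    have hqt : bitSize q ≤ t := (bitSize_ediv_le _ _).trans (ha (.inl j))
    have hqb : ∀ x, bitSize (q * rowEntry b x) ≤ t + t := fun x => bitSize_mul_le hqt (hb x)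
    obtain ⟨i1, i2, i3⟩ := hrec r c (fun x => by
        rw [hcx]
        exact (bitSize_sub_le ((ha x).trans (Nat.le_add_right t t)) (hqb x)).trans (by omega))
      (by rw [hcj]; exact Int.emod_nonneg _ hb0) (by rw [hcj]; exact Int.emod_lt_abs _ hb0)
    refine ⟨?_, i2, i3⟩
    have hrs := h.rowSubT_cost_le hW (hqt.trans (by omega)) (fun x => (ha x).trans (by omega))
      (fun x => (hb x).trans (by omega)) fun x => (hqb x).trans (by omega)
    have hdv := divT_cost_le (ha (.inl j)) (hb (.inl j))
    have h3 : 3 * (t * t) ≤ t * W := by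
      have := Nat.mul_le_mul_left t h.le
      linarith
    have h4 : 5 * (k + d) * W ≤ 5 * (k + d) * (t * W) :=
      Nat.mul_le_mul_left _ (Nat.le_mul_of_pos_left _ ht)
    have h5 : 5 * (k + d + 1) * (t * W) = 5 * (k + d) * (t * W) + 5 * (t * W) := by ring
    have hdv' : (divT (a.1 j) (b.1 j)).cost ≤ 3 * (t * t) := hdv
    omega

/-- Two steps bring arbitrary rows to the situation `0 ≤ b_j < a_j`: after the first one the second
entry is nonnegative, after the second one it is also smaller than the first entry. Sizes grow from
`t` to `3 t` and `9 t`, and the invariant quantity then has about twice as many bits, which `19 t`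
accommodates. -/
theorem euclidT_bound {μ : ℕ → ℕ} {t W : ℕ} (h : Cap μ (19 * t) W) (ht : 1 ≤ t) (j : Fin k)
    (r : ℕ) {a b : Row d k} (ha : ∀ x, bitSize (rowEntry a x) ≤ t)
    (hb : ∀ x, bitSize (rowEntry b x) ≤ t) :
    (euclidT μ j r a b).cost ≤ 200 * (k + d + 1) * (t * W) ∧
      (∀ x, bitSize (rowEntry (euclidT μ j r a b).val.1 x) ≤ 19 * t) ∧
      ∀ x, bitSize (rowEntry (euclidT μ j r a b).val.2 x) ≤ 19 * t := by
  have key : ∀ (r : ℕ) (a b : Row d k), (∀ x, bitSize (rowEntry a x) ≤ 9 * t) →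
      (∀ x, bitSize (rowEntry b x) ≤ 9 * t) → 0 ≤ b.1 j → b.1 j < a.1 j →
      (euclidT μ j r a b).cost ≤ (5 * (k + d) + 7) * W * (19 * t) ∧
      (∀ x, bitSize (rowEntry (euclidT μ j r a b).val.1 x) ≤ 19 * t) ∧
      ∀ x, bitSize (rowEntry (euclidT μ j r a b).val.2 x) ≤ 19 * t := by
    intro r a b ha hb h0 hba
    obtain ⟨e, he⟩ : ∃ e, 9 * t = e + 1 := ⟨9 * t - 1, by omega⟩
    rw [he] at ha hb
    simp only [bitSize_le_iff] at ha hb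
    have hpow : (2 : ℤ) ^ e ≤ 2 ^ (2 * e + 1) := pow_le_pow_right₀ (by norm_num) (by omega)
    have hprod : ∀ x, |rowEntry a x| * b.1 j + |rowEntry b x| * a.1 j < 2 ^ (2 * e + 1) := by
      intro x
      have h1 : |rowEntry a x| * b.1 j < 2 ^ e * 2 ^ e :=
        mul_lt_mul'' (ha x) ((le_abs_self _).trans_lt (hb (.inl j))) (abs_nonneg _) h0
      have h2 : |rowEntry b x| * a.1 j < 2 ^ e * 2 ^ e :=
        mul_lt_mul'' (hb x) ((le_abs_self _).trans_lt (ha (.inl j))) (abs_nonneg _)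
          (h0.trans hba.le)
      rw [pow_succ, two_mul, pow_add]
      linarith
    obtain ⟨i1, i2, i3⟩ := euclidT_bound_of_lt (h.of_le (by omega : 2 * e + 1 + 1 ≤ 19 * t)) j r
      h0 hba (fun x => (ha x).trans_le hpow) (fun x => (hb x).trans_le hpow) hprod
    refine ⟨i1.trans (Nat.mul_le_mul_left _ ?_), fun x => (bitSize_le_iff.2 (i2 x)).trans (by omega),
      fun x => (bitSize_le_iff.2 (i3 x)).trans (by omega)⟩
    have e1 : bitSize (a.1 j) ≤ e + 1 := bitSize_le_iff.2 (ha (.inl j))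
    have e2 : bitSize (b.1 j) ≤ e + 1 := bitSize_le_iff.2 (hb (.inl j))
    unfold bitSize at e1 e2
    omega
  have key1 : ∀ (r : ℕ) (a b : Row d k), (∀ x, bitSize (rowEntry a x) ≤ 3 * t) →
      (∀ x, bitSize (rowEntry b x) ≤ 3 * t) → 0 ≤ b.1 j →
      (euclidT μ j r a b).cost ≤
        (5 * (k + d) + 7) * W * (19 * t) + 5 * (k + d + 1) * (3 * t * W) ∧
      (∀ x, bitSize (rowEntry (euclidT μ j r a b).val.1 x) ≤ 19 * t) ∧
      ∀ x, bitSize (rowEntry (euclidT μ j r a b).val.2 x) ≤ 19 * t := by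
    intro r a b ha hb h0
    refine euclidT_bound_of_step (h.of_le (by omega)) (by omega) (by omega) j ha hb
      (fun r c hc hc0 hcb => ?_) r
    rw [abs_of_nonneg h0] at hcb
    exact key r b c (fun x => (hb x).trans (by omega)) (fun x => (hc x).trans (by omega)) hc0 hcb
  obtain ⟨i1, i2, i3⟩ := euclidT_bound_of_step (h.of_le (by omega)) ht (by omega) j ha hb
    (fun r c hc hc0 _ => key1 r b c (fun x => (hb x).trans (by omega)) hc hc0) r
  refine ⟨i1.trans ?_, i2, i3⟩
  have : (5 * (k + d) + 7) * W * (19 * t) + 5 * (k + d + 1) * (3 * t * W) +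
    5 * (k + d + 1) * (t * W) = (115 * (k + d) + 153) * (t * W) := by ring
  rw [this]
  exact Nat.mul_le_mul_right _ (by omega)

/-- Each row treated multiplies the sizes by 19. The number of rows is bounded by the dimension, so
the power of 19 is a constant. -/
theorem clearColumnT_bound {μ : ℕ → ℕ} (j : Fin k) (bs : List (Row d k)) {t W : ℕ}
    (h : Cap μ (19 ^ bs.length * t) W) (ht : 1 ≤ t) {a : Row d k}
    (ha : ∀ x, bitSize (rowEntry a x) ≤ t) (hbs : ∀ b ∈ bs, ∀ x, bitSize (rowEntry b x) ≤ t) :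
    (clearColumnT μ j a bs).cost ≤
        (bs.length + 1) * (200 * (k + d + 1) + 1) * (19 ^ bs.length * t * W) ∧
      (∀ x, bitSize (rowEntry (clearColumnT μ j a bs).val.1 x) ≤ 19 ^ bs.length * t) ∧
      (∀ b ∈ (clearColumnT μ j a bs).val.2, ∀ x, bitSize (rowEntry b x) ≤ 19 ^ bs.length * t) ∧
      (clearColumnT μ j a bs).val.2.length = bs.length := by
  induction bs generalizing a t with
  | nil =>
    simp only [List.length_nil, pow_zero, one_mul] at h ⊢
    refine ⟨?_, ha, by simp [clearColumnT], by simp [clearColumnT]⟩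
    have hW := h.one_le ht
    have : (clearColumnT μ j a ([] : List (Row d k))).cost = 1 := rfl
    rw [this]
    exact Nat.mul_pos (by omega) (Nat.mul_pos ht hW)
  | cons b bs ih =>
    have hpow : 1 ≤ 19 ^ bs.length := Nat.one_le_pow _ _ (by norm_num)
    have hpt : 19 ^ (b :: bs).length * t = 19 ^ bs.length * (19 * t) := by
      rw [List.length_cons, pow_succ, mul_assoc]
    rw [hpt] at h ⊢
    have hle : 19 * t ≤ 19 ^ bs.length * (19 * t) := Nat.le_mul_of_pos_left _ hpow
    obtain ⟨i1, i2, i3⟩ := euclidT_bound (h.of_le hle) ht j (b.1 j).natAbs ha (hbs b (by simp))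
    obtain ⟨j1, j2, j3, j4⟩ := ih (a := (euclidT μ j (b.1 j).natAbs a b).val.1) (t := 19 * t) h
      (by omega) i2 fun c hc x => (hbs c (by simp [hc]) x).trans (by omega)
    have hcost : (clearColumnT μ j a (b :: bs)).cost = 1 +
      ((euclidT μ j (b.1 j).natAbs a b).cost +
        ((clearColumnT μ j (euclidT μ j (b.1 j).natAbs a b).val.1 bs).cost + 0)) := rfl
    have hval1 : (clearColumnT μ j a (b :: bs)).val.1 =
      (clearColumnT μ j (euclidT μ j (b.1 j).natAbs a b).val.1 bs).val.1 := rfl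
    have hval2 : (clearColumnT μ j a (b :: bs)).val.2 =
      (euclidT μ j (b.1 j).natAbs a b).val.2 ::
        (clearColumnT μ j (euclidT μ j (b.1 j).natAbs a b).val.1 bs).val.2 := rfl
    rw [hcost, hval1, hval2]
    refine ⟨?_, j2, ?_, by simp [j4]⟩
    · have hW := h.one_le (by omega)
      have e1 : t * W ≤ 19 ^ bs.length * (19 * t) * W :=
        Nat.mul_le_mul_right _ (by omega)
      have e2 : 1 ≤ 19 ^ bs.length * (19 * t) * W := (Nat.mul_pos ht hW).trans_le e1
      have e3 := Nat.mul_le_mul_left (200 * (k + d + 1)) e1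
      have e4 : ((b :: bs).length + 1) * (200 * (k + d + 1) + 1) *
        (19 ^ bs.length * (19 * t) * W) = (bs.length + 1) * (200 * (k + d + 1) + 1) *
        (19 ^ bs.length * (19 * t) * W) + 200 * (k + d + 1) * (19 ^ bs.length * (19 * t) * W) +
        19 ^ bs.length * (19 * t) * W := by
        rw [List.length_cons]; ring
      rw [e4]
      omega
    · intro c hc x
      rcases List.mem_cons.1 hc with rfl | hc
      · exact (i3 x).trans hle
      · exact j3 c hc x

end HermiteCost

section HermiteTransformCost

variable {d k : ℕ}

theorem fixSignT_bound {μ : ℕ → ℕ} {B W : ℕ} (h : Cap μ B W) (hW : 1 ≤ W) (j : Fin k)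
    {a : Row d k} (ha : ∀ x, bitSize (rowEntry a x) ≤ B) :
    (fixSignT j a).cost ≤ 2 * (k + d + 1) * W ∧
      ∀ x, bitSize (rowEntry (fixSignT j a).val x) ≤ B := by
  have h1 : (cmpT (a.1 j) 0).cost ≤ 2 * W := by
    have e1 := ha (.inl j)
    have e2 := h.le
    have e3 : rowEntry a (.inl j) = a.1 j := rfl
    show bitSize (a.1 j) + bitSize 0 ≤ _
    rw [bitSize_zero, ← e3]
    omega
  have h2 := h.vecNegT_cost_le (u := a.1) fun i => ha (.inl i)
  have h3 := h.vecNegT_cost_le (u := a.2) fun i => ha (.inr i)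
  have h4 : 2 * (k + d + 1) * W = k * (W + W) + d * (W + W) + 2 * W := by ring
  have h5 : k * (W + 1) ≤ k * (W + W) := by gcongr
  have h6 : d * (W + 1) ≤ d * (W + W) := by gcongr
  simp only [fixSignT, Timed.cost_bind, Timed.val_bind]
  rw [h4]
  split
  · refine ⟨?_, fun x => ?_⟩
    · simp only [Timed.cost_bind, Timed.cost_pure]
      omega
    · simp only [Timed.val_bind, Timed.val_pure, vecNegT_val]
      cases x with
      | inl i =>
        show bitSize (-(a.1 i)) ≤ _
        rw [bitSize_neg]
        exact ha (.inl i)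
      | inr i =>
        show bitSize (-(a.2 i)) ≤ _
        rw [bitSize_neg]
        exact ha (.inr i)
  · refine ⟨?_, ha⟩
    simp only [Timed.cost_pure]
    omega

/-- Reduction of a row modulo a pivot row. -/
def reduceRowT (μ : ℕ → ℕ) (j : Fin k) (p r : Row d k) : Timed (Row d k) := do
  let q ← divT (r.1 j) (p.1 j)
  rowSubT μ q r p

theorem reduceRowT_bound {μ : ℕ → ℕ} {t W : ℕ} (h : Cap μ (3 * t) W) (ht : 1 ≤ t) (j : Fin k)
    {p r : Row d k} (hp : ∀ x, bitSize (rowEntry p x) ≤ t)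
    (hr : ∀ x, bitSize (rowEntry r x) ≤ t) :
    (reduceRowT μ j p r).cost ≤ 5 * (k + d + 1) * (t * W) ∧
      ∀ x, bitSize (rowEntry (reduceRowT μ j p r).val x) ≤ 3 * t := by
  have hW := h.one_le (by omega)
  have hqt : bitSize (r.1 j / p.1 j) ≤ t := (bitSize_ediv_le _ _).trans (hr (.inl j))
  have hqb : ∀ x, bitSize (r.1 j / p.1 j * rowEntry p x) ≤ t + t := fun x =>
    bitSize_mul_le hqt (hp x)
  have hrs := h.rowSubT_cost_le hW (hqt.trans (by omega)) (fun x => (hr x).trans (by omega))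
    (fun x => (hp x).trans (by omega)) fun x => (hqb x).trans (by omega)
  have hdv : (divT (r.1 j) (p.1 j)).cost ≤ 3 * (t * t) := divT_cost_le (hr (.inl j)) (hp (.inl j))
  have h3 : 3 * (t * t) ≤ t * W := by
    have := Nat.mul_le_mul_left t h.le
    linarith
  have h4 : 5 * (k + d) * W ≤ 5 * (k + d) * (t * W) :=
    Nat.mul_le_mul_left _ (Nat.le_mul_of_pos_left _ ht)
  have h5 : 5 * (k + d + 1) * (t * W) = 5 * (k + d) * (t * W) + 5 * (t * W) := by ring
  have hcost : (reduceRowT μ j p r).cost = (divT (r.1 j) (p.1 j)).cost +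
    (rowSubT μ (r.1 j / p.1 j) r p).cost := rfl
  refine ⟨by omega, fun x => ?_⟩
  have hval : rowEntry (reduceRowT μ j p r).val x =
    rowEntry r x - r.1 j / p.1 j * rowEntry p x := rowEntry_rowSubT μ _ r p x
  rw [hval]
  exact (bitSize_sub_le ((hr x).trans (Nat.le_add_right t t)) (hqb x)).trans (by omega)

/-- Induction on the number of columns left. A column enlarges the entries by the factor `3 * 19 ^
M` at most, and this factor enters the constant; with boundedly many rows and columns the sizes stay
linear in `t`. -/
theorem hermiteT_bound (n M L : ℕ) : ∃ C, 1 ≤ C ∧ ∀ μ t W, 1 ≤ t → Cap μ (C * t) W →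
    ∀ (d k : ℕ) (js : List (Fin k)) (done rows : List (Row d k)), k + d + 1 ≤ n →
      js.length = L → done.length + rows.length ≤ M →
      (∀ a ∈ done, ∀ x, bitSize (rowEntry a x) ≤ t) →
      (∀ a ∈ rows, ∀ x, bitSize (rowEntry a x) ≤ t) →
      (hermiteT μ js done rows).cost ≤ C * (t * W) ∧
        ∀ a ∈ (hermiteT μ js done rows).val, ∀ x, bitSize (rowEntry a x) ≤ C * t := by
  induction L with
  | zero =>
    refine ⟨M + 2, by omega, fun μ t W ht h d k js done rows hn hL hM hdone hrows => ?_⟩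
    obtain rfl := List.length_eq_zero_iff.1 hL
    have hW := h.one_le (Nat.mul_pos (by omega) ht)
    have hcost : (hermiteT μ [] done rows).cost = 1 + (appendT done rows).cost := rfl
    have hval : (hermiteT μ [] done rows).val = (appendT done rows).val := rfl
    rw [hcost, hval, appendT_cost, appendT_val]
    constructor
    · calc 1 + (done.length + 1) ≤ (M + 2) * 1 := by omega
        _ ≤ _ := Nat.mul_le_mul_left _ (Nat.mul_pos ht hW)
    · intro a ha x
      have : t ≤ (M + 2) * t := Nat.le_mul_of_pos_left _ (by omega)
      rcases List.mem_append.1 ha with ha | ha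
      · exact (hdone a ha x).trans this
      · exact (hrows a ha x).trans this
  | succ L ih =>
    obtain ⟨C, hC1, hC⟩ := ih
    set E := 19 ^ M with hE
    have hE1 : 1 ≤ E := Nat.one_le_pow _ _ (by norm_num)
    refine ⟨C * (3 * E) + (M + 1) * (200 * n + 1) * E + 2 * n * E + (M * (5 * n + 1) + 1) * E +
        (M + 2), by omega, fun μ t W ht h d k js done rows hn hL hM hdone hrows => ?_⟩
    set C' := C * (3 * E) + (M + 1) * (200 * n + 1) * E + 2 * n * E + (M * (5 * n + 1) + 1) * E +
      (M + 2) with hC'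
    have hcap : Cap μ (C * (3 * (E * t))) W := h.of_le <| by
      calc C * (3 * (E * t)) = C * (3 * E) * t := by ring
        _ ≤ C' * t := Nat.mul_le_mul_right _ (by omega)
    have hcap3 : Cap μ (3 * (E * t)) W := hcap.of_le (Nat.le_mul_of_pos_left _ hC1)
    have hEt : 1 ≤ E * t := Nat.mul_pos hE1 ht
    have hW := hcap3.one_le (by omega)
    have htE : t ≤ E * t := Nat.le_mul_of_pos_left _ hE1
    match js, rows with
    | j :: js, [] =>
      have hcost : (hermiteT μ (j :: js) done []).cost = 1 + 0 := rfl
      have hval : (hermiteT μ (j :: js) done []).val = done := rfl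
      rw [hcost, hval]
      refine ⟨?_, fun a ha x => (hdone a ha x).trans (Nat.le_mul_of_pos_left _ (by omega))⟩
      exact Nat.mul_pos (by omega) (Nat.mul_pos ht hW)
    | j :: js, a :: as =>
      have hlen : as.length ≤ M := by simp at hM; omega
      have hpow : 19 ^ as.length * t ≤ E * t :=
        Nat.mul_le_mul_right _ (Nat.pow_le_pow_right (by norm_num) hlen)
      obtain ⟨i1, i2, i3, i4⟩ := clearColumnT_bound j as (hcap3.of_le (by omega)) ht
        (hrows a (by simp)) fun b hb => hrows b (by simp [hb])
      set cl := clearColumnT μ j a as with hcl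
      obtain ⟨j1, j2⟩ := fixSignT_bound (hcap3.of_le (by omega)) hW j
        fun x => (i2 x).trans hpow
      set p := fixSignT j cl.val.1 with hp
      have hred : ∀ r ∈ done, _ := fun r hr =>
        reduceRowT_bound hcap3 hEt j j2 fun x => (hdone r hr x).trans htE
      have k1 : (mapT (reduceRowT μ j p.val) done).cost ≤
        done.length * (5 * (k + d + 1) * (E * t * W) + 1) + 1 :=
        mapT_cost_le fun r hr => (hred r hr).1
      have hcost : (hermiteT μ (j :: js) done (a :: as)).cost = 1 + (cl.cost + (p.cost +
        ((mapT (reduceRowT μ j p.val) done).cost +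
          ((appendT (mapT (reduceRowT μ j p.val) done).val [p.val]).cost +
          (hermiteT μ js (appendT (mapT (reduceRowT μ j p.val) done).val [p.val]).val
            cl.val.2).cost)))) := rfl
      have hval : (hermiteT μ (j :: js) done (a :: as)).val =
        (hermiteT μ js (appendT (mapT (reduceRowT μ j p.val) done).val [p.val]).val
            cl.val.2).val := rfl
      rw [hcost, hval, appendT_cost, appendT_val, mapT_val, List.length_map]
      obtain ⟨l1, l2⟩ := hC μ (3 * (E * t)) W (by omega) hcap d k js
        (done.map (fun r => (reduceRowT μ j p.val r).val) ++ [p.val]) cl.val.2 hn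
        (by simpa using hL) (by simp [i4]; simp at hM; omega)
        (by
          intro b hb x
          rcases List.mem_append.1 hb with hb | hb
          · obtain ⟨r, hr, rfl⟩ := List.mem_map.1 hb
            exact (hred r hr).2 x
          · rw [List.mem_singleton.1 hb]
            exact (j2 x).trans (by omega))
        fun b hb x => (i3 b hb x).trans (by omega)
      refine ⟨?_, fun b hb x => (l2 b hb x).trans ?_⟩
      · have htW : 1 ≤ t * W := Nat.mul_pos ht hW
        have hdl : done.length ≤ M := by omega
        calc _ ≤ 1 + ((as.length + 1) * (200 * (k + d + 1) + 1) * (19 ^ as.length * t * W) +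
              (2 * (k + d + 1) * W + ((done.length * (5 * (k + d + 1) * (E * t * W) + 1) + 1) +
                ((done.length + 1) + C * (3 * (E * t) * W))))) := by gcongr
          _ ≤ t * W + ((M + 1) * (200 * n + 1) * (E * t * W) +
              (2 * n * (E * t * W) + ((M * (5 * n * (E * t * W) + E * t * W) + E * t * W) +
                ((M + 1) * (t * W) + C * (3 * (E * t) * W))))) := by
              have e1 : W ≤ E * t * W := Nat.le_mul_of_pos_left _ hEt
              have e2 : 1 ≤ E * t * W := hW.trans e1
              have e3 : done.length + 1 ≤ (M + 1) * (t * W) :=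
                (by omega : done.length + 1 ≤ M + 1).trans (Nat.le_mul_of_pos_right _ htW)
              gcongr
          _ = C' * (t * W) := by rw [hC']; ring
      · calc C * (3 * (E * t)) = C * (3 * E) * t := by ring
          _ ≤ C' * t := Nat.mul_le_mul_right _ (by omega)

/-- The assumption `2 ≤ t` covers the entries 1 of the identity block, which have two bits with the
sign. -/
theorem hermiteTransformT_bound (d N : ℕ) : ∃ C, 1 ≤ C ∧ ∀ μ t W, 2 ≤ t → Cap μ (C * t) W →
    ∀ cols : List (Pt d), cols.length ≤ N → (∀ v ∈ cols, ∀ i, bitSize (v i) ≤ t) →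
      (hermiteTransformT μ cols).cost ≤ C * (t * W) ∧
        ∀ i j, bitSize ((hermiteTransformT μ cols).val i j) ≤ C * t := by
  choose C hC1 hC using hermiteT_bound (N + d + 1) d
  have hle : ∀ L ≤ N, C L ≤ ∑ L ∈ Finset.range (N + 1), C L := fun L hL =>
    Finset.single_le_sum (f := C) (fun _ _ => Nat.zero_le _) (Finset.mem_range.2 (by omega))
  set S := ∑ L ∈ Finset.range (N + 1), C L with hS
  refine ⟨S + (d * (N + d) + N + d) + 1, by omega, fun μ t W ht h cols hN hcols => ?_⟩
  have hW := h.one_le (Nat.mul_pos (by omega) (by omega : 0 < t))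
  set rows : List (Row d cols.length) :=
    List.ofFn (fun i : Fin d => ((fun j => cols.get j i), (Pi.single i 1 : Fin d → ℤ))) with hrows
  have hrowsb : ∀ a ∈ rows, ∀ x, bitSize (rowEntry a x) ≤ t := by
    intro a ha x
    obtain ⟨i, rfl⟩ := List.mem_ofFn.1 ha
    cases x with
    | inl j => exact hcols _ (List.get_mem cols j) i
    | inr j =>
      show bitSize ((Pi.single i 1 : Fin d → ℤ) j) ≤ t
      rw [Pi.single_apply]
      split
      · rw [bitSize_one]; exact ht
      · rw [bitSize_zero]; omega
  have hCL : C cols.length * t ≤ (S + (d * (N + d) + N + d) + 1) * t :=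
    Nat.mul_le_mul_right _ (by have := hle _ hN; omega)
  obtain ⟨h1, h2⟩ := hC cols.length μ t W (by omega) (h.of_le hCL) d cols.length
    (List.finRange cols.length) [] rows (by omega) (by simp) (by simp [hrows]) (by simp) hrowsb
  have hcost : (hermiteTransformT μ cols).cost = (d * (cols.length + d) + cols.length) +
    ((hermiteT μ (List.finRange cols.length) [] rows).cost + (d + 0)) := rfl
  have hval : ∀ i, (hermiteTransformT μ cols).val i =
    ((hermiteT μ (List.finRange cols.length) [] rows).val.getD i (0, 0)).2 := fun _ => rfl
  constructor
  · rw [hcost]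
    have htW : 1 ≤ t * W := Nat.mul_pos (by omega) hW
    have e1 : d * (cols.length + d) + cols.length + d ≤ (d * (N + d) + N + d) * (t * W) :=
      le_trans (by gcongr) (Nat.le_mul_of_pos_right _ htW)
    have e2 : C cols.length * (t * W) ≤ S * (t * W) := Nat.mul_le_mul_right _ (hle _ hN)
    rw [add_mul, add_mul]
    omega
  · intro i j
    rw [hval]
    refine le_trans ?_ hCL
    by_cases hi : (i : ℕ) < (hermiteT μ (List.finRange cols.length) [] rows).val.length
    · rw [List.getD_eq_getElem _ _ hi]
      exact h2 _ (List.getElem_mem hi) (.inr j)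
    · rw [List.getD_eq_default _ _ (by omega)]
      show bitSize 0 ≤ _
      rw [bitSize_zero]
      exact Nat.mul_pos (hC1 _) (by omega)

end HermiteTransformCost

/-! ## Cost of the canonical form with a frame -/

section FrameCanonicalFormCost

variable {d : ℕ}

theorem size_le_log_add_one (n : ℕ) : Nat.size n ≤ Nat.log 2 n + 1 :=
  Nat.size_le.2 (Nat.lt_pow_succ_log_self one_lt_two n)

theorem clog_le_log_add_one (n : ℕ) : Nat.clog 2 n ≤ Nat.log 2 n + 1 :=
  Nat.clog_le_of_le_pow (Nat.lt_pow_succ_log_self one_lt_two n).le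

theorem sortT_cost_le {b : ℕ} {l : List (Pt d)} (hl : ∀ p ∈ l, ∀ i, bitSize (p i) ≤ b) :
    (sortT l).cost ≤ (d * (2 * b + 3) + 8) * l.length * (Nat.log 2 l.length + 1) + 2 := by
  have h1 := lengthT_cost_le l
  have h2 := mergeSortT_cost_le (cmp := cmpVecT) (r := l.length) (l := l)
    (c := d * (2 * b + 3) + 1) fun p hp q hq => cmpVecT_cost_le (hl p hp) (hl q hq)
  have hcost : (sortT l).cost = (lengthT l).cost + (mergeSortT cmpVecT l.length l).cost := by
    simp only [sortT, Timed.cost_bind, lengthT_val]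
  rw [hcost]
  set n := l.length
  calc _ ≤ (n * (Nat.log 2 n + 1 + 2) + 1) +
        ((d * (2 * b + 3) + 1 + 4) * n * (Nat.log 2 n + 1) + 1) := by
        refine Nat.add_le_add (h1.trans ?_) (h2.trans ?_)
        · gcongr; exact size_le_log_add_one n
        · gcongr; exact clog_le_log_add_one n
    _ ≤ (n * (Nat.log 2 n + 1 + 2 * (Nat.log 2 n + 1)) + 1) +
        ((d * (2 * b + 3) + 1 + 4) * n * (Nat.log 2 n + 1) + 1) := by gcongr; omega
    _ = _ := by ring

/-- The image of a point under `x ↦ A (x - p₀)`. -/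
def frameMapT (μ : ℕ → ℕ) (A : Fin d → Fin d → ℤ) (p₀ x : Pt d) : Timed (Pt d) := do
  let y ← vecSubT x p₀
  tupleT (fun i => dotT μ (A i) y)

theorem frameMapT_bound {μ : ℕ → ℕ} {b W : ℕ} (h : Cap μ ((d + 2) * (2 * b)) W) (hb : 1 ≤ b)
    {A : Fin d → Fin d → ℤ} {p₀ x : Pt d} (hA : ∀ i j, bitSize (A i j) ≤ 2 * b)
    (hp : ∀ i, bitSize (p₀ i) ≤ b) (hx : ∀ i, bitSize (x i) ≤ b) :
    (frameMapT μ A p₀ x).cost ≤ d * (4 * d + 5) * W ∧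
      ∀ i, bitSize ((frameMapT μ A p₀ x).val i) ≤ (d + 2) * (2 * b) := by
  have hW := h.one_le (Nat.mul_pos (by omega) (by omega))
  have hle : 2 * b ≤ (d + 2) * (2 * b) := Nat.le_mul_of_pos_left _ (by omega)
  have hy : ∀ i, bitSize ((vecSubT x p₀).val i) ≤ 2 * b := fun i =>
    (bitSize_sub_le (hx i) (hp i)).trans (by omega)
  have h1 := h.vecSubT_cost_le (u := x) (v := p₀) (fun i => (hx i).trans (by omega))
    fun i => (hp i).trans (by omega)
  have h2 : (tupleT (fun i => dotT μ (A i) (vecSubT x p₀).val)).cost ≤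
      d * ((4 * d + 1) * W + 1) := tupleT_cost_le fun i => h.dotT_cost_le' (by omega) (hA i) hy
  have hcost : (frameMapT μ A p₀ x).cost = (vecSubT x p₀).cost +
    (tupleT (fun i => dotT μ (A i) (vecSubT x p₀).val)).cost := rfl
  rw [hcost]
  constructor
  · calc _ ≤ d * (2 * W + W) + d * ((4 * d + 1) * W + W) :=
          Nat.add_le_add (h1.trans (by gcongr)) (h2.trans (by gcongr))
      _ = _ := by ring
  · intro i
    have := bitSize_dotT_le (μ := μ) (by omega) (hA i) hy
    refine this.trans ?_
    have : d ≤ d * (2 * b) := Nat.le_mul_of_pos_right _ (by omega)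
    linarith

theorem RFrame.mem_of_mem_interT {μ : ℕ → ℕ} {Q : RFrame d} (hQ : 0 < Q.den) {Λ : List (Pt d)}
    {p : Pt d} (hp : p ∈ (Q.interT μ Λ).val) : p ∈ Λ := by
  have h1 : toRat p ∈ (Q.interT μ Λ).val.map toRat := List.mem_map_of_mem hp
  rw [RFrame.interT_val μ hQ] at h1
  obtain ⟨q, hq, hqp⟩ := of_decide_eq_true (List.mem_filter.1 h1).2
  exact toRat_injective hqp ▸ List.mem_toFinset.1 hq

/-- The points of the completed frame are points of `Λ`, so their size is the original one and does
not depend on the size of the coordinates used to select them. -/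
theorem mem_of_mem_extendT {μ : ℕ → ℕ} {cs : List (List ℤ × Pt d)} {Λ : List (Pt d)}
    (hcs : ∀ cp ∈ cs, cp.2 ∈ Λ) (r : ℕ) {T : List (Pt d)} (hT : ∀ p ∈ T, p ∈ Λ) :
    ∀ p ∈ (extendT μ cs r T).val, p ∈ Λ := by
  induction r generalizing T with
  | zero => exact hT
  | succ r ih =>
    simp only [extendT, Timed.val_bind, filterT_val]
    split
    · exact hT
    · next c out' ho =>
      simp only [Timed.val_bind, appendT_val]
      refine ih fun p hp => ?_
      rcases List.mem_append.1 hp with hp | hp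
      · exact hT p hp
      · rw [List.mem_singleton.1 hp]
        have := minT_mem (fun x y : List ℤ × Pt d => cmpListT cmpT x.1 y.1) c out'
        rw [← ho] at this
        exact hcs _ (List.mem_of_mem_filter this)

/-- Per point the linear algebra costs `O(W)`. The sorting contributes the logarithm, with
comparisons linear in `b`, and the Hermite form contributes `b * W` once. A single product majorizes
all these terms. -/
theorem canonicalFormWithFrameT_bound (d N : ℕ) : ∃ C, 1 ≤ C ∧ ∀ μ b W, 1 ≤ b →
    Cap μ (C * b) W → ∀ (Q : RFrame d) (Λ : List (Pt d)), 0 < Q.den → Q.pts.length ≤ N →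
      Q.BitsLE b → (∀ p ∈ Λ, ∀ i, bitSize (p i) ≤ b) →
      (canonicalFormWithFrameT μ Λ Q).cost ≤
        C * ((Λ.length + 1) * ((Nat.log 2 Λ.length + 1) * (b * W))) ∧
      (canonicalFormWithFrameT μ Λ Q).val.1.length ≤ Λ.length ∧
      (∀ p ∈ (canonicalFormWithFrameT μ Λ Q).val.1, ∀ i, bitSize (p i) ≤ C * b) ∧
      (canonicalFormWithFrameT μ Λ Q).val.2.length ≤ N + d + 1 ∧
      (∀ p ∈ (canonicalFormWithFrameT μ Λ Q).val.2, ∀ i, bitSize (p i) ≤ C * b) := by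
  obtain ⟨C₁, hC₁, h₁⟩ := RFrame.interT_bound d N
  obtain ⟨C₂, hC₂, h₂⟩ := RFrame.coordsT_bound d N
  obtain ⟨C₃, hC₃, h₃⟩ := extendT_bound d (N + d + 1)
  obtain ⟨C₄, hC₄, h₄⟩ := hermiteTransformT_bound d (N + d + 1)
  set D := (d + 2) * (2 * C₄) with hD
  refine ⟨C₁ + C₂ + C₃ * C₂ + C₄ * 2 + D + (d + 2) * C₃ + ((N + d + 1) * (3 * d + 1) + 1) +
    2 * C₄ + (d * (4 * d + 5) + 2) + (d * (2 * D + 3) + 10) +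
    ((N + d + 1) * (d * (4 * d + 5) + 1) + 1), by omega, fun μ b W hb h Q Λ hden hN hQ hΛ => ?_⟩
  set C := C₁ + C₂ + C₃ * C₂ + C₄ * 2 + D + (d + 2) * C₃ + ((N + d + 1) * (3 * d + 1) + 1) +
    2 * C₄ + (d * (4 * d + 5) + 2) + (d * (2 * D + 3) + 10) +
    ((N + d + 1) * (d * (4 * d + 5) + 1) + 1) with hC
  have hcap : ∀ C', C' ≤ C → Cap μ (C' * b) W := fun C' hC' =>
    h.of_le (Nat.mul_le_mul_right _ hC')
  have hbW : b ≤ W := by simpa using (hcap 1 (by omega)).le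
  have hW : 1 ≤ W := hb.trans hbW
  set n := Λ.length with hn
  set P := (Nat.log 2 n + 1) * (b * W) with hP
  have hbWP : b * W ≤ P := Nat.le_mul_of_pos_left _ (by omega)
  have hWP : W ≤ P := (Nat.le_mul_of_pos_left _ hb).trans hbWP
  have hP1 : 1 ≤ P := hW.trans hWP
  set U := (n + 1) * P with hU
  have hPU : P ≤ U := Nat.le_mul_of_pos_left _ (by omega)
  have hU1 : 1 ≤ U := hP1.trans hPU
  have hnW : (n + 1) * W ≤ U := Nat.mul_le_mul_left _ hWP
  obtain ⟨a1, a2⟩ := h₁ μ b W hb (hcap C₁ (by omega)) Q Λ hN hQ hΛ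
  obtain ⟨b1, b2, b3⟩ := h₂ μ b W hb (hcap C₂ (by omega)) Q Λ hN hQ hΛ
  set T₀ := Q.interT μ Λ with hT₀
  set cs := Q.coordsT μ Λ with hcs
  have hT₀b : ∀ p ∈ T₀.val, ∀ i, bitSize (p i) ≤ C₂ * b := fun p hp i =>
    (hΛ p (RFrame.mem_of_mem_interT hden hp) i).trans (Nat.le_mul_of_pos_left _ hC₂)
  have hcsT : ∀ p ∈ (extendT μ cs.val (d + 1) T₀.val).val, p ∈ Λ :=
    mem_of_mem_extendT (fun cp hcp => (b3 cp hcp).1) _ fun p hp =>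
      RFrame.mem_of_mem_interT hden hp
  obtain ⟨c1, c2, -⟩ := h₃ μ (C₂ * b) W (Nat.mul_pos hC₂ hb)
    (by rw [← mul_assoc]; exact hcap _ (by omega)) cs.val
    (fun cp hcp => ⟨fun i => (hΛ cp.2 (b3 cp hcp).1 i).trans (Nat.le_mul_of_pos_left _ hC₂),
      (b3 cp hcp).2.1.trans (by omega), (b3 cp hcp).2.2⟩) (d + 1) T₀.val (by omega) hT₀b
  rw [b2] at c1
  set T := extendT μ cs.val (d + 1) T₀.val with hT
  have hfix : canonicalFormWithFrameT μ Λ Q = (do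
      let T₀ ← T₀
      let cs ← cs
      let T ← extendT μ cs (d + 1) T₀
      match T with
      | [] => pure ([], [])
      | p₀ :: ps => do
        let cols ← diffsT p₀ ps
        let A ← hermiteTransformT μ cols
        let Ω ← mapT (frameMapT μ A p₀) Λ
        let Ω' ← sortT Ω
        let U ← mapT (frameMapT μ A p₀) (p₀ :: ps)
        pure (Ω', U)) := rfl
  rw [hfix]
  simp only [Timed.cost_bind, Timed.val_bind]
  rw [← hT]
  have a1' : T₀.cost ≤ C₁ * U := a1.trans (Nat.mul_le_mul_left _ hnW)
  have b1' : cs.cost ≤ C₂ * U := b1.trans (Nat.mul_le_mul_left _ hnW)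
  have c1' : T.cost ≤ (d + 2) * C₃ * U := by
    rw [mul_assoc]
    exact c1.trans (Nat.mul_le_mul_left _ (Nat.mul_le_mul_left _ hnW))
  cases hTv : T.val with
  | nil =>
    simp only [Timed.cost_pure, Timed.val_pure]
    refine ⟨?_, by simp, by simp, by simp, by simp⟩
    calc T₀.cost + (cs.cost + (T.cost + 0)) ≤ (C₁ + C₂ + (d + 2) * C₃) * U := by
          rw [add_mul, add_mul]; omega
      _ ≤ C * U := Nat.mul_le_mul_right _ (by omega)
  | cons p₀ ps =>
    rw [hTv] at hcsT c2
    simp only [Timed.cost_bind, Timed.val_bind, Timed.cost_pure, Timed.val_pure]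
    have hp₀ : ∀ i, bitSize (p₀ i) ≤ b := hΛ p₀ (hcsT p₀ (by simp))
    have hps : ∀ p ∈ ps, ∀ i, bitSize (p i) ≤ b := fun p hp => hΛ p (hcsT p (by simp [hp]))
    have hlen : ps.length ≤ N + d + 1 := by simp at c2; omega
    have d1 := diffsT_cost_le (by simpa using hcap 1 (by omega)) hW hp₀ hps
    set cols := diffsT p₀ ps with hcols
    obtain ⟨e1, e2⟩ := h₄ μ (2 * b) W (by omega)
      (by rw [← mul_assoc]; exact hcap _ (by omega)) cols.val
      (by rw [hcols, length_diffsT]; exact hlen)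
      fun v hv i => (bitSize_diffsT_le hp₀ hps v hv i).trans (by omega)
    set A := hermiteTransformT μ cols.val with hA
    have hDb : (d + 2) * (2 * (C₄ * b)) = D * b := by rw [hD]; ring
    have hfm : ∀ x : Pt d, (∀ i, bitSize (x i) ≤ b) → _ := fun x hx =>
      frameMapT_bound (x := x) (b := C₄ * b) (by rw [hDb]; exact hcap D (by omega))
        (Nat.mul_pos hC₄ hb) (fun i j => (e2 i j).trans (le_of_eq (by ring)))
        (fun i => (hp₀ i).trans (Nat.le_mul_of_pos_left _ hC₄))
        (fun i => (hx i).trans (Nat.le_mul_of_pos_left b hC₄))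
    rw [hDb] at hfm
    have f1 : (mapT (frameMapT μ A.val p₀) Λ).cost ≤ n * (d * (4 * d + 5) * W + 1) + 1 :=
      mapT_cost_le fun x hx => (hfm x (hΛ x hx)).1
    have f2 : (mapT (frameMapT μ A.val p₀) (p₀ :: ps)).cost ≤
        (p₀ :: ps).length * (d * (4 * d + 5) * W + 1) + 1 :=
      mapT_cost_le fun x hx => (hfm x (hΛ x (hcsT x hx))).1
    have hΩb : ∀ p ∈ (mapT (frameMapT μ A.val p₀) Λ).val, ∀ i, bitSize (p i) ≤ D * b := by
      intro p hp
      rw [mapT_val] at hp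
      obtain ⟨x, hx, rfl⟩ := List.mem_map.1 hp
      exact (hfm x (hΛ x hx)).2
    have g1 := sortT_cost_le hΩb
    have hΩlen : (mapT (frameMapT μ A.val p₀) Λ).val.length = n := by
      rw [mapT_val, List.length_map]
    have hperm : (sortT (mapT (frameMapT μ A.val p₀) Λ).val).val.Perm
        (mapT (frameMapT μ A.val p₀) Λ).val := by
      simpa [sortT] using mergeSortT_perm cmpVecT _ (mapT (frameMapT μ A.val p₀) Λ).val
    rw [hΩlen] at g1
    have hDC : D * b ≤ C * b := Nat.mul_le_mul_right _ (by omega)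
    refine ⟨?_, by rw [hperm.length_eq, hΩlen], fun p hp i => (hΩb p (hperm.subset hp) i).trans hDC,
      by rw [mapT_val, List.length_map]; exact c2, ?_⟩
    · have d1' : cols.cost ≤ ((N + d + 1) * (3 * d + 1) + 1) * U :=
        d1.trans (Nat.mul_le_mul (by gcongr) (hWP.trans hPU))
      have e1' : A.cost ≤ 2 * C₄ * U := by
        calc A.cost ≤ C₄ * (2 * b * W) := e1
          _ = 2 * C₄ * (b * W) := by ring
          _ ≤ _ := Nat.mul_le_mul_left _ (hbWP.trans hPU)
      have f1' : (mapT (frameMapT μ A.val p₀) Λ).cost ≤ (d * (4 * d + 5) + 2) * U := by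
        calc _ ≤ (n + 1) * (d * (4 * d + 5) * P + P) + U := f1.trans (by gcongr; omega)
          _ = _ := by rw [hU]; ring
      have f2' : (mapT (frameMapT μ A.val p₀) (p₀ :: ps)).cost ≤
          ((N + d + 1) * (d * (4 * d + 5) + 1) + 1) * U := by
        have : W ≤ U := hWP.trans hPU
        calc _ ≤ (N + d + 1) * (d * (4 * d + 5) * U + U) + U := f2.trans (by gcongr)
          _ = _ := by ring
      have g1' : (sortT (mapT (frameMapT μ A.val p₀) Λ).val).cost ≤
          (d * (2 * D + 3) + 10) * U := by
        have hlog : b * (Nat.log 2 n + 1) ≤ P := by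
          rw [mul_comm, hP]
          exact Nat.mul_le_mul_left _ (Nat.le_mul_of_pos_right _ hW)
        calc _ ≤ (d * (2 * (D * b) + 3 * b) + 8 * b) * n * (Nat.log 2 n + 1) + 2 :=
              g1.trans (by gcongr <;> omega)
          _ = (d * (2 * D + 3) + 8) * (n * (b * (Nat.log 2 n + 1))) + 2 := by ring
          _ ≤ (d * (2 * D + 3) + 8) * ((n + 1) * P) + 2 * U := by
              gcongr <;> omega
          _ = _ := by rw [hU]; ring
      have hCU : C * U = C₁ * U + C₂ * U + (C₃ * C₂ + C₄ * 2 + D) * U + (d + 2) * C₃ * U +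
        ((N + d + 1) * (3 * d + 1) + 1) * U + 2 * C₄ * U + (d * (4 * d + 5) + 2) * U +
        (d * (2 * D + 3) + 10) * U + ((N + d + 1) * (d * (4 * d + 5) + 1) + 1) * U := by
        rw [hC]; ring
      rw [hCU]
      omega
    · intro p hp
      rw [mapT_val] at hp
      obtain ⟨x, hx, rfl⟩ := List.mem_map.1 hp
      exact fun i => ((hfm x (hΛ x (hcsT x hx))).2 i).trans hDC

end FrameCanonicalFormCost

/-! ## Cost of the local steps of `EquivariantFrames2` -/

section LocalCost

variable {d : ℕ}

/-- The enumeration is polynomial in the size of the pool, which is itself bounded in terms of `d`;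
so it counts as a constant. -/
theorem listsT_bound (x m : ℕ) : ∃ C, 1 ≤ C ∧ ∀ (α : Type) (X : List α), X.length ≤ x →
    (listsT X m).val.length ≤ C ∧ (listsT X m).cost ≤ C := by
  induction m with
  | zero => exact ⟨1, le_rfl, fun α X _ => ⟨le_rfl, le_rfl⟩⟩
  | succ m ih =>
    obtain ⟨C, hC1, hC⟩ := ih
    refine ⟨1 + (C + ((x * (C + 2) + 1) + (x * C + 2 * x + 1))), by omega, fun α X hX => ?_⟩
    obtain ⟨h1, h2⟩ := hC α X hX
    set ls := listsT X m with hls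
    set f : α → Timed (List (List α)) := fun x => mapT (fun l => pure (x :: l)) ls.val with hf
    have hval : (listsT X (m + 1)).val = [] :: (flattenT (mapT f X).val).val := rfl
    have hcost : (listsT X (m + 1)).cost =
      1 + (ls.cost + ((mapT f X).cost + ((flattenT (mapT f X).val).cost + 0))) := rfl
    have hflen : ∀ x, (f x).val.length ≤ C := fun x => by
      rw [hf, mapT_val, List.length_map]; exact h1
    have hmap : (mapT f X).cost ≤ x * (C + 2) + 1 :=
      (mapT_cost_le (c := C + 1) fun y _ => (mapT_cost_le (c := 0) fun l _ => le_rfl).trans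
        (by omega)).trans (by gcongr)
    have hmlen : (mapT f X).val.length ≤ x := by rw [mapT_val, List.length_map]; exact hX
    have hflat : (mapT f X).val.flatten.length ≤ x * C := by
      refine (length_flatten_le (c := C) fun l hl => ?_).trans (Nat.mul_le_mul_right _ hmlen)
      rw [mapT_val] at hl
      obtain ⟨y, -, rfl⟩ := List.mem_map.1 hl
      exact hflen y
    rw [hval, hcost, flattenT_cost, flattenT_val, List.length_cons]
    constructor <;> omega

theorem completionsT_bound (d N x : ℕ) : ∃ C, 1 ≤ C ∧ ∀ μ b W, 1 ≤ b → Cap μ (C * b) W →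
    ∀ (Λ : List (Pt d)) (Q : RFrame d) (X : List (Pt d)), X.length ≤ x → Q.pts.length ≤ N →
      Q.BitsLE b → (∀ p ∈ X, ∀ i, bitSize (p i) ≤ b) → (∀ p ∈ Λ, ∀ i, bitSize (p i) ≤ b) →
      (completionsT μ Λ Q X).cost ≤ C * ((Λ.length + 1) * W) ∧
      (completionsT μ Λ Q X).val.length ≤ C := by
  obtain ⟨C₁, hC₁, h₁⟩ := listsT_bound x (d + 1)
  obtain ⟨C₂, hC₂, h₂⟩ := indepT_bound d (N + (d + 1))
  obtain ⟨C₃, hC₃, h₃⟩ := RFrame.memSpanT_bound d (N + (d + 1))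
  set E := ((N + (d + 1)) * (2 * d + 2) + 2) + C₂ + (C₃ + 2) with hE
  refine ⟨C₂ * 2 + C₃ * 2 + C₁ * (E + 1) + 1 + C₁, by omega,
    fun μ b W hb h Λ Q X hX hN hQ hXb hΛ => ?_⟩
  set C := C₂ * 2 + C₃ * 2 + C₁ * (E + 1) + 1 + C₁ with hC
  have hcap : ∀ C', C' ≤ C → Cap μ (C' * b) W := fun C' hC' =>
    h.of_le (Nat.mul_le_mul_right _ hC')
  have hW : 1 ≤ W := (hcap 1 (by omega)).one_le (by omega)
  set n := Λ.length with hn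
  have hU : 1 ≤ (n + 1) * W := Nat.mul_pos (by omega) hW
  have hWU : W ≤ (n + 1) * W := Nat.le_mul_of_pos_left _ (by omega)
  obtain ⟨a1, a2⟩ := h₁ (Pt d) X hX
  set f : List (Pt d) → Timed Bool := fun R => do
    let Q' ← Q.unionT μ R
    let b ← indepT μ Q'.pts
    if b then allT (Q'.memSpanT μ) Λ else pure false with hf
  have hfc : ∀ R ∈ (listsT X (d + 1)).val, (f R).cost ≤ E * ((n + 1) * W) := by
    intro R hR
    obtain ⟨hRlen, hRX⟩ := (mem_listsT X (d + 1) R).1 hR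
    have hRb : ∀ x ∈ R, ∀ i, bitSize (x i) ≤ b := fun x hx => hXb x (hRX x hx)
    have e1 := RFrame.unionT_cost_le (N := N + (d + 1)) (by simpa using hcap 1 (by omega)) hW
      (Q := Q) (R := R) (by omega) (by omega) hQ.den hRb
    have hQ' := hQ.unionT (μ := μ) hRb
    have hlen' : (Q.unionT μ R).val.pts.length ≤ N + (d + 1) := by
      rw [RFrame.length_unionT]; omega
    set Q' := Q.unionT μ R with hQ'def
    have e2 := h₂ μ (2 * b) W (by omega) (by rw [← mul_assoc]; exact hcap _ (by omega))
      Q'.val.pts hlen' hQ'.pts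
    have e3 : (allT (Q'.val.memSpanT μ) Λ).cost ≤ n * (C₃ * W + 1) + 1 :=
      allT_cost_le fun p hp => h₃ μ (2 * b) W (by omega)
        (by rw [← mul_assoc]; exact hcap _ (by omega)) Q'.val p hlen' hQ'
        fun i => (hΛ p hp i).trans (by omega)
    have e4 : n * (C₃ * W + 1) + 1 ≤ (C₃ + 2) * ((n + 1) * W) := by
      calc n * (C₃ * W + 1) + 1 ≤ (n + 1) * (C₃ * W + W) + (n + 1) * W := by gcongr; omega
        _ = _ := by ring
    have e5 : (f R).cost ≤ Q'.cost + ((indepT μ Q'.val.pts).cost + (C₃ + 2) * ((n + 1) * W)) := by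
      simp only [hf, Timed.cost_bind]
      rw [← hQ'def]
      refine Nat.add_le_add_left (Nat.add_le_add_left ?_ _) _
      split
      · exact e3.trans e4
      · exact Nat.zero_le _
    have e6 := e1.trans (Nat.mul_le_mul_left _ hWU)
    have e7 := e2.trans (Nat.mul_le_mul_left _ hWU)
    rw [hE, add_mul, add_mul]
    omega
  have hcost : (completionsT μ Λ Q X).cost = (listsT X (d + 1)).cost +
    (filterT f (listsT X (d + 1)).val).cost := rfl
  have hval : (completionsT μ Λ Q X).val = (filterT f (listsT X (d + 1)).val).val := rfl
  constructor
  · have h3 : (filterT f (listsT X (d + 1)).val).cost ≤ C₁ * (E * ((n + 1) * W) + 1) + 1 :=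
      (filterT_cost_le hfc).trans (by gcongr)
    rw [hcost]
    calc _ ≤ C₁ * ((n + 1) * W) + (C₁ * (E * ((n + 1) * W) + (n + 1) * W) + (n + 1) * W) := by
          refine Nat.add_le_add (a2.trans (Nat.le_mul_of_pos_right _ hU)) (h3.trans ?_)
          gcongr
      _ = (C₁ + C₁ * (E + 1) + 1) * ((n + 1) * W) := by ring
      _ ≤ _ := Nat.mul_le_mul_right _ (by omega)
  · rw [hval, filterT_val]
    exact (List.length_filter_le _ _).trans (by omega)

theorem cmpPairT_cost_le {b n N : ℕ} {X Y : List (Pt d) × List (Pt d)} (hX1 : X.1.length ≤ n)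
    (hX2 : X.2.length ≤ N) (hXb1 : ∀ p ∈ X.1, ∀ i, bitSize (p i) ≤ b)
    (hXb2 : ∀ p ∈ X.2, ∀ i, bitSize (p i) ≤ b) (hYb1 : ∀ p ∈ Y.1, ∀ i, bitSize (p i) ≤ b)
    (hYb2 : ∀ p ∈ Y.2, ∀ i, bitSize (p i) ≤ b) :
    (cmpPairT X Y).cost ≤ (n + N) * (d * (2 * b + 3) + 2) + 2 := by
  have h1 : (cmpListT cmpVecT X.1 Y.1).cost ≤ X.1.length * (d * (2 * b + 3) + 2) + 1 :=
    cmpListT_cost_le fun p hp q hq => cmpVecT_cost_le (hXb1 p hp) (hYb1 q hq)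
  have h2 : (cmpListT cmpVecT X.2 Y.2).cost ≤ X.2.length * (d * (2 * b + 3) + 2) + 1 :=
    cmpListT_cost_le fun p hp q hq => cmpVecT_cost_le (hXb2 p hp) (hYb2 q hq)
  have h3 := Nat.mul_le_mul_right (d * (2 * b + 3) + 2) hX1
  have h4 := Nat.mul_le_mul_right (d * (2 * b + 3) + 2) hX2
  rw [add_mul]
  simp only [cmpPairT, Timed.cost_bind]
  split
  · omega
  · simp only [Timed.cost_pure]; omega
  · simp only [Timed.cost_pure]; omega

/-- The number `x` of candidates is absorbed by the constant. This is legitimate because the bound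
on the number of frames makes `x` depend on `d` only. -/
theorem minimalT_bound (d N x : ℕ) : ∃ C, 1 ≤ C ∧ ∀ μ b W, 1 ≤ b → Cap μ (C * b) W →
    ∀ (Λ : List (Pt d)) (Q : RFrame d) (cand : List (List (Pt d))), cand.length ≤ x →
      0 < Q.den → Q.pts.length ≤ N → Q.BitsLE b →
      (∀ R ∈ cand, R.length ≤ N ∧ ∀ p ∈ R, ∀ i, bitSize (p i) ≤ b) →
      (∀ p ∈ Λ, ∀ i, bitSize (p i) ≤ b) →
      (minimalT μ Λ Q cand).cost ≤
        C * ((Λ.length + 1) * ((Nat.log 2 Λ.length + 1) * (b * W))) := by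
  obtain ⟨C₁, hC₁, h₁⟩ := canonicalFormWithFrameT_bound d (2 * N)
  set D := (N * (2 * d + 2) + 2) + C₁ * 2 with hD
  set F := (2 * N + d + 1 + 1) * (d * (2 * (C₁ * 2) + 3) + 2) + 2 with hF
  refine ⟨C₁ * 2 + (x * (D + 1) + 1) + (x * (F + 1) + 1) + (x * (F + 1) + 1) + (x + 1), by omega,
    fun μ b W hb h Λ Q cand hx hden hN hQ hcand hΛ => ?_⟩
  set C := C₁ * 2 + (x * (D + 1) + 1) + (x * (F + 1) + 1) + (x * (F + 1) + 1) + (x + 1) with hC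
  have hcap : ∀ C', C' ≤ C → Cap μ (C' * b) W := fun C' hC' =>
    h.of_le (Nat.mul_le_mul_right _ hC')
  have hbW : b ≤ W := by simpa using (hcap 1 (by omega)).le
  have hW : 1 ≤ W := hb.trans hbW
  set n := Λ.length with hn
  set P := (Nat.log 2 n + 1) * (b * W) with hP
  have hbP : b * W ≤ P := Nat.le_mul_of_pos_left _ (by omega)
  have hWP : W ≤ P := (Nat.le_mul_of_pos_left _ hb).trans hbP
  set U := (n + 1) * P with hU
  have hPU : P ≤ U := Nat.le_mul_of_pos_left _ (by omega)
  have hU1 : 1 ≤ U := hW.trans (hWP.trans hPU)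
  set f : List (Pt d) → Timed ((List (Pt d) × List (Pt d)) × List (Pt d)) := fun R => do
    let Q' ← Q.unionT μ R
    let X ← canonicalFormWithFrameT μ Λ Q'
    pure (X, R) with hf
  have hcf : ∀ R ∈ cand, _ := fun R hR =>
    h₁ μ (2 * b) W (by omega) (by rw [← mul_assoc]; exact hcap _ (by omega)) (Q.unionT μ R).val Λ
      hden (by rw [RFrame.length_unionT]; have := (hcand R hR).1; omega)
      (hQ.unionT (hcand R hR).2) fun p hp i => (hΛ p hp i).trans (by omega)
  have hfcost : ∀ R ∈ cand, (f R).cost ≤ D * U := by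
    intro R hR
    have e1 := RFrame.unionT_cost_le (N := N) (by simpa using hcap 1 (by omega)) hW
      (Q := Q) (R := R) hN (hcand R hR).1 hQ.den (hcand R hR).2
    have e3 : C₁ * ((n + 1) * ((Nat.log 2 n + 1) * (2 * b * W))) = C₁ * 2 * U := by
      rw [hU, hP]; ring
    have e2 := (hcf R hR).1.trans (le_of_eq e3)
    have e4 := e1.trans (Nat.mul_le_mul_left _ (hWP.trans hPU))
    have e5 : (f R).cost = (Q.unionT μ R).cost +
      ((canonicalFormWithFrameT μ Λ (Q.unionT μ R).val).cost + 0) := rfl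
    rw [e5, hD, add_mul]
    omega
  have hkeyed : (mapT f cand).cost ≤ x * (D * U + 1) + 1 :=
    (mapT_cost_le hfcost).trans (by gcongr)
  have hmem : ∀ a ∈ (mapT f cand).val, ∃ R ∈ cand,
      a.1 = (canonicalFormWithFrameT μ Λ (Q.unionT μ R).val).val := by
    intro a ha
    rw [mapT_val] at ha
    obtain ⟨R, hR, rfl⟩ := List.mem_map.1 ha
    exact ⟨R, hR, rfl⟩
  have hcmp : ∀ a ∈ (mapT f cand).val, ∀ a' ∈ (mapT f cand).val, (cmpPairT a.1 a'.1).cost ≤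
      F * U := by
    intro a ha a' ha'
    obtain ⟨R, hR, e⟩ := hmem a ha
    obtain ⟨R', hR', e'⟩ := hmem a' ha'
    rw [e, e']
    obtain ⟨-, q1, q2, q3, q4⟩ := hcf R hR
    obtain ⟨-, -, r2, -, r4⟩ := hcf R' hR'
    refine (cmpPairT_cost_le q1 q3 q2 q4 r2 r4).trans ?_
    calc (n + (2 * N + d + 1)) * (d * (2 * (C₁ * (2 * b)) + 3) + 2) + 2
        ≤ (n + 1) * (2 * N + d + 1 + 1) * (d * (2 * (C₁ * (2 * b)) + 3 * b) + 2 * b) + 2 * U := by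
          have : n + (2 * N + d + 1) ≤ (n + 1) * (2 * N + d + 1 + 1) := by nlinarith
          gcongr <;> omega
      _ = (2 * N + d + 1 + 1) * (d * (2 * (C₁ * 2) + 3) + 2) * ((n + 1) * b) + 2 * U := by ring
      _ ≤ (2 * N + d + 1 + 1) * (d * (2 * (C₁ * 2) + 3) + 2) * U + 2 * U := by
          have : (n + 1) * b ≤ U := Nat.mul_le_mul_left _ (hbW.trans hWP)
          gcongr
      _ = F * U := by rw [hF]; ring
  have hlen : (mapT f cand).val.length ≤ x := by rw [mapT_val, List.length_map]; exact hx
  have hfix : minimalT μ Λ Q cand = (do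
      let keyed ← mapT f cand
      match keyed with
      | [] => pure []
      | x :: xs => do
        let best ← minT (fun a b => cmpPairT a.1 b.1) x xs
        let sel ← filterT (fun a => do
          let o ← cmpPairT a.1 best.1
          pure (o == .eq)) keyed
        mapT (fun a => pure a.2) sel) := rfl
  have hCU : C * U = C₁ * 2 * U + (x * (D * U + U) + U) + (x * (F * U + U) + U) +
    (x * (F * U + U) + U) + (x * U + U) := by rw [hC]; ring
  have hk' : x * (D * U + 1) + 1 ≤ x * (D * U + U) + U := by gcongr
  rw [hfix]
  simp only [Timed.cost_bind]
  generalize mapT f cand = keyed at *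
  rw [hCU]
  cases hkv : keyed.val with
  | nil =>
    simp only [Timed.cost_pure]
    omega
  | cons y ys =>
    rw [hkv] at hcmp hlen
    simp only [Timed.cost_bind]
    have m1 : (minT (fun a b => cmpPairT a.1 b.1) y ys).cost ≤ ys.length * (F * U + 1) + 1 :=
      minT_cost_le hcmp
    have hb := minT_mem (fun a b => cmpPairT a.1 b.1) y ys
    generalize minT (fun a b => cmpPairT a.1 b.1) y ys = best at *
    have m2 : (filterT (fun a => do
          let o ← cmpPairT a.1 best.val.1
          pure (o == .eq)) (y :: ys)).cost ≤ (y :: ys).length * (F * U + 1) + 1 :=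
      filterT_cost_le fun a ha => by simpa using hcmp a ha best.val hb
    have m3 : (filterT (fun a => do
          let o ← cmpPairT a.1 best.val.1
          pure (o == .eq)) (y :: ys)).val.length ≤ x := by
      rw [filterT_val]; exact (List.length_filter_le _ _).trans hlen
    generalize filterT (fun a => do
          let o ← cmpPairT a.1 best.val.1
          pure (o == .eq)) (y :: ys) = sel at *
    have m4 : (mapT (fun a : (List (Pt d) × List (Pt d)) × List (Pt d) =>
        (pure a.2 : Timed (List (Pt d)))) sel.val).cost ≤ sel.val.length * (0 + 1) + 1 :=
      mapT_cost_le fun _ _ => le_rfl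
    have m1' : ys.length * (F * U + 1) + 1 ≤ x * (F * U + U) + U := by
      have : ys.length ≤ x := by simp at hlen; omega
      gcongr
    have m2' : (y :: ys).length * (F * U + 1) + 1 ≤ x * (F * U + U) + U := by gcongr
    have m4' : sel.val.length * (0 + 1) + 1 ≤ x * U + U := by
      have : 0 + 1 ≤ U := hU1
      gcongr
    omega

theorem congruentT_cost (p q : Pt d) : (congruentT p q).cost = 4 * d := by
  have : (congruentT p q).cost = ∑ _i : Fin d, (2 + 1) + (d + 0) := rfl
  rw [this]
  simp
  omega

theorem insertClassT_cost_le (p : Pt d) (cs : List (List (Pt d))) :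
    (insertClassT p cs).cost ≤ cs.length * (4 * d + 1) + 1 := by
  induction cs with
  | nil => simp [insertClassT]
  | cons c cs ih =>
    rw [List.length_cons, add_mul]
    cases c with
    | nil =>
      simp only [insertClassT, Timed.cost_bind, tick_cost, Timed.cost_pure]
      omega
    | cons q c =>
      simp only [insertClassT, Timed.cost_bind, tick_cost, congruentT_cost]
      split
      · simp only [Timed.cost_pure]; omega
      · simp only [Timed.cost_bind, Timed.cost_pure]; omega

theorem length_partitionT_le (l : List (Pt d)) : (partitionT l).val.length ≤ 2 ^ d := by
  obtain ⟨ρs, hnd, hval, -⟩ := partitionT_spec l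
  rw [hval, List.length_map]
  have := hnd.length_le_card
  simpa [ZMod.card] using this

theorem partitionT_cost_le (l : List (Pt d)) :
    (partitionT l).cost ≤ l.length * (2 ^ d * (4 * d + 1) + 2) + 1 := by
  induction l with
  | nil => simp [partitionT]
  | cons p l ih =>
    have h1 := (insertClassT_cost_le p (partitionT l).val).trans
      (Nat.add_le_add_right (Nat.mul_le_mul_right _ (length_partitionT_le l)) 1)
    simp only [partitionT, Timed.cost_bind, tick_cost, List.length_cons, add_mul]
    omega

theorem lengthT_cost_le_log (l : List (Pt d)) :
    (lengthT l).cost ≤ 4 * ((l.length + 1) * (Nat.log 2 l.length + 1)) := by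
  have h1 := lengthT_cost_le l
  have h2 := size_le_log_add_one l.length
  set n := l.length
  calc _ ≤ n * (Nat.log 2 n + 1 + 2) + 1 := h1.trans (by gcongr)
    _ ≤ 4 * ((n + 1) * (Nat.log 2 n + 1)) := by nlinarith [Nat.zero_le (n * Nat.log 2 n)]

theorem largeClassT_cost_le {n : ℕ} {cs : List (List (Pt d))} (h : ∀ c ∈ cs, c.length ≤ n) :
    (largeClassT n cs).cost ≤ cs.length * (10 * ((n + 1) * (Nat.log 2 n + 1))) + 1 := by
  induction cs with
  | nil => simp [largeClassT]
  | cons c cs ih =>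
    have hc := h c (by simp)
    have ih := ih fun x hx => h x (by simp [hx])
    have h1 := lengthT_cost_le_log c
    have h2 : 4 * ((c.length + 1) * (Nat.log 2 c.length + 1)) ≤
        4 * ((n + 1) * (Nat.log 2 n + 1)) := by
      have := Nat.log_mono_right (b := 2) hc
      gcongr
    have h3 := size_le_log_add_one n
    have h4 : Nat.size (2 * c.length) ≤ Nat.log 2 n + 2 := by
      rw [Nat.size_le]
      calc 2 * c.length ≤ 2 * n := by omega
        _ < 2 * 2 ^ (Nat.log 2 n + 1) :=
          Nat.mul_lt_mul_of_pos_left (Nat.lt_pow_succ_log_self one_lt_two n) (by norm_num)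
        _ = 2 ^ (Nat.log 2 n + 2) := by ring
    have h5 : Nat.log 2 n + 1 ≤ (n + 1) * (Nat.log 2 n + 1) :=
      Nat.le_mul_of_pos_left _ (by omega)
    simp only [largeClassT, Timed.cost_bind, tick_cost, lengthT_val, List.length_cons, add_mul,
      one_mul] at ih h1 h2 h5 ⊢
    split
    · simp only [Timed.cost_pure]; omega
    · simp only [Timed.cost_bind]
      split <;> simp only [Timed.cost_pure] <;> omega

end LocalCost

/-! ## Cost of `EquivariantFrames2` -/

section RecursionInvariant

variable {d : ℕ}

/-- The invariant of the recursion: bounds for the points and for the frame, which imply that all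
numbers have `O(s)` bits. -/
structure NodeInv (s δ : ℕ) (Λ : List (Pt d)) (Q : RFrame d) : Prop where
  nodup : Λ.Nodup
  pos : 0 < Q.den
  frame : IsFrame Q.toList
  diam : DiamLT Λ δ
  abs_le : ∀ p ∈ Λ, ∀ i, |p i| ≤ 2 ^ s
  den_le : Q.den * 2 ^ δ ≤ 2 ^ (s + 1)
  pts_le : ∀ q ∈ Q.pts, ∀ i, |q i| ≤ Q.den * 2 ^ (s + 1)

variable {s δ : ℕ} {Λ : List (Pt d)} {Q : RFrame d}

theorem NodeInv.sublist (h : NodeInv s δ Λ Q) {Λ' : List (Pt d)} (hs : Λ'.Sublist Λ) :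
    NodeInv s δ Λ' Q :=
  ⟨h.nodup.sublist hs, h.pos, h.frame, h.diam.mono fun _ hp => hs.subset hp,
    fun p hp => h.abs_le p (hs.subset hp), h.den_le, h.pts_le⟩

theorem NodeInv.unionT (h : NodeInv s δ Λ Q) (μ : ℕ → ℕ) {R : List (Pt d)}
    (hR : ∀ p ∈ R, ∀ i, |p i| ≤ 2 ^ s) (hf : IsFrame (Q.toList ++ R.map toRat)) :
    NodeInv s δ Λ (Q.unionT μ R).val := by
  refine ⟨h.nodup, h.pos, ?_, h.diam, h.abs_le, h.den_le, fun q hq i => ?_⟩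
  · rw [RFrame.unionT_toList μ h.pos]
    exact hf
  · rw [RFrame.unionT_pts, List.mem_append] at hq
    rcases hq with hq | hq
    · exact h.pts_le q hq i
    · obtain ⟨x, hx, rfl⟩ := List.mem_map.1 hq
      show |Q.den * x i| ≤ Q.den * 2 ^ (s + 1)
      rw [abs_mul, abs_of_pos h.pos]
      refine mul_le_mul_of_nonneg_left ((hR x hx i).trans ?_) h.pos.le
      exact pow_le_pow_right₀ (by norm_num) (by omega)

/-- The denominator doubles while `δ` drops by one, so `den * 2 ^ δ` is preserved. Halved
differences of points are again at most `2 ^ s`. For the numerators, `den * 2 ^ (s + 1) + den * 2 ^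
s` is at most the new bound `2 * den * 2 ^ (s + 1)`. -/
theorem NodeInv.halve (h : NodeInv s (δ + 1) Λ Q) (μ : ℕ → ℕ) {p : Pt d} (hp : p ∈ Λ)
    (hres : ∀ x ∈ Λ, residue x = residue p) :
    NodeInv s δ (Λ.map (halvePt p)) (Q.shrinkT μ p).val := by
  have hhalf : ∀ x ∈ Λ, ∀ i, 2 * halvePt p x i + p i = x i := fun x hx i => by
    have := congrFun (two_mul_halvePt (hres x hx)) i
    simpa using this
  have hden : (Q.shrinkT μ p).val.den = 2 * Q.den := by
    rw [RFrame.shrinkT_den]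
    ring
  refine ⟨?_, ?_, ?_, h.diam.halve hres, ?_, ?_, ?_⟩
  · refine h.nodup.map_on fun x hx y hy hxy => ?_
    funext i
    rw [← hhalf x hx i, ← hhalf y hy i, hxy]
  · rw [hden]
    have := h.pos
    omega
  · rw [RFrame.shrinkT_toList μ h.pos]
    exact (isFrame_map (halveAt_injective _)).2 h.frame
  · intro y hy i
    obtain ⟨x, hx, rfl⟩ := List.mem_map.1 hy
    have h1 := hhalf x hx i
    have h2 := _root_.abs_le.1 (h.abs_le x hx i)
    have h3 := _root_.abs_le.1 (h.abs_le p hp i)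
    rw [_root_.abs_le]
    constructor <;> linarith
  · have := h.den_le
    rw [hden]
    rw [pow_succ] at this
    linarith
  · intro q hq i
    have hpts : (Q.shrinkT μ p).val.pts = Q.pts.map (fun q => q - Q.den • p) := by
      show (diffsT (vecScaleT μ Q.den p).val Q.pts).val = _
      rw [diffsT, mapT_val]
      rfl
    rw [hpts] at hq
    obtain ⟨q', hq', rfl⟩ := List.mem_map.1 hq
    have h1 := h.pts_le q' hq' i
    have h2 : |Q.den * p i| ≤ Q.den * 2 ^ s := by
      rw [abs_mul, abs_of_pos h.pos]
      exact mul_le_mul_of_nonneg_left (h.abs_le p hp i) h.pos.le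
    have h3 := abs_sub (q' i) (Q.den * p i)
    have h4 : 0 ≤ Q.den * 2 ^ s := mul_nonneg h.pos.le (by positivity)
    show |q' i - Q.den * p i| ≤ _
    rw [hden]
    rw [pow_succ] at h1 ⊢
    linarith

theorem NodeInv.length_le (h : NodeInv s δ Λ Q) : Q.pts.length ≤ d + 1 := by
  have := h.frame.length_le
  simpa [RFrame.toList] using this

theorem NodeInv.bitSize_le (h : NodeInv s δ Λ Q) (hs : 1 ≤ s) :
    ∀ p ∈ Λ, ∀ i, bitSize (p i) ≤ 6 * s := by
  intro p hp i
  have : bitSize (p i) ≤ (s + 1) + 1 := bitSize_le_iff.2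
    ((h.abs_le p hp i).trans_lt (pow_lt_pow_right₀ (by norm_num) (by omega)))
  omega

/-- The denominator is at most `2 ^ (s + 1)`, so the numerators are at most `2 ^ (2 * s + 2)` and
have at most `2 * s + 4 ≤ 6 * s` bits. -/
theorem NodeInv.bitsLE (h : NodeInv s δ Λ Q) (hs : 1 ≤ s) : Q.BitsLE (6 * s) := by
  have hden : Q.den ≤ 2 ^ (s + 1) := by
    have h1 := h.den_le
    have h2 : (1 : ℤ) ≤ 2 ^ δ := one_le_pow₀ (by norm_num)
    have := h.pos
    nlinarith
  constructor
  · have : bitSize Q.den ≤ (s + 2) + 1 := bitSize_le_iff.2 (by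
      rw [abs_of_pos h.pos]
      exact hden.trans_lt (pow_lt_pow_right₀ (by norm_num) (by omega)))
    omega
  · intro q hq i
    have : bitSize (q i) ≤ (2 * s + 3) + 1 := bitSize_le_iff.2 (by
      refine (h.pts_le q hq i).trans_lt ?_
      calc Q.den * 2 ^ (s + 1) ≤ 2 ^ (s + 1) * 2 ^ (s + 1) := by gcongr
        _ = 2 ^ (2 * s + 2) := by rw [← pow_add]; congr 1; omega
        _ < _ := pow_lt_pow_right₀ (by norm_num) (by omega))
    omega

/-- The size of the output of `EquivariantFrames2`. -/
theorem NodeInv.output (h : NodeInv s δ Λ Q) (μ : ℕ → ℕ) {r : ℕ} (hr : Λ.length + δ + 1 ≤ r) :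
    (equivariantFrames2T μ r Λ Q).val.length ≤ 3 ^ (d * d) ∧
      ∀ V ∈ (equivariantFrames2T μ r Λ Q).val, V.length ≤ d + 1 ∧ ∀ p ∈ V, p ∈ Λ := by
  obtain ⟨h1, -, h2⟩ := equivariantFrames2T_spec μ r h.nodup h.pos h.frame h.diam hr
  constructor
  · rw [← List.toFinset_card_of_nodup h1]
    exact h2.card_le h.frame
  · intro V hV
    obtain ⟨h3, h4⟩ := h2.frames h.frame V (List.mem_toFinset.2 hV)
    refine ⟨?_, fun p hp => List.mem_toFinset.1 (mem_outside.1 (h3 p hp)).1⟩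
    simpa using h4.1.append_right.length_le

theorem length_flatten_insertClassT (p : Pt d) (cs : List (List (Pt d))) :
    (insertClassT p cs).val.flatten.length = cs.flatten.length + 1 := by
  induction cs with
  | nil => rfl
  | cons c cs ih =>
    cases c with
    | nil =>
      simp only [insertClassT, Timed.val_bind, Timed.val_pure, List.flatten_cons,
        List.nil_append, ih]
    | cons q c =>
      simp only [insertClassT, Timed.val_bind]
      split
      · simp [Timed.val_pure]
      · simp only [Timed.val_bind, Timed.val_pure, List.flatten_cons, List.length_append, ih]
        omega

theorem length_flatten_partitionT (l : List (Pt d)) :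
    (partitionT l).val.flatten.length = l.length := by
  induction l with
  | nil => rfl
  | cons p l ih =>
    simp only [partitionT, Timed.val_bind, length_flatten_insertClassT, ih, List.length_cons]

theorem mem_partitionT {l c : List (Pt d)} (hc : c ∈ (partitionT l).val) :
    c.Sublist l ∧ c ≠ [] ∧ ∃ ρ, c = classList l ρ := by
  obtain ⟨ρs, -, hval, hmem⟩ := partitionT_spec l
  rw [hval] at hc
  obtain ⟨ρ, hρ, rfl⟩ := List.mem_map.1 hc
  obtain ⟨p, hp, hpρ⟩ := (hmem ρ).1 hρ
  exact ⟨List.filter_sublist, List.ne_nil_of_mem (mem_classList.2 ⟨hp, hpρ⟩), ρ, rfl⟩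

theorem partitionT_cases {l : List (Pt d)} (hl : l ≠ []) :
    (∃ c, (partitionT l).val = [c] ∧ ∀ x ∈ l, ∀ y ∈ l, residue x = residue y) ∨
      (∀ c, (partitionT l).val = [c] → False) ∧
        ∀ c ∈ (partitionT l).val, c.length < l.length := by
  obtain ⟨ρs, hnd, hval, hmem⟩ := partitionT_spec l
  match ρs with
  | [] =>
    obtain ⟨p, hp⟩ := List.exists_mem_of_ne_nil _ hl
    have := (hmem (residue p)).2 ⟨p, hp, rfl⟩
    simp at this
  | [ρ] =>
    have hres := allCongruent_of_singleton hmem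
    exact .inl ⟨_, hval, fun x hx y hy => (hres x hx).trans (hres y hy).symm⟩
  | ρ :: ρ' :: ρs =>
    refine .inr ⟨fun c hc => by rw [hval] at hc; simp at hc, fun c hc => ?_⟩
    rw [hval] at hc
    obtain ⟨σ, hσ, rfl⟩ := List.mem_map.1 hc
    by_cases h : σ = ρ
    · exact classList_length_lt (c' := ρ') (by
        rintro rfl
        simp [← h] at hnd) ((hmem ρ').1 (by simp))
    · exact classList_length_lt h ((hmem ρ).1 (by simp))

/-- A class with at most half of the points gains one unit of logarithm, which is the unit that pays
for the local work. -/
theorem one_add_log_le {k n : ℕ} (hk : 1 ≤ k) (h : 2 * k ≤ n) :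
    1 + Nat.log 2 k ≤ Nat.log 2 n := by
  calc 1 + Nat.log 2 k = Nat.log 2 (k * 2) := by
        rw [Nat.log_mul_base one_lt_two (by omega)]; omega
    _ ≤ _ := Nat.log_mono_right (by omega)

end RecursionInvariant

section StepCost

variable {d : ℕ}

/-- A bound for the size of a list of lists of points. -/
def FramesLE (g m b : ℕ) (F : List (List (Pt d))) : Prop :=
  F.length ≤ g ∧ ∀ V ∈ F, V.length ≤ m ∧ ∀ p ∈ V, ∀ i, bitSize (p i) ≤ b

/-- With at most `h` classes, `g` frames for each of them and `m` points in a frame, the pool has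
bounded size, and the quadratic removal of repetitions costs only a constant times `b`. -/
theorem pool_cost_le {h g m b : ℕ} (hb : 1 ≤ b) {S : List (List (List (Pt d)))}
    (hS : S.length ≤ h) (hF : ∀ F ∈ S, FramesLE g m b F) :
    (flattenT S).cost + ((flattenT S.flatten).cost + (dedupT eqVecT S.flatten.flatten).cost) ≤
        ((h * g + 2 * h + 1) + (h * g * m + 2 * (h * g) + 1) +
          (h * g * m * (h * g * m * (d * 5 + 2) + 2) + 1)) * b ∧
      (dedupT eqVecT S.flatten.flatten).val.length ≤ h * g * m ∧
      ∀ p ∈ (dedupT eqVecT S.flatten.flatten).val, ∀ i, bitSize (p i) ≤ b := by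
  have h1 : S.flatten.length ≤ h * g :=
    (length_flatten_le fun F hFS => (hF F hFS).1).trans (Nat.mul_le_mul_right _ hS)
  have hV : ∀ V ∈ S.flatten, V.length ≤ m ∧ ∀ p ∈ V, ∀ i, bitSize (p i) ≤ b := by
    intro V hV
    obtain ⟨F, hFS, hVF⟩ := List.mem_flatten.1 hV
    exact (hF F hFS).2 V hVF
  have h2 : S.flatten.flatten.length ≤ h * g * m :=
    (length_flatten_le fun V hVS => (hV V hVS).1).trans (Nat.mul_le_mul_right _ h1)
  have hp : ∀ p ∈ S.flatten.flatten, ∀ i, bitSize (p i) ≤ b := by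
    intro p hp
    obtain ⟨V, hVS, hpV⟩ := List.mem_flatten.1 hp
    exact (hV V hVS).2 p hpV
  refine ⟨?_, (length_dedupT_le _ _).trans h2, fun p hpX => hp p (dedupT_val_subset _ _ p hpX)⟩
  have h3 : (dedupT eqVecT S.flatten.flatten).cost ≤
      h * g * m * (h * g * m * (d * (2 * b + 3) + 1 + 1) + 2) + 1 :=
    (dedupT_cost_le fun x hx y hy => eqVecT_cost_le (hp x hx) (hp y hy)).trans (by gcongr)
  have h4 : h * g * m * (h * g * m * (d * (2 * b + 3) + 1 + 1) + 2) + 1 ≤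
      (h * g * m * (h * g * m * (d * 5 + 2) + 2) + 1) * b := by
    calc _ = h * g * m * (h * g * m * (d * (2 * b + 3) + 2) + 2) + 1 := by ring
      _ ≤ h * g * m * (h * g * m * (d * (2 * b + 3 * b) + 2 * b) + 2 * b) + b := by
          gcongr <;> omega
      _ = _ := by ring
  rw [flattenT_cost, flattenT_cost, add_mul, add_mul]
  have h5 := Nat.le_mul_of_pos_right (h * g + 2 * h + 1) hb
  have h6 := Nat.le_mul_of_pos_right (h * g * m + 2 * (h * g) + 1) hb
  omega

/-- The step of `equivariantFrames2T` when all points are congruent modulo 2. -/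
def congruentStepT (μ : ℕ → ℕ) (rec : List (Pt d) → RFrame d → Timed (List (List (Pt d))))
    (p : Pt d) (Λ : List (Pt d)) (Q : RFrame d) : Timed (List (List (Pt d))) := do
  let Λ' ← mapT (fun x => do
    let y ← vecSubT x p
    vecHalfT y) Λ
  let Q' ← Q.shrinkT μ p
  let S' ← rec Λ' Q'
  mapT (fun V => mapT (fun x => do
    let y ← vecAddT x x
    vecAddT y p) V) S'

theorem congruentStepT_cost_le (g : ℕ) {μ : ℕ → ℕ} {b W : ℕ} (hb : 1 ≤ b)
    (h : Cap μ (2 * b) W) (rec : List (Pt d) → RFrame d → Timed (List (List (Pt d))))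
    {p : Pt d} {Λ : List (Pt d)} {Q : RFrame d} (hΛ : ∀ x ∈ Λ, ∀ i, bitSize (x i) ≤ b)
    (hp : p ∈ Λ) (hQN : Q.pts.length ≤ d + 1) (hQ : Q.BitsLE b)
    (hrec : FramesLE g (d + 1) b (rec (Λ.map (halvePt p)) (Q.shrinkT μ p).val).val) :
    (congruentStepT μ rec p Λ Q).cost ≤
      ((5 * d + 2) + ((d + 1) * (3 * d + 1) + 2 * d + 3) +
        (g * ((d + 1) * (6 * d + 1) + 2) + 1)) * (Λ.length * W) +
        (rec (Λ.map (halvePt p)) (Q.shrinkT μ p).val).cost := by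
  have hW : 1 ≤ W := h.one_le (by omega)
  have hn : 1 ≤ Λ.length := List.length_pos_of_mem hp
  set n := Λ.length with hn'
  have hWn : W ≤ n * W := Nat.le_mul_of_pos_left _ hn
  set f : Pt d → Timed (Pt d) := fun x => do
    let y ← vecSubT x p
    vecHalfT y with hf
  set φ : List (Pt d) → Timed (List (Pt d)) := fun V => mapT (fun x => do
    let y ← vecAddT x x
    vecAddT y p) V with hφ
  set S := rec (Λ.map (halvePt p)) (Q.shrinkT μ p).val with hS
  have hval : (mapT f Λ).val = Λ.map (halvePt p) := by rw [mapT_val]; rfl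
  have hcost : (congruentStepT μ rec p Λ Q).cost =
      (mapT f Λ).cost + ((Q.shrinkT μ p).cost + (S.cost + (mapT φ S.val).cost)) := by
    rw [hS, ← hval]
    rfl
  have hfc : ∀ x ∈ Λ, (f x).cost ≤ d * (2 * W + 1) + d * (W + 1) := by
    intro x hx
    have e1 := h.vecSubT_cost_le (u := x) (v := p) (fun i => (hΛ x hx i).trans (by omega))
      fun i => (hΛ p hp i).trans (by omega)
    have e2 := h.vecHalfT_cost_le (u := (vecSubT x p).val) fun i =>
      (bitSize_sub_le (hΛ x hx i) (hΛ p hp i)).trans (by omega)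
    exact Nat.add_le_add e1 e2
  have h1 : (mapT f Λ).cost ≤ (5 * d + 2) * (n * W) := by
    refine (mapT_cost_le hfc).trans ?_
    calc n * (d * (2 * W + 1) + d * (W + 1) + 1) + 1
        ≤ n * (d * (2 * W + W) + d * (W + W) + W) + n * W := by
          gcongr
          exact hW.trans hWn
      _ = _ := by ring
  have h2 := (RFrame.shrinkT_cost_le h hb hQN hQ (hΛ p hp)).trans (Nat.mul_le_mul_left _ hWn)
  have hφc : ∀ V ∈ S.val, (φ V).cost ≤ ((d + 1) * (6 * d + 1) + 1) * W := by
    intro V hV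
    obtain ⟨hV1, hV2⟩ := hrec.2 V hV
    refine (mapT_cost_le (c := d * (2 * W + 1) + d * (2 * W + 1)) fun x hx => ?_).trans ?_
    · have e1 := h.vecAddT_cost_le (u := x) (v := x) (fun i => (hV2 x hx i).trans (by omega))
        fun i => (hV2 x hx i).trans (by omega)
      have e2 := h.vecAddT_cost_le (u := (vecAddT x x).val) (v := p)
        (fun i => (bitSize_add_le (hV2 x hx i) (hV2 x hx i)).trans (by omega))
        fun i => (hΛ p hp i).trans (by omega)
      exact Nat.add_le_add e1 e2
    · calc V.length * (d * (2 * W + 1) + d * (2 * W + 1) + 1) + 1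
          ≤ (d + 1) * (d * (2 * W + W) + d * (2 * W + W) + W) + W := by gcongr
        _ = _ := by ring
  have h3 : (mapT φ S.val).cost ≤ (g * ((d + 1) * (6 * d + 1) + 2) + 1) * (n * W) := by
    refine ((mapT_cost_le hφc).trans ?_).trans (Nat.mul_le_mul_left _ hWn)
    calc S.val.length * (((d + 1) * (6 * d + 1) + 1) * W + 1) + 1
        ≤ g * (((d + 1) * (6 * d + 1) + 1) * W + W) + W := by
          gcongr
          exact hrec.1
      _ = _ := by ring
  rw [hcost, add_mul, add_mul]
  omega

/-- The step of `equivariantFrames2T` when no congruence class is large. -/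
def balancedStepT (μ : ℕ → ℕ) (rec : List (Pt d) → RFrame d → Timed (List (List (Pt d))))
    (classes : List (List (Pt d))) (Λ : List (Pt d)) (Q : RFrame d) :
    Timed (List (List (Pt d))) := do
  let S ← mapT (fun c => rec c Q) classes
  let S₁ ← flattenT S
  let S₂ ← flattenT S₁
  let X ← dedupT eqVecT S₂
  let cand ← completionsT μ Λ Q X
  minimalT μ Λ Q cand

/-- The recursive procedure is a parameter, and the costs of its calls are kept as an exact sum.
Only the local work is estimated; the recursion distributes the rest. -/
theorem balancedStepT_bound (d h g : ℕ) : ∃ C, 1 ≤ C ∧ ∀ μ b W, 1 ≤ b → Cap μ (C * b) W →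
    ∀ (rec : List (Pt d) → RFrame d → Timed (List (List (Pt d)))) (classes : List (List (Pt d)))
      (Λ : List (Pt d)) (Q : RFrame d), classes.length ≤ h → 0 < Q.den → Q.pts.length ≤ d + 1 →
      Q.BitsLE b → (∀ p ∈ Λ, ∀ i, bitSize (p i) ≤ b) →
      (∀ c ∈ classes, FramesLE g (d + 1) b (rec c Q).val) →
      (balancedStepT μ rec classes Λ Q).cost ≤ (classes.map fun c => (rec c Q).cost).sum +
        C * ((Λ.length + 1) * ((Nat.log 2 Λ.length + 1) * (b * W))) := by
  obtain ⟨C₁, hC₁, h₁⟩ := completionsT_bound d (d + 1) (h * g * (d + 1))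
  obtain ⟨C₂, hC₂, h₂⟩ := minimalT_bound d (d + 1) C₁
  set D := (h * g + 2 * h + 1) + (h * g * (d + 1) + 2 * (h * g) + 1) +
          (h * g * (d + 1) * (h * g * (d + 1) * (d * 5 + 2) + 2) + 1) with hD
  refine ⟨h + 1 + D + C₁ + C₂, by omega,
    fun μ b W hb hc rec classes Λ Q hh hden hN hQ hΛ hrec => ?_⟩
  have hcap : ∀ C', C' ≤ h + 1 + D + C₁ + C₂ → Cap μ (C' * b) W := fun C' hC' =>
    hc.of_le (Nat.mul_le_mul_right _ hC')
  have hbW : b ≤ W := by simpa using (hcap 1 (by omega)).le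
  have hW : 1 ≤ W := hb.trans hbW
  set n := Λ.length with hn
  have hWP : W ≤ (Nat.log 2 n + 1) * (b * W) :=
    (Nat.le_mul_of_pos_left _ hb).trans (Nat.le_mul_of_pos_left _ (by omega))
  set P := (Nat.log 2 n + 1) * (b * W) with hP
  have hPU : P ≤ (n + 1) * P := Nat.le_mul_of_pos_left _ (by omega)
  set U := (n + 1) * P with hU
  set S := classes.map fun c => (rec c Q).val with hS
  have hSF : ∀ F ∈ S, FramesLE g (d + 1) b F := by
    intro F hF
    obtain ⟨c, hc, rfl⟩ := List.mem_map.1 hF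
    exact hrec c hc
  obtain ⟨e1, e2, e3⟩ := pool_cost_le (h := h) hb (S := S) (by rw [hS, List.length_map]; exact hh) hSF
  set X := dedupT eqVecT S.flatten.flatten with hX
  obtain ⟨e4, e5⟩ := h₁ μ b W hb (hcap _ (by omega)) Λ Q X.val e2 hN hQ e3 hΛ
  have hcand : ∀ R ∈ (completionsT μ Λ Q X.val).val,
      R.length ≤ d + 1 ∧ ∀ p ∈ R, ∀ i, bitSize (p i) ≤ b := by
    intro R hR
    have hR : R ∈ (listsT X.val (d + 1)).val := by
      simp only [completionsT, Timed.val_bind, filterT_val] at hR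
      exact List.mem_of_mem_filter hR
    obtain ⟨q1, q2⟩ := (mem_listsT _ _ R).1 hR
    exact ⟨q1, fun p hp => e3 p (q2 p hp)⟩
  have e6 := h₂ μ b W hb (hcap _ (by omega)) Λ Q _ e5 hden hN hQ hcand hΛ
  have e7 : (mapT (fun c => rec c Q) classes).cost ≤
      (classes.map fun c => (rec c Q).cost).sum + classes.length + 1 :=
    mapT_cost_le_sum fun _ _ => le_rfl
  have hcost : (balancedStepT μ rec classes Λ Q).cost =
      (mapT (fun c => rec c Q) classes).cost + ((flattenT S).cost + ((flattenT S.flatten).cost +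
        (X.cost + ((completionsT μ Λ Q X.val).cost +
          (minimalT μ Λ Q (completionsT μ Λ Q X.val).val).cost)))) := by
    simp only [balancedStepT, Timed.cost_bind, mapT_val, flattenT_val, hX, hS]
  have e8 : C₁ * ((n + 1) * W) ≤ C₁ * U :=
    Nat.mul_le_mul_left _ (Nat.mul_le_mul_left _ hWP)
  have e9 : D * b ≤ D * U := Nat.mul_le_mul_left _ (hbW.trans (hWP.trans hPU))
  have e10 : h + 1 ≤ (h + 1) * U := Nat.le_mul_of_pos_right _ (hW.trans (hWP.trans hPU))
  have e11 : (h + 1 + D + C₁ + C₂) * U = (h + 1) * U + D * U + C₁ * U + C₂ * U := by ring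
  have e12 := e1.trans e9
  have e13 := e4.trans e8
  change _ ≤ C₂ * U at e6
  rw [hcost, e11]
  omega

/-- The step of `equivariantFrames2T` when there is a large congruence class. -/
def unbalancedStepT (μ : ℕ → ℕ) (rec : List (Pt d) → RFrame d → Timed (List (List (Pt d))))
    (big : List (Pt d)) (rest : List (List (Pt d))) (Λ : List (Pt d)) (Q : RFrame d) :
    Timed (List (List (Pt d))) := do
  let S ← mapT (fun c => rec c Q) rest
  let S₁ ← flattenT S
  let S₂ ← flattenT S₁
  let X ← dedupT eqVecT S₂
  let small ← flattenT rest
  let E ← completionsT μ small Q X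
  let RT ← mapT (fun R => do
    let Q' ← Q.unionT μ R
    let SR ← rec big Q'
    mapT (appendT R) SR) E
  let cand ← flattenT RT
  minimalT μ Λ Q cand

/-- The bound on the number of completions is part of the conclusion, since the large class is
treated once for each of them and the recursion has to compensate exactly this factor. -/
theorem unbalancedStepT_bound (d h g : ℕ) : ∃ C, 1 ≤ C ∧ ∀ μ b W, 1 ≤ b → Cap μ (C * b) W →
    ∀ (rec : List (Pt d) → RFrame d → Timed (List (List (Pt d)))) (big : List (Pt d))
      (rest : List (List (Pt d))) (Λ : List (Pt d)) (Q : RFrame d) (X : List (Pt d)),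
      X = (dedupT eqVecT (rest.map fun c => (rec c Q).val).flatten.flatten).val →
      rest.length ≤ h → rest.flatten.length ≤ Λ.length → (∀ p ∈ rest.flatten, p ∈ Λ) →
      0 < Q.den → Q.pts.length ≤ d + 1 → Q.BitsLE b → (∀ p ∈ Λ, ∀ i, bitSize (p i) ≤ b) →
      (∀ c ∈ rest, FramesLE g (d + 1) b (rec c Q).val) →
      (∀ R ∈ (completionsT μ rest.flatten Q X).val,
        FramesLE g (d + 1) b (rec big (Q.unionT μ R).val).val) →
      (completionsT μ rest.flatten Q X).val.length ≤ C ∧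
      (unbalancedStepT μ rec big rest Λ Q).cost ≤ (rest.map fun c => (rec c Q).cost).sum +
        ((completionsT μ rest.flatten Q X).val.map
          fun R => (rec big (Q.unionT μ R).val).cost).sum +
        C * ((Λ.length + 1) * ((Nat.log 2 Λ.length + 1) * (b * W))) := by
  obtain ⟨C₁, hC₁, h₁⟩ := completionsT_bound d (d + 1) (h * g * (d + 1))
  obtain ⟨C₂, hC₂, h₂⟩ := minimalT_bound d (2 * (d + 1)) (C₁ * g)
  set D := (h * g + 2 * h + 1) + (h * g * (d + 1) + 2 * (h * g) + 1) +
          (h * g * (d + 1) * (h * g * (d + 1) * (d * 5 + 2) + 2) + 1) with hD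
  set G := ((d + 1) * (2 * d + 2) + 2) + (g * (d + 3) + 1) with hG
  refine ⟨h + 1 + D + (2 * h + 2) + C₁ + (C₁ * (G + 1) + 1) + (C₁ * g + 2 * C₁ + 1) + C₂,
    by omega, fun μ b W hb hc rec big rest Λ Q X hXdef hh hflen hfsub hden hN hQ hΛ hrest hbig => ?_⟩
  set C := h + 1 + D + (2 * h + 2) + C₁ + (C₁ * (G + 1) + 1) + (C₁ * g + 2 * C₁ + 1) + C₂ with hC
  have hcap : ∀ C', C' ≤ C → Cap μ (C' * b) W := fun C' hC' =>
    hc.of_le (Nat.mul_le_mul_right _ hC')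
  have hbW : b ≤ W := by simpa using (hcap 1 (by omega)).le
  have hW : 1 ≤ W := hb.trans hbW
  set n := Λ.length with hn
  have hWP : W ≤ (Nat.log 2 n + 1) * (b * W) :=
    (Nat.le_mul_of_pos_left _ hb).trans (Nat.le_mul_of_pos_left _ (by omega))
  set P := (Nat.log 2 n + 1) * (b * W) with hP
  have hPU : P ≤ (n + 1) * P := Nat.le_mul_of_pos_left _ (by omega)
  have hnP : n + 1 ≤ (n + 1) * P := Nat.le_mul_of_pos_right _ (hW.trans hWP)
  have hWU : (n + 1) * W ≤ (n + 1) * P := Nat.mul_le_mul_left _ hWP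
  set U := (n + 1) * P with hU
  set S := rest.map fun c => (rec c Q).val with hS
  have hSF : ∀ F ∈ S, FramesLE g (d + 1) b F := by
    intro F hF
    obtain ⟨c, hc, rfl⟩ := List.mem_map.1 hF
    exact hrest c hc
  obtain ⟨e1, e2, e3⟩ := pool_cost_le (h := h) hb (S := S) (by rw [hS, List.length_map]; exact hh) hSF
  rw [← hXdef] at e2 e3
  obtain ⟨e4, e5⟩ := h₁ μ b W hb (hcap _ (by omega)) rest.flatten Q X e2 hN hQ e3
    fun p hp => hΛ p (hfsub p hp)
  have hE : ∀ R ∈ (completionsT μ rest.flatten Q X).val,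
      R.length ≤ d + 1 ∧ ∀ p ∈ R, ∀ i, bitSize (p i) ≤ b := by
    intro R hR
    have hR : R ∈ (listsT X (d + 1)).val := by
      simp only [completionsT, Timed.val_bind, filterT_val] at hR
      exact List.mem_of_mem_filter hR
    obtain ⟨q1, q2⟩ := (mem_listsT _ _ R).1 hR
    exact ⟨q1, fun p hp => e3 p (q2 p hp)⟩
  set E := completionsT μ rest.flatten Q X with hEdef
  set f : List (Pt d) → Timed (List (List (Pt d))) := fun R => do
    let Q' ← Q.unionT μ R
    let SR ← rec big Q'
    mapT (appendT R) SR with hf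
  have hfval : ∀ R, (f R).val = (rec big (Q.unionT μ R).val).val.map fun T => R ++ T := fun R => by
    simp only [hf, Timed.val_bind, mapT_val, appendT_val]
  have hfc : ∀ R ∈ E.val, (f R).cost ≤ (rec big (Q.unionT μ R).val).cost + G * W := by
    intro R hR
    have q1 := RFrame.unionT_cost_le (N := d + 1) (by simpa using hcap 1 (by omega)) hW
      (Q := Q) (R := R) hN (hE R hR).1 hQ.den (hE R hR).2
    have q2 : (mapT (appendT R) (rec big (Q.unionT μ R).val).val).cost ≤ g * (d + 3) + 1 := by
      refine (mapT_cost_le (c := d + 2) fun V _ => ?_).trans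
        (Nat.add_le_add_right (Nat.mul_le_mul_right _ (hbig R hR).1) 1)
      rw [appendT_cost]
      have := (hE R hR).1
      omega
    have q3 := Nat.le_mul_of_pos_right (g * (d + 3) + 1) hW
    have q4 : (f R).cost = (Q.unionT μ R).cost + ((rec big (Q.unionT μ R).val).cost +
      (mapT (appendT R) (rec big (Q.unionT μ R).val).val).cost) := rfl
    rw [q4, hG, add_mul]
    omega
  have e6 : (mapT f E.val).cost ≤ (E.val.map fun R => (rec big (Q.unionT μ R).val).cost).sum +
      (C₁ * (G + 1) + 1) * U := by
    refine (mapT_cost_le_sum hfc).trans ?_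
    have q1 : (E.val.map fun R => (rec big (Q.unionT μ R).val).cost + G * W).sum =
        (E.val.map fun R => (rec big (Q.unionT μ R).val).cost).sum + E.val.length * (G * W) := by
      rw [List.sum_map_add]
      simp
    rw [q1]
    have q2 : E.val.length * (G * W) ≤ C₁ * (G * U) := by
      have := hWP.trans hPU
      gcongr
    have q3 : E.val.length ≤ C₁ * U := by
      exact e5.trans (Nat.le_mul_of_pos_right _ (hW.trans (hWP.trans hPU)))
    have q4 : 1 ≤ U := hW.trans (hWP.trans hPU)
    have q5 : (C₁ * (G + 1) + 1) * U = C₁ * (G * U) + C₁ * U + U := by ring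
    omega
  set RT := (mapT f E.val).val with hRT
  have hRTm : ∀ F ∈ RT, ∃ R ∈ E.val,
      F = (rec big (Q.unionT μ R).val).val.map fun T => R ++ T := by
    intro F hF
    rw [hRT, mapT_val] at hF
    obtain ⟨R, hR, rfl⟩ := List.mem_map.1 hF
    exact ⟨R, hR, hfval R⟩
  have hRTlen : RT.length ≤ C₁ := by rw [hRT, mapT_val, List.length_map]; exact e5
  have e7 : RT.flatten.length ≤ C₁ * g := by
    refine (length_flatten_le fun F hF => ?_).trans (Nat.mul_le_mul_right _ hRTlen)
    obtain ⟨R, hR, rfl⟩ := hRTm F hF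
    rw [List.length_map]
    exact (hbig R hR).1
  have hcand : ∀ V ∈ RT.flatten, V.length ≤ 2 * (d + 1) ∧ ∀ p ∈ V, ∀ i, bitSize (p i) ≤ b := by
    intro V hV
    obtain ⟨F, hF, hVF⟩ := List.mem_flatten.1 hV
    obtain ⟨R, hR, rfl⟩ := hRTm F hF
    obtain ⟨T, hT, rfl⟩ := List.mem_map.1 hVF
    obtain ⟨t1, t2⟩ := (hbig R hR).2 T hT
    obtain ⟨r1, r2⟩ := hE R hR
    constructor
    · rw [List.length_append]
      omega
    · intro p hp
      rcases List.mem_append.1 hp with hp | hp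
      · exact r2 p hp
      · exact t2 p hp
  have e8 := h₂ μ b W hb (hcap _ (by omega)) Λ Q RT.flatten e7 hden (by omega) hQ hcand hΛ
  have e9 : (mapT (fun c => rec c Q) rest).cost ≤
      (rest.map fun c => (rec c Q).cost).sum + rest.length + 1 :=
    mapT_cost_le_sum fun _ _ => le_rfl
  have hcost : (unbalancedStepT μ rec big rest Λ Q).cost =
      (mapT (fun c => rec c Q) rest).cost + ((flattenT S).cost + ((flattenT S.flatten).cost +
        ((dedupT eqVecT S.flatten.flatten).cost + ((flattenT rest).cost + (E.cost +
          ((mapT f E.val).cost + ((flattenT RT).cost +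
            (minimalT μ Λ Q RT.flatten).cost))))))) := by
    simp only [unbalancedStepT, Timed.cost_bind, mapT_val, flattenT_val, hEdef, hXdef, hS, hRT, hf]
  refine ⟨e5.trans (by omega), ?_⟩
  have e10 : C₁ * ((rest.flatten.length + 1) * W) ≤ C₁ * U :=
    Nat.mul_le_mul_left _ ((Nat.mul_le_mul_right _ (by omega)).trans hWU)
  have e11 : D * b ≤ D * U := Nat.mul_le_mul_left _ (hbW.trans (hWP.trans hPU))
  have hU1 : 1 ≤ U := hW.trans (hWP.trans hPU)
  have e12 : h + 1 ≤ (h + 1) * U := Nat.le_mul_of_pos_right _ hU1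
  have e13 : (flattenT rest).cost ≤ (2 * h + 2) * U := by
    rw [flattenT_cost]
    have q1 := Nat.le_mul_of_pos_right (2 * h + 1) hU1
    have q2 : (2 * h + 2) * U = (2 * h + 1) * U + U := by ring
    omega
  have e14 : (flattenT RT).cost ≤ (C₁ * g + 2 * C₁ + 1) * U := by
    rw [flattenT_cost]
    exact le_trans (by omega) (Nat.le_mul_of_pos_right _ hU1)
  have e15 : C * U = (h + 1) * U + D * U + (2 * h + 2) * U + C₁ * U + (C₁ * (G + 1) + 1) * U +
      (C₁ * g + 2 * C₁ + 1) * U + C₂ * U := by rw [hC]; ring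
  have e16 := e1.trans e11
  have e17 := e4.trans e10
  change _ ≤ C₂ * U at e8
  rw [hcost, e15]
  omega

end StepCost

section RecursionCost

variable {d : ℕ} {s δ : ℕ} {Λ : List (Pt d)} {Q : RFrame d}

theorem NodeInv.framesLE (h : NodeInv s δ Λ Q) (hs : 1 ≤ s) (μ : ℕ → ℕ) {r : ℕ}
    (hr : Λ.length + δ + 1 ≤ r) :
    FramesLE (3 ^ (d * d)) (d + 1) (6 * s) (equivariantFrames2T μ r Λ Q).val := by
  obtain ⟨h1, h2⟩ := h.output μ hr
  exact ⟨h1, fun V hV => ⟨(h2 V hV).1, fun p hp => h.bitSize_le hs p ((h2 V hV).2 p hp)⟩⟩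

/-- The points of a list that do not lie in the span of a frame. -/
def outsideT (μ : ℕ → ℕ) (Q : RFrame d) (Λ : List (Pt d)) : Timed (List (Pt d)) :=
  filterT (fun p => do
    let b ← Q.memSpanT μ p
    pure (!b)) Λ

theorem outsideT_val (μ : ℕ → ℕ) (Q : RFrame d) (Λ : List (Pt d)) :
    (outsideT μ Q Λ).val = Λ.filter fun p => !(Q.memSpanT μ p).val := by
  rw [outsideT, filterT_val]
  rfl

theorem equivariantFrames2T_cost_small {μ : ℕ → ℕ} {r : ℕ}
    (hL : (outsideT μ Q Λ).val.length ≤ 1) :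
    (equivariantFrames2T μ (r + 1) Λ Q).cost = 1 + (outsideT μ Q Λ).cost := by
  simp only [equivariantFrames2T, Timed.cost_bind, tick_cost]
  rw [← outsideT]
  match hm : (outsideT μ Q Λ).val with
  | [] => simp [Timed.cost_pure]
  | [p] => simp [Timed.cost_pure]
  | p :: p' :: L => rw [hm] at hL; simp at hL

theorem equivariantFrames2T_cost_congruent {μ : ℕ → ℕ} {r : ℕ} {p p' : Pt d} {L c : List (Pt d)}
    (hL : (outsideT μ Q Λ).val = p :: p' :: L) (hc : (partitionT (p :: p' :: L)).val = [c]) :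
    (equivariantFrames2T μ (r + 1) Λ Q).cost = 1 + ((outsideT μ Q Λ).cost +
      ((partitionT (p :: p' :: L)).cost +
        (congruentStepT μ (equivariantFrames2T μ r) p (p :: p' :: L) Q).cost)) := by
  simp only [equivariantFrames2T, Timed.cost_bind, tick_cost]
  rw [← outsideT, hL]
  simp only [Timed.cost_bind, hc]
  rfl

theorem equivariantFrames2T_cost_balanced {μ : ℕ → ℕ} {r : ℕ} {p p' : Pt d} {L : List (Pt d)}
    (hL : (outsideT μ Q Λ).val = p :: p' :: L)
    (hc : ∀ c, (partitionT (p :: p' :: L)).val = [c] → False)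
    (hl : (largeClassT (p :: p' :: L).length (partitionT (p :: p' :: L)).val).val = none) :
    (equivariantFrames2T μ (r + 1) Λ Q).cost = 1 + ((outsideT μ Q Λ).cost +
      ((partitionT (p :: p' :: L)).cost + ((lengthT (p :: p' :: L)).cost +
        ((largeClassT (p :: p' :: L).length (partitionT (p :: p' :: L)).val).cost +
          (balancedStepT μ (equivariantFrames2T μ r) (partitionT (p :: p' :: L)).val
            (p :: p' :: L) Q).cost)))) := by
  simp only [equivariantFrames2T, Timed.cost_bind, tick_cost]
  rw [← outsideT, hL]
  simp only [Timed.cost_bind, lengthT_val]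
  rw [hl]
  rfl

theorem equivariantFrames2T_cost_unbalanced {μ : ℕ → ℕ} {r : ℕ} {p p' : Pt d} {L : List (Pt d)}
    {big : List (Pt d)} {rest : List (List (Pt d))}
    (hL : (outsideT μ Q Λ).val = p :: p' :: L)
    (hc : ∀ c, (partitionT (p :: p' :: L)).val = [c] → False)
    (hl : (largeClassT (p :: p' :: L).length (partitionT (p :: p' :: L)).val).val =
      some (big, rest)) :
    (equivariantFrames2T μ (r + 1) Λ Q).cost = 1 + ((outsideT μ Q Λ).cost +
      ((partitionT (p :: p' :: L)).cost + ((lengthT (p :: p' :: L)).cost +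
        ((largeClassT (p :: p' :: L).length (partitionT (p :: p' :: L)).val).cost +
          (unbalancedStepT μ (equivariantFrames2T μ r) big rest (p :: p' :: L) Q).cost)))) := by
  simp only [equivariantFrames2T, Timed.cost_bind, tick_cost]
  rw [← outsideT, hL]
  simp only [Timed.cost_bind, lengthT_val]
  rw [hl]
  rfl

/-- The classes are disjoint, so costs proportional to their lengths add up to a cost proportional
to the length of the whole. -/
theorem sum_map_le_length_flatten_mul {α : Type} {cs : List (List α)} {f : List α → ℕ} {K : ℕ}
    (h : ∀ c ∈ cs, f c ≤ c.length * K) : (cs.map f).sum ≤ cs.flatten.length * K := by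
  induction cs with
  | nil => simp
  | cons c cs ih =>
    have h1 := h c (by simp)
    have h2 := ih fun x hx => h x (by simp [hx])
    rw [List.map_cons, List.sum_cons, List.flatten_cons, List.length_append, add_mul]
    omega

end RecursionCost

section RecursionCost

/-- The points of a completion of a frame are among the given points; a completion that covers a
point outside the span of the frame is nonempty. -/
theorem mem_completionsT {d : ℕ} {μ : ℕ → ℕ} {Q : RFrame d} (hQ : 0 < Q.den) {Λ X R : List (Pt d)}
    (hR : R ∈ (completionsT μ Λ Q X).val) :
    (∀ p ∈ R, p ∈ X) ∧ IsFrame (Q.toList ++ R.map toRat) ∧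
      ((∃ p ∈ Λ, toRat p ∉ ratSpan Q.toList) → R ≠ []) := by
  obtain ⟨⟨h1, -⟩, -, h2, h3⟩ := ((completionsT_spec μ hQ Λ X).1 R).1 hR
  refine ⟨h1, h2, ?_⟩
  rintro ⟨p, hp, hpQ⟩ rfl
  exact hpQ (by simpa using h3 p (List.mem_toFinset.2 hp))

/-- The cost of `EquivariantFrames2`. -/
theorem equivariantFrames2T_bound (d : ℕ) : ∃ C c κ : ℕ, 1 ≤ C ∧ ∀ μ s W N, 1 ≤ s →
    Cap μ (C * s) W → ∀ r δ (Λ : List (Pt d)) (Q : RFrame d), NodeInv s δ Λ Q → Λ ≠ [] →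
      Λ.length ≤ N → Λ.length + δ + 1 ≤ r →
      (equivariantFrames2T μ r Λ Q).cost ≤ c * κ ^ (d + 1 - Q.pts.length) *
        (Λ.length * (W * δ + (Nat.log 2 N + 1) * (s * W) * (1 + Nat.log 2 Λ.length))) := by
  obtain ⟨C₁, hC₁, h₁⟩ := RFrame.memSpanT_bound d (d + 1)
  obtain ⟨C₂, hC₂, h₂⟩ := balancedStepT_bound d (2 ^ d) (3 ^ (d * d))
  obtain ⟨C₃, hC₃, h₃⟩ := unbalancedStepT_bound d (2 ^ d) (3 ^ (d * d))
  set D := (5 * d + 2) + ((d + 1) * (3 * d + 1) + 2 * d + 3) +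
        (3 ^ (d * d) * ((d + 1) * (6 * d + 1) + 2) + 1) with hD
  set G := 2 ^ d * (4 * d + 1) + 3 with hG
  set c₁ := 1 + (C₁ + 2) + G + D with hc₁
  set c₂ := c₁ + (8 + (2 ^ d * 20 + 1)) + 12 * C₂ + 12 * C₃ with hc₂
  refine ⟨6 * (2 + C₁ + C₂ + C₃), 2 * c₂, 2 * C₃, by omega, fun μ s W N hs hcapT => ?_⟩
  have hcap : ∀ C', C' ≤ 2 + C₁ + C₂ + C₃ → Cap μ (C' * (6 * s)) W := fun C' hC' =>
    hcapT.of_le <| by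
      calc C' * (6 * s) ≤ (2 + C₁ + C₂ + C₃) * (6 * s) := Nat.mul_le_mul_right _ hC'
        _ = _ := by ring
  have hW : 1 ≤ W := (hcap 1 (by omega)).one_le (by omega)
  have hb : 1 ≤ 6 * s := by omega
  -- The size `N` of the initial set is fixed, so `P` is the same at all nodes; up to a constant it
  -- is the local cost per point.
  set P := (Nat.log 2 N + 1) * (s * W) with hP
  have hsWP : s * W ≤ P := Nat.le_mul_of_pos_left _ (by omega)
  have hWP : W ≤ P := (Nat.le_mul_of_pos_left _ hs).trans hsWP
  have hlogP : Nat.log 2 N + 1 ≤ P := Nat.le_mul_of_pos_right _ (Nat.mul_pos hs hW)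
  have hκ : 0 < 2 * C₃ := by omega
  intro r
  induction r with
  | zero => intros; omega
  | succ r ih =>
  intro δ Λ Q hI hne hN hr
  set n := Λ.length with hn
  have hn1 : 1 ≤ n := List.length_pos_iff.2 hne
  have hQN := hI.length_le
  have hQb := hI.bitsLE hs
  have hΛb := hI.bitSize_le hs
  -- The exponent counts the points that can still be added to the frame. The base exceeds by a
  -- factor 2 the bound `C₃` for the number of completions.
  set K := 2 * c₂ * (2 * C₃) ^ (d + 1 - Q.pts.length) with hK
  have hcK : 2 * c₂ ≤ K := Nat.le_mul_of_pos_right _ (pow_pos hκ _)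
  have hnW : 1 ≤ n * W := Nat.mul_pos hn1 hW
  have hfilter : (outsideT μ Q Λ).cost ≤ (C₁ + 2) * (n * W) := by
    have : (outsideT μ Q Λ).cost ≤ n * (C₁ * W + 1) + 1 := filterT_cost_le fun p hp => by
      simpa using h₁ μ (6 * s) W hb (hcap _ (by omega)) Q p hQN hQb (hΛb p hp)
    calc _ ≤ n * (C₁ * W + W) + n * W := this.trans (by gcongr)
      _ = _ := by ring
  have hval := outsideT_val μ Q Λ
  have hsub : (outsideT μ Q Λ).val.Sublist Λ := by rw [hval]; exact List.filter_sublist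
  have hIL := hI.sublist hsub
  have hout : ∀ p ∈ (outsideT μ Q Λ).val, toRat p ∉ ratSpan Q.toList := fun p hp =>
    (mem_outside.1 (toFinset_filter_memSpanT μ hI.pos hI.frame Λ ▸
      List.mem_toFinset.2 (hval ▸ hp))).2
  have hlocal₁ : 1 + (outsideT μ Q Λ).cost ≤ c₁ * (n * W) := by
    have e : c₁ * (n * W) = n * W + (C₁ + 2) * (n * W) + (G + D) * (n * W) := by rw [hc₁]; ring
    omega
  match hL : (outsideT μ Q Λ).val with
  | [] =>
    rw [equivariantFrames2T_cost_small (by simp [hL])]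
    calc _ ≤ c₁ * (n * W) := hlocal₁
      _ ≤ K * (n * (P * 1)) := by
        have : c₁ ≤ K := by omega
        rw [mul_one]
        gcongr
      _ ≤ _ := by
        gcongr
        exact (Nat.mul_le_mul_left P (by omega)).trans (Nat.le_add_left _ _)
  | [p] =>
    rw [equivariantFrames2T_cost_small (by simp [hL])]
    calc _ ≤ c₁ * (n * W) := hlocal₁
      _ ≤ K * (n * (P * 1)) := by
        have : c₁ ≤ K := by omega
        rw [mul_one]
        gcongr
      _ ≤ _ := by
        gcongr
        exact (Nat.mul_le_mul_left P (by omega)).trans (Nat.le_add_left _ _)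
  | p :: p' :: L' =>
    rw [hL] at hsub hIL hout
    generalize hLdef : p :: p' :: L' = L at hsub hIL hout
    have hpL : p ∈ L := by simp [← hLdef]
    have hp'L : p' ∈ L := by simp [← hLdef]
    have hpp' : p ≠ p' := by
      rintro rfl
      have := hIL.nodup
      simp [← hLdef] at this
    have hLne : L ≠ [] := List.ne_nil_of_mem hpL
    have hLn : L.length ≤ n := hsub.length_le
    have hLb := hIL.bitSize_le hs
    have hlogL : Nat.log 2 L.length ≤ Nat.log 2 n := Nat.log_mono_right hLn
    have hlogN : Nat.log 2 L.length ≤ Nat.log 2 N := Nat.log_mono_right (hLn.trans hN)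
    have hpart : (partitionT L).cost ≤ G * (n * W) := by
      refine (partitionT_cost_le L).trans ?_
      calc _ ≤ (n * W) * (2 ^ d * (4 * d + 1) + 2) + n * W := by
            have : L.length ≤ n * W := hLn.trans (Nat.le_mul_of_pos_right _ hW)
            gcongr
        _ = _ := by rw [hG]; ring
    rcases partitionT_cases hLne with ⟨c, hc, hres⟩ | ⟨hc, hlt⟩
    · obtain ⟨δ, rfl⟩ : ∃ δ', δ = δ' + 1 :=
        Nat.exists_eq_succ_of_ne_zero (hIL.diam.pos hpL hp'L hpp').ne'
      have hIc := hIL.halve μ hpL fun x hx => hres x hx p hpL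
      have hlen : (L.map (halvePt p)).length = L.length := List.length_map _
      have hrec := ih δ _ _ hIc (by simpa using hLne) (by rw [hlen]; omega)
        (by rw [hlen]; omega)
      have hstep := congruentStepT_cost_le (3 ^ (d * d)) hb (hcap 2 (by omega))
        (equivariantFrames2T μ r) hLb hpL hQN hQb
        (hIc.framesLE hs μ (r := r) (by rw [hlen]; omega))
      have hpts : (Q.shrinkT μ p).val.pts.length = Q.pts.length := by
        show (diffsT (vecScaleT μ Q.den p).val Q.pts).val.length = _
        rw [diffsT, mapT_val, List.length_map]
      rw [hlen, hpts, ← hK] at hrec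
      rw [equivariantFrames2T_cost_congruent (hLdef ▸ hL) (hLdef ▸ hc), hLdef]
      have hstep' : D * (L.length * W) ≤ D * (n * W) := by gcongr
      have hstep := hstep.trans (Nat.add_le_add_right hstep' _)
      have e1 : 1 + ((outsideT μ Q Λ).cost + ((partitionT L).cost +
          (congruentStepT μ (equivariantFrames2T μ r) p L Q).cost)) ≤ c₁ * (n * W) +
          (equivariantFrames2T μ r (L.map (halvePt p)) (Q.shrinkT μ p).val).cost := by
        have e : c₁ * (n * W) = n * W + (C₁ + 2) * (n * W) + G * (n * W) + D * (n * W) := by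
          rw [hc₁]; ring
        omega
      -- In the congruent branch the frame and the number of points stay the same, and the local
      -- work is paid by one unit of `δ`.
      calc _ ≤ c₁ * (n * W) + K * (L.length * (W * δ + P * (1 + Nat.log 2 L.length))) :=
            e1.trans (Nat.add_le_add_left hrec _)
        _ ≤ K * (n * W) + K * (n * (W * δ + P * (1 + Nat.log 2 n))) := by
            have : c₁ ≤ K := by omega
            gcongr
        _ = _ := by ring
    -- This is the potential per point available to a class with at most half of the points of `L`:
    -- its logarithm is smaller by one, so no summand `P` is left over.
    · set Z := W * δ + P * Nat.log 2 L.length with hZ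
      have hclassI : ∀ c ∈ (partitionT L).val, NodeInv s δ c Q ∧ c ≠ [] ∧
          c.length < L.length := fun c hcm =>
        ⟨hIL.sublist (mem_partitionT hcm).1, (mem_partitionT hcm).2.1, hlt c hcm⟩
      have hclassrec : ∀ c ∈ (partitionT L).val, 2 * c.length ≤ L.length →
          (equivariantFrames2T μ r c Q).cost ≤ c.length * (K * Z) := by
        intro c hcm h2
        obtain ⟨q1, q2, q3⟩ := hclassI c hcm
        refine (ih δ c Q q1 q2 (by omega) (by omega)).trans ?_
        have q4 := one_add_log_le (List.length_pos_iff.2 q2) h2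
        calc _ ≤ K * (c.length * Z) := by rw [hZ]; gcongr
          _ = _ := by ring
      have hclassF : ∀ c ∈ (partitionT L).val,
          FramesLE (3 ^ (d * d)) (d + 1) (6 * s) (equivariantFrames2T μ r c Q).val := by
        intro c hcm
        obtain ⟨q1, q2, q3⟩ := hclassI c hcm
        exact q1.framesLE hs μ (by omega)
      have hflat := length_flatten_partitionT L
      have hLone : 1 ≤ L.length := List.length_pos_iff.2 hLne
      have hlocal : ∀ C', C' ≤ C₂ ∨ C' ≤ C₃ → 1 + ((outsideT μ Q Λ).cost +
          ((partitionT L).cost + ((lengthT L).cost +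
            (largeClassT L.length (partitionT L).val).cost))) +
            C' * ((L.length + 1) * ((Nat.log 2 L.length + 1) * (6 * s * W))) ≤ c₂ * (n * P) := by
        intro C' hC'
        have hL2 : L.length + 1 ≤ 2 * n := by omega
        have q0 : (L.length + 1) * (Nat.log 2 L.length + 1) ≤ 2 * (n * P) := by
          calc _ ≤ 2 * n * P := Nat.mul_le_mul hL2 ((Nat.add_le_add_right hlogN 1).trans hlogP)
            _ = _ := by ring
        have q1 := lengthT_cost_le_log L
        have q2 := largeClassT_cost_le (n := L.length) (cs := (partitionT L).val)
          fun c hcm => (hlt c hcm).le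
        have q3 : (partitionT L).val.length *
            (10 * ((L.length + 1) * (Nat.log 2 L.length + 1))) ≤ 2 ^ d * (10 * (2 * (n * P))) := by
          gcongr
          exact length_partitionT_le L
        have q4 : (L.length + 1) * ((Nat.log 2 L.length + 1) * (6 * s * W)) ≤ 12 * (n * P) := by
          calc _ ≤ 2 * n * ((Nat.log 2 N + 1) * (6 * s * W)) := by gcongr
            _ = _ := by rw [hP]; ring
        have q5 : C' * ((L.length + 1) * ((Nat.log 2 L.length + 1) * (6 * s * W))) ≤
            (C₂ + C₃) * (12 * (n * P)) := by
          have : C' ≤ C₂ + C₃ := by omega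
          gcongr
        have q6 : n * W ≤ n * P := Nat.mul_le_mul_left _ hWP
        have q7 : 1 ≤ n * P := hnW.trans q6
        have q8 : c₁ * (n * W) = n * W + (C₁ + 2) * (n * W) + G * (n * W) + D * (n * W) := by
          rw [hc₁]; ring
        have q9 : c₁ * (n * W) ≤ c₁ * (n * P) := Nat.mul_le_mul_left _ q6
        have q10 : c₂ * (n * P) = c₁ * (n * P) + 8 * (n * P) + 2 ^ d * (10 * (2 * (n * P))) +
            n * P + (C₂ + C₃) * (12 * (n * P)) := by rw [hc₂]; ring
        omega
      -- The amount `K * (n * P)` beyond `K * (n * Z)` is the budget for the local work and for the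
      -- large class.
      have hfinal : K * (n * (Z + P)) ≤
          K * (n * (W * δ + P * (1 + Nat.log 2 n))) := by
        have : Z + P ≤ W * δ + P * (1 + Nat.log 2 n) := by
          calc Z + P = W * δ + P * (1 + Nat.log 2 L.length) := by rw [hZ]; ring
            _ ≤ _ := by gcongr
        gcongr
      cases hl : (largeClassT L.length (partitionT L).val).val with
      | none =>
        have hsmall := largeClassT_none hl
        have hstep := h₂ μ (6 * s) W hb (hcap _ (by omega)) (equivariantFrames2T μ r)
          (partitionT L).val L Q (length_partitionT_le L) hI.pos hQN hQb hLb hclassF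
        have hsum := sum_map_le_length_flatten_mul (cs := (partitionT L).val)
          (f := fun c => (equivariantFrames2T μ r c Q).cost)
          fun c hcm => hclassrec c hcm (hsmall c hcm)
        rw [hflat] at hsum
        rw [equivariantFrames2T_cost_balanced (hLdef ▸ hL) (hLdef ▸ hc) (by rw [hLdef, hl]), hLdef]
        refine le_trans ?_ hfinal
        have hloc := hlocal C₂ (Or.inl le_rfl)
        have e1 : L.length * (K * Z) ≤ K * (n * Z) := by
          calc _ ≤ n * (K * Z) := Nat.mul_le_mul_right _ hLn
            _ = _ := by ring
        have e2 : c₂ * (n * P) ≤ K * (n * P) := Nat.mul_le_mul_right _ (by omega)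
        have e3 : K * (n * (Z + P)) = K * (n * Z) + K * (n * P) := by ring
        omega
      | some br =>
        obtain ⟨big, rest⟩ := br
        obtain ⟨hbig, l₁, l₂, hcl, hrest⟩ := largeClassT_some hl
        have hrestsub : ∀ c ∈ rest, c ∈ (partitionT L).val := by
          intro c hcm
          rw [hrest] at hcm
          rw [hcl]
          rcases List.mem_append.1 hcm with h | h <;> simp [h]
        have hbigmem : big ∈ (partitionT L).val := by rw [hcl]; simp
        obtain ⟨hbigI, hbigne, hbiglt⟩ := hclassI big hbigmem
        have hlens : rest.flatten.length + big.length = L.length := by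
          rw [← hflat, hcl, hrest]
          simp only [List.flatten_append, List.flatten_cons, List.length_append]
          omega
        have hrestlen : rest.length ≤ 2 ^ d := by
          refine le_trans ?_ (length_partitionT_le L)
          rw [hcl, hrest]
          simp
        have hrestL : ∀ x ∈ rest.flatten, x ∈ L := by
          intro x hx
          obtain ⟨c, hcm, hxc⟩ := List.mem_flatten.1 hx
          exact (mem_partitionT (hrestsub c hcm)).1.subset hxc
        -- The partition has at least two classes, so there are points outside the large one, and
        -- they lie outside the span of `Q`. Every `R ∈ E` covers them and is therefore nonempty.
        have hrestne : ∃ x ∈ rest.flatten, toRat x ∉ ratSpan Q.toList := by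
          have : rest ≠ [] := by
            rintro rfl
            obtain ⟨rfl, rfl⟩ := List.append_eq_nil_iff.1 hrest.symm
            exact hc big (by simpa using hcl)
          obtain ⟨c, hcm⟩ := List.exists_mem_of_ne_nil _ this
          obtain ⟨x, hx⟩ := List.exists_mem_of_ne_nil _ (hclassI c (hrestsub c hcm)).2.1
          have hx' := List.mem_flatten.2 ⟨c, hcm, hx⟩
          exact ⟨x, hx', hout x (hrestL x hx')⟩
        generalize hX : (dedupT eqVecT (rest.map fun c =>
          (equivariantFrames2T μ r c Q).val).flatten.flatten).val = X
        have hXL : ∀ x ∈ X, x ∈ L := by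
          intro x hx
          rw [← hX] at hx
          obtain ⟨V, hV, hxV⟩ := List.mem_flatten.1 (dedupT_val_subset _ _ x hx)
          obtain ⟨F, hF, hVF⟩ := List.mem_flatten.1 hV
          obtain ⟨c, hcm, rfl⟩ := List.mem_map.1 hF
          obtain ⟨q1, q2, q3⟩ := hclassI c (hrestsub c hcm)
          exact (mem_partitionT (hrestsub c hcm)).1.subset
            (((q1.output μ (r := r) (by omega)).2 V hVF).2 x hxV)
        have hER : ∀ R ∈ (completionsT μ rest.flatten Q X).val,
            NodeInv s δ big (Q.unionT μ R).val ∧ R ≠ [] := by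
          intro R hR
          obtain ⟨q1, q2, q3⟩ := mem_completionsT hI.pos hR
          exact ⟨hbigI.unionT μ (fun x hx => hIL.abs_le x (hXL x (q1 x hx))) q2, q3 hrestne⟩
        obtain ⟨hElen, hstep⟩ := h₃ μ (6 * s) W hb (hcap _ (by omega)) (equivariantFrames2T μ r)
          big rest L Q X hX.symm hrestlen (by omega) hrestL hI.pos hQN hQb hLb
          (fun c hcm => hclassF c (hrestsub c hcm))
          (fun R hR => (hER R hR).1.framesLE hs μ (by omega))
        generalize hE : (completionsT μ rest.flatten Q X).val = E at hER hElen hstep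
        have hsum := sum_map_le_length_flatten_mul (cs := rest)
          (f := fun c => (equivariantFrames2T μ r c Q).cost)
          fun c hcm => hclassrec c (hrestsub c hcm) (by
            have : c.length ≤ rest.flatten.length := by
              rw [List.length_flatten]
              exact List.single_le_sum (by simp) _ (List.mem_map_of_mem hcm)
            omega)
        -- Since `R` is nonempty the exponent drops by at least one, which compensates the at most
        -- `C₃` calls and still leaves a factor 2. If `E` is nonempty the exponent is positive, so
        -- the truncated subtraction is exact.
        have hEpow : 2 * (E.length * (2 * c₂ * (2 * C₃) ^ (d + 1 - Q.pts.length - 1))) ≤ K := by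
          match E, hER, hElen with
          | [], _, _ => simp
          | R :: E', hER, hElen =>
            obtain ⟨q1, q2⟩ := hER R (by simp)
            have q3 := q1.length_le
            rw [RFrame.length_unionT] at q3
            have q4 : 1 ≤ R.length := List.length_pos_iff.2 q2
            obtain ⟨m, hm⟩ : ∃ m, d + 1 - Q.pts.length = m + 1 :=
              ⟨d + 1 - Q.pts.length - 1, by omega⟩
            rw [hK, hm, Nat.add_sub_cancel]
            calc _ ≤ 2 * (C₃ * (2 * c₂ * (2 * C₃) ^ m)) := by gcongr
              _ = _ := by ring
        -- The logarithm of the large class need not drop, hence `Z + P` instead of `Z`; the factor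
        -- 2 makes up for it.
        have hEsum : 2 * (E.map fun R =>
            (equivariantFrames2T μ r big (Q.unionT μ R).val).cost).sum ≤
              K * (big.length * (Z + P)) := by
          have q1 : (E.map fun R =>
              (equivariantFrames2T μ r big (Q.unionT μ R).val).cost).sum ≤ E.length *
              (2 * c₂ * (2 * C₃) ^ (d + 1 - Q.pts.length - 1) * (big.length * (Z + P))) := by
            refine (List.sum_le_card_nsmul _ _ ?_).trans (le_of_eq (by
              rw [List.length_map, smul_eq_mul]))
            intro y hy
            obtain ⟨R, hR, rfl⟩ := List.mem_map.1 hy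
            obtain ⟨q1, q2⟩ := hER R hR
            have q4 : 1 ≤ R.length := List.length_pos_iff.2 q2
            refine (ih δ big _ q1 hbigne (by omega) (by omega)).trans ?_
            rw [RFrame.length_unionT]
            have q5 : d + 1 - (Q.pts.length + R.length) ≤ d + 1 - Q.pts.length - 1 := by omega
            have q6 := Nat.pow_le_pow_right hκ q5
            have q7 : W * δ + P * (1 + Nat.log 2 big.length) ≤ Z + P := by
              calc _ ≤ W * δ + P * (1 + Nat.log 2 L.length) := by
                    have : Nat.log 2 big.length ≤ Nat.log 2 L.length :=
                      Nat.log_mono_right hbiglt.le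
                    gcongr
                _ = _ := by rw [hZ]; ring
            exact Nat.mul_le_mul (Nat.mul_le_mul_left _ q6) (Nat.mul_le_mul_left _ q7)
          calc _ ≤ 2 * (E.length * (2 * c₂ * (2 * C₃) ^ (d + 1 - Q.pts.length - 1) *
                (big.length * (Z + P)))) := Nat.mul_le_mul_left _ q1
            _ = 2 * (E.length * (2 * c₂ * (2 * C₃) ^ (d + 1 - Q.pts.length - 1))) *
                (big.length * (Z + P)) := by ring
            _ ≤ _ := Nat.mul_le_mul_right _ hEpow
        rw [equivariantFrames2T_cost_unbalanced (hLdef ▸ hL) (hLdef ▸ hc) (by rw [hLdef, hl]),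
          hLdef]
        refine le_trans ?_ hfinal
        have hloc := hlocal C₃ (Or.inr le_rfl)
        have e1 : 2 * (c₂ * (n * P)) ≤ K * (n * P) := by
          rw [← mul_assoc]
          exact Nat.mul_le_mul_right _ hcK
        -- After division by 2, the large class uses `K * (big.length * Z)` and half of the budget
        -- `K * (n * P)`. The other half pays for the local work, by the factor 2 in `2 * c₂`.
        have e2 : K * (big.length * (Z + P)) ≤ 2 * (K * (big.length * Z)) + K * (n * P) := by
          have e : K * (big.length * P) ≤ K * (n * P) := by
            have : big.length ≤ n := by omega
            gcongr
          have e' : K * (big.length * (Z + P)) = K * (big.length * Z) + K * (big.length * P) := by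
            ring
          omega
        have e3 : rest.flatten.length * (K * Z) + K * (big.length * Z) ≤ K * (n * Z) := by
          calc _ = K * ((rest.flatten.length + big.length) * Z) := by ring
            _ ≤ _ := by
              rw [hlens]
              gcongr
        have e4 : K * (n * (Z + P)) = K * (n * Z) + K * (n * P) := by ring
        omega

end RecursionCost

/-! ## Cost of `CanonicalForm` -/

section TotalCost

variable {d : ℕ}

/-- The minimum serves two purposes: `δ ≤ s` enters the complexity, whereas the sum of the bit sizes
is what the fuel `recursionBound`, defined without `s`, accounts for. -/
theorem nodeInv_start {s : ℕ} {l : List (Pt d)} (hl : l.Nodup)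
    (hb : ∀ p ∈ l, ∀ i, bitSize (p i) ≤ s) : ∃ δ ≤ s, l.length + δ + 1 ≤ recursionBound l ∧
      NodeInv s δ l ⟨1, []⟩ := by
  refine ⟨min s (l.map (fun p => ∑ i, bitSize (p i))).sum, min_le_left _ _, ?_, hl, one_pos,
    isFrame_nil, ?_, fun p hp i => ?_, ?_, ?_⟩
  · unfold recursionBound
    have := min_le_right s (l.map (fun p => ∑ i, bitSize (p i))).sum
    omega
  · rcases min_choice s (l.map (fun p => ∑ i, bitSize (p i))).sum with h | h <;> rw [h]
    · exact diamLT_of_bitSize_le hb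
    · exact diamLT_recursionBound l
  · exact (abs_lt_two_pow_of_bitSize_le ((hb p hp i).trans (Nat.le_succ s))).le
  · rw [one_mul]
    exact pow_le_pow_right₀ (by norm_num) ((min_le_left _ _).trans (Nat.le_succ s))
  · simp

theorem canonicalFormT_bound (d : ℕ) : ∃ C c : ℕ, 1 ≤ C ∧ ∀ μ s W, 1 ≤ s → Cap μ (C * s) W →
    ∀ (l : List (Pt d)) (n : ℕ), l.Nodup → n = max l.length 2 →
      (∀ p ∈ l, ∀ i, bitSize (p i) ≤ s) →
      (canonicalFormT μ l).cost ≤ c * (n * ((Nat.log 2 n + 1) ^ 2 * (s * W))) := by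
  obtain ⟨C₁, c₁, κ, hC₁, h₁⟩ := equivariantFrames2T_bound d
  obtain ⟨C₂, hC₂, h₂⟩ := canonicalFormWithFrameT_bound d (d + 1)
  set F := 2 * (d * (12 * C₂ + 3) + 2) + 1 with hF
  set A := c₁ * κ ^ (d + 1) * 2 + 2 with hA
  refine ⟨C₁ + 6 * C₂ + 6, 1 + A + (3 ^ (d * d) * (12 * C₂ + 1) + 1) +
    (3 ^ (d * d) * (F + 1) + 1), by omega, fun μ s W hs hcapT l n hl hn hb => ?_⟩
  have hcap : ∀ C', C' ≤ C₁ + 6 * C₂ + 6 → Cap μ (C' * s) W := fun C' hC' =>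
    hcapT.of_le (Nat.mul_le_mul_right _ hC')
  have hsW : s ≤ W := by simpa using (hcap 1 (by omega)).le
  have hW : 1 ≤ W := hs.trans hsW
  have hln : l.length ≤ n := by omega
  have hln2 : l.length + 1 ≤ 2 * n := by omega
  have hlog : Nat.log 2 l.length ≤ Nat.log 2 n := Nat.log_mono_right hln
  set V := s * W with hV
  have hV1 : 1 ≤ V := Nat.mul_pos hs hW
  have hWV : W ≤ V := Nat.le_mul_of_pos_left _ hs
  set lg := Nat.log 2 n + 1 with hlg
  have hlg1 : 1 ≤ lg := by omega
  have hlgV : V ≤ lg ^ 2 * V := Nat.le_mul_of_pos_left _ (pow_pos hlg1 2)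
  have hlg2 : lg * V ≤ lg ^ 2 * V := Nat.mul_le_mul_right _ (by nlinarith)
  set U := n * (lg ^ 2 * V) with hU
  have hVU : V ≤ U := hlgV.trans (Nat.le_mul_of_pos_left _ (by omega))
  have hU1 : 1 ≤ U := hV1.trans hVU
  obtain ⟨δ, hδs, hr, hI⟩ := nodeInv_start hl hb
  have hFr := hI.framesLE hs μ hr
  have e1 : (equivariantFrames2T μ (recursionBound l) l ⟨1, []⟩).cost ≤ A * U := by
    -- The recursive bound is stated for nonempty sets; the call on the empty list costs two units.
    by_cases hne : l = []
    · have : (equivariantFrames2T μ (recursionBound l) l ⟨1, []⟩).cost = 2 := by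
        subst hne
        rfl
      rw [this]
      calc 2 ≤ A := by omega
        _ ≤ _ := Nat.le_mul_of_pos_right _ hU1
    · refine (h₁ μ s W l.length hs (hcap _ (by omega)) _ δ l _ hI hne le_rfl hr).trans ?_
      have q1 : l.length * (W * δ + (Nat.log 2 l.length + 1) * (s * W) *
          (1 + Nat.log 2 l.length)) ≤ 2 * U := by
        have r0 : Nat.log 2 l.length + 1 ≤ lg := Nat.add_le_add_right hlog 1
        have r0' : 1 + Nat.log 2 l.length ≤ lg := by omega
        calc _ ≤ n * (W * s + lg * V * lg) :=
              Nat.mul_le_mul hln (Nat.add_le_add (Nat.mul_le_mul_left _ hδs)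
                (Nat.mul_le_mul (Nat.mul_le_mul_right _ r0) r0'))
          _ ≤ n * (lg ^ 2 * V + lg ^ 2 * V) := by
              have r1 : W * s ≤ lg ^ 2 * V := by rwa [mul_comm W s]
              have r2 : lg * V * lg ≤ lg ^ 2 * V := le_of_eq (by ring)
              exact Nat.mul_le_mul_left _ (Nat.add_le_add r1 r2)
          _ = _ := by rw [hU]; ring
      calc _ ≤ c₁ * κ ^ (d + 1) * (2 * U) := Nat.mul_le_mul_left _ q1
        _ = c₁ * κ ^ (d + 1) * 2 * U := by ring
        _ ≤ _ := Nat.mul_le_mul_right _ (by omega)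
  set S := equivariantFrames2T μ (recursionBound l) l ⟨1, []⟩ with hS
  set f : List (Pt d) → Timed (List (Pt d)) := fun R => do
    let X ← canonicalFormWithFrameT μ l ⟨1, R⟩
    pure X.1 with hf
  have hcf : ∀ R ∈ S.val, (f R).cost ≤ 12 * C₂ * U ∧ (f R).val.length ≤ l.length ∧
      ∀ p ∈ (f R).val, ∀ i, bitSize (p i) ≤ C₂ * (6 * s) := by
    intro R hR
    obtain ⟨q1, q2⟩ := hFr.2 R hR
    obtain ⟨r1, r2, r3, -⟩ := h₂ μ (6 * s) W (by omega)
      (by rw [← mul_assoc]; exact hcap _ (by omega)) ⟨1, R⟩ l one_pos q1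
      ⟨by rw [bitSize_one]; omega, q2⟩ fun p hp i => (hb p hp i).trans (by omega)
    refine ⟨?_, r2, r3⟩
    have e : (f R).cost = (canonicalFormWithFrameT μ l ⟨1, R⟩).cost + 0 := rfl
    rw [e, add_zero]
    have r4 : Nat.log 2 l.length + 1 ≤ lg := Nat.add_le_add_right hlog 1
    calc _ ≤ C₂ * (2 * n * (lg * (6 * s * W))) := r1.trans (by gcongr)
      _ = 12 * C₂ * (n * (lg * V)) := by rw [hV]; ring
      _ ≤ _ := by rw [hU]; gcongr
  have e2 : (mapT f S.val).cost ≤ (3 ^ (d * d) * (12 * C₂ + 1) + 1) * U := by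
    refine (mapT_cost_le fun R hR => (hcf R hR).1).trans ?_
    calc _ ≤ 3 ^ (d * d) * (12 * C₂ * U + U) + U := by
          gcongr
          exact hFr.1
      _ = _ := by ring
  have hΩ : ∀ X ∈ (mapT f S.val).val, X.length ≤ l.length ∧
      ∀ p ∈ X, ∀ i, bitSize (p i) ≤ C₂ * (6 * s) := by
    intro X hX
    rw [mapT_val] at hX
    obtain ⟨R, hR, rfl⟩ := List.mem_map.1 hX
    exact (hcf R hR).2
  have hΩlen : (mapT f S.val).val.length ≤ 3 ^ (d * d) := by
    rw [mapT_val, List.length_map]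
    exact hFr.1
  have hcmp : ∀ X ∈ (mapT f S.val).val, ∀ Y ∈ (mapT f S.val).val,
      (cmpListT cmpVecT X Y).cost ≤ F * U := by
    intro X hX Y hY
    refine (cmpListT_cost_le fun p hp q hq => cmpVecT_cost_le ((hΩ X hX).2 p hp)
      ((hΩ Y hY).2 q hq)).trans ?_
    calc X.length * (d * (2 * (C₂ * (6 * s)) + 3) + 1 + 1) + 1
        = X.length * (d * (2 * (C₂ * (6 * s)) + 3) + 2) + 1 := rfl
      _ ≤ 2 * n * (d * (2 * (C₂ * (6 * s)) + 3 * s) + 2 * s) + U := by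
          have : X.length ≤ 2 * n := (hΩ X hX).1.trans (by omega)
          gcongr <;> omega
      _ = 2 * (d * (12 * C₂ + 3) + 2) * (n * s) + U := by ring
      _ ≤ 2 * (d * (12 * C₂ + 3) + 2) * U + U := by
          have : n * s ≤ U :=
            Nat.mul_le_mul_left _ (hsW.trans (hWV.trans hlgV))
          gcongr
      _ = _ := by rw [hF]; ring
  have hfix : canonicalFormT μ l = (do
      tick 1
      let S ← S
      let Ωs ← mapT f S
      match Ωs with
      | [] => pure []
      | Ω :: Ωs' => minT (cmpListT cmpVecT) Ω Ωs') := rfl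
  have e3 : (1 + A + (3 ^ (d * d) * (12 * C₂ + 1) + 1) + (3 ^ (d * d) * (F + 1) + 1)) * U =
      U + A * U + (3 ^ (d * d) * (12 * C₂ + 1) + 1) * U + (3 ^ (d * d) * (F * U + U) + U) := by
    ring
  rw [hfix, e3]
  simp only [Timed.cost_bind, tick_cost]
  generalize mapT f S.val = Ωs at *
  match hm : Ωs.val with
  | [] =>
    simp only [Timed.cost_pure]
    omega
  | Ω :: Ωs' =>
    rw [hm] at hcmp hΩlen
    have e4 : (minT (cmpListT cmpVecT) Ω Ωs').cost ≤ Ωs'.length * (F * U + 1) + 1 :=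
      minT_cost_le hcmp
    have e5 : Ωs'.length * (F * U + 1) + 1 ≤ 3 ^ (d * d) * (F * U + U) + U := by
      have : Ωs'.length ≤ 3 ^ (d * d) := by simp at hΩlen; omega
      gcongr
    simp only
    omega

/-- Constants inside the argument of `μ` are moved outside: as `C ≤ 2 ^ C`, doubling `C` times gives
`μ (C * s) ≤ K ^ C * μ s`. The condition `t ≤ a * μ t` lets multiplications dominate linear costs.
-/
theorem exists_cap (C a K : ℕ) : ∃ D : ℕ, ∀ μ : ℕ → ℕ, Monotone μ → (∀ t, t ≤ a * μ t) →
    (∀ t, μ (2 * t) ≤ K * μ t) → ∀ s, Cap μ (C * s) (D * μ s) := by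
  refine ⟨K ^ C + C * a, fun μ h1 h2 h3 s => ⟨h1, ?_, ?_⟩⟩
  · calc C * s ≤ C * (a * μ s) := Nat.mul_le_mul_left _ (h2 s)
      _ ≤ _ := by rw [add_mul, ← mul_assoc]; omega
  · have hpow : ∀ k, μ (2 ^ k * s) ≤ K ^ k * μ s := by
      intro k
      induction k with
      | zero => simp
      | succ k ih =>
        calc μ (2 ^ (k + 1) * s) = μ (2 * (2 ^ k * s)) := by ring_nf
          _ ≤ K * μ (2 ^ k * s) := h3 _
          _ ≤ K * (K ^ k * μ s) := Nat.mul_le_mul_left _ ih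
          _ = _ := by ring
    calc μ (C * s) ≤ μ (2 ^ C * s) := h1 (Nat.mul_le_mul_right _ Nat.lt_two_pow_self.le)
      _ ≤ K ^ C * μ s := hpow C
      _ ≤ _ := by rw [add_mul]; omega

/-- The complexity of `CanonicalForm`. -/
theorem canonicalFormT_cost_le (d a K : ℕ) : ∃ C : ℝ, ∀ μ : ℕ → ℕ, Monotone μ →
    (∀ t, t ≤ a * μ t) → (∀ t, μ (2 * t) ≤ K * μ t) →
    ∀ (l : List (Pt d)) (n s : ℕ), l.Nodup → n = max l.length 2 → 1 ≤ s →
      (∀ p ∈ l, ∀ i, bitSize (p i) ≤ s) →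
      ((canonicalFormT μ l).cost : ℝ) ≤ C * (n * Real.logb 2 n ^ 2 * s * μ s) := by
  obtain ⟨C, c, -, h⟩ := canonicalFormT_bound d
  obtain ⟨D, hD⟩ := exists_cap C a K
  refine ⟨4 * c * D, fun μ h1 h2 h3 l n s hl hn hs hb => ?_⟩
  have hcost := h μ s (D * μ s) hs (hD μ h1 h2 h3 s) l n hl hn hb
  have hn2 : 2 ≤ n := by omega
  have hlog1 : 1 ≤ Real.logb 2 n := by
    rw [Real.le_logb_iff_rpow_le one_lt_two (by positivity)]
    simpa using (by exact_mod_cast hn2 : (2 : ℝ) ≤ n)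
  -- As `n ≥ 2` the real logarithm is at least 1 and absorbs the additive 1. Squaring produces the
  -- constant 4.
  have hlog : ((Nat.log 2 n + 1 : ℕ) : ℝ) ≤ 2 * Real.logb 2 n := by
    have : (Nat.log 2 n : ℝ) ≤ Real.logb 2 n := by
      rw [Real.le_logb_iff_rpow_le one_lt_two (by positivity), Real.rpow_natCast]
      exact_mod_cast Nat.pow_log_le_self 2 (by omega)
    push_cast
    linarith
  calc ((canonicalFormT μ l).cost : ℝ)
      ≤ c * (n * (((Nat.log 2 n + 1 : ℕ) : ℝ) ^ 2 * (s * (D * μ s)))) := by exact_mod_cast hcost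
    _ ≤ c * (n * ((2 * Real.logb 2 n) ^ 2 * (s * (D * μ s)))) := by gcongr
    _ = _ := by ring

end TotalCost

end LatticeCanonicalForm

theorem mainTheorem1 (d : ℕ) (hd : 0 < d) :
    ∃ f : Finset (LatticeCanonicalForm.Pt d) → Finset (LatticeCanonicalForm.Pt d),
      (∀ Λ Ω, LatticeCanonicalForm.CanonicalForm Λ Ω ↔ Ω = f Λ) ∧
      LatticeCanonicalForm.IsCanonicalForm (LatticeCanonicalForm.Aff d) f ∧
      (∀ (μ : ℕ → ℕ) (l : List (LatticeCanonicalForm.Pt d)), l.Nodup →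
        (LatticeCanonicalForm.canonicalFormT μ l).val.Nodup ∧
        (LatticeCanonicalForm.canonicalFormT μ l).val.toFinset = f l.toFinset) ∧
      ∀ a K : ℕ, ∃ C : ℝ, ∀ μ : ℕ → ℕ, Monotone μ → (∀ t, t ≤ a * μ t) →
        (∀ t, μ (2 * t) ≤ K * μ t) →
        ∀ (l : List (LatticeCanonicalForm.Pt d)) (n s : ℕ), l.Nodup → n = max l.length 2 → 1 ≤ s →
          (∀ p ∈ l, ∀ i, LatticeCanonicalForm.bitSize (p i) ≤ s) →
          ((LatticeCanonicalForm.canonicalFormT μ l).cost : ℝ) ≤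
            C * (n * Real.logb 2 n ^ 2 * s * μ s) := by
  obtain ⟨h1, h2⟩ := LatticeCanonicalForm.isCanonicalForm_of_canonicalForm
    (LatticeCanonicalForm.exists_canonicalForm (d := d))
  refine ⟨_, h1, h2, fun μ l hl => ?_, fun a K => ?_⟩
  · obtain ⟨h3, h4⟩ := LatticeCanonicalForm.canonicalFormT_spec μ hl
    -- The output of the implementation is an admissible output of the procedure. By uniqueness it
    -- does not depend on the enumeration `l` or on `μ`.
    exact ⟨h3, (h1 _ _).1 h4⟩
  · exact LatticeCanonicalForm.canonicalFormT_cost_le d a K
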